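/- **Theorem (Dual Feasibility for Time-Windows).** There is an absolute constant $K$ such that in every run of the algorithm below on any instance, at any time, for every node $v$ of height $h+1\ge 1$, the dual variables $z_C$ of all constraints that $\mathrm{FullUpdate}$ and $\mathrm{SimpleUpdate}$ have added to the local LP $\mathfrak L^v$ are $\beta_h$-feasible for the dual of $\mathfrak L^v$, where $$\beta_h=\Big(1+\frac1H\Big)^h\cdot K\cdot\Big(H^4+H\big(\ln n+\ln M+\ln\tfrac k\gamma\big)\Big).$$ That is, $\beta_h\ge1$, $z\ge 0$, and $\sum_{C\in\mathfrak L^v:\;y^v(u,t)\text{ occurs in }C} z_C\le \beta_h\,c_u$ for every proper descendant $u$ of $v$ and every timestep $t$. **Instance.** A rooted tree of height $H\ge2$ with root $r$ on level $H$, the other levels decreasing by one from parent to child. The root has, among its children, $2k$ dummy leaves ($k\ge1$); all other leaves are on level $0$. For every $v$ put $c_v=\lambda^{\mathrm{level}(v)}$, where $\lambda\ge10H$; for $v\ne r$ this is the length of the edge from $v$ to its parent $p(v)$. $T_v$ is the subtree below $v$, $n_v$ its number of nodes, and $n=n_r$. Requests $(\ell,[b,e])$ are at non-dummy leaves, where $1\le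 b<e$ are integers, and all start and end times are distinct. Let $\Delta\ge\lambda^{H-1}$ be the bound used for the aspect ratio, $\delta'=n^{-2}$, $\delta=\frac1{10}n^{-3}$, $\gamma=n^{-4}\Delta^{-1}$, and $M\ge\frac{5H\lambda^{2H}k}{2\gamma}+1$. Timesteps are the multiples of $\eta=1/N$, for an integer $N\ge2$. A leaf is active if its server mass is at least $\delta$. $\mathrm{activesib}(v)$ is the set of siblings of $v$ with an active leaf below them. **Constraints.** For a set $A$ of nodes of $T_v$, windows $[b_u,e_u]$ $(u\in A)$ and timesteps $\tau_w$ for the nodes $w$ of $T^A_v$ (the least subtree containing $v$ and $A$), the constraint is $$\sum_{u\in A,u\neq v}y^v(u,(b_u,\tau_{p(u)}])+\sum_{u\in T_v^A\setminus A,\,u\ne v}y^v(u,(\tau_u,\tau_{p(u)}])\ \ge\ b^C:=|A|-k_v-2\delta(n-n_v),$$ where $k_v$ is the server mass in $T_v$ when the constraint is added and $y(u,I)=\sum_{t\in I}y(u,t)$. It is a $\bot$-constraint if $|A|=1$. $\mathfrak L^v$ minimizes $\sum c_uy^v(u,t)$ over $y^v\ge0$ subject to the constraints added at $v$; $\mathfrak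 L^v(\tau)$ are those added at timestep $\tau$. A non-$\bot$ constraint $C$ at $u$ is slack if $\sum z_{C'}<(1+\frac1H)z_C$, summed over the constraints $C'$ at $p(u)$ composed from $C$; otherwise it is depleted. $\bot$-constraints are always slack, with $z=0$. $\mathcal R^{ns}(u)$ is the set of timesteps at which non-$\bot$ constraints were added at $u$; $\mathrm{Awake}(u)$ is a set of timesteps, changed as below. **Start.** Each dummy leaf $v$ has server mass $\frac12$ and a $\bot$-constraint at timestep $0$ (with $A=\{v\}$, $b_v=0$), and $\mathrm{Awake}(v)=\{0\}$. The other leaves have mass $\delta/2$. All $y^v$ are $0$, all charging forests are empty. **Main procedure, at $q=1,2,\dots$** A request is served if there is mass at least $1-2\delta'$ at its leaf at some timestep after its arrival, or if it is piggybacked (see below). It is outstanding at $q$ if it has arrived, its deadline is at least $q$, and it is unserved. If an unserved request with deadline $q$ exists, at a leaf $v_0$ with ancestors $v_1,\dots,v_H=r$, then it is critical and the following is done. 1. BuildTree. Let $\mathrm{cost}$ be the least cost, in the tree metric, of moving server mass to $v_0$ so that $v_0$ has mass $1-\delta'$ and no leaf that sends mass keeps less than $\delta-\gamma$; let $\mathrm{logcost}=\max(0,\lfloor\log_\lambda(2\lambda\,\mathrm{cost})\rfloor)$.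 For each $v\in Z_q=\{v_i: i\le\min(H,\mathrm{logcost})\}$ start with $v$ and process, recursively, all nodes spawned. To process $w$: add the paths from $w$ to the leaves of $T_w$ with outstanding requests one by one, in order of earliest deadline, until the nodes of the paths on some level below $w$ cost at least $c_w$ in total; then $w$ spawns these nodes of one such level (none, if this never happens). $F_{v,q}$ is the union of all these paths. Each processed $w$ gives a vertex $(w,q)$ of the charging forest $\mathcal F^{ch}(v)$, with which the outstanding request below $w$ of earliest deadline is recorded. If $q'$ is the last time before $q$ with $(w,q')\in\mathcal F^{ch}(v)$, and $q'$ is in the window of that request, then the children of $(w,q)$ are all $(w',q')$ with $w'$ spawned by $w$ at time $q'$ (in the forest of $v$); otherwise $(w,q)$ has no children. 2. While $v_0$ has mass at most $1-\delta'$, at successive timesteps $\tau=q+\eta,q+2\eta,\dots<q+1$: let $i_0$ be the least index with $\mathrm{activesib}(v_{i_0})\ne\emptyset$; call $\mathrm{SimpleUpdate}(v_i,\tau,\lambda^i\gamma/\lambda^{i_0})$ for $i=0,\dots,i_0$, then $\mathrm{FullUpdate}(v_i,\tau)$ for $i=i_0+1,\dots,H$. 3. All outstanding requests at leaves of the trees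 $F_{v,q}$, $v\in Z_q$, are served (piggybacked), without changing the server masses. **SimpleUpdate$(v_i,\tau,\xi)$.** Add $\tau$ to $\mathrm{Awake}(v_i)$. Let $i^\star=\min(i,\mathrm{logcost})$ and $\mathcal T$ the tree of $\mathcal F^{ch}(v_{i^\star})$ rooted at $(v_{i^\star},q)$. If $\mathcal T$ is a single vertex, add the $\bot$-constraint with $A=\{v_i\}$, $\tau_{v_i}=\tau$ and the window of the critical request. Otherwise choose a level $s$ such that the leaves $(u_j,q_j)$ of $\mathcal T$ with $u_j$ on level $s$ satisfy $\sum_j c_{u_j}\ge c_{v_{i^\star}}/H$, and add the constraint $C$ with $A=\{u_j\}$, the windows $[b_j,e_j]$ recorded with $(u_j,q_j)$, $\tau_{u_j}=b_j$, and $\tau_w=\tau$ for the other nodes $w$ of $T_{v_i}^A$; set $z_C=\xi/b^C$. **FullUpdate$(v,\tau)$.** Let $h=\mathrm{level}(v)-1$, $u_0$ the child of $v$ above $v_0$, $U=\{u_0\}\cup\mathrm{activesib}(u_0)$, and $L_U$ the active leaves below $U\setminus\{u_0\}$. Add $\tau$ to $\mathrm{Awake}(v)$. Repeat the following until $\sum_{C\in\mathfrak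 L^v(\tau)}b^Cz_C=\gamma$. - For $u\in U$ let $\tau_u=\max(\mathrm{Awake}(u)\cap[0,\tau])$, $I_u=(\tau_u,\tau]$, and choose a slack constraint $C_u\in\mathfrak L^u(\tau_u)$. Add to $\mathfrak L^v(\tau)$ the composed constraint $C$: its $A$ is the union of the sets $A$ of the $C_u$, its windows and timesteps extend theirs, and $\tau_v=\tau$. - While all $C_u$ are slack and $\sum_{C'\in\mathfrak L^v(\tau)}b^{C'}z_{C'}<\gamma$, raise $z_C$ from $0$ at the rate of a timer $s$; for $u\in U$ and $t\in I_u\cap(\mathcal R^{ns}(u)\cup\{\tau_u+\eta\})$ raise $y^v(u,t)$ at rate $\frac{dy^v(u,t)}{ds}=\frac{y^v(u,t)}{\lambda^h}+\frac{\gamma}{Mn\lambda^h}$; and for $u\in U\setminus\{u_0\}$ move server mass from leaves of $L_U\cap T_u$ (chosen arbitrarily) to $v_0$ at rate $\frac{dy^v(u,I_u)}{ds}+\frac{b^{C_u}}{\lambda^h}$. - For each $u\in U$, remove $\tau_u$ from $\mathrm{Awake}(u)$ if all constraints of $\mathfrak L^u(\tau_u)$ are depleted. Finally, if $\mathrm{activesib}(u_0)\ne\emptyset$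 and the call has moved less than $\frac{\gamma}{4H\lambda^h}$ to $v_0$, move more from $L_U$ until the total is $\frac{\gamma}{4H\lambda^h}$. -/

import Mathlib

open scoped Classical

noncomputable section

namespace KServerTW

/-! # Instances of fractional k-server with time-windows on an HST -/

/-- A request at `leaf` with window `[b, e]`. -/
structure Req (V : Type*) where
  leaf : V
  b : ℕ
  e : ℕ

/-- A rooted tree of height `H` in which a non-root node `v` has an edge of length
`lam ^ level v` to its parent; the root carries `2 * k` dummy leaves as children (which are on
level `H - 1`), and every other leaf is on level `0`. -/
structure HST (V : Type*) [Fintype V] where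
  root : V
  parent : V → V
  level : V → ℕ
  H : ℕ
  k : ℕ
  lam : ℝ
  dummy : Finset V
  two_le_H : 2 ≤ H
  one_le_k : 1 ≤ k
  lam_ge : 10 * (H : ℝ) ≤ lam
  parent_root : parent root = root
  level_root : level root = H
  level_parent : ∀ v, v ≠ root → level (parent v) = level v + 1
  dummy_card : dummy.card = 2 * k
  dummy_spec : ∀ v ∈ dummy, v ≠ root ∧ parent v = root ∧ ∀ u, u ≠ root → parent u ≠ v
  leaf_level : ∀ v, v ∉ dummy → (∀ u, u ≠ root → parent u ≠ v) → level v = 0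

section Tree

/-- The children of `v`. -/
def HST.children {V : Type*} [Fintype V] (T : HST V) (v : V) : Finset V :=
  Finset.univ.filter fun u => u ≠ T.root ∧ T.parent u = v

def HST.IsLeaf {V : Type*} [Fintype V] (T : HST V) (v : V) : Prop := T.children v = ∅

/-- `T.anc v i` is the `i`-th ancestor of `v`. -/
def HST.anc {V : Type*} [Fintype V] (T : HST V) (v : V) (i : ℕ) : V := T.parent^[i] v

/-- The nodes of the subtree `T_v` rooted at `v`. -/
def HST.sub {V : Type*} [Fintype V] (T : HST V) (v : V) : Finset V :=
  Finset.univ.filter fun u => ∃ i : ℕ, T.anc u i = v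

/-- The length of the edge from `v` to its parent (also used for the root). -/
def HST.c {V : Type*} [Fintype V] (T : HST V) (v : V) : ℝ := T.lam ^ T.level v

/-- Tree distance: the total length of the edges on the path from `a` to `b`. -/
def HST.dist {V : Type*} [Fintype V] (T : HST V) (a b : V) : ℝ :=
  ∑ w : V, if Xor (a ∈ T.sub w) (b ∈ T.sub w) then T.c w else 0

/-- The number `n` of nodes of the tree. -/
def HST.n {V : Type*} [Fintype V] (_T : HST V) : ℝ := (Fintype.card V : ℝ)

/-- The number `n_v` of nodes of `T_v`. -/
def HST.nv {V : Type*} [Fintype V] (T : HST V) (v : V) : ℝ := ((T.sub v).card : ℝ)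

/-- The parameter `δ' = 1 / n ^ 2`. -/
def HST.del' {V : Type*} [Fintype V] (T : HST V) : ℝ := 1 / T.n ^ 2

/-- The parameter `δ = 1 / (10 n ^ 3)`. -/
def HST.del {V : Type*} [Fintype V] (T : HST V) : ℝ := 1 / (10 * T.n ^ 3)

/-- The nodes of `T_v^A` : the minimal subtree containing `v` and all nodes of `A ∩ T_v`. -/
def HST.subTo {V : Type*} [Fintype V] (T : HST V) (v : V) (A : Finset V) : Finset V :=
  (T.sub v).filter fun u => u = v ∨ ∃ a ∈ A, a ∈ T.sub u

end Tree

/-- An instance, together with the parameters of the algorithm: `Δ` bounds the aspect ratio,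
there are `N` timesteps per unit of time (so `η = 1 / N`), and `M` is the parameter of the update
rule. Timesteps are numbered by `ℕ`; timestep `t` is at time `t / N`, and time `q` is timestep
`q * N`. -/
structure Inst (V : Type*) [Fintype V] extends HST V where
  Δ : ℝ
  Δ_ge : lam ^ (H - 1) ≤ Δ
  N : ℕ
  two_le_N : 2 ≤ N
  M : ℝ
  M_ge : 5 * (H : ℝ) * lam ^ (2 * H) * k / (2 * (1 / ((Fintype.card V : ℝ) ^ 4 * Δ))) + 1 ≤ M
  /-- the requests, finitely or infinitely many -/
  reqs : Set (Req V)
  req_leaf : ∀ r ∈ reqs, r.leaf ∉ dummy ∧ ∀ u, u ≠ root → parent u ≠ r.leaf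
  req_window : ∀ r ∈ reqs, 1 ≤ r.b ∧ r.b < r.e
  req_distinct : ∀ r ∈ reqs, ∀ s ∈ reqs, r.b ≠ s.e ∧ (r ≠ s → r.b ≠ s.b ∧ r.e ≠ s.e)

/-- The granularity `γ = 1 / (n ^ 4 Δ)` of server movement. -/
def Inst.gam {V : Type*} [Fintype V] (I : Inst V) : ℝ := 1 / (I.n ^ 4 * I.Δ)

/-! # Constraints of the local LPs -/

/-- A truncated constraint `φ_{A, f, tau, v}` of the local LP at a node `v`, ending at timestep
`time`, with its dual variable `z`. `mass` is the server mass `k_{v, time}` in `T_v` when the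
constraint is added. If it was made by composing constraints of children `u` of `v`, then
`src u` is the position in the list of constraints at `u` of the constraint that was used. The
values of `f` outside `A` and those of `tau` outside `T_v^A` are irrelevant. -/
structure Con (V : Type*) where
  time : ℕ
  A : Finset V
  f : V → Req V
  tau : V → ℕ
  mass : ℝ
  src : V → Option ℕ
  z : ℝ

/-- A `⊥`-constraint. -/
def Con.IsBot {V : Type*} (C : Con V) : Prop := C.A.card = 1

/-- The variable `y^v(u, t)` occurs (with coefficient one) on the left-hand side
`∑_{u ∈ A, u ≠ v} y^v(u, (b_u, τ_{p(u)}]) + ∑_{u ∈ T_v^A \ A, u ≠ v} y^v(u, (τ_u, τ_{p(u)}])`. -/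
def Con.Occurs {V : Type*} [Fintype V] (I : Inst V) (v : V) (C : Con V) (u : V) (t : ℕ) : Prop :=
  u ∈ I.subTo v C.A ∧ u ≠ v ∧
    ((u ∈ C.A ∧ (C.f u).b * I.N < t ∧ t ≤ C.tau (I.parent u)) ∨
      (u ∉ C.A ∧ C.tau u < t ∧ t ≤ C.tau (I.parent u)))

/-- The right-hand side `|A ∩ T_v| - k_{v, τ_v} - 2 δ (n - n_v)`. -/
def Con.rhs {V : Type*} [Fintype V] (I : Inst V) (v : V) (C : Con V) : ℝ :=
  ((C.A ∩ I.sub v).card : ℝ) - C.mass - 2 * I.del * (I.n - I.nv v)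

/-- `w` is feasible for the dual of the local LP
`min ∑_{u, t} c_u y^v(u, t)`, `⟨a^C, y^v⟩ ≥ b^C` for all `C` in the list `L`, `y^v ≥ 0`. -/
def DualFeasible {V : Type*} [Fintype V] (I : Inst V) (v : V) (L : List (Con V))
    (w : Con V → ℝ) : Prop :=
  (∀ C ∈ L, 0 ≤ w C) ∧
    ∀ u ∈ I.sub v, u ≠ v → ∀ t : ℕ,
      (L.map fun C => (if C.Occurs I v u t then 1 else 0) * w C).sum ≤ I.c u

/-! # The state of the algorithm -/

/-- A charging forest. Its vertices are pairs `(w, q)`; `spawned w q` are the nodes spawned by `w`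
at time `q`, `kids a` are the children of the vertex `a`, and `req a` is its earliest leaf
request. -/
structure Forest (V : Type*) where
  node : Set (V × ℕ)
  spawned : V → ℕ → Finset V
  kids : V × ℕ → Set (V × ℕ)
  req : V × ℕ → Req V

/-- `mass ℓ` is the server mass at the leaf `ℓ`; `cons v` are the constraints of the local LP at
`v`, in the order of their creation; `awake v` are the awake timesteps of `v`; `y v u t` is the
variable `y^v(u, t)`; `forest v` is the charging forest of `v`; `served` are the requests that
have been served. -/
structure State (V : Type*) where
  mass : V → ℝ
  cons : V → List (Con V)
  awake : V → Set ℕ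
  y : V → V → ℕ → ℝ
  forest : V → Forest V
  served : Set (Req V)

section Defs

/-- The server mass in `T_v`. -/
def subMass {V : Type*} [Fintype V] (I : Inst V) (S : State V) (v : V) : ℝ :=
  ∑ l ∈ (I.sub v).filter I.IsLeaf, S.mass l

/-- The constraint set `𝔏^v(τ)`, as a list. -/
def consAt {V : Type*} (S : State V) (v : V) (τ : ℕ) : List (Con V) :=
  (S.cons v).filter fun C => C.time = τ

/-- The non-solitary timesteps of `v`. -/
def nonSolitary {V : Type*} (S : State V) (v : V) : Set ℕ :=
  {t | ∃ C ∈ S.cons v, C.time = t ∧ ¬ C.IsBot}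

/-- The dual objective value of the constraints in `𝔏^v(τ)`. -/
def dualObj {V : Type*} [Fintype V] (I : Inst V) (S : State V) (v : V) (τ : ℕ) : ℝ :=
  ((consAt S v τ).map fun C => C.rhs I v * C.z).sum

/-- The sum of the dual variables of the constraints at the parent of `u` that were composed
from the `j`-th constraint at `u`. -/
def load {V : Type*} [Fintype V] (I : Inst V) (S : State V) (u : V) (j : ℕ) : ℝ :=
  (((S.cons (I.parent u)).filter fun C => C.src u = some j).map fun C => C.z).sum

/-- The constraint `C`, the `j`-th one at `u`, is slack after the dual variables of the
constraints composed from it have been raised by a further amount `s`. -/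
def Slack {V : Type*} [Fintype V] (I : Inst V) (S : State V) (u : V) (j : ℕ) (C : Con V)
    (s : ℝ) : Prop :=
  C.IsBot ∨ load I S u j + s < (1 + 1 / (I.H : ℝ)) * C.z

/-- The active leaves of `T_v`. -/
def activeLeaves {V : Type*} [Fintype V] (I : Inst V) (S : State V) (v : V) : Finset V :=
  (I.sub v).filter fun l => I.IsLeaf l ∧ I.del ≤ S.mass l

/-- The siblings of `v` with active leaves in their subtrees. -/
def activeSib {V : Type*} [Fintype V] (I : Inst V) (S : State V) (v : V) : Finset V :=
  if v = I.root then ∅ else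
    (I.children (I.parent v)).filter fun u => u ≠ v ∧ (activeLeaves I S u).Nonempty

/-- Moving the amounts `x ℓ` of server mass from the leaves `ℓ` of `L` to the leaf `v0`. -/
def Transfer {V : Type*} [Fintype V] (L : Finset V) (v0 : V) (m m' : V → ℝ) (x : V → ℝ) : Prop :=
  (∀ l, 0 ≤ x l) ∧ (∀ l, l ∉ L → x l = 0) ∧ (∀ l ∈ L, x l ≤ m l) ∧
    ∀ l, m' l = m l - x l + if l = v0 then ∑ l' ∈ L, x l' else 0

/-! # BuildTree, FindLeaves and BuildWitness -/

/-- The request `r` is outstanding at time `q`. -/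
def Outstanding {V : Type*} [Fintype V] (I : Inst V) (S : State V) (q : ℕ) (r : Req V) : Prop :=
  r ∈ I.reqs ∧ r.b ≤ q ∧ q ≤ r.e ∧ r ∉ S.served

/-- `r` is the earliest outstanding request at its leaf. -/
def FirstAtLeaf {V : Type*} [Fintype V] (I : Inst V) (S : State V) (q : ℕ) (r : Req V) : Prop :=
  Outstanding I S q r ∧ ∀ r', Outstanding I S q r' → r'.leaf = r.leaf → r.e ≤ r'.e

/-- `r` is the outstanding request of earliest deadline below `w`. -/
def EarliestLeafReq {V : Type*} [Fintype V] (I : Inst V) (S : State V) (w : V) (q : ℕ)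
    (r : Req V) : Prop :=
  Outstanding I S q r ∧ r.leaf ∈ I.sub w ∧
    ∀ r', Outstanding I S q r' → r'.leaf ∈ I.sub w → r.e ≤ r'.e

/-- The union of the paths from `w` to the leaves of the requests in `L`. -/
def paths {V : Type*} [Fintype V] (I : Inst V) (w : V) (L : List (Req V)) : Finset V :=
  (I.sub w).filter fun x => ∃ r ∈ L, r.leaf ∈ I.sub x

/-- The nodes of `G` at level `j`, strictly below `w`, cost at least `c_w`. -/
def Tight {V : Type*} [Fintype V] (I : Inst V) (w : V) (G : Finset V) (j : ℕ) : Prop :=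
  j < I.level w ∧ I.c w ≤ ∑ u ∈ G.filter (fun u => I.level u = j), I.c u

/-- `FindLeaves(q, w)` returns `(G, Sp)`. The leaves below `w` with outstanding requests are
represented by their earliest requests, and listed in the order of the deadlines. -/
def FindLeaves {V : Type*} [Fintype V] (I : Inst V) (S : State V) (q : ℕ) (w : V)
    (G Sp : Finset V) : Prop :=
  ∃ L : List (Req V), L.Pairwise (fun r s => r.e < s.e) ∧
    (∀ r, r ∈ L ↔ FirstAtLeaf I S q r ∧ r.leaf ∈ I.sub w) ∧
    ((∃ i j : ℕ, i ≤ L.length ∧ Tight I w (paths I w (L.take i)) j ∧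
        (∀ i' < i, ∀ j', ¬ Tight I w (paths I w (L.take i')) j') ∧
        G = paths I w (L.take i) ∧ Sp = G.filter fun u => I.level u = j) ∨
      ((∀ i ≤ L.length, ∀ j, ¬ Tight I w (paths I w (L.take i)) j) ∧
        G = paths I w L ∧ Sp = ∅))

/-- The part of `BuildTree(q)` that treats the node `v` of `Z_q`, with the calls to `BuildWitness`:
`P` is the set of the nodes `w` that are put into the queue, `tr` is the tree `F_{v, q}`, and the
charging forest of `v` changes from `F` to `F'`. -/
def BuildTreeAt {V : Type*} [Fintype V] (I : Inst V) (S : State V) (q : ℕ) (v : V)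
    (F F' : Forest V) (tr : Set V) : Prop :=
  ∃ (G Sp : V → Finset V) (P : Set V),
    P = {w | Relation.ReflTransGen (fun a b => b ∈ Sp a) v w} ∧
    (∀ w ∈ P, FindLeaves I S q w (G w) (Sp w)) ∧
    tr = {x | ∃ w ∈ P, x ∈ G w} ∧
    F'.node = F.node ∪ {a | a.1 ∈ P ∧ a.2 = q} ∧
    (∀ w ∈ P, F'.spawned w q = Sp w ∧
      EarliestLeafReq I S w q (F'.req (w, q)) ∧
      -- the last earlier time `a.2` at which `w` is in the forest must lie in the window
      F'.kids (w, q) = {a | IsGreatest {q' | q' < q ∧ (w, q') ∈ F.node} a.2 ∧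
        (F'.req (w, q)).b ≤ a.2 ∧ a.2 ≤ (F'.req (w, q)).e ∧ a.1 ∈ F.spawned w a.2}) ∧
    (∀ w q', ¬ (w ∈ P ∧ q' = q) → F'.spawned w q' = F.spawned w q' ∧
      F'.req (w, q') = F.req (w, q') ∧ F'.kids (w, q') = F.kids (w, q'))

/-- The least cost of moving servers to the leaf `v0` so that it has mass `1 - δ'`, where no leaf
that sends out server mass is left with less than `δ - γ`. -/
def moveCost {V : Type*} [Fintype V] (I : Inst V) (S : State V) (v0 : V) : ℝ :=
  sInf {x | ∃ a : V → ℝ, (∀ u, 0 ≤ a u) ∧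
    (∀ u, a u ≠ 0 → I.IsLeaf u ∧ u ≠ v0 ∧ I.del - I.gam ≤ S.mass u - a u) ∧
    S.mass v0 + ∑ u, a u = 1 - I.del' ∧ x = ∑ u, a u * I.dist u v0}

/-- `⌊log_λ (2 λ cost)⌋`, or `0` should this be negative. -/
def logCost {V : Type*} [Fintype V] (I : Inst V) (S : State V) (v0 : V) : ℕ :=
  ⌊Real.logb I.lam (2 * I.lam * moveCost I S v0)⌋₊

/-- `BuildTree(q)` for the critical request `r` with deadline `q`; `tr v` is the tree `F_{v, q}`. -/
def BuildTree {V : Type*} [Fintype V] (I : Inst V) (S S' : State V) (r : Req V)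
    (tr : V → Set V) : Prop :=
  ∃ F' : V → Forest V, S' = { S with forest := F' } ∧
    ∀ v, if ∃ i ≤ min (logCost I S r.leaf) I.H, v = I.anc r.leaf i
      then BuildTreeAt I S r.e v (S.forest v) (F' v) (tr v)
      else F' v = S.forest v ∧ tr v = ∅

/-! # The update procedures -/

/-- `SimpleUpdate(v_i, τ, ξ)`, where `v_i` is the `i`-th ancestor of the leaf of the critical
request `r`, and `lc` is the value of `logCost` when `r` became critical. -/
def SimpleUpdate {V : Type*} [Fintype V] (I : Inst V) (r : Req V) (lc τ i : ℕ) (ξ : ℝ)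
    (S S' : State V) : Prop :=
  let v := I.anc r.leaf i
  let vs := I.anc r.leaf (min i lc)
  let F := S.forest vs
  ∃ C : Con V,
    S' = { S with
      cons := Function.update S.cons v (S.cons v ++ [C])
      awake := Function.update S.awake v (insert τ (S.awake v)) } ∧
    C.time = τ ∧ C.mass = subMass I S v ∧ (∀ u, C.src u = none) ∧
    if F.kids (vs, r.e) = ∅ then
      C.A = {v} ∧ C.f v = r ∧ C.tau v = τ ∧ C.z = 0
    else
      -- `Ls` are the leaves at level `s` of the charging tree rooted at `(vs, q)`
      ∃ (s : ℕ) (Ls : Finset (V × ℕ)),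
        (∀ a, a ∈ Ls ↔ Relation.ReflTransGen (fun a b => b ∈ F.kids a) (vs, r.e) a ∧
          F.kids a = ∅ ∧ I.level a.1 = s) ∧
        I.c vs / I.H ≤ ∑ a ∈ Ls, I.c a.1 ∧
        C.A = Ls.image Prod.fst ∧
        (∀ a ∈ Ls, C.f a.1 = F.req a ∧ C.tau a.1 = (F.req a).b * I.N) ∧
        (∀ w ∈ I.subTo v C.A, w ∉ C.A → C.tau w = τ) ∧
        C.z = ξ / C.rhs I v

/-- One iteration of the repeat-loop of `FullUpdate(v, τ)`: a constraint `C` is composed from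
slack constraints `σ u` (the `j u`-th one at `u`, ending at the last awake timestep `τu u`), and
then the timer runs for a duration `d`, until one of the `σ u` gets depleted or the dual objective
reaches `γ`. `u0` is the principal child of `v`, `U` consists of `u0` and its active siblings, `LU`
are the active leaves below `U \ {u0}`, and `v0` is the requested leaf. `Y s` are the values of
the variables `y^v` after the timer has run for `s`. -/
def Phase {V : Type*} [Fintype V] (I : Inst V) (v0 v u0 : V) (U LU : Finset V) (τ : ℕ)
    (S S' : State V) : Prop :=
  ∃ (τu j : V → ℕ) (σ : V → Con V) (C : Con V) (d : ℝ) (Y : ℝ → V → ℕ → ℝ) (x : V → ℝ),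
    -- the choice of the constraints
    (∀ u ∈ U, IsGreatest {t | t ∈ S.awake u ∧ t ≤ τ} (τu u) ∧
      (S.cons u)[j u]? = some (σ u) ∧ (σ u).time = τu u ∧ Slack I S u (j u) (σ u) 0) ∧
    -- their composition
    C.time = τ ∧ C.A = U.biUnion (fun u => (σ u).A) ∧ C.tau v = τ ∧
    (∀ u ∈ U, ∀ w ∈ I.sub u, C.f w = (σ u).f w ∧ C.tau w = (σ u).tau w) ∧
    C.mass = subMass I S v ∧ (∀ u, C.src u = if u ∈ U then some (j u) else none) ∧ C.z = d ∧
    -- the duration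
    0 < d ∧
    (∀ s, 0 ≤ s → s ≤ d → (s < d ↔
      (∀ u ∈ U, Slack I S u (j u) (σ u) s) ∧ dualObj I S v τ + C.rhs I v * s < I.gam)) ∧
    -- the exponential update of the variables
    Y 0 = S.y v ∧
    (∀ u t, if u ∈ U ∧ τu u < t ∧ t ≤ τ ∧ (t ∈ nonSolitary S u ∨ t = τu u + 1)
      then ∀ s ∈ Set.Icc 0 d, HasDerivWithinAt (fun s => Y s u t)
        (Y s u t / I.lam ^ (I.level v - 1) + I.gam / (I.M * I.n * I.lam ^ (I.level v - 1)))
        (Set.Icc 0 d) s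
      else ∀ s ∈ Set.Icc 0 d, Y s u t = S.y v u t) ∧
    -- the server transfer
    Transfer LU v0 S.mass S'.mass x ∧
    (∀ u ∈ U, u ≠ u0 → ∑ l ∈ LU ∩ I.sub u, x l =
      ∑ t ∈ Finset.Ioc (τu u) τ, (Y d u t - S.y v u t) +
        d * ((σ u).rhs I u / I.lam ^ (I.level v - 1))) ∧
    S'.cons = Function.update S.cons v (S.cons v ++ [C]) ∧
    S'.y = Function.update S.y v (Y d) ∧
    -- timesteps all of whose constraints are depleted stop being awake
    (∀ u, S'.awake u = if u ∈ U ∧ ∀ (i : ℕ) (B : Con V), (S.cons u)[i]? = some B →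
        B.time = τu u → ¬ Slack I S' u i B 0
      then S.awake u \ {τu u} else S.awake u) ∧
    S'.forest = S.forest ∧ S'.served = S.served

/-- `FullUpdate(v_i, τ)`, where `i ≥ 1` and `v_i` is the `i`-th ancestor of the leaf `v0` of the
critical request. -/
def FullUpdate {V : Type*} [Fintype V] (I : Inst V) (v0 : V) (τ i : ℕ) (S S' : State V) : Prop :=
  let v := I.anc v0 i
  let u0 := I.anc v0 (i - 1)
  let sib := activeSib I S u0
  let LU := sib.biUnion (activeLeaves I S)
  let amount := I.gam / (4 * I.H * I.lam ^ (I.level v - 1))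
  ∃ S1 : State V,
    Relation.TransGen
      (fun X X' => dualObj I X v τ < I.gam ∧ Phase I v0 v u0 (insert u0 sib) LU τ X X')
      { S with awake := Function.update S.awake v (insert τ (S.awake v)) } S1 ∧
    dualObj I S1 v τ = I.gam ∧
    if sib.Nonempty ∧ S1.mass v0 - S.mass v0 < amount then
      ∃ m x, Transfer LU v0 S1.mass m x ∧
        ∑ l ∈ LU, x l = amount - (S1.mass v0 - S.mass v0) ∧ S' = { S1 with mass := m }
    else S' = S1

/-! # The main procedure -/

/-- The requests that have arrived by time `q`, and at whose leaf there is now server mass at least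
`1 - 2 δ'`, are served. -/
def markServed {V : Type*} [Fintype V] (I : Inst V) (q : ℕ) (S : State V) : State V :=
  { S with served := S.served ∪ {r | r ∈ I.reqs ∧ r.b ≤ q ∧ 1 - 2 * I.del' ≤ S.mass r.leaf} }

/-- One iteration of the while-loop, at timestep `τ`, for the critical request `r`; `X i` is the
state after the updates at the first `i` nodes of the path from `r.leaf` to the root. -/
def Iteration {V : Type*} [Fintype V] (I : Inst V) (r : Req V) (lc τ : ℕ) (S S' : State V) :
    Prop :=
  ∃ (i0 : ℕ) (X : ℕ → State V),
    IsLeast {i | (activeSib I S (I.anc r.leaf i)).Nonempty} i0 ∧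
    X 0 = S ∧
    (∀ i ≤ I.H, if i ≤ i0
      then SimpleUpdate I r lc τ i (I.lam ^ i * (I.gam / I.lam ^ i0)) (X i) (X (i + 1))
      else FullUpdate I r.leaf τ i (X i) (X (i + 1))) ∧
    S' = markServed I r.e (X (I.H + 1))

/-- The while-loop: after `m` iterations, at the timesteps `q + η, …, q + m η < q + 1`, there is
server mass more than `1 - δ'` at the requested leaf. -/
def WhileLoop {V : Type*} [Fintype V] (I : Inst V) (r : Req V) (lc : ℕ) (S S' : State V) : Prop :=
  ∃ (m : ℕ) (X : ℕ → State V), m < I.N ∧ X 0 = S ∧ X m = S' ∧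
    (∀ i < m, (X i).mass r.leaf ≤ 1 - I.del' ∧
      Iteration I r lc (r.e * I.N + (i + 1)) (X i) (X (i + 1))) ∧
    1 - I.del' < (X m).mass r.leaf

/-- The request `r` becomes critical at time `q`. -/
def Critical {V : Type*} [Fintype V] (I : Inst V) (S : State V) (q : ℕ) (r : Req V) : Prop :=
  r ∈ I.reqs ∧ r.e = q ∧ r ∉ S.served

/-- The starting configuration: mass `1 / 2` and a `⊥`-constraint at every dummy leaf, and mass
`δ / 2` at the other leaves. -/
def start {V : Type*} [Fintype V] (I : Inst V) : State V where
  mass l := if l ∈ I.dummy then 1 / 2 else if I.IsLeaf l then I.del / 2 else 0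
  cons v := if v ∈ I.dummy then
    [{ time := 0, A := {v}, f := fun _ => ⟨v, 0, 0⟩, tau := fun _ => 0, mass := 1 / 2,
       src := fun _ => none, z := 0 }] else []
  awake v := if v ∈ I.dummy then {0} else ∅
  y _ _ _ := 0
  forest _ := ⟨∅, fun _ _ => ∅, fun _ => ∅, fun _ => ⟨I.root, 0, 0⟩⟩
  served := ∅

/-- `Run I q S`: the algorithm can be in the state `S` after it has processed the times
`1, …, q`. -/
inductive Run {V : Type*} [Fintype V] (I : Inst V) : ℕ → State V → Prop
  | start : Run I 0 (start I)
  | idle (q : ℕ) (S : State V) : Run I q S → (∀ r, ¬ Critical I S (q + 1) r) →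
      Run I (q + 1) (markServed I (q + 1) S)
  | critical (q : ℕ) (S S1 S2 : State V) (r : Req V) (tr : V → Set V) : Run I q S →
      Critical I S (q + 1) r → BuildTree I S S1 r tr →
      WhileLoop I r (logCost I S r.leaf) S1 S2 →
      Run I (q + 1) { S2 with
        served := S2.served ∪ {s | Outstanding I S1 (q + 1) s ∧ ∃ v, s.leaf ∈ tr v} }

/-- The dual variables of the local LP at `v` are `β`-feasible: scaled down by `β`, they satisfy
the constraints of the dual. -/
def BetaFeasible {V : Type*} [Fintype V] (I : Inst V) (S : State V) (v : V) (β : ℝ) : Prop :=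
  1 ≤ β ∧ DualFeasible I v (S.cons v) fun C => C.z / β

end Defs

end KServerTW

end

/-!
# Dual feasibility for fractional k-server with time-windows

Fix a node `v`, a proper descendant `u` and a timestep `t`. The total `occSum` of the dual variables of
the constraints at `v` in which `y(u, t)` occurs has to be bounded by `β c_u`.

**From level to level.** Below a child `w` of `v`, a composed constraint at `v` contains the same
variables as its source at `w`, and no source is used for more than `1 + 1 / H` times its own dual
variable. So the contribution of composed constraints grows by at most this factor per level
(`Core.compSum_le`), and everything is reduced to the constraints added by simple updates, and to the
constraints composed at the parent of `u` (`Core.occSum_le`).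

**Simple updates.** A constraint added by a simple update comes from a tree of a charging forest.
A tree matters only if it has a leaf at `u` whose window contains `t`, and for each of the at most
`H + 1` forests there are at most `H + 2` such trees (`ForestInv.card_badTimes_le`). In the time period
of such a tree, the dual variables are `O(H²) c_u` in total, by comparison with a movement whose cost
is about `λ ^ logcost` (`LoopInv.sum_R_le`).

**Constraints composed at the parent of `u`.** If the source at `u` is from before `t`, then the
timer of the constraint also raised one of two variables `y(u, t₁)`, `y(u, t₂)` (`Core.sum_before_le`). A
variable grows exponentially with the timer but never exceeds `k + 3`, so its timer is bounded by a
logarithm times `c_u` (`YInv.timerSum_le`). Otherwise the source is a `⊥`-constraint with `t` in its window.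
If it is from an earlier time period, its successor timestep saw the timer (`RunInv.sum_after_le`).
If it is from the same timestep, the potential function `SumBound` gives `O(H) c_u` per time period; it
exploits that right-hand sides differ by integers from a quantity that hardly changes. There are
at most `H + 1` such time periods for `u` and `t`, because from each to the next the number of levels
below `u` at which charging trees are built increases (`RunInv.ncard_botTimes_le`).

**Boundedness of the variables.** All of this rests on invariants of the server masses. The
inequality `Balance` says that the server mass in `T_u` pays for the variables `y(u, ·)`, for the mass that
has entered `T_u`, and for a loss at every timestep that is no longer awake. It yields the bound
`k + 3`, and together with the choice of `M` the fact that few variables are raised at a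
time. Then a full update moves about as much mass as its constraints pay for (`PhaseData.estimates`,
`FullUpdate.res`), and the geometric growth of `λ ^ h` absorbs what enters from higher levels
(`Mid.full_step`).
-/

open scoped Classical

noncomputable section

set_option linter.unusedSectionVars false

namespace KServerTW

variable {V : Type*} [Fintype V]

/-! ### The tree -/

namespace HST
variable (T : HST V)

theorem anc_zero (v : V) : T.anc v 0 = v := rfl

theorem anc_succ (v : V) (i : ℕ) : T.anc v (i + 1) = T.parent (T.anc v i) := by
  simp [anc, Function.iterate_succ_apply']

theorem anc_add (v : V) (i j : ℕ) : T.anc v (i + j) = T.anc (T.anc v i) j := by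
  simp [anc, add_comm i j, Function.iterate_add_apply]

theorem anc_root (i : ℕ) : T.anc T.root i = T.root := by
  induction i with
  | zero => rfl
  | succ i ih => rw [anc_succ, ih, T.parent_root]

/-- Before the root is reached, every step upwards increases the level by one. -/
theorem level_anc_of_ne (v : V) (i : ℕ) (h : ∀ j < i, T.anc v j ≠ T.root) :
    T.level (T.anc v i) = T.level v + i := by
  induction i with
  | zero => rfl
  | succ i ih =>
    rw [anc_succ, T.level_parent _ (h i (by omega)), ih fun j hj => h j (by omega)]; omega

theorem exists_anc_eq_root (v : V) : ∃ i, T.anc v i = T.root := by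
  by_contra! hc
  have h : ∀ i, T.level (T.anc v i) = T.level v + i := fun i =>
    T.level_anc_of_ne v i fun j _ => hc j
  refine not_injective_infinite_finite (T.anc v) fun i j hij => ?_
  have := h i
  rw [hij, h j] at this
  omega

theorem level_lt {v : V} (hv : v ≠ T.root) : T.level v < T.H := by
  have hex := T.exists_anc_eq_root v
  have h := T.level_anc_of_ne v (Nat.find hex) fun j hj => Nat.find_min hex hj
  rw [Nat.find_spec hex, T.level_root] at h
  have : Nat.find hex ≠ 0 := fun h0 => hv (by have := Nat.find_spec hex; rwa [h0] at this)
  omega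

theorem level_le (v : V) : T.level v ≤ T.H := by
  by_cases hv : v = T.root
  · rw [hv, T.level_root]
  · exact (T.level_lt hv).le

theorem eq_root_of_level {v : V} (h : T.H ≤ T.level v) : v = T.root := by
  by_contra hv
  have := T.level_lt hv
  omega

/-- No node is above the root, so `T.anc v i` is on level `level v + i` as long as there is such a
level. -/
theorem level_anc (v : V) (i : ℕ) (h : T.level v + i ≤ T.H) :
    T.level (T.anc v i) = T.level v + i := by
  induction i with
  | zero => rfl
  | succ i ih =>
    have h1 := ih (by omega)
    have : T.anc v i ≠ T.root := fun h2 => by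
      rw [h2, T.level_root] at h1; omega
    rw [anc_succ, T.level_parent _ this, h1]; omega

theorem mem_sub {u v : V} : u ∈ T.sub v ↔ ∃ i, T.anc u i = v := by simp [sub]

theorem self_mem_sub (v : V) : v ∈ T.sub v := T.mem_sub.2 ⟨0, rfl⟩

theorem anc_mem (v : V) (i : ℕ) : v ∈ T.sub (T.anc v i) := T.mem_sub.2 ⟨i, rfl⟩

theorem mem_sub_trans {u v w : V} (h1 : u ∈ T.sub v) (h2 : v ∈ T.sub w) : u ∈ T.sub w := by
  obtain ⟨i, rfl⟩ := T.mem_sub.1 h1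
  obtain ⟨j, rfl⟩ := T.mem_sub.1 h2
  exact T.mem_sub.2 ⟨i + j, T.anc_add u i j⟩

theorem sub_subset {u v : V} (h : u ∈ T.sub v) : T.sub u ⊆ T.sub v :=
  fun _ hx => T.mem_sub_trans hx h

theorem mem_sub_root (v : V) : v ∈ T.sub T.root := T.mem_sub.2 (T.exists_anc_eq_root v)

theorem eq_anc_of_mem_sub {u v : V} (h : u ∈ T.sub v) :
    T.level u ≤ T.level v ∧ T.anc u (T.level v - T.level u) = v := by
  have hu := T.level_le u
  by_cases hv : v = T.root
  · subst hv
    rw [T.level_root]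
    exact ⟨hu, T.eq_root_of_level (by rw [T.level_anc u _ (by omega)]; omega)⟩
  · obtain ⟨i, rfl⟩ := T.mem_sub.1 h
    have : ∀ j < i, T.anc u j ≠ T.root := fun j hj h0 => by
      apply hv
      have : i = j + (i - j) := by omega
      rw [this, anc_add, h0, anc_root]
    have h1 := T.level_anc_of_ne u i this
    rw [h1]
    exact ⟨by omega, by congr 1; omega⟩

theorem level_le_of_mem_sub {u v : V} (h : u ∈ T.sub v) : T.level u ≤ T.level v :=
  (T.eq_anc_of_mem_sub h).1

theorem eq_of_mem_sub_of_level {u v : V} (h : u ∈ T.sub v) (hl : T.level v ≤ T.level u) :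
    u = v := by
  have h1 := T.eq_anc_of_mem_sub h
  rw [Nat.sub_eq_zero_of_le hl] at h1
  exact h1.2

/-- Two ancestors of the same node are comparable. -/
theorem mem_sub_of_level_le {u v w : V} (hv : u ∈ T.sub v) (hw : u ∈ T.sub w)
    (hl : T.level v ≤ T.level w) : v ∈ T.sub w := by
  have h1 := T.eq_anc_of_mem_sub hv
  have h2 := T.eq_anc_of_mem_sub hw
  refine T.mem_sub.2 ⟨T.level w - T.level v, ?_⟩
  have h3 : T.level w - T.level u = (T.level v - T.level u) + (T.level w - T.level v) := by omega
  rw [h3, anc_add, h1.2] at h2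
  exact h2.2

theorem eq_of_level_eq {u v w : V} (hv : u ∈ T.sub v) (hw : u ∈ T.sub w)
    (hl : T.level v = T.level w) : v = w :=
  T.eq_of_mem_sub_of_level (T.mem_sub_of_level_le hv hw hl.le) hl.ge

theorem mem_sub_parent (v : V) : v ∈ T.sub (T.parent v) := T.mem_sub.2 ⟨1, rfl⟩

theorem parent_mem_sub {u v : V} (h : u ∈ T.sub v) (hne : u ≠ v) : T.parent u ∈ T.sub v := by
  obtain ⟨i, hi⟩ := T.mem_sub.1 h
  cases i with
  | zero => exact absurd hi hne
  | succ i =>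
    refine T.mem_sub.2 ⟨i, ?_⟩
    rw [add_comm, anc_add] at hi
    exact hi

theorem mem_children {u v : V} : u ∈ T.children v ↔ u ≠ T.root ∧ T.parent u = v := by
  simp [children]

theorem level_of_mem_children {u v : V} (h : u ∈ T.children v) : T.level v = T.level u + 1 := by
  obtain ⟨h1, rfl⟩ := T.mem_children.1 h
  exact T.level_parent u h1

theorem mem_sub_of_mem_children {u v : V} (h : u ∈ T.children v) : u ∈ T.sub v := by
  obtain ⟨_, rfl⟩ := T.mem_children.1 h
  exact T.mem_sub_parent u

theorem ne_of_mem_children {u v : V} (h : u ∈ T.children v) : u ≠ v := fun h1 => by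
  have := T.level_of_mem_children h
  rw [h1] at this; omega

theorem notMem_sub_of_mem_children {u v : V} (h : u ∈ T.children v) : v ∉ T.sub u := fun h1 => by
  have := T.level_of_mem_children h
  have := T.level_le_of_mem_sub h1
  omega

theorem exists_child {u v : V} (h : u ∈ T.sub v) (hne : u ≠ v) :
    ∃ w ∈ T.children v, u ∈ T.sub w := by
  have h1 := T.eq_anc_of_mem_sub h
  have h2 : T.level u ≠ T.level v := fun h2 => hne (T.eq_of_mem_sub_of_level h h2.ge)
  set d := T.level v - T.level u with hd
  have h3 : T.anc u d = T.parent (T.anc u (d - 1)) := by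
    rw [← anc_succ]; congr 1; omega
  refine ⟨T.anc u (d - 1), T.mem_children.2 ⟨fun h4 => ?_, h3.symm.trans h1.2⟩, T.anc_mem _ _⟩
  have h5 := T.level_anc u (d - 1) (by have := T.level_le v; omega)
  rw [h4, T.level_root] at h5
  have := T.level_le v
  omega

theorem disjoint_sub {u w v : V} (hu : u ∈ T.children v) (hw : w ∈ T.children v) (hne : u ≠ w) :
    Disjoint (T.sub u) (T.sub w) := by
  rw [Finset.disjoint_left]
  intro x hx hx'
  exact hne (T.eq_of_level_eq hx hx' (by
    have := T.level_of_mem_children hu; have := T.level_of_mem_children hw; omega))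

theorem sub_eq (v : V) : T.sub v = insert v ((T.children v).biUnion T.sub) := by
  ext x
  simp only [Finset.mem_insert, Finset.mem_biUnion]
  constructor
  · intro h
    by_cases hx : x = v
    · exact Or.inl hx
    · exact Or.inr (T.exists_child h hx)
  · rintro (rfl | ⟨u, hu, hx⟩)
    · exact T.self_mem_sub x
    · exact T.mem_sub_trans hx (T.mem_sub_of_mem_children hu)

theorem sum_sub (v : V) (f : V → ℝ) :
    ∑ x ∈ T.sub v, f x = f v + ∑ u ∈ T.children v, ∑ x ∈ T.sub u, f x := by
  rw [sub_eq, Finset.sum_insert, Finset.sum_biUnion]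
  · intro u hu w hw hne
    exact T.disjoint_sub hu hw hne
  · simp only [Finset.mem_biUnion, not_exists, not_and]
    exact fun u hu => T.notMem_sub_of_mem_children hu

theorem nv_eq (v : V) : T.nv v = 1 + ∑ u ∈ T.children v, T.nv u := by
  have := T.sum_sub v fun _ => 1
  simpa [nv] using this

theorem nv_pos (v : V) : 1 ≤ T.nv v := by
  have : 1 ≤ (T.sub v).card := Finset.card_pos.2 ⟨v, T.self_mem_sub v⟩
  simpa [nv] using this

theorem nv_le (v : V) : T.nv v ≤ T.n := by
  simpa [nv, n] using Finset.card_le_univ (T.sub v)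

theorem not_isLeaf {u v : V} (h : u ∈ T.children v) : ¬ T.IsLeaf v := fun h1 => by
  rw [IsLeaf] at h1
  simp [h1] at h

theorem sub_eq_of_isLeaf {v : V} (h : T.IsLeaf v) : T.sub v = {v} := by
  rw [sub_eq, h]; simp

theorem isLeaf_iff {v : V} : T.IsLeaf v ↔ ∀ u, u ≠ T.root → T.parent u ≠ v := by
  simp [IsLeaf, children, Finset.filter_eq_empty_iff]

theorem anc_ne_root {v : V} {i : ℕ} (h : T.level v + i < T.H) : T.anc v i ≠ T.root := fun h1 => by
  have := T.level_anc v i h.le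
  rw [h1, T.level_root] at this
  omega

theorem anc_mem_children {v : V} {i : ℕ} (h : T.level v + i < T.H) :
    T.anc v i ∈ T.children (T.anc v (i + 1)) :=
  T.mem_children.2 ⟨T.anc_ne_root h, (T.anc_succ v i).symm⟩

/-- The ancestors of `u` are on different levels. -/
theorem card_ancestors_le (u : V) :
    (Finset.univ.filter fun w => u ∈ T.sub w).card ≤ T.H + 1 := by
  rw [← Finset.card_range (T.H + 1)]
  refine Finset.card_le_card_of_injOn T.level (fun w _ => ?_) fun v hv w hw h => ?_
  · simpa [Nat.lt_succ_iff] using T.level_le w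
  · simp only [Finset.coe_filter, Finset.mem_univ, true_and, Set.mem_ofPred_eq] at hv hw
    exact T.eq_of_level_eq hv hw h

end HST

/-! ### The parameters -/

namespace Inst
variable (I : Inst V)

theorem H_ge : (2 : ℝ) ≤ I.H := by exact_mod_cast I.two_le_H

theorem k_ge : (1 : ℝ) ≤ I.k := by exact_mod_cast I.one_le_k

theorem lam_ge' : (20 : ℝ) ≤ I.lam := by have := I.lam_ge; have := I.H_ge; linarith

theorem lam_pos : 0 < I.lam := by have := I.lam_ge'; linarith

theorem c_pos (v : V) : 0 < I.c v := pow_pos I.lam_pos _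

theorem one_le_lam_pow (i : ℕ) : 1 ≤ I.lam ^ i := one_le_pow₀ (by have := I.lam_ge'; linarith)

theorem lam_pow_pos (i : ℕ) : 0 < I.lam ^ i := pow_pos I.lam_pos _

theorem Δ_ge' : 20 ≤ I.Δ := by
  refine le_trans ?_ I.Δ_ge
  calc (20 : ℝ) ≤ I.lam ^ 1 := by simpa using I.lam_ge'
    _ ≤ I.lam ^ (I.H - 1) := pow_le_pow_right₀ (by have := I.lam_ge'; linarith)
        (by have := I.two_le_H; omega)

/-- The root and the dummy leaves alone are at least three nodes; the bound five that is used
below holds whenever there is a leaf on level `0`. -/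
theorem n_ge {v : V} (hv : I.level v = 0) : (5 : ℝ) ≤ I.n := by
  have hH := I.two_le_H
  have h0 : I.level (I.anc v 0) = 0 := hv
  have h1 : I.level (I.anc v 1) = 1 := by rw [I.level_anc v 1 (by omega)]; omega
  have hnd : ∀ x ∈ I.dummy, I.level x = I.H - 1 := fun x hx => by
    obtain ⟨ha, hb, -⟩ := I.dummy_spec x hx
    have := I.level_parent x ha
    rw [hb, I.level_root] at this; omega
  have hleaf : ∀ x ∈ I.dummy, ∀ u, u ∈ I.sub x → u = x := fun x hx u hu => by
    obtain ⟨-, -, hc⟩ := I.dummy_spec x hx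
    have := I.sub_eq_of_isLeaf (I.isLeaf_iff.2 hc)
    rw [this] at hu; simpa using hu
  have hd0 : v ∉ I.dummy := fun h => by have := hnd v h; omega
  have hd1 : I.anc v 1 ∉ I.dummy := fun h => by
    have := hleaf _ h v (I.anc_mem v 1)
    rw [← this] at h1; omega
  have hdr : I.root ∉ I.dummy := fun h => (I.dummy_spec _ h).1 rfl
  have hv1 : v ≠ I.anc v 1 := fun h => by rw [← h] at h1; omega
  have hvr : v ≠ I.root := fun h => by rw [h, I.level_root] at hv; omega
  have h1r : I.anc v 1 ≠ I.root := fun h => by rw [h, I.level_root] at h1; omega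
  have hcard : (insert v (insert (I.anc v 1) (insert I.root I.dummy))).card = 2 * I.k + 3 := by
    rw [Finset.card_insert_of_notMem, Finset.card_insert_of_notMem, Finset.card_insert_of_notMem,
      I.dummy_card]
    · exact hdr
    · simp [h1r, hd1]
    · simp [hv1, hvr, hd0]
  have h5 : 5 ≤ Fintype.card V := by
    have := Finset.card_le_univ (insert v (insert (I.anc v 1) (insert I.root I.dummy)))
    have := I.one_le_k
    omega
  simp only [HST.n]
  exact_mod_cast h5

theorem n_ge_three : (3 : ℝ) ≤ I.n := by
  have hdr : I.root ∉ I.dummy := fun h => (I.dummy_spec _ h).1 rfl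
  have h5 : 3 ≤ Fintype.card V := by
    have := Finset.card_le_univ (insert I.root I.dummy)
    rw [Finset.card_insert_of_notMem hdr, I.dummy_card] at this
    have := I.one_le_k
    omega
  simp only [HST.n]
  exact_mod_cast h5

theorem del_pos : 0 < I.del := by
  have := I.n_ge_three
  unfold HST.del; positivity

theorem del'_pos : 0 < I.del' := by
  have := I.n_ge_three
  unfold HST.del'; positivity

theorem gam_pos : 0 < I.gam := by
  have := I.n_ge_three
  have := I.Δ_ge'
  unfold gam; positivity

theorem del_mul_n : I.del * I.n = I.del' / 10 := by
  have := I.n_ge_three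
  unfold HST.del HST.del'
  field_simp

theorem del'_le : I.del' ≤ 1 / 9 := by
  have := I.n_ge_three
  unfold HST.del'
  gcongr
  nlinarith

/-- The granularity is much smaller than the activity threshold. -/
theorem four_n_gam_le : 4 * I.n * I.gam ≤ 2 * I.del := by
  have hn := I.n_ge_three
  have hΔ := I.Δ_ge'
  have h1 : I.gam ≤ 1 / (I.n ^ 4 * 20) := by unfold gam; gcongr
  have h2 : 4 * I.n * (1 / (I.n ^ 4 * 20)) = 2 * I.del := by
    unfold HST.del; field_simp; norm_num
  calc _ ≤ 4 * I.n * (1 / (I.n ^ 4 * 20)) := by gcongr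
    _ = _ := h2

/-- Right-hand sides are at least `δ' / 2`, so this bounds the duration of a timer. -/
theorem two_gam_div_del'_le : 2 * I.gam / I.del' ≤ 1 / 10 := by
  have hn := I.n_ge_three
  have h := I.four_n_gam_le
  have h2 := I.del_mul_n
  have h3 := I.del'_pos
  have h4 := I.gam_pos
  rw [div_le_iff₀ h3]
  have h5 := mul_le_mul_of_nonneg_left h (by linarith : 0 ≤ I.n)
  have h6 : 9 * I.gam ≤ I.n * I.n * I.gam := by gcongr; nlinarith
  nlinarith

theorem gam_le_del' : I.gam ≤ I.del' / 20 := by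
  have h := I.two_gam_div_del'_le
  have h3 := I.del'_pos
  rw [div_le_iff₀ h3] at h
  linarith

theorem gam_le_one : I.gam ≤ 1 / 100 := by
  have := I.gam_le_del'
  have := I.del'_le
  linarith

theorem M_ge' : 5 / 2 * (I.H * I.lam ^ (2 * I.H) * I.k / I.gam) + 1 ≤ I.M := by
  refine le_trans (le_of_eq ?_) I.M_ge
  have := I.gam_pos
  have h : (1 / ((Fintype.card V : ℝ) ^ 4 * I.Δ)) = I.gam := rfl
  rw [h]
  field_simp

theorem one_le_M : 1 ≤ I.M := by
  have := I.M_ge'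
  have := I.gam_pos
  have := I.lam_pow_pos (2 * I.H)
  have : 0 ≤ (I.H * I.lam ^ (2 * I.H) * I.k / I.gam : ℝ) := by positivity
  linarith

/-- The constant `γ / (M n)`: the rate at which a variable `y(u, t)` grows when it is zero is
`rate / lam ^ level u`. -/
def rate : ℝ := I.gam / (I.M * I.n)

theorem rate_pos : 0 < I.rate := by
  have := I.gam_pos
  have := I.one_le_M
  have := I.n_ge_three
  unfold rate; positivity

end Inst

/-- Only leaves hold server mass, so that of an inner node is the total of its children. -/
theorem subMass_eq (I : Inst V) (S : State V) {v : V} (h : (I.children v).Nonempty) :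
    subMass I S v = ∑ u ∈ I.children v, subMass I S u := by
  have h1 := I.sum_sub v fun l => if I.IsLeaf l then S.mass l else 0
  obtain ⟨u, hu⟩ := h
  rw [if_neg (I.not_isLeaf hu), zero_add] at h1
  simpa [subMass, Finset.sum_filter] using h1

/-! ### Sums over lists -/

section Lists
variable {α β : Type*}

theorem sum_map_filter_eq (L : List α) (p : α → Prop) [DecidablePred p] (f : α → ℝ) :
    ((L.filter fun x => p x).map f).sum = (L.map fun x => if p x then f x else 0).sum := by
  induction L with
  | nil => rfl
  | cons a L ih =>
    by_cases h : p a
    · simp [h, ih]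
    · simp [h, ih]

theorem sum_map_le {L : List α} {f g : α → ℝ} (h : ∀ x ∈ L, f x ≤ g x) :
    (L.map f).sum ≤ (L.map g).sum := List.sum_le_sum h

theorem sum_map_nonneg {L : List α} {f : α → ℝ} (h : ∀ x ∈ L, 0 ≤ f x) : 0 ≤ (L.map f).sum :=
  List.sum_nonneg (by simpa using h)

theorem sum_map_congr {L : List α} {f g : α → ℝ} (h : ∀ x ∈ L, f x = g x) :
    (L.map f).sum = (L.map g).sum := by rw [List.map_congr_left h]

theorem sum_map_zero {L : List α} {f : α → ℝ} (h : ∀ x ∈ L, f x = 0) : (L.map f).sum = 0 := by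
  rw [sum_map_congr h]; simp

theorem sum_map_append_singleton (L : List α) (a : α) (f : α → ℝ) :
    ((L ++ [a]).map f).sum = (L.map f).sum + f a := by simp

/-- Sum of `f j a` over the entries `a` of a list, where `j` is the position of `a`. -/
def idxSum (L : List α) (f : ℕ → α → ℝ) : ℝ :=
  ∑ j ∈ Finset.range L.length, (L[j]?).elim 0 (f j)

@[simp] theorem idxSum_nil (f : ℕ → α → ℝ) : idxSum [] f = 0 := by simp [idxSum]

theorem idxSum_append (L : List α) (a : α) (f : ℕ → α → ℝ) :
    idxSum (L ++ [a]) f = idxSum L f + f L.length a := by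
  unfold idxSum
  rw [List.length_append, List.length_singleton, Finset.sum_range_succ]
  congr 1
  · refine Finset.sum_congr rfl fun j hj => ?_
    rw [List.getElem?_append_left (Finset.mem_range.1 hj)]
  · simp

theorem idxSum_le {L : List α} {f g : ℕ → α → ℝ}
    (h : ∀ j a, L[j]? = some a → f j a ≤ g j a) : idxSum L f ≤ idxSum L g := by
  refine Finset.sum_le_sum fun j hj => ?_
  have := List.getElem?_eq_getElem (Finset.mem_range.1 hj)
  rw [this]
  exact h j _ this

theorem idxSum_congr {L : List α} {f g : ℕ → α → ℝ}
    (h : ∀ j a, L[j]? = some a → f j a = g j a) : idxSum L f = idxSum L g :=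
  le_antisymm (idxSum_le fun j a ha => (h j a ha).le) (idxSum_le fun j a ha => (h j a ha).ge)

theorem idxSum_add (L : List α) (f g : ℕ → α → ℝ) :
    idxSum L (fun j a => f j a + g j a) = idxSum L f + idxSum L g := by
  induction L using List.reverseRecOn with
  | nil => simp
  | append_singleton L a ih => rw [idxSum_append, idxSum_append, idxSum_append, ih]; ring

theorem idxSum_const (L : List α) (f : α → ℝ) :
    idxSum L (fun _ a => f a) = (L.map f).sum := by
  induction L using List.reverseRecOn with
  | nil => simp
  | append_singleton L a ih => rw [idxSum_append, ih, sum_map_append_singleton]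

theorem idxSum_mul (L : List α) (c : ℝ) (f : ℕ → α → ℝ) :
    idxSum L (fun j a => c * f j a) = c * idxSum L f := by
  induction L using List.reverseRecOn with
  | nil => simp
  | append_singleton L a ih => rw [idxSum_append, idxSum_append, ih]; ring

theorem idxSum_zero {L : List α} {f : ℕ → α → ℝ} (h : ∀ j a, L[j]? = some a → f j a = 0) :
    idxSum L f = 0 := by
  rw [idxSum_congr h]
  simpa using idxSum_mul L 0 fun _ _ => 0

theorem idxSum_single {L : List α} {j₀ : ℕ} {a₀ : α} (h : L[j₀]? = some a₀) (f : α → ℝ) :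
    idxSum L (fun j a => if j = j₀ then f a else 0) = f a₀ := by
  have hj : j₀ < L.length := (List.getElem?_eq_some_iff.1 h).1
  unfold idxSum
  rw [Finset.sum_eq_single_of_mem j₀ (Finset.mem_range.2 hj)]
  · simp [h]
  · intro j hj hne
    cases L[j]? <;> simp [hne]

theorem sum_map_idxSum (L : List β) (M : List α) (g : β → ℕ → α → ℝ) :
    (L.map fun C => idxSum M (g C)).sum = idxSum M fun j a => (L.map fun C => g C j a).sum := by
  induction L with
  | nil => simp [idxSum_zero]
  | cons b L ih => simp [ih, idxSum_add]

end Lists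

theorem load_eq (I : Inst V) (S : State V) (u : V) (j : ℕ) :
    load I S u j = ((S.cons (I.parent u)).map fun C => if C.src u = some j then C.z else 0).sum :=
  sum_map_filter_eq _ _ _

theorem dualObj_eq (I : Inst V) (S : State V) (v : V) (τ : ℕ) :
    dualObj I S v τ =
      ((S.cons v).map fun C => if C.time = τ then C.rhs I v * C.z else 0).sum :=
  sum_map_filter_eq _ _ _

/-! ### Invariants of the local constraints -/

/-- The properties of a single constraint `C` of the local LP at `v`. The lower bound on its right-hand
side holds since, after the start, constraints are only added while the requested leaf has mass at
most `1 - δ'`. -/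
structure ConWF (I : Inst V) (v : V) (C : Con V) : Prop where
  A_sub : C.A ⊆ I.sub v
  A_ne : C.A.Nonempty
  tau_self : C.tau v = C.time
  z_nonneg : 0 ≤ C.z
  rhs_ge : I.del' / 2 ≤ C.rhs I v
  bot : C.IsBot → C.A = {v} ∧ C.z = 0 ∧ ∀ u, C.src u = none
  nonbot : ¬ C.IsBot → v ∉ C.A
  mass_le : C.mass ≤ I.k + 1

/-- The constraint `C` at `v` was composed from the constraint `σ` at the child `u` of `v`, which
was the latest one at `u` that was awake; as `⊥`-constraints are always awake, none of
these is between `σ` and `C`. -/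
structure SrcOK (I : Inst V) (S : State V) (v : V) (C : Con V) (u : V) (σ : Con V) : Prop where
  child : u ∈ I.children v
  A_inter : C.A ∩ I.sub u = σ.A
  agree : ∀ w ∈ I.sub u, C.f w = σ.f w ∧ C.tau w = σ.tau w
  time_le : σ.time ≤ C.time
  /-- A source that is not from the same timestep is even from an earlier time period, as the
  siblings of the path to the requested leaf get no constraints in the current one. -/
  period : σ.time < C.time → σ.time / I.N < C.time / I.N
  bots : ∀ B ∈ S.cons u, B.IsBot → B.time ≤ C.time → B.time ≤ σ.time

/-- The invariants of the server masses and of the lists of constraints which hold between any two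
elementary steps of the algorithm, up to timestep `τ`. -/
structure Core (I : Inst V) (τ : ℕ) (S : State V) : Prop where
  mass_nonneg : ∀ l, 0 ≤ S.mass l
  le_total : (I.k : ℝ) ≤ subMass I S I.root
  total_le : subMass I S I.root ≤ I.k + 1
  times : ∀ v, ∀ C ∈ S.cons v, C.time ≤ τ
  wf : ∀ v, ∀ C ∈ S.cons v, ConWF I v C
  src : ∀ v, ∀ C ∈ S.cons v, ∀ u j, C.src u = some j →
    ∃ σ, (S.cons u)[j]? = some σ ∧ SrcOK I S v C u σ
  /-- The set `A` of a composed constraint is the union of the sets of its sources. -/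
  cover : ∀ v, ∀ C ∈ S.cons v, (∃ u, C.src u ≠ none) → ∀ a ∈ C.A, ∃ u, C.src u ≠ none ∧ a ∈ I.sub u
  /-- A timestep only stops being awake when its constraints are depleted. -/
  awake : ∀ u j B, (S.cons u)[j]? = some B →
    B.time ∈ S.awake u ∨ (¬ B.IsBot ∧ (1 + 1 / (I.H : ℝ)) * B.z ≤ load I S u j)
  /-- The timers stop as soon as a source is depleted. -/
  load_le : ∀ u j B, (S.cons u)[j]? = some B → ¬ B.IsBot →
    load I S u j ≤ (1 + 1 / (I.H : ℝ)) * B.z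

theorem rhs_eq {I : Inst V} {v : V} {C : Con V} (h : C.A ⊆ I.sub v) :
    C.rhs I v = C.A.card - C.mass - 2 * I.del * (I.n - I.nv v) := by
  rw [Con.rhs, Finset.inter_eq_left.2 h]

theorem ConWF.rhs_pos {I : Inst V} {v : V} {C : Con V} (h : ConWF I v C) : 0 < C.rhs I v := by
  have := I.del'_pos
  linarith [h.rhs_ge]

theorem subMass_nonneg {I : Inst V} {S : State V} (h : ∀ l, 0 ≤ S.mass l) (v : V) :
    0 ≤ subMass I S v := Finset.sum_nonneg fun l _ => h l

theorem subMass_mono {I : Inst V} {S : State V} (h : ∀ l, 0 ≤ S.mass l) {u v : V}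
    (huv : u ∈ I.sub v) : subMass I S u ≤ subMass I S v := by
  refine Finset.sum_le_sum_of_subset_of_nonneg ?_ fun l _ _ => h l
  exact Finset.filter_subset_filter _ (I.sub_subset huv)

theorem Core.subMass_le {I : Inst V} {τ : ℕ} {S : State V} (h : Core I τ S) (v : V) :
    subMass I S v ≤ I.k + 1 :=
  (subMass_mono h.mass_nonneg (I.mem_sub_root v)).trans h.total_le

theorem mem_of_getElem? {α : Type*} {L : List α} {j : ℕ} {a : α} (h : L[j]? = some a) : a ∈ L :=
  List.mem_of_getElem? h

theorem load_nonneg {I : Inst V} {τ : ℕ} {S : State V} (h : Core I τ S) (u : V) (j : ℕ) :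
    0 ≤ load I S u j := by
  rw [load_eq]
  refine sum_map_nonneg fun C hC => ?_
  split_ifs
  exacts [(h.wf _ C hC).z_nonneg, le_rfl]

theorem load_eq_zero {I : Inst V} {τ : ℕ} {S : State V} (h : Core I τ S) (u : V) (j : ℕ)
    (hj : ∀ B, (S.cons u)[j]? = some B → ∀ C ∈ S.cons (I.parent u), C.time < B.time) :
    load I S u j = 0 := by
  rw [load_eq]
  refine sum_map_zero fun C hC => ?_
  rw [if_neg]
  intro h1
  obtain ⟨σ, h2, h3⟩ := h.src _ C hC u j h1
  have := hj σ h2 C hC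
  have := h3.time_le
  omega

/-- `S'` arises from `S` by appending `C` to the constraints at `v`. -/
def Appends (S S' : State V) (v : V) (C : Con V) : Prop :=
  S'.cons = Function.update S.cons v (S.cons v ++ [C])

theorem Appends.self {S S' : State V} {v : V} {C : Con V} (h : Appends S S' v C) :
    S'.cons v = S.cons v ++ [C] := by rw [h]; simp

theorem Appends.of_ne {S S' : State V} {v : V} {C : Con V} (h : Appends S S' v C) {u : V}
    (hu : u ≠ v) : S'.cons u = S.cons u := by rw [h]; simp [hu]

theorem Appends.mem {S S' : State V} {v : V} {C : Con V} (h : Appends S S' v C) {u : V}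
    {B : Con V} : B ∈ S'.cons u ↔ B ∈ S.cons u ∨ (u = v ∧ B = C) := by
  by_cases hu : u = v
  · subst hu; rw [h.self]; simp
  · rw [h.of_ne hu]; simp [hu]

theorem Appends.getElem? {S S' : State V} {v : V} {C : Con V} (h : Appends S S' v C) {u : V}
    {j : ℕ} {B : Con V} (hB : (S'.cons u)[j]? = some B) :
    (S.cons u)[j]? = some B ∨ (u = v ∧ j = (S.cons v).length ∧ B = C) := by
  by_cases hu : u = v
  · subst hu
    rw [h.self] at hB
    rcases lt_or_ge j (S.cons u).length with hj | hj
    · left; rwa [List.getElem?_append_left hj] at hB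
    · right
      rw [List.getElem?_append_right hj] at hB
      have hj2 := (List.getElem?_eq_some_iff.1 hB).1
      simp only [List.length_singleton] at hj2
      have hj3 : j = (S.cons u).length := by omega
      rw [hj3] at hB
      simp only [Nat.sub_self, List.getElem?_cons_zero, Option.some.injEq] at hB
      exact ⟨rfl, hj3, hB.symm⟩
  · rw [h.of_ne hu] at hB; exact Or.inl hB

theorem Appends.getElem?_old {S S' : State V} {v : V} {C : Con V} (h : Appends S S' v C) {u : V}
    {j : ℕ} {B : Con V} (hB : (S.cons u)[j]? = some B) : (S'.cons u)[j]? = some B := by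
  by_cases hu : u = v
  · subst hu
    rw [h.self, List.getElem?_append_left (List.getElem?_eq_some_iff.1 hB).1]
    exact hB
  · rw [h.of_ne hu]; exact hB

theorem Appends.load {I : Inst V} {S S' : State V} {v : V} {C : Con V} (h : Appends S S' v C)
    (u : V) (j : ℕ) : load I S' u j =
      load I S u j + if I.parent u = v ∧ C.src u = some j then C.z else 0 := by
  rw [load_eq, load_eq]
  by_cases hu : I.parent u = v
  · rw [hu, h.self, sum_map_append_singleton]; simp
  · rw [h.of_ne hu]; simp [hu]

/-- The invariants `Core` persist when a constraint is appended whose own properties are as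
required, if the node has an ancestor only with earlier constraints, and if timesteps
stop being awake only when depleted. -/
theorem Core.append {I : Inst V} {τ₀ τ : ℕ} {S S' : State V} {v : V} {C : Con V}
    (h : Core I τ₀ S) (hτ : τ₀ ≤ τ) (hap : Appends S S' v C) (hC : C.time = τ)
    (hmass : ∀ l, 0 ≤ S'.mass l) (htot : subMass I S' I.root = subMass I S I.root)
    (hpar : v ≠ I.root → ∀ B ∈ S.cons (I.parent v), B.time < τ)
    (hwf : ConWF I v C)
    (hsrc : ∀ u j, C.src u = some j → ∃ σ, (S.cons u)[j]? = some σ ∧ SrcOK I S v C u σ)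
    (hcover : (∃ u, C.src u ≠ none) → ∀ a ∈ C.A, ∃ u, C.src u ≠ none ∧ a ∈ I.sub u)
    (hself : τ ∈ S'.awake v)
    (haw : ∀ u, ∀ t ∈ S.awake u, t ∈ S'.awake u ∨ ∀ j B, (S.cons u)[j]? = some B → B.time = t →
      ¬ B.IsBot ∧ (1 + 1 / (I.H : ℝ)) * B.z ≤ load I S' u j)
    (hload : ∀ u j σ, C.src u = some j → (S.cons u)[j]? = some σ → ¬ σ.IsBot →
      load I S u j + C.z ≤ (1 + 1 / (I.H : ℝ)) * σ.z) : Core I τ S' := by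
  have hkeep : ∀ w D u σ, SrcOK I S w D u σ → (u = v → D.time < τ) → SrcOK I S' w D u σ := by
    intro w D u σ hs hD
    refine ⟨hs.child, hs.A_inter, hs.agree, hs.time_le, hs.period, fun B hB hbot hBt => ?_⟩
    rcases hap.mem.1 hB with hB | ⟨rfl, rfl⟩
    · exact hs.bots B hB hbot hBt
    · have := hD rfl; omega
  have hchild : ∀ w D u j, D ∈ S.cons w → D.src u = some j → u = v → D.time < τ := by
    intro w D u j hD hj huv
    subst huv
    obtain ⟨σ, -, hs⟩ := h.src w D hD u j hj
    obtain ⟨h1, rfl⟩ := I.mem_children.1 hs.child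
    exact hpar h1 D hD
  have hnoself : ∀ j, C.src v = some j → False := fun j hj => by
    obtain ⟨σ, -, hs⟩ := hsrc v j hj
    exact I.ne_of_mem_children hs.child rfl
  refine ⟨hmass, htot ▸ h.le_total, htot ▸ h.total_le, ?_, ?_, ?_, ?_, ?_, ?_⟩
  · intro u B hB
    rcases hap.mem.1 hB with hB | ⟨rfl, rfl⟩
    exacts [(h.times u B hB).trans hτ, hC.le]
  · intro u B hB
    rcases hap.mem.1 hB with hB | ⟨rfl, rfl⟩
    exacts [h.wf u B hB, hwf]
  · intro w D hD u j hj
    rcases hap.mem.1 hD with hD | ⟨rfl, rfl⟩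
    · obtain ⟨σ, h1, h2⟩ := h.src w D hD u j hj
      exact ⟨σ, hap.getElem?_old h1, hkeep w D u σ h2 (hchild w D u j hD hj)⟩
    · obtain ⟨σ, h1, h2⟩ := hsrc u j hj
      refine ⟨σ, hap.getElem?_old h1, hkeep w D u σ h2 fun huv => ?_⟩
      subst huv
      exact (hnoself j hj).elim
  · intro w D hD
    rcases hap.mem.1 hD with hD | ⟨rfl, rfl⟩
    exacts [h.cover w D hD, hcover]
  · intro u j B hB
    have hmono : load I S u j ≤ load I S' u j := by
      rw [hap.load]
      have := hwf.z_nonneg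
      split_ifs <;> linarith
    rcases hap.getElem? hB with hB | ⟨rfl, rfl, rfl⟩
    · rcases h.awake u j B hB with h1 | ⟨h1, h2⟩
      · rcases haw u _ h1 with h3 | h3
        exacts [Or.inl h3, Or.inr (h3 j B hB rfl)]
      · exact Or.inr ⟨h1, h2.trans hmono⟩
    · exact Or.inl (hC ▸ hself)
  · intro u j B hB hbot
    rw [hap.load]
    rcases hap.getElem? hB with hB | ⟨rfl, rfl, rfl⟩
    · split_ifs with h1
      · exact hload u j B h1.2 hB hbot
      · simpa using h.load_le u j B hB hbot
    · rw [if_neg fun h1 => hnoself _ h1.2, load_eq_zero h, zero_add]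
      · have := hwf.z_nonneg
        have := I.H_ge
        positivity
      · intro B' hB'
        rw [List.getElem?_eq_none le_rfl] at hB'
        simp at hB'

/-! ### The potential of a node -/

/-- The potential of `u` with respect to the timesteps after `T`. A constraint of dual value `z`
contributes `b ((1 + 3 / (4 H)) z - load)`: adding it pays for the server mass that enters `T_u` at
that time, and using it in composed constraints accounts for the server mass that leaves `T_u`. The
factor is smaller than the one at which a constraint becomes depleted, so depleted constraints
contribute at most `- b z / (4 H)`. -/
def pot (I : Inst V) (S : State V) (u : V) (T : ℕ) : ℝ :=
  idxSum (S.cons u) fun j B => if T < B.time then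
    B.rhs I u * ((1 + 3 / (4 * I.H : ℝ)) * B.z - load I S u j) else 0

/-- The balance of server mass in `T_u`: since timestep `C0.time`, the server mass that has left
`T_u` pays for the increase of the variables `y(u, ·)` and for all the mass that has
entered `T_u`, up to the potential. The number `a` is the mass that may still enter `T_u` during
the current timestep. A `⊥`-constraint adds nothing to the potential although server mass may enter
`T_u` when it is added; hence there must be none after `C0`. -/
def Balance (I : Inst V) (S : State V) (τ : ℕ) (u : V) (a : ℝ) : Prop :=
  ∀ C0 ∈ S.cons u, (∀ C ∈ S.cons u, C0.time < C.time → ¬ C.IsBot) →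
    subMass I S u + ∑ t ∈ Finset.Ioc C0.time τ, S.y (I.parent u) u t + a ≤
      C0.mass + 2 * I.gam + pot I S u C0.time / I.lam ^ I.level u

/-- Non-solitary timesteps have a dual objective value of at least `γ / λ ^ H`. -/
def DualLB (I : Inst V) (S : State V) (u : V) : Prop :=
  ∀ T ∈ nonSolitary S u, I.gam / I.lam ^ I.H ≤ dualObj I S u T

/-- The total duration for which the variable `y^v(u, t)` has been raised. -/
def timerSum (S : State V) (v u : V) (t : ℕ) : ℝ :=
  ((S.cons v).map fun C => if C.src u ≠ none ∧ C.tau u < t ∧ t ≤ C.time ∧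
    (t ∈ nonSolitary S u ∨ t = C.tau u + 1) then C.z else 0).sum

/-- The invariants of the primal variables. The last one integrates the exponential update rule; as the
variables are bounded, it bounds the timers. -/
structure YInv (I : Inst V) (τ : ℕ) (S : State V) : Prop where
  nonneg : ∀ v u t, 0 ≤ S.y v u t
  zero : ∀ v u t, τ < t → S.y v u t = 0
  le : ∀ v u t, S.y v u t ≤ I.k + 3
  timer : ∀ v, ∀ u ∈ I.children v, ∀ t,
    I.rate * Real.exp (timerSum S v u t / I.lam ^ I.level u) ≤ S.y v u t + I.rate

/-! ### Server movement -/

/-- Server mass moves from the leaves in `L` to the leaf `v0`. -/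
structure Moved (L : Finset V) (v0 : V) (m m' : V → ℝ) : Prop where
  le : ∀ l, l ≠ v0 → m' l ≤ m l
  eq : ∀ l, l ≠ v0 → l ∉ L → m' l = m l
  total : ∑ l ∈ L, m' l + m' v0 = ∑ l ∈ L, m l + m v0

theorem Moved.refl (L : Finset V) (v0 : V) (m : V → ℝ) : Moved L v0 m m :=
  ⟨fun _ _ => le_rfl, fun _ _ _ => rfl, rfl⟩

theorem Moved.trans {L : Finset V} {v0 : V} {m m' m'' : V → ℝ} (h : Moved L v0 m m')
    (h' : Moved L v0 m' m'') : Moved L v0 m m'' :=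
  ⟨fun l hl => (h'.le l hl).trans (h.le l hl),
    fun l hl hL => (h'.eq l hl hL).trans (h.eq l hl hL), h'.total.trans h.total⟩

section Transfer
variable {L : Finset V} {v0 : V} {m m' x : V → ℝ}

theorem Transfer.of_ne (h : Transfer L v0 m m' x) {l : V} (hl : l ≠ v0) : m' l = m l - x l := by
  simpa [hl] using h.2.2.2 l

theorem Transfer.self (h : Transfer L v0 m m' x) (hv : v0 ∉ L) :
    m' v0 = m v0 + ∑ l ∈ L, x l := by
  have := h.2.2.2 v0
  rw [h.2.1 v0 hv] at this
  simpa using this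

theorem Transfer.nonneg (h : Transfer L v0 m m' x) (hm : ∀ l, 0 ≤ m l) (l : V) : 0 ≤ m' l := by
  have h1 : 0 ≤ m l - x l := by
    by_cases hl : l ∈ L
    · have := h.2.2.1 l hl; linarith
    · rw [h.2.1 l hl]; simpa using hm l
  rw [h.2.2.2 l]
  have : 0 ≤ ∑ l ∈ L, x l := Finset.sum_nonneg fun l _ => h.1 l
  split_ifs <;> linarith

theorem Transfer.moved (h : Transfer L v0 m m' x) (hv : v0 ∉ L) : Moved L v0 m m' := by
  refine ⟨fun l hl => ?_, fun l hl hL => ?_, ?_⟩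
  · rw [h.of_ne hl]; linarith [h.1 l]
  · rw [h.of_ne hl, h.2.1 l hL, sub_zero]
  · rw [h.self hv, Finset.sum_congr rfl fun l hl =>
      h.of_ne (l := l) (ne_of_mem_of_not_mem hl hv), Finset.sum_sub_distrib]
    ring

end Transfer

section SubMass
variable {I : Inst V} {S S' : State V} {L : Finset V} {v0 : V}

theorem subMass_sub (I : Inst V) (S S' : State V) (w : V) : subMass I S' w - subMass I S w =
    ∑ l ∈ (I.sub w).filter I.IsLeaf, (S'.mass l - S.mass l) := by
  rw [subMass, subMass, Finset.sum_sub_distrib]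

theorem Moved.subMass_le (h : Moved L v0 S.mass S'.mass) {w : V} (hw : v0 ∉ I.sub w) :
    subMass I S' w ≤ subMass I S w := by
  refine Finset.sum_le_sum fun l hl => h.le l fun h1 => ?_
  rw [h1, Finset.mem_filter] at hl
  exact hw hl.1

theorem Moved.subMass_eq (h : Moved L v0 S.mass S'.mass) {w : V} (hv : v0 ∉ L)
    (h0 : I.IsLeaf v0) (hw : v0 ∈ I.sub w) (hL : ∀ l ∈ L, I.IsLeaf l ∧ l ∈ I.sub w) :
    subMass I S' w = subMass I S w := by
  rw [← sub_eq_zero, subMass_sub]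
  have hsub : insert v0 L ⊆ (I.sub w).filter I.IsLeaf := by
    intro l hl
    rcases Finset.mem_insert.1 hl with rfl | hl
    · exact Finset.mem_filter.2 ⟨hw, h0⟩
    · exact Finset.mem_filter.2 ⟨(hL l hl).2, (hL l hl).1⟩
  rw [← Finset.sum_subset hsub, Finset.sum_insert hv, Finset.sum_sub_distrib]
  · have := h.total; linarith
  · intro l _ hl
    rw [Finset.mem_insert, not_or] at hl
    rw [h.eq l hl.1 hl.2, sub_self]

theorem Moved.subMass_add (h : Moved L v0 S.mass S'.mass) {w : V}
    (h0 : I.IsLeaf v0) (hw : v0 ∈ I.sub w) (hL : ∀ l ∈ L, l ∉ I.sub w) :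
    subMass I S' w = subMass I S w + (S'.mass v0 - S.mass v0) := by
  rw [← sub_eq_iff_eq_add', subMass_sub]
  refine Finset.sum_eq_single_of_mem v0 (Finset.mem_filter.2 ⟨hw, h0⟩) fun l hl hne => ?_
  rw [h.eq l hne fun h1 => hL l h1 (Finset.mem_filter.1 hl).1, sub_self]

theorem Transfer.subMass_eq {x : V → ℝ} (h : Transfer L v0 S.mass S'.mass x) {w : V}
    (hw : v0 ∉ I.sub w) (hL : ∀ l ∈ L, I.IsLeaf l) :
    subMass I S' w = subMass I S w - ∑ l ∈ L ∩ I.sub w, x l := by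
  have h1 : subMass I S' w - subMass I S w = - ∑ l ∈ (I.sub w).filter I.IsLeaf, x l := by
    rw [subMass_sub, ← Finset.sum_neg_distrib]
    refine Finset.sum_congr rfl fun l hl => ?_
    rw [h.of_ne fun h1 => hw (h1 ▸ (Finset.mem_filter.1 hl).1)]
    ring
  have h2 : ∑ l ∈ L ∩ I.sub w, x l = ∑ l ∈ (I.sub w).filter I.IsLeaf, x l := by
    refine Finset.sum_subset (fun l hl => ?_) fun l hl hl' => ?_
    · rw [Finset.mem_inter] at hl
      exact Finset.mem_filter.2 ⟨hl.2, hL l hl.1⟩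
    · refine h.2.1 l fun h3 => hl' (Finset.mem_inter.2 ⟨h3, (Finset.mem_filter.1 hl).1⟩)
  linarith

end SubMass

/-! ### The exponential update -/

/-- The solution of the differential equation that defines the update of the variables. -/
theorem exp_update {Y : ℝ → ℝ} {d Λ g : ℝ} (hd : 0 < d)
    (h : ∀ s ∈ Set.Icc 0 d, HasDerivWithinAt Y (Y s / Λ + g / Λ) (Set.Icc 0 d) s) :
    Y d = (Y 0 + g) * Real.exp (d / Λ) - g := by
  set F : ℝ → ℝ := fun s => (Y s + g) * Real.exp (-(s / Λ)) with hF
  have hder : ∀ s ∈ Set.Icc 0 d, HasDerivWithinAt F 0 (Set.Icc 0 d) s := by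
    intro s hs
    have h1 := (h s hs).add_const g
    have h2 : HasDerivAt (fun s : ℝ => Real.exp (-(s / Λ))) (Real.exp (-(s / Λ)) * -(1 / Λ)) s :=
      ((hasDerivAt_id s).div_const Λ).neg.exp
    refine (h1.mul h2.hasDerivWithinAt).congr_deriv ?_
    ring
  have hcon := constant_of_derivWithin_zero
    (fun s hs => (hder s hs).differentiableWithinAt)
    (fun s hs => (hder s (Set.Ico_subset_Icc_self hs)).derivWithin
      (uniqueDiffOn_Icc hd s (Set.Ico_subset_Icc_self hs))) d (Set.right_mem_Icc.2 hd.le)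
  simp only [hF, zero_div, neg_zero, Real.exp_zero, mul_one] at hcon
  rw [← hcon, mul_assoc, ← Real.exp_add]
  simp

theorem exp_sub_one_le {θ : ℝ} (h0 : 0 ≤ θ) (h1 : θ ≤ 1) : Real.exp θ - 1 ≤ θ * (1 + θ) := by
  have := Real.abs_exp_sub_one_sub_id_le (x := θ) (by rwa [abs_of_nonneg h0])
  have := (abs_le.1 this).2
  nlinarith

/-! ### The balance of a sibling -/

section Sibling
variable {I : Inst V} {τ : ℕ} {S : State V} {u : V} {T : ℕ}

/-- After the last awake timestep, all constraints are depleted. -/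
theorem Core.depleted (h : Core I τ S) (hT : IsGreatest {t | t ∈ S.awake u ∧ t ≤ τ} T) {j : ℕ}
    {B : Con V} (hB : (S.cons u)[j]? = some B) (hTB : T < B.time) :
    ¬ B.IsBot ∧ (1 + 1 / (I.H : ℝ)) * B.z ≤ load I S u j := by
  rcases h.awake u j B hB with h1 | h1
  · have := hT.2 ⟨h1, h.times u B (mem_of_getElem? hB)⟩
    omega
  · exact h1

theorem sum_dualObj_le {f : Con V → ℝ} {L : List (Con V)} (hf : ∀ C ∈ L, 0 ≤ f C)
    (TS : Finset ℕ) (hTS : ∀ t ∈ TS, T < t) :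
    ∑ t ∈ TS, (L.map fun C => if C.time = t then f C else 0).sum ≤
      (L.map fun C => if T < C.time then f C else 0).sum := by
  induction L with
  | nil => simp
  | cons C L ih =>
    simp only [List.map_cons, List.sum_cons, Finset.sum_add_distrib]
    refine add_le_add ?_ (ih fun D hD => hf D (List.mem_cons_of_mem _ hD))
    rw [Finset.sum_ite_eq]
    have := hf C List.mem_cons_self
    by_cases h : C.time ∈ TS
    · rw [if_pos h, if_pos (hTS _ h)]
    · rw [if_neg h]; split_ifs <;> simp [this]

/-- Every non-solitary timestep after the last awake one contributes at most `- γ / (4 H λ ^ H)` to the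
potential, because it is depleted and its dual objective value is not too small. -/
theorem pot_le_of_depleted (h : Core I τ S) (hlb : DualLB I S u)
    (hT : IsGreatest {t | t ∈ S.awake u ∧ t ≤ τ} T) (TS : Finset ℕ)
    (hTS : ∀ t ∈ TS, t ∈ nonSolitary S u ∧ T < t) :
    pot I S u T ≤ -(1 / (4 * I.H : ℝ)) * (TS.card * (I.gam / I.lam ^ I.H)) := by
  have hH := I.H_ge
  have h1 : pot I S u T ≤ idxSum (S.cons u) fun _ B =>
      -(1 / (4 * I.H : ℝ)) * if T < B.time then B.rhs I u * B.z else 0 := by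
    refine idxSum_le fun j B hB => ?_
    split_ifs with hTB
    · have h2 := (h.depleted hT hB hTB).2
      have h3 := (h.wf u B (mem_of_getElem? hB)).rhs_pos
      have h4 : (1 + 3 / (4 * I.H : ℝ)) * B.z - load I S u j ≤ -(1 / (4 * I.H : ℝ)) * B.z := by
        have : (1 + 1 / (I.H : ℝ)) * B.z =
          (1 + 3 / (4 * I.H : ℝ)) * B.z + (1 / (4 * I.H : ℝ)) * B.z := by field_simp; ring
        linarith
      calc _ ≤ B.rhs I u * (-(1 / (4 * I.H : ℝ)) * B.z) := by gcongr
        _ = _ := by ring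
    · simp
  rw [idxSum_const] at h1
  have h2 : ((S.cons u).map fun B => -(1 / (4 * I.H : ℝ)) *
      if T < B.time then B.rhs I u * B.z else 0).sum = -(1 / (4 * I.H : ℝ)) *
      ((S.cons u).map fun B => if T < B.time then B.rhs I u * B.z else 0).sum :=
    List.sum_map_mul_left ..
  rw [h2] at h1
  have h3 := sum_dualObj_le (T := T) (f := fun B => B.rhs I u * B.z) (L := S.cons u)
    (fun C hC => mul_nonneg (h.wf u C hC).rhs_pos.le (h.wf u C hC).z_nonneg) TS
    fun t ht => (hTS t ht).2
  have h4 : TS.card * (I.gam / I.lam ^ I.H) ≤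
      ∑ t ∈ TS, ((S.cons u).map fun C => if C.time = t then C.rhs I u * C.z else 0).sum := by
    rw [← nsmul_eq_mul]
    refine Finset.card_nsmul_le_sum _ _ _ fun t ht => ?_
    rw [← dualObj_eq]
    exact hlb t (hTS t ht).1
  have h5 := h4.trans h3
  have h6 : 0 < 1 / (4 * I.H : ℝ) := by positivity
  nlinarith

/-- The server mass that is missing in `T_u` since the last awake timestep bounds the
variables `y(u, ·)` that are raised. -/
theorem Balance.sum_le (hbal : Balance I S τ u 0) (h : Core I τ S) (hlb : DualLB I S u)
    (hT : IsGreatest {t | t ∈ S.awake u ∧ t ≤ τ} T) {σ : Con V} (hσ : σ ∈ S.cons u)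
    (hσT : σ.time = T) :
    subMass I S u + ∑ t ∈ Finset.Ioc T τ, S.y (I.parent u) u t ≤ σ.mass + 2 * I.gam := by
  have h1 := hbal σ hσ fun C hC hlt => by
    obtain ⟨j, hj⟩ := List.mem_iff_getElem?.1 hC
    exact (h.depleted hT hj (hσT ▸ hlt)).1
  have h2 := pot_le_of_depleted h hlb hT ∅ (by simp)
  rw [hσT] at h1
  have h3 : pot I S u T / I.lam ^ I.level u ≤ 0 :=
    div_nonpos_of_nonpos_of_nonneg (by simpa using h2) (I.lam_pow_pos _).le
  linarith

/-- There are few non-solitary timesteps after the last awake one, as each of them has led to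
a net loss of server mass in `T_u`. -/
theorem Balance.card_le (hbal : Balance I S τ u 0) (h : Core I τ S) (hlb : DualLB I S u)
    (hy : ∀ v u t, 0 ≤ S.y v u t)
    (hT : IsGreatest {t | t ∈ S.awake u ∧ t ≤ τ} T) {σ : Con V} (hσ : σ ∈ S.cons u)
    (hσT : σ.time = T) (TS : Finset ℕ)
    (hTS : ∀ t ∈ TS, t ∈ nonSolitary S u ∧ T < t) : (TS.card : ℝ) ≤ 5 * I.M := by
  have h1 := hbal σ hσ fun C hC hlt => by
    obtain ⟨j, hj⟩ := List.mem_iff_getElem?.1 hC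
    exact (h.depleted hT hj (hσT ▸ hlt)).1
  have h2 := pot_le_of_depleted h hlb hT TS hTS
  rw [hσT] at h1
  have h3 : 0 ≤ subMass I S u := subMass_nonneg h.mass_nonneg u
  have h4 : 0 ≤ ∑ t ∈ Finset.Ioc T τ, S.y (I.parent u) u t :=
    Finset.sum_nonneg fun t _ => hy _ _ _
  have h5 := (h.wf u σ hσ).mass_le
  have hg := I.gam_pos
  have hg1 := I.gam_le_one
  have hk := I.k_ge
  have hH := I.H_ge
  have hl := I.lam_pow_pos (I.level u)
  have hL := I.lam_pow_pos I.H
  have h6 : -(pot I S u T) / I.lam ^ I.level u ≤ 3 * I.k := by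
    rw [neg_div]; linarith
  rw [div_le_iff₀ hl] at h6
  have hle : I.lam ^ I.level u ≤ I.lam ^ I.H :=
    pow_le_pow_right₀ (by have := I.lam_ge'; linarith) (I.level_le u)
  -- the potential is at least the negative of the mass `k + 1 + 2 γ ≤ 3 k` that can have left `T_u`
  have h7 : TS.card * I.gam ≤ 12 * (I.H * I.lam ^ (2 * I.H) * I.k) := by
    have h8 : 1 / (4 * I.H : ℝ) * (TS.card * (I.gam / I.lam ^ I.H)) ≤ 3 * I.k * I.lam ^ I.H := by
      have : 3 * I.k * I.lam ^ I.level u ≤ 3 * I.k * I.lam ^ I.H := by gcongr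
      linarith
    have h9 : 1 / (4 * I.H : ℝ) * (TS.card * (I.gam / I.lam ^ I.H)) * (4 * I.H * I.lam ^ I.H) =
        TS.card * I.gam := by field_simp
    rw [← h9]
    calc _ ≤ 3 * I.k * I.lam ^ I.H * (4 * I.H * I.lam ^ I.H) := by gcongr
      _ = _ := by rw [two_mul, pow_add]; ring
  have h8 := I.M_ge'
  have h9 : (TS.card : ℝ) ≤ 12 * (I.H * I.lam ^ (2 * I.H) * I.k / I.gam) := by
    rw [← mul_div_assoc, le_div_iff₀ hg]; exact h7
  linarith

end Sibling

/-! ### Composing constraints -/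

/-- The sum of the loads of the constraints at `u`, weighted by `g`. -/
def wload (I : Inst V) (S : State V) (u : V) (g : Con V → ℝ) : ℝ :=
  idxSum (S.cons u) fun j B => g B * load I S u j

/-- The part of the dual objective value of `𝔏^u(T)` that is used by the constraints composed
from the constraints in `𝔏^u(T)`. -/
def usedLoad (I : Inst V) (S : State V) (u : V) (T : ℕ) : ℝ :=
  wload I S u fun B => if B.time = T then B.rhs I u else 0

theorem pot_eq (I : Inst V) (S : State V) (u : V) (T : ℕ) :
    pot I S u T = ((S.cons u).map fun B => if T < B.time then
      (1 + 3 / (4 * I.H : ℝ)) * (B.rhs I u * B.z) else 0).sum -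
      wload I S u fun B => if T < B.time then B.rhs I u else 0 := by
  rw [eq_sub_iff_add_eq, ← idxSum_const, pot, wload, ← idxSum_add]
  refine idxSum_congr fun j B _ => ?_
  split_ifs <;> ring

theorem Appends.wload_of_src {I : Inst V} {S S' : State V} {v : V} {C : Con V}
    (h : Appends S S' v C) {u : V} (hu : u ∈ I.children v) {j : ℕ} (hj : C.src u = some j)
    {σ : Con V} (hσ : (S.cons u)[j]? = some σ) (g : Con V → ℝ) :
    wload I S' u g = wload I S u g + g σ * C.z := by
  have hp := (I.mem_children.1 hu).2
  rw [wload, h.of_ne (I.ne_of_mem_children hu), wload, ← idxSum_single hσ fun B => g B * C.z,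
    ← idxSum_add]
  refine idxSum_congr fun i B _ => ?_
  rw [h.load, hp, hj]
  by_cases hi : i = j
  · simp [hi]; ring
  · have : ¬ (some j = some i) := fun h1 => hi (by simpa using h1.symm)
    simp [hi, this]

theorem Appends.wload_of_none {I : Inst V} {S S' : State V} {v : V} {C : Con V}
    (h : Appends S S' v C) {u : V} (huv : u ≠ v) (hu : I.parent u ≠ v ∨ C.src u = none)
    (g : Con V → ℝ) : wload I S' u g = wload I S u g := by
  rw [wload, h.of_ne huv, wload]
  refine idxSum_congr fun i B _ => ?_
  rw [h.load, if_neg, add_zero]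
  rintro ⟨h1, h2⟩
  rcases hu with hu | hu
  · exact hu h1
  · rw [hu] at h2; simp at h2

theorem Appends.wload_self {I : Inst V} {τ : ℕ} {S S' : State V} {v : V} {C : Con V}
    (h : Appends S S' v C) (hcore : Core I τ S) (hv : C.src v = none) (g : Con V → ℝ) :
    wload I S' v g = wload I S v g := by
  have hl : ∀ j, KServerTW.load I S' v j = KServerTW.load I S v j := fun j => by
    rw [h.load, hv]; simp
  rw [wload, h.self, idxSum_append, hl, load_eq_zero hcore, mul_zero, add_zero, wload]
  · exact idxSum_congr fun j B _ => by rw [hl]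
  · intro B hB
    rw [List.getElem?_eq_none le_rfl] at hB
    simp at hB

/-- The setting of `FullUpdate` at `v`, whose principal child is `u0`: `sib` are the active
siblings of `u0`, and `LU` are leaves below them. -/
structure Ctx (I : Inst V) (v0 v u0 : V) (sib LU : Finset V) : Prop where
  lvl0 : I.level v0 = 0
  leaf0 : I.IsLeaf v0
  child0 : u0 ∈ I.children v
  mem0 : v0 ∈ I.sub u0
  sibs : sib ⊆ I.children v
  notMem : u0 ∉ sib
  leaves : ∀ l ∈ LU, I.IsLeaf l ∧ ∃ u ∈ sib, l ∈ I.sub u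

namespace Ctx
variable {I : Inst V} {v0 v u0 : V} {sib LU : Finset V}

theorem ne_u0 (h : Ctx I v0 v u0 sib LU) {u : V} (hu : u ∈ sib) : u ≠ u0 :=
  fun h1 => h.notMem (h1 ▸ hu)

theorem notMem_sub (h : Ctx I v0 v u0 sib LU) {u : V} (hu : u ∈ I.children v) (hne : u ≠ u0) :
    v0 ∉ I.sub u := fun h1 =>
  Finset.disjoint_left.1 (I.disjoint_sub hu h.child0 hne) h1 h.mem0

theorem notMem_LU (h : Ctx I v0 v u0 sib LU) : v0 ∉ LU := fun h1 => by
  obtain ⟨-, u, hu, h2⟩ := h.leaves v0 h1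
  exact h.notMem_sub (h.sibs hu) (h.ne_u0 hu) h2

theorem LU_sub (h : Ctx I v0 v u0 sib LU) {l : V} (hl : l ∈ LU) : l ∈ I.sub v := by
  obtain ⟨-, u, hu, h2⟩ := h.leaves l hl
  exact I.mem_sub_trans h2 (I.mem_sub_of_mem_children (h.sibs hu))

theorem LU_not_sub (h : Ctx I v0 v u0 sib LU) {l : V} (hl : l ∈ LU) : l ∉ I.sub u0 := fun h1 => by
  obtain ⟨-, u, hu, h2⟩ := h.leaves l hl
  exact Finset.disjoint_left.1 (I.disjoint_sub (h.sibs hu) h.child0 (h.ne_u0 hu)) h2 h1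

theorem level_sib (h : Ctx I v0 v u0 sib LU) {u : V} (hu : u ∈ I.children v) :
    I.level u = I.level u0 := by
  have := I.level_of_mem_children hu
  have := I.level_of_mem_children h.child0
  omega

theorem level_v (h : Ctx I v0 v u0 sib LU) : I.level v - 1 = I.level u0 := by
  have := I.level_of_mem_children h.child0
  omega

theorem mem_v (h : Ctx I v0 v u0 sib LU) : v0 ∈ I.sub v :=
  I.mem_sub_trans h.mem0 (I.mem_sub_of_mem_children h.child0)

theorem sum_LU (h : Ctx I v0 v u0 sib LU) (x : V → ℝ) :
    ∑ l ∈ LU, x l = ∑ u ∈ sib, ∑ l ∈ LU ∩ I.sub u, x l := by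
  rw [← Finset.sum_biUnion]
  · refine Finset.sum_congr ?_ fun _ _ => rfl
    ext l
    simp only [Finset.mem_biUnion, Finset.mem_inter]
    exact ⟨fun hl => by obtain ⟨-, u, hu, h2⟩ := h.leaves l hl; exact ⟨u, hu, hl, h2⟩,
      fun ⟨_, _, hl, _⟩ => hl⟩
  · intro u hu w hw hne
    exact (I.disjoint_sub (h.sibs hu) (h.sibs hw) hne).mono Finset.inter_subset_right
      Finset.inter_subset_right

theorem sum_children (h : Ctx I v0 v u0 sib LU) (f : V → ℝ) :
    ∑ u ∈ I.children v, f u =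
      f u0 + ∑ u ∈ sib, f u + ∑ u ∈ (I.children v).filter (fun u => u ≠ u0 ∧ u ∉ sib), f u := by
  have h1 : I.children v =
      insert u0 (sib ∪ (I.children v).filter (fun u => u ≠ u0 ∧ u ∉ sib)) := by
    ext u
    simp only [Finset.mem_insert, Finset.mem_union, Finset.mem_filter]
    constructor
    · intro hu; by_cases h1 : u = u0
      · exact Or.inl h1
      · by_cases h2 : u ∈ sib
        · exact Or.inr (Or.inl h2)
        · exact Or.inr (Or.inr ⟨hu, h1, h2⟩)
    · rintro (rfl | h1 | h1)
      exacts [h.child0, h.sibs h1, h1.1]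
  conv_lhs => rw [h1]
  rw [Finset.sum_insert, Finset.sum_union, add_assoc]
  · rw [Finset.disjoint_left]
    intro u hu h2
    exact (Finset.mem_filter.1 h2).2.2 hu
  · simp [h.notMem]

end Ctx

section Rhs
variable {I : Inst V} {v0 v u0 : V} {sib LU : Finset V}

theorem card_biUnion_eq (h : Ctx I v0 v u0 sib LU) {σ : V → Con V}
    (hσ : ∀ u ∈ insert u0 sib, (σ u).A ⊆ I.sub u) :
    (((insert u0 sib).biUnion fun u => (σ u).A).card : ℝ) =
      (σ u0).A.card + ∑ u ∈ sib, ((σ u).A.card : ℝ) := by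
  rw [Finset.card_biUnion, Finset.sum_insert h.notMem]
  · push_cast; rfl
  · intro u hu w hw hne
    have hu' : u ∈ I.children v := by
      rcases Finset.mem_insert.1 hu with rfl | hu
      exacts [h.child0, h.sibs hu]
    have hw' : w ∈ I.children v := by
      rcases Finset.mem_insert.1 hw with rfl | hw
      exacts [h.child0, h.sibs hw]
    exact (I.disjoint_sub hu' hw' hne).mono (hσ u hu) (hσ w hw)

theorem biUnion_inter (h : Ctx I v0 v u0 sib LU) {σ : V → Con V}
    (hσ : ∀ u ∈ insert u0 sib, (σ u).A ⊆ I.sub u) {u : V} (hu : u ∈ insert u0 sib) :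
    ((insert u0 sib).biUnion fun u => (σ u).A) ∩ I.sub u = (σ u).A := by
  have hch : ∀ w ∈ insert u0 sib, w ∈ I.children v := by
    intro w hw
    rcases Finset.mem_insert.1 hw with rfl | hw
    exacts [h.child0, h.sibs hw]
  ext a
  simp only [Finset.mem_inter, Finset.mem_biUnion]
  constructor
  · rintro ⟨⟨w, hw, ha⟩, ha'⟩
    by_cases hwu : w = u
    · rwa [hwu] at ha
    · exact (Finset.disjoint_left.1 (I.disjoint_sub (hch w hw) (hch u hu) hwu) (hσ w hw ha) ha').elim
  · intro ha
    exact ⟨⟨u, hu, ha⟩, hσ u hu ha⟩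

/-- The right-hand side of a composed constraint exceeds that of its principal part by the
amounts that the siblings contribute. The term `2 δ` in the right-hand sides leaves room for the
inactive leaves, and for the server mass moved in a single timestep. -/
theorem rhs_compose (h : Ctx I v0 v u0 sib LU) {S : State V} {σ : V → Con V} {C : Con V}
    (hσ : ∀ u ∈ insert u0 sib, (σ u).A ⊆ I.sub u)
    (hCA : C.A = (insert u0 sib).biUnion fun u => (σ u).A) (hCm : C.mass = subMass I S v)
    (hinact : ∀ u ∈ I.children v, u ≠ u0 → u ∉ sib → subMass I S u ≤ I.del * I.nv u)
    {Y : V → ℝ} (hY : ∀ u ∈ sib, subMass I S u + Y u ≤ (σ u).mass + 2 * I.gam)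
    {g : ℝ} (hg : subMass I S u0 ≤ (σ u0).mass + g) :
    ∑ u ∈ sib, (Y u + (σ u).rhs I u) + 2 * I.del ≤ C.rhs I v - (σ u0).rhs I u0 + g := by
  have hAsub : C.A ⊆ I.sub v := by
    rw [hCA]
    intro a ha
    obtain ⟨u, hu, ha⟩ := Finset.mem_biUnion.1 ha
    refine I.mem_sub_trans (hσ u hu ha) (I.mem_sub_of_mem_children ?_)
    rcases Finset.mem_insert.1 hu with rfl | hu
    exacts [h.child0, h.sibs hu]
  rw [rhs_eq hAsub, hCA, card_biUnion_eq h hσ, hCm, rhs_eq (hσ u0 (Finset.mem_insert_self _ _))]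
  have h1 : ∀ u ∈ sib, Y u + (σ u).rhs I u ≤
      (σ u).A.card - subMass I S u + 2 * I.gam - 2 * I.del * (I.n - I.nv u) := fun u hu => by
    rw [rhs_eq (hσ u (Finset.mem_insert_of_mem hu))]
    have := hY u hu
    linarith
  have h2 := Finset.sum_le_sum h1
  have h3 := subMass_eq I S ⟨u0, h.child0⟩
  rw [h.sum_children] at h3
  have h4 := I.nv_eq v
  rw [h.sum_children] at h4
  set rest := (I.children v).filter (fun u => u ≠ u0 ∧ u ∉ sib) with hrest
  have h5 : ∑ u ∈ rest, subMass I S u ≤ ∑ u ∈ rest, I.del * I.nv u :=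
    Finset.sum_le_sum fun u hu => by
      obtain ⟨ha, hb, hc⟩ := Finset.mem_filter.1 hu
      exact hinact u ha hb hc
  have h6 : 0 ≤ ∑ u ∈ rest, I.nv u :=
    Finset.sum_nonneg fun u _ => by have := I.nv_pos u; linarith
  rw [← Finset.mul_sum] at h5
  have h7 : ∑ u ∈ sib, ((σ u).A.card - subMass I S u + 2 * I.gam - 2 * I.del * (I.n - I.nv u)) =
      ∑ u ∈ sib, ((σ u).A.card : ℝ) - ∑ u ∈ sib, subMass I S u +
        sib.card * (2 * I.gam - 2 * I.del * I.n) + 2 * I.del * ∑ u ∈ sib, I.nv u := by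
    rw [Finset.mul_sum]
    simp only [Finset.sum_add_distrib, Finset.sum_sub_distrib, Finset.sum_const, nsmul_eq_mul,
      mul_sub]
    ring
  rw [h7] at h2
  have hd := I.del_pos
  have hn := I.n_ge_three
  have hgam := I.four_n_gam_le
  have hgp := I.gam_pos
  have h8 : (sib.card : ℝ) * (2 * I.gam - 2 * I.del * I.n) ≤ 0 := by
    refine mul_nonpos_of_nonneg_of_nonpos (Nat.cast_nonneg _) ?_
    nlinarith
  have h9 : 0 ≤ I.del * ∑ u ∈ rest, I.nv u := by positivity
  rw [h4, h3]
  nlinarith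

end Rhs

/-! ### One phase of a full update -/

section AppendLemmas
variable {I : Inst V} {τ : ℕ} {S S' : State V} {v : V} {C : Con V}

theorem Appends.pot_src (h : Appends S S' v C) {u : V} (hu : u ∈ I.children v) {j : ℕ}
    (hj : C.src u = some j) {σ : Con V} (hσ : (S.cons u)[j]? = some σ) (T : ℕ) :
    pot I S' u T = pot I S u T - (if T < σ.time then σ.rhs I u else 0) * C.z := by
  rw [pot_eq, pot_eq, h.wload_of_src hu hj hσ, h.of_ne (I.ne_of_mem_children hu)]
  ring

theorem Appends.pot_none (h : Appends S S' v C) {u : V} (huv : u ≠ v)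
    (hu : I.parent u ≠ v ∨ C.src u = none) (T : ℕ) : pot I S' u T = pot I S u T := by
  rw [pot_eq, pot_eq, h.wload_of_none huv hu, h.of_ne huv]

theorem Appends.pot_self (h : Appends S S' v C) (hcore : Core I τ S) (hv : C.src v = none)
    (T : ℕ) : pot I S' v T = pot I S v T +
      if T < C.time then (1 + 3 / (4 * I.H : ℝ)) * (C.rhs I v * C.z) else 0 := by
  rw [pot_eq, pot_eq, h.wload_self hcore hv, h.self, sum_map_append_singleton]
  ring

theorem Appends.nonSolitary_of_ne (h : Appends S S' v C) {u : V} (hu : u ≠ v) :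
    nonSolitary S' u = nonSolitary S u := by
  simp [nonSolitary, h.of_ne hu]

/-- A constraint added at `v` might make its timestep non-solitary at `v`. This has no effect on the
timers at the parent of `v`, as there are no constraints yet from that timestep or a later one. -/
theorem Appends.timerSum_of_ne (h : Appends S S' v C) {w u : V} (hw : w ≠ v)
    (hu : u ∈ I.children w) (hpar : v ≠ I.root → ∀ B ∈ S.cons (I.parent v), B.time < C.time)
    (t : ℕ) : timerSum S' w u t = timerSum S w u t := by
  unfold timerSum
  rw [h.of_ne hw]
  refine sum_map_congr fun D hD => ?_
  congr 1
  by_cases huv : u = v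
  · subst huv
    obtain ⟨h1, rfl⟩ := I.mem_children.1 hu
    have h2 := hpar h1 D hD
    have h3 : t ≤ D.time → (t ∈ nonSolitary S' u ↔ t ∈ nonSolitary S u) := by
      intro ht
      simp only [nonSolitary, Set.mem_ofPred_eq, h.mem]
      constructor
      · rintro ⟨B, hB | ⟨-, rfl⟩, h4, h5⟩
        · exact ⟨B, hB, h4, h5⟩
        · omega
      · rintro ⟨B, hB, h4, h5⟩
        exact ⟨B, Or.inl hB, h4, h5⟩
    apply propext
    constructor
    · rintro ⟨ha, hb, hc, hd⟩
      exact ⟨ha, hb, hc, by rwa [← h3 hc]⟩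
    · rintro ⟨ha, hb, hc, hd⟩
      exact ⟨ha, hb, hc, by rwa [h3 hc]⟩
  · rw [h.nonSolitary_of_ne huv]

theorem Appends.timerSum_self (h : Appends S S' v C) {u : V} (hu : u ∈ I.children v) (t : ℕ) :
    timerSum S' v u t = timerSum S v u t + if C.src u ≠ none ∧ C.tau u < t ∧ t ≤ C.time ∧
      (t ∈ nonSolitary S u ∨ t = C.tau u + 1) then C.z else 0 := by
  unfold timerSum
  rw [h.self, sum_map_append_singleton, h.nonSolitary_of_ne (I.ne_of_mem_children hu)]

theorem Appends.dualObj_self (h : Appends S S' v C) (hC : C.time = τ) :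
    dualObj I S' v τ = dualObj I S v τ + C.rhs I v * C.z := by
  rw [dualObj_eq, dualObj_eq, h.self, sum_map_append_singleton, if_pos hC]

theorem pot_eq_zero (h : Core I τ S) (u : V) : pot I S u τ = 0 :=
  idxSum_zero fun _ B hB => if_neg (by
    have := h.times u B (mem_of_getElem? hB)
    omega)

theorem usedLoad_nonneg (h : Core I τ S) (u : V) (T : ℕ) : 0 ≤ usedLoad I S u T := by
  rw [← idxSum_zero (L := S.cons u) (f := fun _ _ => 0) fun _ _ _ => rfl]
  refine idxSum_le fun j B hB => ?_
  have h1 := (h.wf u B (mem_of_getElem? hB)).rhs_pos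
  have h2 := load_nonneg h u j
  dsimp only
  split_ifs
  · positivity
  · simp

theorem dualObj_nonneg (h : Core I τ S) (u : V) (T : ℕ) : 0 ≤ dualObj I S u T := by
  rw [dualObj_eq]
  refine sum_map_nonneg fun B hB => ?_
  have h1 := (h.wf u B hB).rhs_pos
  have h2 := (h.wf u B hB).z_nonneg
  split_ifs
  · positivity
  · simp

end AppendLemmas

/-- The assumptions on the state before a full update at `v`. The field `off` says that the siblings
got their constraints in earlier time periods, and `inact` that the siblings which do not take part
hold little mass. By `top`, the constraints of the current timestep at `u0` cannot be used up. -/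
structure FullHyp (I : Inst V) (v u0 : V) (sib : Finset V) (τ : ℕ) (S0 : State V) : Prop where
  dlb : ∀ u ∈ I.children v, u ≠ u0 → DualLB I S0 u
  off : ∀ u ∈ I.children v, u ≠ u0 → ∀ C ∈ S0.cons u, C.time / I.N < τ / I.N
  inact : ∀ u ∈ I.children v, u ≠ u0 → u ∉ sib → subMass I S0 u ≤ I.del * I.nv u
  top : (∃ C ∈ S0.cons u0, C.time = τ ∧ C.IsBot) ∨ dualObj I S0 u0 τ = I.gam
  mass0 : ∀ C ∈ S0.cons u0, C.time = τ → C.mass = subMass I S0 u0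
  nb : sib.Nonempty ∨ ∀ C ∈ S0.cons u0, C.time = τ → ¬ C.IsBot
  par : v ≠ I.root → ∀ B ∈ S0.cons (I.parent v), B.time < τ
  old : ∀ B ∈ S0.cons v, B.time < τ

/-- The properties of the constraints added during a full update at `v`. -/
structure NewOK (I : Inst V) (v u0 : V) (τ : ℕ) (S0 : State V) (C : Con V) : Prop where
  time : C.time = τ
  nonbot : ¬ C.IsBot
  mass : C.mass = subMass I S0 v
  src0 : C.src u0 ≠ none
  exists_src : ∃ σ ∈ S0.cons u0, σ.time = τ ∧ σ.rhs I u0 ≤ C.rhs I v ∧ C.A ∩ I.sub u0 = σ.A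

/-- The invariants during a full update at `v` that has started in the state `S0`. The balance of `u0`
decreases by the mass that has entered `T_{u0}` and by the use of its constraints, that of `v`
increases with the value of the new constraints, and the other children stay balanced. By
`gain`, the new constraints pay for the first two. -/
structure FullInv (I : Inst V) (v0 v u0 : V) (LU : Finset V) (τ : ℕ) (S0 S : State V) :
    Prop where
  core : Core I τ S
  yinv : YInv I τ S
  bal : ∀ u ∈ I.children v, u ≠ u0 → Balance I S τ u 0
  bal0 : ∀ B, Balance I S0 τ u0 B → Balance I S τ u0
    (B - (S.mass v0 - S0.mass v0) - usedLoad I S u0 τ / I.lam ^ I.level u0)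
  balv : v ≠ I.root → Balance I S0 τ v 0 → Balance I S τ v
    ((1 + 3 / (4 * I.H : ℝ)) * dualObj I S v τ / I.lam ^ I.level v)
  moved : Moved LU v0 S0.mass S.mass
  gain : S.mass v0 - S0.mass v0 + usedLoad I S u0 τ / I.lam ^ I.level u0 ≤
    dualObj I S v τ / I.lam ^ I.level u0
  gain_nonneg : S0.mass v0 ≤ S.mass v0
  awk : τ ∈ S.awake v
  cons : ∀ u, u ≠ v → S.cons u = S0.cons u
  y : ∀ w, w ≠ v → S.y w = S0.y w
  forest : S.forest = S0.forest
  served : S.served = S0.served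
  new : ∃ New, S.cons v = S0.cons v ++ New ∧ ∀ C ∈ New, NewOK I v u0 τ S0 C

section Phase
variable {I : Inst V} {v0 v u0 : V} {sib LU : Finset V} {τ : ℕ} {S0 S : State V}

/-- The principal child is awake at the current timestep, as the dual objective value there is
not yet used up. -/
theorem FullInv.awake_u0 (hi : FullInv I v0 v u0 LU τ S0 S) (hh : FullHyp I v u0 sib τ S0)
    (hx : Ctx I v0 v u0 sib LU) (hlt : dualObj I S v τ < I.gam) : τ ∈ S.awake u0 := by
  by_contra hna
  have hcu := hi.cons u0 (I.ne_of_mem_children hx.child0)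
  have h1 : ∀ j B, (S.cons u0)[j]? = some B → B.time = τ →
      ¬ B.IsBot ∧ (1 + 1 / (I.H : ℝ)) * B.z ≤ load I S u0 j := by
    intro j B hB hBt
    rcases hi.core.awake u0 j B hB with h2 | h2
    · rw [hBt] at h2; exact (hna h2).elim
    · exact h2
  rcases hh.top with ⟨C, hC, hCt, hCb⟩ | htop
  · rw [← hcu] at hC
    obtain ⟨j, hj⟩ := List.mem_iff_getElem?.1 hC
    exact (h1 j C hj hCt).1 hCb
  · have h2 : (1 + 1 / (I.H : ℝ)) * dualObj I S u0 τ ≤ usedLoad I S u0 τ := by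
      rw [dualObj_eq, ← idxSum_const, ← idxSum_mul, usedLoad, wload]
      refine idxSum_le fun j B hB => ?_
      have h3 := (hi.core.wf u0 B (mem_of_getElem? hB)).rhs_pos
      split_ifs with hBt
      · have := (h1 j B hB hBt).2
        nlinarith
      · simp
    have h3 : dualObj I S u0 τ = I.gam := by
      rw [← htop, dualObj_eq, dualObj_eq, hcu]
    have h4 := hi.gain
    have h5 := hi.gain_nonneg
    have hl := I.lam_pow_pos (I.level u0)
    have h6 : usedLoad I S u0 τ ≤ dualObj I S v τ := by
      rw [← div_le_div_iff_of_pos_right hl]; linarith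
    have hg := I.gam_pos
    have hH := I.H_ge
    have h7 : 0 < 1 / (I.H : ℝ) := by positivity
    rw [h3] at h2
    nlinarith

theorem FullInv.subMass_u0 (hi : FullInv I v0 v u0 LU τ S0 S) (hx : Ctx I v0 v u0 sib LU) :
    subMass I S u0 = subMass I S0 u0 + (S.mass v0 - S0.mass v0) :=
  hi.moved.subMass_add hx.leaf0 hx.mem0 fun _ hl => hx.LU_not_sub hl

theorem FullInv.subMass_v (hi : FullInv I v0 v u0 LU τ S0 S) (hx : Ctx I v0 v u0 sib LU) :
    subMass I S v = subMass I S0 v :=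
  hi.moved.subMass_eq hx.notMem_LU hx.leaf0 hx.mem_v
    fun _ hl => ⟨(hx.leaves _ hl).1, hx.LU_sub hl⟩

/-- The increase of the variables `y(u, ·)` while the timer runs for `θ lam ^ h`. The number of
variables that are raised is at most `M + 1`, where the summand one is for the timestep `T + 1`. -/
theorem sum_raise_le {y Yd : ℕ → ℝ} {T : ℕ} {R : Set ℕ} {θ r M : ℝ} (hθ0 : 0 ≤ θ) (hθ1 : θ ≤ 1)
    (hr : 0 ≤ r) (hy : ∀ t, 0 ≤ y t)
    (hYd : ∀ t, Yd t = if T < t ∧ t ≤ τ ∧ (t ∈ R ∨ t = T + 1)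
      then (y t + r) * Real.exp θ - r else y t)
    (hcard : ∀ TS : Finset ℕ, (∀ t ∈ TS, t ∈ R ∧ T < t) → (TS.card : ℝ) ≤ M) :
    (∀ t, y t ≤ Yd t) ∧ ∑ t ∈ Finset.Ioc T τ, (Yd t - y t) ≤
      θ * (1 + θ) * (∑ t ∈ Finset.Ioc T τ, y t + (M + 1) * r) := by
  have he0 : 0 ≤ Real.exp θ - 1 := by
    have := Real.add_one_le_exp θ
    linarith
  have he := exp_sub_one_le hθ0 hθ1
  have hle : ∀ t, y t ≤ Yd t := fun t => by
    rw [hYd t]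
    split_ifs
    · have := hy t
      nlinarith
    · exact le_rfl
  refine ⟨hle, ?_⟩
  set TS := (Finset.Ioc T τ).filter fun t => t ∈ R with hTS
  have h1 : ∀ t ∈ Finset.Ioc T τ, Yd t - y t ≤
      (Real.exp θ - 1) * (y t + if t ∈ insert (T + 1) TS then r else 0) := by
    intro t ht
    rw [Finset.mem_Ioc] at ht
    rw [hYd t]
    have := hy t
    split_ifs with h2 h3 h3
    · nlinarith
    · exfalso
      apply h3
      rw [Finset.mem_insert, hTS, Finset.mem_filter, Finset.mem_Ioc]
      rcases h2.2.2 with h4 | h4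
      exacts [Or.inr ⟨ht, h4⟩, Or.inl h4]
    · rw [sub_self]; positivity
    · rw [sub_self]; positivity
  refine (Finset.sum_le_sum h1).trans ?_
  rw [← Finset.mul_sum, Finset.sum_add_distrib]
  have h2 : ∑ t ∈ Finset.Ioc T τ, (if t ∈ insert (T + 1) TS then r else 0) ≤ (M + 1) * r := by
    rw [← Finset.sum_filter, Finset.sum_const, nsmul_eq_mul]
    refine mul_le_mul_of_nonneg_right ?_ hr
    have h3 : ((Finset.Ioc T τ).filter fun t => t ∈ insert (T + 1) TS).card ≤ TS.card + 1 :=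
      (Finset.card_le_card fun t ht => (Finset.mem_filter.1 ht).2).trans
        (Finset.card_insert_le _ _)
    have h4 := hcard TS fun t ht => by
      rw [hTS, Finset.mem_filter, Finset.mem_Ioc] at ht
      exact ⟨ht.2, ht.1.1⟩
    have h5 : (((Finset.Ioc T τ).filter fun t => t ∈ insert (T + 1) TS).card : ℝ) ≤
      TS.card + 1 := by exact_mod_cast h3
    linarith
  have h3 : 0 ≤ ∑ t ∈ Finset.Ioc T τ, y t := Finset.sum_nonneg fun t _ => hy t
  have h4 : 0 ≤ ∑ t ∈ Finset.Ioc T τ, (if t ∈ insert (T + 1) TS then r else 0) :=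
    Finset.sum_nonneg fun t _ => by split_ifs <;> simp [hr]
  calc _ ≤ θ * (1 + θ) * (∑ t ∈ Finset.Ioc T τ, y t +
        ∑ t ∈ Finset.Ioc T τ, (if t ∈ insert (T + 1) TS then r else 0)) := by gcongr
    _ ≤ _ := by gcongr

/-- If a timer runs as long as a strict linear bound holds, then the bound holds at the end. -/
theorem le_of_timer {a b c d : ℝ} (hac : a < c) (hb : 0 < b)
    (h : ∀ s, 0 ≤ s → s < d → a + b * s < c) : a + b * d ≤ c := by
  by_contra! hc
  have h1 : (c - a) / b < d := by rw [div_lt_iff₀ hb]; linarith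
  have h2 := h ((c - a) / b) (div_nonneg (by linarith) hb.le) h1
  rw [mul_div_cancel₀ _ hb.ne'] at h2
  linarith

theorem not_isBot_compose (hx : Ctx I v0 v u0 sib LU) {σ : V → Con V} {C : Con V}
    (hσ : ∀ u ∈ insert u0 sib, (σ u).A ⊆ I.sub u) (hne : ∀ u ∈ insert u0 sib, (σ u).A.Nonempty)
    (hCA : C.A = (insert u0 sib).biUnion fun u => (σ u).A)
    (hnb : sib.Nonempty ∨ ¬ (σ u0).IsBot) : ¬ C.IsBot := by
  intro hb
  have h1 := card_biUnion_eq hx hσ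
  rw [← hCA, hb] at h1
  have h2 : 1 ≤ (σ u0).A.card := Finset.card_pos.2 (hne u0 (Finset.mem_insert_self _ _))
  have h3 : (1 : ℕ) = (σ u0).A.card + ∑ u ∈ sib, (σ u).A.card := by exact_mod_cast h1
  rcases hnb with ⟨u, hu⟩ | hnb
  · have h4 : 1 ≤ (σ u).A.card := Finset.card_pos.2 (hne u (Finset.mem_insert_of_mem hu))
    have h5 : (σ u).A.card ≤ ∑ u ∈ sib, (σ u).A.card :=
      Finset.single_le_sum (f := fun u => (σ u).A.card) (fun _ _ => Nat.zero_le _) hu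
    omega
  · apply hnb
    rw [Con.IsBot]
    omega

end Phase

/-! ### The server movement in a phase -/

/-- The outcome of one phase of a full update at `v`: the constraint `C` is composed from the
constraints `σ u`, its dual variable is the duration of the timer, and `Yd` are the
values of the variables when the timer stops. -/
structure PhaseData (I : Inst V) (v0 v u0 : V) (sib LU : Finset V) (τ : ℕ) (S S' : State V)
    (C : Con V) (σ : V → Con V) (j : V → ℕ) (x : V → ℝ) (Yd : V → ℕ → ℝ) : Prop where
  ap : Appends S S' v C
  time : C.time = τ
  A : C.A = (insert u0 sib).biUnion fun u => (σ u).A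
  tau : C.tau v = τ
  src : ∀ u, C.src u = if u ∈ insert u0 sib then some (j u) else none
  mass : C.mass = subMass I S v
  z_pos : 0 < C.z
  get : ∀ u ∈ insert u0 sib, (S.cons u)[j u]? = some (σ u)
  greatest : ∀ u ∈ insert u0 sib, IsGreatest {t | t ∈ S.awake u ∧ t ≤ τ} (σ u).time
  agree : ∀ u ∈ insert u0 sib, ∀ w ∈ I.sub u, C.f w = (σ u).f w ∧ C.tau w = (σ u).tau w
  Yd_eq : ∀ u t, Yd u t = if u ∈ insert u0 sib ∧ (σ u).time < t ∧ t ≤ τ ∧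
    (t ∈ nonSolitary S u ∨ t = (σ u).time + 1)
    then (S.y v u t + I.rate) * Real.exp (C.z / I.lam ^ I.level u0) - I.rate else S.y v u t
  tr : Transfer LU v0 S.mass S'.mass x
  amt : ∀ u ∈ sib, ∑ l ∈ LU ∩ I.sub u, x l =
    ∑ t ∈ Finset.Ioc (σ u).time τ, (Yd u t - S.y v u t) +
      C.z * ((σ u).rhs I u / I.lam ^ I.level u0)
  load_le : ∀ u ∈ insert u0 sib, ¬ (σ u).IsBot →
    load I S u (j u) + C.z ≤ (1 + 1 / (I.H : ℝ)) * (σ u).z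
  dual_le : 0 < C.rhs I v → dualObj I S v τ + C.rhs I v * C.z ≤ I.gam
  y' : S'.y = Function.update S.y v Yd
  awake : ∀ u, ∀ t ∈ S.awake u, t ∈ S'.awake u ∨ ∀ i B, (S.cons u)[i]? = some B → B.time = t →
    ¬ B.IsBot ∧ (1 + 1 / (I.H : ℝ)) * B.z ≤ load I S' u i
  awake_of_notMem : ∀ u, u ∉ insert u0 sib → S'.awake u = S.awake u
  forest : S'.forest = S.forest
  served : S'.served = S.served

section Phase
variable {I : Inst V} {v0 v u0 : V} {sib LU : Finset V} {τ : ℕ} {S0 S S' : State V}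

theorem Phase.data (hx : Ctx I v0 v u0 sib LU) (hlt : dualObj I S v τ < I.gam)
    (h : Phase I v0 v u0 (insert u0 sib) LU τ S S') :
    ∃ C σ j x Yd, PhaseData I v0 v u0 sib LU τ S S' C σ j x Yd := by
  obtain ⟨τu, j, σ, C, d, Y, x, hch, hCt, hCA, hCtau, hCcomp, hCmass, hCsrc, hCz, hd, hdur, hY0,
    hYode, htr, hamt, hcons, hyS', hawk, hfor, hser⟩ := h
  have hne : u0 ∉ sib := hx.notMem
  subst hCz
  have hslack : ∀ s, 0 ≤ s → s < C.z → (∀ u ∈ insert u0 sib, Slack I S u (j u) (σ u) s) ∧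
      dualObj I S v τ + C.rhs I v * s < I.gam := fun s h0 h1 => (hdur s h0 h1.le).1 h1
  refine ⟨C, σ, j, x, Y C.z, hcons, hCt, hCA, hCtau, hCsrc, hCmass, hd,
    fun u hu => (hch u hu).2.1, fun u hu => ?_, hCcomp, fun u t => ?_, htr, fun u hu => ?_,
    fun u hu hb => ?_, fun hpos => ?_, hyS', fun u t ht => ?_, fun u hu => ?_, hfor, hser⟩
  · rw [(hch u hu).2.2.1]; exact (hch u hu).1
  · have h1 := hYode u t
    by_cases hu : u ∈ insert u0 sib
    · rw [(hch u hu).2.2.1]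
      split_ifs at h1 ⊢
      · rw [← hY0]
        refine exp_update (Y := fun s => Y s u t) hd fun s hs => ?_
        have h3 := h1 s hs
        rw [hx.level_v] at h3
        refine h3.congr_deriv ?_
        rw [Inst.rate, div_div]
      · exact h1 _ (Set.right_mem_Icc.2 hd.le)
    · rw [if_neg fun h2 => hu h2.1] at h1 ⊢
      exact h1 _ (Set.right_mem_Icc.2 hd.le)
  · have h1 := hamt u (Finset.mem_insert_of_mem hu) (fun h1 => hne (h1 ▸ hu))
    rw [h1, (hch u (Finset.mem_insert_of_mem hu)).2.2.1, hx.level_v]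
  · have h0 := (hslack 0 le_rfl hd).1 u hu
    rcases h0 with h0 | h0
    · exact (hb h0).elim
    · have := le_of_timer (a := load I S u (j u)) (b := 1)
        (c := (1 + 1 / (I.H : ℝ)) * (σ u).z) (d := C.z) (by linarith) one_pos
        fun s hs hs' => by
          rcases (hslack s hs hs').1 u hu with h1 | h1
          · exact (hb h1).elim
          · linarith
      linarith
  · exact le_of_timer hlt hpos fun s hs hs' => (hslack s hs hs').2
  · rw [hawk u]
    split_ifs with h1
    · by_cases h2 : t = τu u
      · right
        intro i B hB hBt
        have h3 := h1.2 i B hB (hBt.trans h2)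
        rw [Slack, not_or, add_zero, not_lt] at h3
        exact h3
      · left; exact ⟨ht, h2⟩
    · exact Or.inl ht
  · rw [hawk u, if_neg fun h1 => hu h1.1]

variable {C : Con V} {σ : V → Con V} {j : V → ℕ} {x : V → ℝ} {Yd : V → ℕ → ℝ}

theorem mem_children_of_mem_insert (hx : Ctx I v0 v u0 sib LU) {u : V} (hu : u ∈ insert u0 sib) :
    u ∈ I.children v := by
  rcases Finset.mem_insert.1 hu with rfl | hu
  exacts [hx.child0, hx.sibs hu]

theorem PhaseData.time_u0 (hp : PhaseData I v0 v u0 sib LU τ S S' C σ j x Yd)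
    (hi : FullInv I v0 v u0 LU τ S0 S) (hh : FullHyp I v u0 sib τ S0)
    (hx : Ctx I v0 v u0 sib LU) (hlt : dualObj I S v τ < I.gam) : (σ u0).time = τ := by
  have h1 := hp.greatest u0 (Finset.mem_insert_self _ _)
  exact le_antisymm h1.1.2 (h1.2 ⟨hi.awake_u0 hh hx hlt, le_rfl⟩)

/-- The estimates for a phase: with the duration `θ lam ^ h` of the timer, the server
mass that is moved is at most `θ` times the amount by which the right-hand side of the composed
constraint exceeds that of its principal part. Moreover, the variables remain bounded, as their
increase is matched by server mass that leaves `T_u`. -/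
theorem PhaseData.estimates (hp : PhaseData I v0 v u0 sib LU τ S S' C σ j x Yd)
    (hi : FullInv I v0 v u0 LU τ S0 S) (hh : FullHyp I v u0 sib τ S0)
    (hx : Ctx I v0 v u0 sib LU) (hlt : dualObj I S v τ < I.gam) :
    (σ u0).rhs I u0 ≤ C.rhs I v ∧
    ∑ l ∈ LU, x l ≤ C.z / I.lam ^ I.level u0 * (C.rhs I v - (σ u0).rhs I u0) ∧
    (∀ u t, S.y v u t ≤ Yd u t) ∧ (∀ u t, Yd u t ≤ I.k + 3) := by
  have hσmem : ∀ u ∈ insert u0 sib, σ u ∈ S.cons u := fun u hu => mem_of_getElem? (hp.get u hu)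
  have hσA : ∀ u ∈ insert u0 sib, (σ u).A ⊆ I.sub u := fun u hu =>
    (hi.core.wf u _ (hσmem u hu)).A_sub
  have hlb : ∀ u ∈ sib, DualLB I S u := fun u hu => by
    have h1 := hh.dlb u (hx.sibs hu) (hx.ne_u0 hu)
    have h2 := hi.cons u (I.ne_of_mem_children (hx.sibs hu))
    intro T hT
    have h3 : T ∈ nonSolitary S0 u := by simpa [nonSolitary, h2] using hT
    have h4 : dualObj I S u T = dualObj I S0 u T := by rw [dualObj_eq, dualObj_eq, h2]
    rw [h4]
    exact h1 T h3
  have hpar : ∀ u ∈ sib, I.parent u = v := fun u hu => (I.mem_children.1 (hx.sibs hu)).2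
  have hin : ∀ u ∈ sib, u ∈ insert u0 sib := fun u hu => Finset.mem_insert_of_mem hu
  have hbalu : ∀ u ∈ sib, Balance I S τ u 0 := fun u hu =>
    hi.bal u (hx.sibs hu) (hx.ne_u0 hu)
  set Y : V → ℝ := fun u => ∑ t ∈ Finset.Ioc (σ u).time τ, S.y v u t with hYdef
  have hY0 : ∀ u, 0 ≤ Y u := fun u => Finset.sum_nonneg fun t _ => hi.yinv.nonneg _ _ _
  have hYle : ∀ u ∈ sib, subMass I S u + Y u ≤ (σ u).mass + 2 * I.gam := fun u hu => by
    have := (hbalu u hu).sum_le hi.core (hlb u hu) (hp.greatest u (hin u hu))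
      (hσmem u (hin u hu)) rfl
    rwa [hpar u hu] at this
  have hcard : ∀ u ∈ sib, ∀ TS : Finset ℕ,
      (∀ t ∈ TS, t ∈ nonSolitary S u ∧ (σ u).time < t) → (TS.card : ℝ) ≤ 5 * I.M :=
    fun u hu TS hTS => (hbalu u hu).card_le hi.core (hlb u hu) hi.yinv.nonneg
      (hp.greatest u (hin u hu)) (hσmem u (hin u hu)) rfl TS hTS
  have ht0 := hp.time_u0 hi hh hx hlt
  have hcu0 := hi.cons u0 (I.ne_of_mem_children hx.child0)
  have hm0 : (σ u0).mass = subMass I S0 u0 := by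
    have h1 := hσmem u0 (Finset.mem_insert_self _ _)
    rw [hcu0] at h1
    exact hh.mass0 _ h1 ht0
  have hinact : ∀ u ∈ I.children v, u ≠ u0 → u ∉ sib → subMass I S u ≤ I.del * I.nv u :=
    fun u hu h1 h2 => (hi.moved.subMass_le (hx.notMem_sub hu h1)).trans (hh.inact u hu h1 h2)
  -- since the constraints at `u0` were added, `T_{u0}` has only received the mass moved by this update
  have hcomp := rhs_compose hx hσA hp.A hp.mass hinact hYle
    (g := S.mass v0 - S0.mass v0) (by rw [hi.subMass_u0 hx, hm0])
  have hgam := I.gam_pos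
  have hl := I.lam_pow_pos (I.level u0)
  have hl1 := I.one_le_lam_pow (I.level u0)
  have hgain : S.mass v0 - S0.mass v0 ≤ I.gam := by
    have h1 := hi.gain
    have h2 : 0 ≤ usedLoad I S u0 τ / I.lam ^ I.level u0 :=
      div_nonneg (usedLoad_nonneg hi.core _ _) hl.le
    have h3 : dualObj I S v τ / I.lam ^ I.level u0 ≤ dualObj I S v τ :=
      div_le_self (dualObj_nonneg hi.core _ _) hl1
    linarith
  have hn5 := I.n_ge hx.lvl0
  have hdel : 20 * I.gam ≤ 2 * I.del := by
    have := I.four_n_gam_le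
    nlinarith
  have hrpos : ∀ u ∈ sib, 0 < (σ u).rhs I u := fun u hu =>
    (hi.core.wf u _ (hσmem u (hin u hu))).rhs_pos
  set Z := ∑ u ∈ sib, (Y u + (σ u).rhs I u) with hZ
  have hZ0 : 0 ≤ Z := Finset.sum_nonneg fun u hu => by
    have := hY0 u; have := hrpos u hu; linarith
  have hb0 : I.del' / 2 ≤ (σ u0).rhs I u0 :=
    (hi.core.wf u0 _ (hσmem u0 (Finset.mem_insert_self _ _))).rhs_ge
  have hbC : (σ u0).rhs I u0 ≤ C.rhs I v := by linarith
  have hd' := I.del'_pos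
  have hCpos : 0 < C.rhs I v := by linarith
  have hdual := hp.dual_le hCpos
  have hdual0 := dualObj_nonneg hi.core v τ
  set θ := C.z / I.lam ^ I.level u0 with hθ
  have hθ0 : 0 ≤ θ := div_nonneg hp.z_pos.le hl.le
  have hθz : θ ≤ C.z := div_le_self hp.z_pos.le hl1
  have hθb : θ * C.rhs I v ≤ I.gam := by nlinarith
  -- the dual objective value increases by `b z`, which is at most `γ`, while `b` is at least `δ' / 2`
  have hθ1 : θ ≤ 1 := by
    have h1 := I.two_gam_div_del'_le
    rw [div_le_iff₀ hd'] at h1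
    by_contra! h2
    nlinarith
  have hrate := I.rate_pos
  have hM := I.one_le_M
  have hMr : I.M * I.rate = I.gam / I.n := by
    have : I.n ≠ 0 := by linarith
    have : I.M ≠ 0 := by linarith
    rw [Inst.rate]; field_simp
  have hraise : ∀ u ∈ sib, (∀ t, S.y v u t ≤ Yd u t) ∧
      ∑ t ∈ Finset.Ioc (σ u).time τ, (Yd u t - S.y v u t) ≤
        θ * (1 + θ) * (Y u + (5 * I.M + 1) * I.rate) := fun u hu => by
    refine sum_raise_le hθ0 hθ1 hrate.le (fun t => hi.yinv.nonneg v u t)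
      (R := nonSolitary S u) (fun t => ?_) (hcard u hu)
    rw [hp.Yd_eq u t]
    simp [hin u hu, hθ]
  have hmono : ∀ u t, S.y v u t ≤ Yd u t := fun u t => by
    by_cases hu : u ∈ sib
    · exact (hraise u hu).1 t
    · rw [hp.Yd_eq]
      split_ifs with h1
      · rcases Finset.mem_insert.1 h1.1 with rfl | h2
        · omega
        · exact (hu h2).elim
      · exact le_rfl
  have hamt : ∀ u ∈ sib, ∑ l ∈ LU ∩ I.sub u, x l ≤
      θ * (1 + θ) * (Y u + (σ u).rhs I u + 6 * (I.gam / I.n)) := fun u hu => by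
    rw [hp.amt u hu]
    have h1 := (hraise u hu).2
    have h2 : C.z * ((σ u).rhs I u / I.lam ^ I.level u0) = θ * (σ u).rhs I u := by
      rw [hθ]; ring
    rw [h2]
    have h3 : (5 * I.M + 1) * I.rate ≤ 6 * (I.gam / I.n) := by rw [← hMr]; nlinarith
    have h4 : θ * (σ u).rhs I u ≤ θ * (1 + θ) * (σ u).rhs I u := by
      have := hrpos u hu
      have h5 : θ ≤ θ * (1 + θ) := by nlinarith
      exact mul_le_mul_of_nonneg_right h5 this.le
    have h5 : 0 ≤ θ * (1 + θ) := by positivity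
    nlinarith
  have hsum : ∑ l ∈ LU, x l ≤ θ * (C.rhs I v - (σ u0).rhs I u0) := by
    rw [hx.sum_LU]
    refine (Finset.sum_le_sum hamt).trans ?_
    rw [← Finset.mul_sum, Finset.sum_add_distrib, ← hZ, Finset.sum_const, nsmul_eq_mul]
    have h1 : (sib.card : ℝ) * (6 * (I.gam / I.n)) ≤ 6 * I.gam := by
      have h2 : (sib.card : ℝ) ≤ I.n := by
        simp only [HST.n]; exact_mod_cast Finset.card_le_univ sib
      have h3 : I.n * (I.gam / I.n) = I.gam := by
        have : I.n ≠ 0 := by linarith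
        field_simp
      have h4 : 0 ≤ I.gam / I.n := by positivity
      nlinarith
    -- the slack `2 δ - 7 γ ≥ γ` absorbs the factor `1 + θ`
    have h2 : Z + sib.card * (6 * (I.gam / I.n)) ≤
        C.rhs I v - (σ u0).rhs I u0 - I.gam := by linarith
    have h3 : θ * (1 + θ) * (Z + sib.card * (6 * (I.gam / I.n))) ≤
        θ * (1 + θ) * (C.rhs I v - (σ u0).rhs I u0 - I.gam) := by gcongr
    have h4 : θ * (C.rhs I v - (σ u0).rhs I u0 - I.gam) ≤ I.gam := by nlinarith
    nlinarith
  have hxle : ∑ l ∈ LU, x l ≤ I.gam := by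
    refine hsum.trans ?_
    nlinarith
  refine ⟨hbC, hsum, hmono, fun u t => ?_⟩
  by_cases h1 : u ∈ sib ∧ (σ u).time < t ∧ t ≤ τ
  · have hmem : t ∈ Finset.Ioc (σ u).time τ := Finset.mem_Ioc.2 h1.2
    have hu := h1.1
    have h2 : Yd u t - S.y v u t ≤ ∑ t ∈ Finset.Ioc (σ u).time τ, (Yd u t - S.y v u t) :=
      Finset.single_le_sum (f := fun t => Yd u t - S.y v u t)
        (fun t _ => sub_nonneg.2 (hmono u t)) hmem
    have h3 : S.y v u t ≤ Y u :=
      Finset.single_le_sum (f := fun t => S.y v u t) (fun t _ => hi.yinv.nonneg v u t) hmem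
    have h4 := hp.amt u hu
    have h5 : ∑ l ∈ LU ∩ I.sub u, x l ≤ ∑ l ∈ LU, x l :=
      Finset.sum_le_sum_of_subset_of_nonneg Finset.inter_subset_left fun l _ _ => hp.tr.1 l
    have h6 : 0 ≤ C.z * ((σ u).rhs I u / I.lam ^ I.level u0) := by
      have := hrpos u hu
      have := hp.z_pos
      positivity
    have h7 := hYle u hu
    have h8 := (hi.core.wf u _ (hσmem u (hin u hu))).mass_le
    have h9 := subMass_nonneg (I := I) hi.core.mass_nonneg u
    have h10 := I.gam_le_one
    linarith
  · rw [hp.Yd_eq, if_neg]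
    · exact hi.yinv.le v u t
    · rintro ⟨h2, h3, h4, -⟩
      rcases Finset.mem_insert.1 h2 with rfl | h2
      · omega
      · exact h1 ⟨h2, h3, h4⟩

end Phase

/-! ### The invariants after a phase -/

section Phase
variable {I : Inst V} {v0 v u0 : V} {sib LU : Finset V} {τ : ℕ} {S0 S S' : State V}
variable {C : Con V} {σ : V → Con V} {j : V → ℕ} {x : V → ℝ} {Yd : V → ℕ → ℝ}

theorem PhaseData.srcOK (hp : PhaseData I v0 v u0 sib LU τ S S' C σ j x Yd)
    (hi : FullInv I v0 v u0 LU τ S0 S) (hh : FullHyp I v u0 sib τ S0)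
    (hx : Ctx I v0 v u0 sib LU) (hlt : dualObj I S v τ < I.gam) {u : V}
    (hu : u ∈ insert u0 sib) : SrcOK I S v C u (σ u) := by
  have hσA : ∀ u ∈ insert u0 sib, (σ u).A ⊆ I.sub u := fun u hu =>
    (hi.core.wf u _ (mem_of_getElem? (hp.get u hu))).A_sub
  have hch := mem_children_of_mem_insert hx hu
  refine ⟨hch, ?_, hp.agree u hu, ?_, ?_, ?_⟩
  · rw [hp.A]; exact biUnion_inter hx hσA hu
  · rw [hp.time]; exact (hp.greatest u hu).1.2
  · intro hlt'
    rw [hp.time] at hlt' ⊢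
    rcases Finset.mem_insert.1 hu with rfl | hu'
    · have := hp.time_u0 hi hh hx hlt; omega
    · refine hh.off u hch (hx.ne_u0 hu') (σ u) ?_
      rw [← hi.cons u (I.ne_of_mem_children hch)]
      exact mem_of_getElem? (hp.get u hu)
  · intro B hB hbot hBt
    obtain ⟨i, hiB⟩ := List.mem_iff_getElem?.1 hB
    rcases hi.core.awake u i B hiB with h1 | h1
    · exact (hp.greatest u hu).2 ⟨h1, hp.time ▸ hBt⟩
    · exact (h1.1 hbot).elim

theorem PhaseData.nonbot (hp : PhaseData I v0 v u0 sib LU τ S S' C σ j x Yd)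
    (hi : FullInv I v0 v u0 LU τ S0 S) (hh : FullHyp I v u0 sib τ S0)
    (hx : Ctx I v0 v u0 sib LU) (hlt : dualObj I S v τ < I.gam) : ¬ C.IsBot := by
  have hwf : ∀ u ∈ insert u0 sib, ConWF I u (σ u) := fun u hu =>
    hi.core.wf u _ (mem_of_getElem? (hp.get u hu))
  refine not_isBot_compose hx (fun u hu => (hwf u hu).A_sub) (fun u hu => (hwf u hu).A_ne) hp.A
    (hh.nb.imp_right fun h => ?_)
  refine h _ ?_ (hp.time_u0 hi hh hx hlt)
  rw [← hi.cons u0 (I.ne_of_mem_children hx.child0)]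
  exact mem_of_getElem? (hp.get u0 (Finset.mem_insert_self _ _))

theorem PhaseData.wf (hp : PhaseData I v0 v u0 sib LU τ S S' C σ j x Yd)
    (hi : FullInv I v0 v u0 LU τ S0 S) (hh : FullHyp I v u0 sib τ S0)
    (hx : Ctx I v0 v u0 sib LU) (hlt : dualObj I S v τ < I.gam) : ConWF I v C := by
  have hwf : ∀ u ∈ insert u0 sib, ConWF I u (σ u) := fun u hu =>
    hi.core.wf u _ (mem_of_getElem? (hp.get u hu))
  have hu0 := Finset.mem_insert_self u0 sib
  refine ⟨?_, ?_, hp.tau.trans hp.time.symm, hp.z_pos.le, ?_, ?_, ?_, ?_⟩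
  · rw [hp.A]
    intro a ha
    obtain ⟨u, hu, ha⟩ := Finset.mem_biUnion.1 ha
    exact I.mem_sub_trans ((hwf u hu).A_sub ha)
      (I.mem_sub_of_mem_children (mem_children_of_mem_insert hx hu))
  · obtain ⟨a, ha⟩ := (hwf u0 hu0).A_ne
    exact ⟨a, by rw [hp.A]; exact Finset.mem_biUnion.2 ⟨u0, hu0, ha⟩⟩
  · exact (hwf u0 hu0).rhs_ge.trans (hp.estimates hi hh hx hlt).1
  · exact fun hb => (hp.nonbot hi hh hx hlt hb).elim
  · intro _ hv
    rw [hp.A] at hv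
    obtain ⟨u, hu, ha⟩ := Finset.mem_biUnion.1 hv
    exact I.notMem_sub_of_mem_children (mem_children_of_mem_insert hx hu) ((hwf u hu).A_sub ha)
  · rw [hp.mass]; exact hi.core.subMass_le v

theorem v_notMem (hx : Ctx I v0 v u0 sib LU) : v ∉ insert u0 sib := fun h =>
  I.ne_of_mem_children (mem_children_of_mem_insert hx h) rfl

theorem PhaseData.core (hp : PhaseData I v0 v u0 sib LU τ S S' C σ j x Yd)
    (hi : FullInv I v0 v u0 LU τ S0 S) (hh : FullHyp I v u0 sib τ S0)
    (hx : Ctx I v0 v u0 sib LU) (hlt : dualObj I S v τ < I.gam) : Core I τ S' := by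
  have hsrc : ∀ u i, C.src u = some i → u ∈ insert u0 sib ∧ i = j u := by
    intro u i hui
    rw [hp.src u] at hui
    split_ifs at hui with h1
    exact ⟨h1, (Option.some.inj hui).symm⟩
  refine hi.core.append le_rfl hp.ap hp.time (hp.tr.nonneg hi.core.mass_nonneg) ?_ ?_
    (hp.wf hi hh hx hlt) ?_ ?_ ?_ hp.awake ?_
  · exact (hp.tr.moved hx.notMem_LU).subMass_eq hx.notMem_LU hx.leaf0 (I.mem_sub_root _)
      fun l hl => ⟨(hx.leaves l hl).1, I.mem_sub_root l⟩
  · intro hv B hB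
    rw [hi.cons] at hB
    · exact hh.par hv B hB
    · intro h1
      have := I.level_parent v hv
      rw [h1] at this; omega
  · intro u i hui
    obtain ⟨h1, rfl⟩ := hsrc u i hui
    exact ⟨σ u, hp.get u h1, hp.srcOK hi hh hx hlt h1⟩
  · rintro - a ha
    rw [hp.A] at ha
    obtain ⟨u, hu, ha⟩ := Finset.mem_biUnion.1 ha
    exact ⟨u, by rw [hp.src, if_pos hu]; simp,
      (hi.core.wf u _ (mem_of_getElem? (hp.get u hu))).A_sub ha⟩
  · rw [hp.awake_of_notMem v (v_notMem hx)]
    exact hi.awk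
  · intro u i σ' hui hσ' hnb
    obtain ⟨h1, rfl⟩ := hsrc u i hui
    rw [hp.get u h1] at hσ'
    obtain rfl := Option.some.inj hσ'
    exact hp.load_le u h1 hnb

theorem PhaseData.y_v (hp : PhaseData I v0 v u0 sib LU τ S S' C σ j x Yd) : S'.y v = Yd := by
  rw [hp.y']; simp

theorem PhaseData.y_ne (hp : PhaseData I v0 v u0 sib LU τ S S' C σ j x Yd) {w : V} (hw : w ≠ v) :
    S'.y w = S.y w := by
  rw [hp.y']; simp [hw]

theorem PhaseData.yInv (hp : PhaseData I v0 v u0 sib LU τ S S' C σ j x Yd)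
    (hi : FullInv I v0 v u0 LU τ S0 S) (hh : FullHyp I v u0 sib τ S0)
    (hx : Ctx I v0 v u0 sib LU) (hlt : dualObj I S v τ < I.gam) : YInv I τ S' := by
  obtain ⟨-, -, hmono, hle⟩ := hp.estimates hi hh hx hlt
  refine ⟨fun w u t => ?_, fun w u t ht => ?_, fun w u t => ?_, fun w u hu t => ?_⟩
  · by_cases hw : w = v
    · subst hw; rw [hp.y_v]; exact (hi.yinv.nonneg _ _ _).trans (hmono u t)
    · rw [hp.y_ne hw]; exact hi.yinv.nonneg _ _ _
  · by_cases hw : w = v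
    · subst hw; rw [hp.y_v, hp.Yd_eq, if_neg (by omega)]; exact hi.yinv.zero _ _ _ ht
    · rw [hp.y_ne hw]; exact hi.yinv.zero _ _ _ ht
  · by_cases hw : w = v
    · subst hw; rw [hp.y_v]; exact hle u t
    · rw [hp.y_ne hw]; exact hi.yinv.le _ _ _
  · have h0 := hi.yinv.timer w u hu t
    by_cases hw : w = v
    · subst hw
      rw [hp.y_v, hp.ap.timerSum_self hu, hp.Yd_eq, hp.time, hx.level_sib hu] at *
      by_cases h1 : u ∈ insert u0 sib
      · have h2 := (hi.core.wf u _ (mem_of_getElem? (hp.get u h1))).tau_self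
        have h3 := (hp.agree u h1 u (I.self_mem_sub u)).2
        have h4 : C.src u ≠ none := by rw [hp.src, if_pos h1]; simp
        rw [h3, h2]
        by_cases h5 : (σ u).time < t ∧ t ≤ τ ∧ (t ∈ nonSolitary S u ∨ t = (σ u).time + 1)
        · rw [if_pos ⟨h4, h5⟩, if_pos ⟨h1, h5⟩, add_div, Real.exp_add]
          have := Real.exp_pos (C.z / I.lam ^ I.level u0)
          nlinarith
        · rw [if_neg fun h => h5 h.2, if_neg fun h => h5 h.2, add_zero]
          exact h0
      · have h4 : C.src u = none := by rw [hp.src, if_neg h1]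
        rw [if_neg fun h => h.1 h4, if_neg fun h => h1 h.1, add_zero]
        exact h0
    · rw [hp.y_ne hw, hp.ap.timerSum_of_ne hw hu]
      · exact h0
      · intro hv B hB
        rw [hp.time]
        rw [hi.cons] at hB
        · exact hh.par hv B hB
        · intro h1
          have := I.level_parent v hv
          rw [h1] at this; omega

/-- Raising the variables only affects timesteps after the last awake one. -/
theorem PhaseData.sum_le (hp : PhaseData I v0 v u0 sib LU τ S S' C σ j x Yd)
    (hmono : ∀ u t, S.y v u t ≤ Yd u t) {u : V} (T : ℕ) :
    ∑ t ∈ Finset.Ioc T τ, Yd u t ≤ ∑ t ∈ Finset.Ioc T τ, S.y v u t +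
      ∑ t ∈ Finset.Ioc (σ u).time τ, (Yd u t - S.y v u t) := by
  rw [← sub_le_iff_le_add', ← Finset.sum_sub_distrib]
  rw [← Finset.sum_filter_of_ne (p := fun t => (σ u).time < t)]
  · refine Finset.sum_le_sum_of_subset_of_nonneg (fun t ht => ?_)
      fun t _ _ => sub_nonneg.2 (hmono u t)
    rw [Finset.mem_filter, Finset.mem_Ioc] at ht
    exact Finset.mem_Ioc.2 ⟨ht.2, ht.1.2⟩
  · intro t _ hne
    by_contra h1
    apply hne
    rw [hp.Yd_eq, if_neg fun h => h1 h.2.1, sub_self]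

theorem PhaseData.fullInv (hp : PhaseData I v0 v u0 sib LU τ S S' C σ j x Yd)
    (hi : FullInv I v0 v u0 LU τ S0 S) (hh : FullHyp I v u0 sib τ S0)
    (hx : Ctx I v0 v u0 sib LU) (hlt : dualObj I S v τ < I.gam) :
    FullInv I v0 v u0 LU τ S0 S' := by
  obtain ⟨hb, hsum, hmono, -⟩ := hp.estimates hi hh hx hlt
  have hcore := hp.core hi hh hx hlt
  have hwf := hp.wf hi hh hx hlt
  have ht0 := hp.time_u0 hi hh hx hlt
  have hmem0 := Finset.mem_insert_self u0 sib
  have hl := I.lam_pow_pos (I.level u0)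
  have hsrc0 : C.src u0 = some (j u0) := by rw [hp.src, if_pos hmem0]
  have hsrcv : C.src v = none := by rw [hp.src, if_neg (v_notMem hx)]
  have hmv := hp.tr.self hx.notMem_LU
  have hdual := hp.ap.dualObj_self (I := I) hp.time
  have hused : usedLoad I S' u0 τ = usedLoad I S u0 τ + (σ u0).rhs I u0 * C.z := by
    rw [usedLoad, hp.ap.wload_of_src hx.child0 hsrc0 (hp.get u0 hmem0), if_pos ht0]; rfl
  have hmoved := hp.tr.moved hx.notMem_LU
  have hpar : ∀ u ∈ I.children v, I.parent u = v := fun u hu => (I.mem_children.1 hu).2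
  refine ⟨hcore, hp.yInv hi hh hx hlt, ?_, ?_, ?_, hi.moved.trans hmoved, ?_, ?_, ?_, ?_, ?_,
    hp.forest.trans hi.forest, hp.served.trans hi.served, ?_⟩
  -- the siblings: what leaves `T_u` pays for the variables and for the loss of potential
  · intro u hu hne C0 hC0 hbots
    rw [hp.ap.of_ne (I.ne_of_mem_children hu)] at hC0 hbots
    have h1 := hi.bal u hu hne C0 hC0 hbots
    rw [hpar u hu] at h1 ⊢
    rw [hp.y_v]
    have hlu := hx.level_sib hu
    rw [hlu] at h1 ⊢
    by_cases hus : u ∈ sib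
    · have hui : u ∈ insert u0 sib := Finset.mem_insert_of_mem hus
      have hsrcu : C.src u = some (j u) := by rw [hp.src, if_pos hui]
      have h2 := hp.ap.pot_src hu hsrcu (hp.get u hui) C0.time
      have h3 := hp.tr.subMass_eq (hx.notMem_sub hu hne) fun l hl => (hx.leaves l hl).1
      have h4 := hp.amt u hus
      have h5 := hp.sum_le hmono (u := u) C0.time
      have h6 := (hi.core.wf u _ (mem_of_getElem? (hp.get u hui))).rhs_pos
      have h7 : (if C0.time < (σ u).time then (σ u).rhs I u else 0) * C.z ≤
          (σ u).rhs I u * C.z := by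
        refine mul_le_mul_of_nonneg_right ?_ hp.z_pos.le
        split_ifs
        exacts [le_rfl, h6.le]
      have h8 : pot I S u C0.time / I.lam ^ I.level u0 ≤ pot I S' u C0.time / I.lam ^ I.level u0 +
          C.z * ((σ u).rhs I u / I.lam ^ I.level u0) := by
        have : pot I S u C0.time ≤ pot I S' u C0.time + (σ u).rhs I u * C.z := by linarith
        rw [mul_comm C.z, div_mul_eq_mul_div, ← add_div]
        gcongr
      linarith
    · have hui : u ∉ insert u0 sib := by simp [hne, hus]
      have hsrcu : C.src u = none := by rw [hp.src, if_neg hui]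
      rw [hp.ap.pot_none (I.ne_of_mem_children hu) (Or.inr hsrcu)]
      have h2 := hmoved.subMass_le (hx.notMem_sub hu hne)
      have h3 : Yd u = S.y v u := by
        funext t; rw [hp.Yd_eq, if_neg fun h => hui h.1]
      rw [h3]
      linarith
  -- the principal child, where no variables are raised, as it is awake at `τ`
  · intro B hB C0 hC0 hbots
    have hne0 := I.ne_of_mem_children hx.child0
    rw [hp.ap.of_ne hne0] at hC0 hbots
    have h1 := hi.bal0 B hB C0 hC0 hbots
    rw [hpar u0 hx.child0] at h1 ⊢
    rw [hp.y_v, hused]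
    have h2 := hp.ap.pot_src hx.child0 hsrc0 (hp.get u0 hmem0) C0.time
    have h3 := hmoved.subMass_add hx.leaf0 hx.mem0 fun l hl => hx.LU_not_sub hl
    have h5 := hp.sum_le hmono (u := u0) C0.time
    rw [ht0, Finset.Ioc_self, Finset.sum_empty, add_zero] at h5
    have h6 := (hi.core.wf u0 _ (mem_of_getElem? (hp.get u0 hmem0))).rhs_pos
    have h7 : (if C0.time < (σ u0).time then (σ u0).rhs I u0 else 0) * C.z ≤
        (σ u0).rhs I u0 * C.z := by
      refine mul_le_mul_of_nonneg_right ?_ hp.z_pos.le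
      split_ifs
      exacts [le_rfl, h6.le]
    have h8 : pot I S u0 C0.time / I.lam ^ I.level u0 ≤
        pot I S' u0 C0.time / I.lam ^ I.level u0 +
        (σ u0).rhs I u0 * C.z / I.lam ^ I.level u0 := by
      have : pot I S u0 C0.time ≤ pot I S' u0 C0.time + (σ u0).rhs I u0 * C.z := by linarith
      rw [← add_div]
      gcongr
    rw [add_div]
    linarith
  -- the node `v` itself, whose server mass does not change
  · intro hv hB C0 hC0 hbots
    have hpv : I.parent v ≠ v := fun h1 => by
      have := I.level_parent v hv
      rw [h1] at this; omega
    have hmass : subMass I S' v = subMass I S v :=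
      hmoved.subMass_eq hx.notMem_LU hx.leaf0 hx.mem_v
        fun l hl => ⟨(hx.leaves l hl).1, hx.LU_sub hl⟩
    have hη : 0 < 1 + 3 / (4 * I.H : ℝ) := by have := I.H_ge; positivity
    rw [hdual, hp.y_ne hpv]
    -- for constraints of the current timestep, the term `2 γ` is enough
    by_cases ht : C0.time = τ
    · have hm : C0.mass = subMass I S v := by
        rcases hp.ap.mem.1 hC0 with h1 | ⟨-, rfl⟩
        · obtain ⟨New, h2, h3⟩ := hi.new
          rw [h2, List.mem_append] at h1
          rcases h1 with h1 | h1
          · have := hh.old C0 h1; omega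
          · rw [(h3 C0 h1).mass, hi.subMass_v hx]
        · exact hp.mass
      rw [hm, hmass, ht, Finset.Ioc_self, Finset.sum_empty, pot_eq_zero hcore, zero_div]
      have h2 := hp.dual_le hwf.rhs_pos
      have h3 : (1 + 3 / (4 * I.H : ℝ)) ≤ 2 := by
        have := I.H_ge
        have : 3 / (4 * I.H : ℝ) ≤ 1 := by rw [div_le_one (by positivity)]; linarith
        linarith
      have h4 := dualObj_nonneg hi.core v τ
      have h5 : 0 ≤ C.rhs I v * C.z := mul_nonneg hwf.rhs_pos.le hp.z_pos.le
      have h6 : (1 + 3 / (4 * I.H : ℝ)) * (dualObj I S v τ + C.rhs I v * C.z) /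
          I.lam ^ I.level v ≤ (1 + 3 / (4 * I.H : ℝ)) * (dualObj I S v τ + C.rhs I v * C.z) :=
        div_le_self (by positivity) (I.one_le_lam_pow _)
      nlinarith
    · have hle := hcore.times v C0 hC0
      have hlt' : C0.time < τ := by omega
      have hC0' : C0 ∈ S.cons v := by
        rcases hp.ap.mem.1 hC0 with h1 | ⟨-, rfl⟩
        exacts [h1, (ht hp.time).elim]
      have h1 := hi.balv hv hB C0 hC0' fun D hD => hbots D (hp.ap.mem.2 (Or.inl hD))
      rw [hp.ap.pot_self hi.core hsrcv, hp.time, if_pos hlt', hmass]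
      rw [mul_add, add_div, add_div]
      linarith
  · rw [hused, hdual, hmv, add_div, add_div]
    have h1 := hi.gain
    have h2 : C.z / I.lam ^ I.level u0 * (C.rhs I v - (σ u0).rhs I u0) =
      C.rhs I v * C.z / I.lam ^ I.level u0 - (σ u0).rhs I u0 * C.z / I.lam ^ I.level u0 := by ring
    linarith
  · rw [hmv]
    have := hi.gain_nonneg
    have : 0 ≤ ∑ l ∈ LU, x l := Finset.sum_nonneg fun l _ => hp.tr.1 l
    linarith
  · rw [hp.awake_of_notMem v (v_notMem hx)]; exact hi.awk
  · intro u hu; rw [hp.ap.of_ne hu, hi.cons u hu]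
  · intro w hw; rw [hp.y_ne hw, hi.y w hw]
  · obtain ⟨New, h1, h2⟩ := hi.new
    refine ⟨New ++ [C], by rw [hp.ap.self, h1, List.append_assoc], fun D hD => ?_⟩
    rcases List.mem_append.1 hD with hD | hD
    · exact h2 D hD
    · rw [List.mem_singleton] at hD
      subst hD
      refine ⟨hp.time, hp.nonbot hi hh hx hlt, by rw [hp.mass, hi.subMass_v hx],
        by rw [hsrc0]; simp, σ u0, ?_, ht0, hb, (hp.srcOK hi hh hx hlt hmem0).A_inter⟩
      rw [← hi.cons u0 (I.ne_of_mem_children hx.child0)]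
      exact mem_of_getElem? (hp.get u0 hmem0)

end Phase

/-! ### A full update -/

theorem Balance.congr {I : Inst V} {S S' : State V} {τ : ℕ} {u : V} {a a' : ℝ}
    (h : Balance I S τ u a) (hc : S'.cons u = S.cons u)
    (hcp : S'.cons (I.parent u) = S.cons (I.parent u))
    (hy : S'.y (I.parent u) u = S.y (I.parent u) u)
    (hm : subMass I S' u + a' ≤ subMass I S u + a) : Balance I S' τ u a' := by
  intro C0 hC0 hbots
  rw [hc] at hC0 hbots
  have h1 := h C0 hC0 hbots
  have h2 : pot I S' u C0.time = pot I S u C0.time := by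
    rw [pot_eq, pot_eq, hc]
    congr 1
    rw [wload, wload, hc]
    refine idxSum_congr fun j B _ => ?_
    rw [load_eq, load_eq, hcp]
  rw [h2, hy]
  linarith

theorem Balance.mono_time {I : Inst V} {S : State V} {τ τ' : ℕ} {u : V} {a : ℝ}
    (h : Balance I S τ u a) (hy : ∀ v u t, τ < t → S.y v u t = 0) (hτ : τ ≤ τ') :
    Balance I S τ' u a := by
  intro C0 hC0 hbots
  have h1 := h C0 hC0 hbots
  have h2 : ∑ t ∈ Finset.Ioc C0.time τ', S.y (I.parent u) u t =
      ∑ t ∈ Finset.Ioc C0.time τ, S.y (I.parent u) u t := by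
    refine (Finset.sum_subset (Finset.Ioc_subset_Ioc_right hτ) fun t ht ht' => hy _ _ _ ?_).symm
    rw [Finset.mem_Ioc] at ht ht'
    omega
  rw [h2]
  exact h1

theorem Balance.anti {I : Inst V} {S : State V} {τ : ℕ} {u : V} {a a' : ℝ}
    (h : Balance I S τ u a) (ha : a' ≤ a) : Balance I S τ u a' :=
  h.congr rfl rfl rfl (by linarith)

theorem Core.mono {I : Inst V} {S : State V} {τ τ' : ℕ} (h : Core I τ S) (hτ : τ ≤ τ') :
    Core I τ' S :=
  { h with times := fun v C hC => (h.times v C hC).trans hτ }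

theorem Core.insert_awake {I : Inst V} {S : State V} {τ : ℕ} (h : Core I τ S) (v : V) (t : ℕ) :
    Core I τ { S with awake := Function.update S.awake v (insert t (S.awake v)) } :=
  { h with
    src := fun w C hC u j hj => by
      obtain ⟨σ, h1, h2⟩ := h.src w C hC u j hj
      exact ⟨σ, h1, ⟨h2.child, h2.A_inter, h2.agree, h2.time_le, h2.period, h2.bots⟩⟩
    awake := fun u j B hB => by
      rcases h.awake u j B hB with h1 | h1
      · left
        by_cases hu : u = v
        · subst hu; simp [h1]
        · simpa [hu] using h1
      · exact Or.inr h1 }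

theorem YInv.mono {I : Inst V} {S : State V} {τ τ' : ℕ} (h : YInv I τ S) (hτ : τ ≤ τ') :
    YInv I τ' S :=
  { h with zero := fun v u t ht => h.zero v u t (by omega) }

/-- The outcome of a full update at `v`: the balance of `u0` decreases by `(1 + 1 / (4 H)) γ / λ ^ h`,
where `γ / λ ^ h` is from the repeat-loop. -/
structure FullRes (I : Inst V) (v0 v u0 : V) (sib LU : Finset V) (τ : ℕ) (S S' : State V) :
    Prop where
  core : Core I τ S'
  yinv : YInv I τ S'
  moved : Moved LU v0 S.mass S'.mass
  gain_nonneg : S.mass v0 ≤ S'.mass v0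
  gain_le : S'.mass v0 - S.mass v0 ≤ I.gam / I.lam ^ I.level u0
  le_gain : sib.Nonempty → I.gam / (4 * I.H * I.lam ^ I.level u0) ≤ S'.mass v0 - S.mass v0
  bal : ∀ u ∈ I.children v, u ≠ u0 → Balance I S' τ u 0
  bal0 : ∀ B, Balance I S τ u0 B → Balance I S' τ u0
    (B - (1 + 1 / (4 * I.H : ℝ)) * I.gam / I.lam ^ I.level u0)
  balv : v ≠ I.root → Balance I S τ v 0 → Balance I S' τ v
    ((1 + 3 / (4 * I.H : ℝ)) * I.gam / I.lam ^ I.level v)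
  cons : ∀ u, u ≠ v → S'.cons u = S.cons u
  y : ∀ w, w ≠ v → S'.y w = S.y w
  forest : S'.forest = S.forest
  served : S'.served = S.served
  dual : dualObj I S' v τ = I.gam
  new : ∃ New, S'.cons v = S.cons v ++ New ∧ ∀ C ∈ New, NewOK I v u0 τ S C

section Full
variable {I : Inst V} {v0 v u0 : V} {sib LU : Finset V} {τ : ℕ} {S S' S1 : State V}

theorem FullInv.start (hx : Ctx I v0 v u0 sib LU) (hh : FullHyp I v u0 sib τ S)
    (hcore : Core I τ S) (hy : YInv I τ S)
    (hbal : ∀ u ∈ I.children v, u ≠ u0 → Balance I S τ u 0) :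
    FullInv I v0 v u0 LU τ S
      { S with awake := Function.update S.awake v (insert τ (S.awake v)) } := by
  have hcore' := hcore.insert_awake v τ
  have hdual : dualObj I { S with awake := Function.update S.awake v (insert τ (S.awake v)) } v τ
      = 0 := by
    rw [dualObj_eq]
    refine sum_map_zero fun C hC => ?_
    rw [if_neg]
    have := hh.old C hC
    omega
  have hused : usedLoad I { S with awake := Function.update S.awake v (insert τ (S.awake v)) } u0 τ
      = 0 := by
    refine idxSum_zero fun j B hB => ?_
    by_cases h1 : B.time = τ
    · rw [load_eq_zero hcore', mul_zero]
      intro B' hB' C hC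
      rw [hB] at hB'
      obtain rfl := Option.some.inj hB'
      rw [(I.mem_children.1 hx.child0).2] at hC
      rw [h1]; exact hh.old C hC
    · simp only [if_neg h1, zero_mul]
  refine ⟨hcore', ⟨hy.nonneg, hy.zero, hy.le, hy.timer⟩, hbal, fun B hB => ?_, fun _ hB => ?_,
    Moved.refl _ _ _, ?_, le_rfl, by simp, fun _ _ => rfl, fun _ _ => rfl, rfl, rfl,
    [], by simp, by simp⟩
  · rw [hused, sub_self, zero_div, sub_zero, sub_zero]; exact hB
  · rw [hdual, mul_zero, zero_div]; exact hB
  · rw [hused, hdual]; simp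

theorem FullInv.phase (hx : Ctx I v0 v u0 sib LU) (hh : FullHyp I v u0 sib τ S)
    (hi : FullInv I v0 v u0 LU τ S S1) (hlt : dualObj I S1 v τ < I.gam)
    (hp : Phase I v0 v u0 (insert u0 sib) LU τ S1 S') : FullInv I v0 v u0 LU τ S S' := by
  obtain ⟨C, σ, j, x, Yd, hd⟩ := hp.data hx hlt
  exact hd.fullInv hi hh hx hlt

/-- Moving more server mass at the end costs the balance of `u0` at most `γ / (4 H λ ^ h)`. -/
theorem FullInv.finish (hx : Ctx I v0 v u0 sib LU) (hi : FullInv I v0 v u0 LU τ S S1)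
    (hd : dualObj I S1 v τ = I.gam)
    (h : if sib.Nonempty ∧ S1.mass v0 - S.mass v0 < I.gam / (4 * I.H * I.lam ^ (I.level v - 1)) then
      ∃ m x, Transfer LU v0 S1.mass m x ∧ ∑ l ∈ LU, x l =
        I.gam / (4 * I.H * I.lam ^ (I.level v - 1)) - (S1.mass v0 - S.mass v0) ∧
        S' = { S1 with mass := m }
      else S' = S1) : FullRes I v0 v u0 sib LU τ S S' := by
  have hl := I.lam_pow_pos (I.level u0)
  have hg := I.gam_pos
  have hH := I.H_ge
  have hgain := hi.gain
  have hused := usedLoad_nonneg hi.core u0 τ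
  have hused' : 0 ≤ usedLoad I S1 u0 τ / I.lam ^ I.level u0 := div_nonneg hused hl.le
  rw [hd] at hgain
  have hamount : I.gam / (4 * I.H * I.lam ^ I.level u0) =
      1 / (4 * I.H : ℝ) * (I.gam / I.lam ^ I.level u0) := by field_simp
  have hgl : 0 ≤ I.gam / I.lam ^ I.level u0 := by positivity
  have hH1 : 1 / (4 * I.H : ℝ) ≤ 1 := by rw [div_le_one (by positivity)]; linarith
  have hH0 : 0 ≤ 1 / (4 * I.H : ℝ) := by positivity
  have hsplit : (1 + 1 / (4 * I.H : ℝ)) * I.gam / I.lam ^ I.level u0 =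
      I.gam / I.lam ^ I.level u0 + 1 / (4 * I.H : ℝ) * (I.gam / I.lam ^ I.level u0) := by ring
  rw [hx.level_v] at h
  split_ifs at h with hc
  · obtain ⟨m, x, htr, hsum, rfl⟩ := h
    have hm := htr.moved hx.notMem_LU
    have hself : m v0 = S1.mass v0 + ∑ l ∈ LU, x l := htr.self hx.notMem_LU
    have hmv : m v0 - S.mass v0 = I.gam / (4 * I.H * I.lam ^ I.level u0) := by
      rw [hself]; linarith
    have hsub : ∀ u, v0 ∉ I.sub u → subMass I { S1 with mass := m } u ≤ subMass I S1 u :=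
      fun u hu => Moved.subMass_le (S := S1) (S' := { S1 with mass := m }) hm hu
    have hsub0 := Moved.subMass_add (S := S1) (S' := { S1 with mass := m }) hm hx.leaf0 hx.mem0
      fun l hl => hx.LU_not_sub hl
    have hsubv : ∀ w, v ∈ I.sub w → subMass I { S1 with mass := m } w = subMass I S1 w :=
      fun w hw => Moved.subMass_eq (S := S1) (S' := { S1 with mass := m }) hm hx.notMem_LU hx.leaf0
        (I.mem_sub_trans hx.mem_v hw)
        fun l hl => ⟨(hx.leaves l hl).1, I.mem_sub_trans (hx.LU_sub hl) hw⟩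
    refine ⟨?_, ⟨hi.yinv.nonneg, hi.yinv.zero, hi.yinv.le, hi.yinv.timer⟩, hi.moved.trans hm,
      ?_, ?_, ?_, ?_, ?_, ?_, hi.cons, hi.y, hi.forest, hi.served, hd, hi.new⟩
    · have hroot := hsubv I.root (I.mem_sub_root v)
      exact { hi.core with
        mass_nonneg := htr.nonneg hi.core.mass_nonneg
        le_total := hroot ▸ hi.core.le_total
        total_le := hroot ▸ hi.core.total_le
        src := fun w C hC u j hj => by
          obtain ⟨σ, h1, h2⟩ := hi.core.src w C hC u j hj
          exact ⟨σ, h1, ⟨h2.child, h2.A_inter, h2.agree, h2.time_le, h2.period, h2.bots⟩⟩ }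
    · have : 0 ≤ I.gam / (4 * I.H * I.lam ^ I.level u0) := by positivity
      show S.mass v0 ≤ m v0
      linarith
    · show m v0 - S.mass v0 ≤ _
      rw [hmv, hamount]; nlinarith
    · intro _
      show _ ≤ m v0 - S.mass v0
      rw [hmv]
    · intro u hu hne
      exact (hi.bal u hu hne).congr rfl rfl rfl (by linarith [hsub u (hx.notMem_sub hu hne)])
    · intro B hB
      refine (hi.bal0 B hB).congr rfl rfl rfl ?_
      rw [hsub0]
      show subMass I S1 u0 + (m v0 - S1.mass v0) + _ ≤ _
      have : usedLoad I S1 u0 τ / I.lam ^ I.level u0 ≤ I.gam / I.lam ^ I.level u0 := by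
        linarith [hi.gain_nonneg]
      rw [hsplit]
      linarith
    · intro hv hB
      have h1 := hi.balv hv hB
      rw [hd] at h1
      exact h1.congr rfl rfl rfl (by rw [hsubv v (I.self_mem_sub v)])
  · subst h
    refine ⟨hi.core, hi.yinv, hi.moved, hi.gain_nonneg, by linarith, ?_, hi.bal, ?_, ?_, hi.cons,
      hi.y, hi.forest, hi.served, hd, hi.new⟩
    · intro hne
      by_contra! h1
      exact hc ⟨hne, h1⟩
    · intro B hB
      refine (hi.bal0 B hB).anti ?_
      rw [hsplit]
      have : 0 ≤ 1 / (4 * I.H : ℝ) * (I.gam / I.lam ^ I.level u0) := by positivity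
      linarith
    · intro hv hB
      have h1 := hi.balv hv hB
      rwa [hd] at h1

theorem FullUpdate.res {i : ℕ} (hv : v = I.anc v0 i) (hu : u0 = I.anc v0 (i - 1))
    (hsib : sib = activeSib I S u0) (hLU : LU = sib.biUnion (activeLeaves I S))
    (hx : Ctx I v0 v u0 sib LU) (hh : FullHyp I v u0 sib τ S)
    (hcore : Core I τ S) (hy : YInv I τ S)
    (hbal : ∀ u ∈ I.children v, u ≠ u0 → Balance I S τ u 0)
    (h : FullUpdate I v0 τ i S S') : FullRes I v0 v u0 sib LU τ S S' := by
  obtain ⟨S1, h1, h2, h3⟩ := h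
  subst hu hsib hLU hv
  have hinv : FullInv I v0 (I.anc v0 i) (I.anc v0 (i - 1))
      ((activeSib I S (I.anc v0 (i - 1))).biUnion (activeLeaves I S)) τ S S1 := by
    have h0 := FullInv.start hx hh hcore hy hbal
    clear h2 h3
    induction h1 with
    | single hp => exact h0.phase hx hh hp.1 hp.2
    | tail _ hp ih => exact ih.phase hx hh hp.1 hp.2
  exact hinv.finish hx h2 h3

end Full

/-! ### A simple update -/

/-- `b` is a descendant of `a` in a charging forest. -/
def Forest.Desc (F : Forest V) (a b : V × ℕ) : Prop :=
  Relation.ReflTransGen (fun a b => b ∈ F.kids a) a b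

/-- The properties of a tree of a charging forest that are used by a simple update: its nodes are
below the root, its leaves are strictly below, unless the tree is a single vertex, and they
belong to different nodes. -/
structure TreeOK (I : Inst V) (F : Forest V) (a : V × ℕ) : Prop where
  sub : ∀ b, F.Desc a b → b.1 ∈ I.sub a.1
  lt : ∀ b, F.Desc a b → b ≠ a → I.level b.1 < I.level a.1
  inj : ∀ b b', F.Desc a b → F.kids b = ∅ → F.Desc a b' → F.kids b' = ∅ → b.1 = b'.1 → b = b'

/-- The properties of the constraint `C` added by a simple update. By `occ`, the variable `y(u, t)`
only occurs in `C` if the charging tree has a leaf at `u` with `t` in its window; the bound on `z` is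
proportional to `c_u`, as the leaves on the chosen level cost `c_{v*} / H` in total. -/
structure SimpleOK (I : Inst V) (r : Req V) (lc τ i : ℕ) (ξ : ℝ) (S : State V) (C : Con V) :
    Prop where
  time : C.time = τ
  mass : C.mass = subMass I S (I.anc r.leaf i)
  src : ∀ u, C.src u = none
  wf : ConWF I (I.anc r.leaf i) C
  bot : C.IsBot → C.f (I.anc r.leaf i) = r ∧
    4 / 5 * (1 - S.mass r.leaf) ≤ C.rhs I (I.anc r.leaf i) ∧
    (S.forest (I.anc r.leaf (min i lc))).kids (I.anc r.leaf (min i lc), r.e) = ∅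
  dual : ¬ C.IsBot → C.rhs I (I.anc r.leaf i) * C.z = ξ
  occ : ∀ u t, C.Occurs I (I.anc r.leaf i) u t → ∃ p,
    (S.forest (I.anc r.leaf (min i lc))).Desc (I.anc r.leaf (min i lc), r.e) (u, p) ∧
    (S.forest (I.anc r.leaf (min i lc))).kids (u, p) = ∅ ∧
    ((S.forest (I.anc r.leaf (min i lc))).req (u, p)).b * I.N < t ∧ t ≤ τ ∧
    C.z ≤ 2 * I.H * I.c u / I.lam ^ (min i lc) * ξ

theorem subMass_le_of_lt {I : Inst V} {S : State V} {v l0 : V} {d : ℝ} (hd : 0 ≤ d)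
    (h0 : 0 ≤ S.mass l0)
    (h : ∀ l ∈ I.sub v, I.IsLeaf l → l ≠ l0 → S.mass l ≤ d) :
    subMass I S v ≤ d * I.nv v + S.mass l0 := by
  calc subMass I S v ≤ ∑ l ∈ (I.sub v).filter I.IsLeaf, (d + if l = l0 then S.mass l0 else 0) := by
        refine Finset.sum_le_sum fun l hl => ?_
        rw [Finset.mem_filter] at hl
        split_ifs with h1
        · rw [h1]; linarith
        · simpa using h l hl.1 hl.2 h1
    _ ≤ ∑ l ∈ I.sub v, (d + if l = l0 then S.mass l0 else 0) := by
        refine Finset.sum_le_sum_of_subset_of_nonneg (Finset.filter_subset _ _) fun l _ _ => ?_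
        split_ifs <;> linarith
    _ ≤ _ := by
        rw [Finset.sum_add_distrib, Finset.sum_const, nsmul_eq_mul, mul_comm, Finset.sum_ite_eq',
          HST.nv]
        split_ifs <;> linarith

theorem SimpleUpdate.exists_simpleOK {I : Inst V} {r : Req V} {lc τ i : ℕ} {ξ : ℝ} {S S' : State V}
    (hl : I.level r.leaf = 0) (hi : i ≤ I.H) (hξ : 0 ≤ ξ)
    (hm0 : S.mass r.leaf ≤ 1 - I.del') (hnn : ∀ l, 0 ≤ S.mass l)
    (hlt : ∀ l ∈ I.sub (I.anc r.leaf i), I.IsLeaf l → l ≠ r.leaf → S.mass l < I.del)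
    (htree : TreeOK I (S.forest (I.anc r.leaf (min i lc))) (I.anc r.leaf (min i lc), r.e))
    (h : SimpleUpdate I r lc τ i ξ S S') : ∃ C, SimpleOK I r lc τ i ξ S C ∧
      S' = { S with
        cons := Function.update S.cons (I.anc r.leaf i) (S.cons (I.anc r.leaf i) ++ [C])
        awake := Function.update S.awake (I.anc r.leaf i) (insert τ (S.awake (I.anc r.leaf i))) } := by
  obtain ⟨C, hS', htime, hmass, hsrc, hC⟩ := h
  refine ⟨C, ?_, hS'⟩
  set v := I.anc r.leaf i with hv
  set vs := I.anc r.leaf (min i lc) with hvs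
  set F := S.forest vs with hF
  have hlv : I.level v = i := by rw [hv, I.level_anc _ _ (by omega), hl, zero_add]
  have hlvs : I.level vs = min i lc := by rw [hvs, I.level_anc _ _ (by omega), hl, zero_add]
  have hvsv : vs ∈ I.sub v := by
    rw [hv, hvs, show i = min i lc + (i - min i lc) by omega, I.anc_add]
    rw [show min (min i lc + (i - min i lc)) lc = min i lc by omega]
    exact I.anc_mem _ _
  have hsm := subMass_le_of_lt (v := v) I.del_pos.le (hnn r.leaf)
    fun l h1 h2 h3 => (hlt l h1 h2 h3).le
  have hnv := I.nv_le v
  have hnv1 := I.nv_pos v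
  have hdn := I.del_mul_n
  have hd := I.del_pos
  have hd' := I.del'_pos
  have hd'1 := I.del'_le
  have hdnv : I.del * I.nv v ≤ I.del * I.n := mul_le_mul_of_nonneg_left hnv hd.le
  have hk := I.k_ge
  by_cases hkids : F.kids (vs, r.e) = ∅
  · rw [if_pos hkids] at hC
    obtain ⟨hA, hf, htau, hz⟩ := hC
    have hbot : C.IsBot := by simp [Con.IsBot, hA]
    have hrhs : 4 / 5 * (1 - S.mass r.leaf) ≤ C.rhs I v := by
      rw [rhs_eq (by rw [hA]; simpa using I.self_mem_sub v), hA, hmass]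
      simp only [Finset.card_singleton, Nat.cast_one]
      nlinarith
    refine ⟨htime, hmass, hsrc, ⟨?_, ?_, ?_, ?_, ?_, ?_, ?_, ?_⟩, ?_, ?_, ?_⟩
    · rw [hA]; simpa using I.self_mem_sub v
    · rw [hA]; simp
    · rw [htau, htime]
    · rw [hz]
    · linarith
    · exact fun _ => ⟨hA, hz, hsrc⟩
    · exact fun h1 => (h1 hbot).elim
    · rw [hmass]; linarith
    · exact fun _ => ⟨hf, hrhs, hkids⟩
    · exact fun h1 => (h1 hbot).elim
    · rintro u t ⟨h1, h2, -⟩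
      rw [HST.subTo, Finset.mem_filter, hA] at h1
      rcases h1.2 with h3 | ⟨a, ha, h3⟩
      · exact (h2 h3).elim
      · rw [Finset.mem_singleton.1 ha] at h3
        exact (h2 (I.eq_of_mem_sub_of_level h1.1 (I.level_le_of_mem_sub h3))).elim
  · rw [if_neg hkids] at hC
    obtain ⟨s, Ls, hLs, hcost, hA, hfL, htau, hz⟩ := hC
    have hinj : Set.InjOn Prod.fst (Ls : Set (V × ℕ)) := by
      intro a ha b hb hab
      have h1 := (hLs a).1 ha
      have h2 := (hLs b).1 hb
      exact htree.inj a b h1.1 h1.2.1 h2.1 h2.2.1 hab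
    have hcard : C.A.card = Ls.card := by rw [hA, Finset.card_image_of_injOn hinj]
    have hAmem : ∀ u, u ∈ C.A → ∃ p, (u, p) ∈ Ls := by
      intro u hu
      rw [hA, Finset.mem_image] at hu
      obtain ⟨⟨w, p⟩, h1, rfl⟩ := hu
      exact ⟨p, h1⟩
    have hAlev : ∀ u ∈ C.A, I.level u = s ∧ u ∈ I.sub vs ∧ s < min i lc := by
      intro u hu
      obtain ⟨p, hp⟩ := hAmem u hu
      have h1 := (hLs _).1 hp
      refine ⟨h1.2.2, htree.sub _ h1.1, ?_⟩
      rw [← h1.2.2, ← hlvs]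
      refine htree.lt _ h1.1 fun h2 => hkids ?_
      rw [← h2]; exact h1.2.1
    have hsum : ∑ a ∈ Ls, I.c a.1 = C.A.card * I.lam ^ s := by
      rw [hcard, ← nsmul_eq_mul, ← Finset.sum_const]
      refine Finset.sum_congr rfl fun a ha => ?_
      rw [HST.c, ((hLs a).1 ha).2.2]
    have hH := I.H_ge
    have hcvs : I.c vs = I.lam ^ min i lc := by rw [HST.c, hlvs]
    rw [hsum, hcvs] at hcost
    have hlam := I.lam_pow_pos
    have hApos : 0 < C.A.card := by
      rw [Nat.pos_iff_ne_zero]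
      intro h1
      rw [h1, Nat.cast_zero, zero_mul] at hcost
      have : 0 < I.lam ^ min i lc / I.H := div_pos (hlam _) (by linarith)
      linarith
    have hAne : C.A.Nonempty := Finset.card_pos.1 hApos
    obtain ⟨a0, ha0⟩ := hAne
    have hs := (hAlev a0 ha0).2.2
    -- the leaves are at least one level below the root, and `λ ≥ 10 H`
    have hten : (10 : ℝ) ≤ C.A.card := by
      have h1 : I.lam ^ (s + 1) ≤ I.lam ^ min i lc :=
        pow_le_pow_right₀ (by have := I.lam_ge'; linarith) (by omega)
      have h2 : I.lam ^ (s + 1) / I.H ≤ C.A.card * I.lam ^ s :=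
        (div_le_div_of_nonneg_right h1 (by linarith)).trans hcost
      rw [pow_succ, div_le_iff₀ (by linarith)] at h2
      have h3 : I.lam ^ s * I.lam ≤ I.lam ^ s * (C.A.card * I.H) := by linarith
      have h4 := le_of_mul_le_mul_left h3 (hlam s)
      have h5 := I.lam_ge
      nlinarith
    have hAsub : C.A ⊆ I.sub v := fun u hu => I.mem_sub_trans (hAlev u hu).2.1 hvsv
    have hvA : ∀ u ∈ C.A, I.level u < i := fun u hu => by
      have := hAlev u hu; omega
    have hnb : ¬ C.IsBot := by
      intro h1
      rw [Con.IsBot] at h1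
      rw [h1] at hten; norm_num at hten
    have hrhs : (C.A.card : ℝ) / 2 ≤ C.rhs I v := by
      rw [rhs_eq hAsub, hmass]
      nlinarith
    have hrpos : 0 < C.rhs I v := by linarith
    have hvnot : v ∉ C.A := fun h1 => by have := hvA v h1; omega
    have hvto : v ∈ I.subTo v C.A := by
      rw [HST.subTo, Finset.mem_filter]; exact ⟨I.self_mem_sub v, Or.inl rfl⟩
    refine ⟨htime, hmass, hsrc, ⟨hAsub, ⟨a0, ha0⟩, ?_, ?_, ?_, ?_, ?_, ?_⟩, ?_, ?_, ?_⟩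
    · rw [htau v hvto hvnot, htime]
    · rw [hz]; exact div_nonneg hξ hrpos.le
    · linarith
    · exact fun h1 => (hnb h1).elim
    · exact fun _ => hvnot
    · rw [hmass]; linarith
    · exact fun h1 => (hnb h1).elim
    · intro _
      change C.rhs I v * C.z = ξ
      rw [hz]; field_simp
    · rintro u t ⟨h1, h2, h3⟩
      have hu := h1
      rw [HST.subTo, Finset.mem_filter] at hu
      obtain ⟨a, ha, hau⟩ := hu.2.resolve_left h2
      have hus : s ≤ I.level u := (hAlev a ha).1 ▸ I.level_le_of_mem_sub hau
      have hpar : C.tau (I.parent u) = τ := by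
        have hur : u ≠ I.root := by
          rintro rfl
          exact h2 (I.eq_of_mem_sub_of_level hu.1 (I.level_root ▸ I.level_le v))
        refine htau _ ?_ fun h4 => ?_
        · rw [HST.subTo, Finset.mem_filter]
          exact ⟨I.parent_mem_sub hu.1 h2, Or.inr ⟨a, ha, I.mem_sub_trans hau (I.mem_sub_parent u)⟩⟩
        · have := (hAlev _ h4).1
          rw [I.level_parent u hur] at this
          omega
      rw [hpar] at h3
      rcases h3 with ⟨huA, hb, ht⟩ | ⟨huA, hb, ht⟩
      · obtain ⟨p, hp⟩ := hAmem u huA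
        have h5 := (hLs _).1 hp
        have h6 := hfL _ hp
        refine ⟨p, h5.1, h5.2.1, ?_, ht, ?_⟩
        · simp only at h6; rw [← h6.1]; exact hb
        · rw [hz, HST.c, (hAlev u huA).1, div_le_iff₀ hrpos]
          have h7 : I.lam ^ min i lc ≤ C.A.card * I.lam ^ s * I.H := by
            rwa [div_le_iff₀ (by linarith)] at hcost
          have h8 : 1 ≤ 2 * I.H * I.lam ^ s / I.lam ^ min i lc * C.rhs I v := by
            rw [div_mul_eq_mul_div, le_div_iff₀ (hlam _), one_mul]
            have h9 : 0 ≤ I.H * I.lam ^ s := mul_nonneg (by linarith) (hlam s).le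
            nlinarith
          nlinarith
      · rw [htau u h1 huA] at hb; omega

/-! ### One iteration of the while-loop -/

/-- The properties of the constraints added by the full update at the `j`-th node `v` of the path,
when `v_{i0 + 1}` is the first node of the path with a full update. -/
structure FullOK (I : Inst V) (r : Req V) (τ i0 j : ℕ) (S0 S : State V) (C : Con V) : Prop where
  time : C.time = τ
  nonbot : ¬ C.IsBot
  mass : j = i0 + 1 → C.mass = subMass I S0 (I.anc r.leaf j)
  src0 : C.src (I.anc r.leaf (j - 1)) ≠ none
  exists_src : ∃ σ ∈ S.cons (I.anc r.leaf (j - 1)), σ.time = τ ∧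
    σ.rhs I (I.anc r.leaf (j - 1)) ≤ C.rhs I (I.anc r.leaf j) ∧
    C.A ∩ I.sub (I.anc r.leaf (j - 1)) = σ.A

/-- The assumptions about the state at the beginning of an iteration at timestep `τ`. -/
structure IterHyp (I : Inst V) (r : Req V) (lc τ : ℕ) (S0 : State V) : Prop where
  level : I.level r.leaf = 0
  leaf : I.IsLeaf r.leaf
  mass_le : S0.mass r.leaf ≤ 1 - I.del'
  core : Core I (τ - 1) S0
  pos : 0 < τ
  yinv : YInv I (τ - 1) S0
  dlb : ∀ u, DualLB I S0 u
  bal : ∀ u, u ≠ I.root → Balance I S0 (τ - 1) u 0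
  off : ∀ u, r.leaf ∉ I.sub u → ∀ C ∈ S0.cons u, C.time / I.N < τ / I.N
  tree : ∀ i ≤ I.H, TreeOK I (S0.forest (I.anc r.leaf (min i lc))) (I.anc r.leaf (min i lc), r.e)

/-- The server mass that may still enter the subtrees of the nodes already treated, before the
update at the `i`-th node. As `λ ≥ 10 H`, what comes from the levels above `i` is covered by the
difference of the factors `1 + 3 / (4 H)` here and `1 + 1 / (4 H)` in a single full update. -/
def budget (I : Inst V) (i : ℕ) : ℝ := (1 + 3 / (4 * I.H : ℝ)) * I.gam / I.lam ^ (i - 1)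

/-- The invariants before the update at the `i`-th node of the path. The factor `20 / 19` in the bounds
on the server mass is that of a geometric series with ratio at most `1 / 20`. -/
structure Mid (I : Inst V) (r : Req V) (lc τ : ℕ) (S0 : State V) (i0 i : ℕ) (S : State V) :
    Prop where
  core : Core I τ S
  yinv : YInv I τ S
  dlb : ∀ u, DualLB I S u
  cons : ∀ u, (∀ j < i, u ≠ I.anc r.leaf j) → S.cons u = S0.cons u
  bal_off : ∀ u, r.leaf ∉ I.sub u → Balance I S τ u 0
  bal_up : ∀ j, i ≤ j → j < I.H → Balance I S τ (I.anc r.leaf j) 0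
  bal_lo : ∀ j < i, j < I.H → Balance I S τ (I.anc r.leaf j) (budget I (max i (i0 + 1)))
  mass_eq : i ≤ i0 + 1 → S.mass = S0.mass
  mass_le : ∀ l, l ≠ r.leaf → S.mass l ≤ S0.mass l
  mass_ge : S0.mass r.leaf ≤ S.mass r.leaf
  sub_ge : ∀ j ≤ I.H, subMass I S0 (I.anc r.leaf j) ≤ subMass I S (I.anc r.leaf j)
  sub_le : ∀ j, i0 ≤ j → j ≤ I.H → subMass I S (I.anc r.leaf j) ≤ subMass I S0 (I.anc r.leaf j) +
    20 / 19 * I.gam * (1 / I.lam ^ j - 1 / I.lam ^ (max j (i - 1)))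
  gain : i0 + 1 < i → I.gam / (4 * I.H * I.lam ^ i0) ≤ S.mass r.leaf - S0.mass r.leaf
  gain_le : S.mass r.leaf ≤ S0.mass r.leaf +
    20 / 19 * I.gam * (1 / I.lam ^ i0 - 1 / I.lam ^ (max i0 (i - 1)))
  forest : S.forest = S0.forest
  served : S.served = S0.served
  mass0 : ∀ j < i, j + 1 = i → ∀ C ∈ S.cons (I.anc r.leaf j), C.time = τ →
    C.mass = subMass I S (I.anc r.leaf j)
  simple : ∀ j < i, j ≤ i0 → ∃ C, S.cons (I.anc r.leaf j) = S0.cons (I.anc r.leaf j) ++ [C] ∧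
    SimpleOK I r lc τ j (I.lam ^ j * (I.gam / I.lam ^ i0)) S0 C
  full : ∀ j < i, i0 < j → dualObj I S (I.anc r.leaf j) τ = I.gam ∧
    ∃ New, S.cons (I.anc r.leaf j) = S0.cons (I.anc r.leaf j) ++ New ∧
      ∀ C ∈ New, FullOK I r τ i0 j S0 S C

section Iteration
variable {I : Inst V} {r : Req V} {lc τ i0 i : ℕ} {S0 S S' : State V}

theorem SimpleOK.congr {ξ : ℝ} {C : Con V} (h : SimpleOK I r lc τ i ξ S C)
    (hm : S.mass = S'.mass) (hf : S.forest = S'.forest) : SimpleOK I r lc τ i ξ S' C :=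
  ⟨h.time, h.mass.trans (by rw [subMass, subMass, hm]), h.src, h.wf, by rw [← hm, ← hf]; exact h.bot,
    h.dual, by rw [← hf]; exact h.occ⟩

theorem DualLB.congr {u : V} (h : DualLB I S u) (hc : S'.cons u = S.cons u) : DualLB I S' u := by
  intro T hT
  rw [dualObj_eq, hc, ← dualObj_eq]
  refine h T ?_
  obtain ⟨C, hC, h1⟩ := hT
  exact ⟨C, hc ▸ hC, h1⟩

/-- The lower bound on dual objective values persists if constraints at a new timestep are added
whose total value is large. -/
theorem DualLB.append {u : V} {New : List (Con V)} (h : DualLB I S u)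
    (hc : S'.cons u = S.cons u ++ New) (hold : ∀ C ∈ S.cons u, C.time < τ)
    (hnew : ∀ C ∈ New, C.time = τ)
    (hd : (∀ C ∈ New, C.IsBot) ∨ I.gam / I.lam ^ I.H ≤ dualObj I S' u τ) : DualLB I S' u := by
  rintro T ⟨C, hC, hT, hb⟩
  rw [hc, List.mem_append] at hC
  rcases hC with hC | hC
  · have hT' : T ≠ τ := by have := hold C hC; omega
    have h1 := h T ⟨C, hC, hT, hb⟩
    rw [dualObj_eq] at h1 ⊢
    rw [hc, List.map_append, List.sum_append, sum_map_zero (L := New), add_zero]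
    · exact h1
    · intro D hD
      rw [if_neg (by rw [hnew D hD]; exact hT'.symm)]
  · rcases hd with hd | hd
    · exact (hb (hd C hC)).elim
    · rw [← hT, hnew C hC]; exact hd

theorem anc_ne (hl : I.level r.leaf = 0) {j i : ℕ} (hj : j ≤ I.H) (hi : i ≤ I.H) (h : j ≠ i) :
    I.anc r.leaf j ≠ I.anc r.leaf i := by
  intro h1
  have h2 := congrArg I.level h1
  rw [I.level_anc _ _ (by omega), I.level_anc _ _ (by omega)] at h2
  omega

theorem activeSib_congr (h : S.mass = S'.mass) (v : V) : activeSib I S v = activeSib I S' v := by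
  unfold activeSib activeLeaves
  rw [h]

theorem activeSib_anc_lt (h : (activeSib I S (I.anc r.leaf i)).Nonempty)
    (hl : I.level r.leaf = 0) : i < I.H := by
  by_contra h1
  have : I.anc r.leaf i = I.root := by
    obtain ⟨k, hk⟩ := Nat.exists_eq_add_of_le (not_lt.1 h1)
    rw [hk, I.anc_add, I.eq_root_of_level (v := I.anc r.leaf I.H), I.anc_root]
    rw [I.level_anc _ _ (by omega)]; omega
  rw [this, activeSib, if_pos rfl] at h
  simp at h

/-- If no proper ancestor of the requested leaf up to `v` has an active sibling, then all other
leaves below `v` are inactive. -/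
theorem mass_lt_of_activeSib_empty (hl : I.level r.leaf = 0) (hi : i ≤ I.H)
    (h : ∀ j < i, ¬ (activeSib I S (I.anc r.leaf j)).Nonempty) :
    ∀ l ∈ I.sub (I.anc r.leaf i), I.IsLeaf l → l ≠ r.leaf → S.mass l < I.del := by
  induction i with
  | zero =>
    intro l hlm hleaf hne
    rw [I.anc_zero] at hlm
    exact (hne (I.eq_of_mem_sub_of_level hlm (by omega))).elim
  | succ i ih =>
    intro l hlm hleaf hne
    by_cases h1 : l ∈ I.sub (I.anc r.leaf i)
    · exact ih (by omega) (fun j hj => h j (by omega)) l h1 hleaf hne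
    have hch := I.anc_mem_children (v := r.leaf) (i := i) (by omega)
    obtain ⟨w, hw, hlw⟩ := I.exists_child hlm (by
      rintro rfl; exact I.not_isLeaf hch hleaf)
    by_contra h2
    refine h i (by omega) ⟨w, ?_⟩
    have hroot := I.anc_ne_root (v := r.leaf) (i := i) (by omega)
    rw [activeSib, if_neg hroot, Finset.mem_filter]
    rw [I.anc_succ] at hw
    refine ⟨hw, ?_, l, ?_⟩
    · rintro rfl; exact h1 hlw
    · rw [activeLeaves, Finset.mem_filter]
      exact ⟨hlw, hleaf, not_lt.1 h2⟩

theorem budget_le (I : Inst V) (i : ℕ) : budget I i ≤ 2 * I.gam := by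
  rw [budget, div_le_iff₀ (I.lam_pow_pos _)]
  have h1 : 3 / (4 * I.H : ℝ) ≤ 1 := by
    rw [div_le_one (by have := I.H_ge; linarith)]; have := I.H_ge; linarith
  have := I.gam_pos
  have := I.one_le_lam_pow (i - 1)
  nlinarith

theorem Mid.zero (h : IterHyp I r lc τ S0) : Mid I r lc τ S0 i0 0 S0 := by
  have hb : ∀ u, u ≠ I.root → Balance I S0 τ u 0 := fun u hu =>
    (h.bal u hu).mono_time h.yinv.zero (by omega)
  refine ⟨h.core.mono (by omega), h.yinv.mono (by omega), h.dlb, fun _ _ => rfl, fun u hu => ?_,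
    fun j _ hj => ?_, fun j hj => by omega, fun _ => rfl, fun _ _ => le_rfl, le_rfl,
    fun _ _ => le_rfl, fun j _ _ => ?_, fun h1 => by omega, ?_, rfl, rfl, fun j hj => by omega,
    fun j hj => by omega, fun j hj => by omega⟩
  · refine hb u ?_
    rintro rfl
    exact hu (I.mem_sub_root _)
  · exact hb _ (I.anc_ne_root (by have := h.level; omega))
  · simp
  · simp

theorem Mid.simple_step (h : IterHyp I r lc τ S0) (hm : Mid I r lc τ S0 i0 i S)
    (hi0 : ∀ j < i0, ¬ (activeSib I S0 (I.anc r.leaf j)).Nonempty) (hi : i ≤ i0) (hi0H : i0 < I.H)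
    (hs : SimpleUpdate I r lc τ i (I.lam ^ i * (I.gam / I.lam ^ i0)) S S') :
    Mid I r lc τ S0 i0 (i + 1) S' := by
  have hl := h.level
  have hmass := hm.mass_eq (by omega)
  have hξ : 0 ≤ I.lam ^ i * (I.gam / I.lam ^ i0) :=
    mul_nonneg (I.lam_pow_pos _).le (div_nonneg I.gam_pos.le (I.lam_pow_pos _).le)
  obtain ⟨C, hC, rfl⟩ := hs.exists_simpleOK hl (by omega) hξ (by rw [hmass]; exact h.mass_le)
    hm.core.mass_nonneg
    (by rw [hmass]
        exact mass_lt_of_activeSib_empty (S := S0) hl (by omega) fun j hj => hi0 j (by omega))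
    (by rw [hm.forest]; exact h.tree i (by omega))
  set v := I.anc r.leaf i with hv
  set S' : State V := { S with
        cons := Function.update S.cons v (S.cons v ++ [C])
        awake := Function.update S.awake v (insert τ (S.awake v)) } with hS'
  have hlv : I.level v = i := by rw [hv, I.level_anc _ _ (by omega)]; omega
  have hvroot : v ≠ I.root := I.anc_ne_root (by omega)
  have hap : Appends S S' v C := rfl
  have hold : ∀ j, i ≤ j → j ≤ I.H → ∀ B ∈ S.cons (I.anc r.leaf j), B.time < τ := by
    intro j hj hjH B hB
    rw [hm.cons _ fun k hk => anc_ne hl hjH (by omega) (by omega)] at hB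
    have := h.core.times _ B hB
    have := h.pos
    omega
  have hpar : ∀ B ∈ S.cons (I.parent v), B.time < τ := by
    rw [hv, ← I.anc_succ]; exact hold (i + 1) (by omega) (by omega)
  have hcore : Core I τ S' := by
    refine hm.core.append le_rfl hap hC.time hm.core.mass_nonneg rfl (fun _ => hpar) hC.wf ?_ ?_ ?_
      ?_ ?_
    · intro u j hj; rw [hC.src] at hj; cases hj
    · rintro ⟨u, hu⟩; exact (hu (hC.src u)).elim
    · simp [hS']
    · intro u t ht
      left
      by_cases huv : u = v
      · subst huv; simp [hS', ht]
      · simpa [hS', huv] using ht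
    · intro u j σ hj; rw [hC.src] at hj; cases hj
  have hcons : ∀ u, u ≠ v → S'.cons u = S.cons u := fun u hu => hap.of_ne hu
  have hloadpot : ∀ u, u ≠ v → ∀ T, pot I S' u T = pot I S u T := fun u hu T =>
    hap.pot_none hu (Or.inr (hC.src u)) T
  have hbal : ∀ u a, u ≠ v → Balance I S τ u a → Balance I S' τ u a := by
    intro u a hu hb C0 hC0 hC0'
    rw [hloadpot u hu]
    rw [hcons u hu] at hC0 hC0'
    exact hb C0 hC0 hC0'
  have hbalv : Balance I S' τ v (budget I (i0 + 1)) := by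
    intro C0 hC0 hC0'
    have hpot := hap.pot_self hm.core (hC.src v) C0.time
    rcases hap.mem.1 hC0 with h1 | ⟨-, rfl⟩
    · have h2 : C0.time < τ := hold i le_rfl (by omega) C0 h1
      have hnb : ¬ C.IsBot := hC0' C (hap.mem.2 (Or.inr ⟨rfl, rfl⟩)) (by rw [hC.time]; exact h2)
      have h3 := hm.bal_up i le_rfl (by omega) C0 h1
        fun D hD => hC0' D (hap.mem.2 (Or.inl hD))
      rw [hpot, if_pos (by rw [hC.time]; exact h2), hC.dual hnb, add_div, hlv]
      rw [← hv, hlv] at h3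
      have h4 : (1 + 3 / (4 * I.H : ℝ)) * (I.lam ^ i * (I.gam / I.lam ^ i0)) / I.lam ^ i =
          budget I (i0 + 1) := by
        rw [budget, Nat.add_sub_cancel]
        have := I.lam_pow_pos i
        have := I.lam_pow_pos i0
        have := I.H_ge
        field_simp
      have h5 : subMass I S' v = subMass I S v := rfl
      have h6 : S'.y = S.y := rfl
      rw [h4, h5, h6]
      linarith
    · rw [hC.time, pot_eq_zero hcore, hC.mass]
      have := budget_le I (i0 + 1)
      have h5 : subMass I S' v = subMass I S v := rfl
      rw [h5, Finset.Ioc_self, Finset.sum_empty, zero_div, add_zero, add_zero]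
      change subMass I S v + _ ≤ subMass I S v + _
      linarith
  have hne : ∀ j, j ≤ I.H → j ≠ i → I.anc r.leaf j ≠ v := fun j hj hji =>
    anc_ne hl hj (by omega) hji
  have hyi : YInv I τ S' := by
    refine ⟨hm.yinv.nonneg, hm.yinv.zero, hm.yinv.le, fun w u hu t => ?_⟩
    by_cases hw : w = v
    · subst hw
      rw [hap.timerSum_self hu, if_neg (fun h1 => h1.1 (hC.src u)), add_zero]
      exact hm.yinv.timer _ u hu t
    · rw [hap.timerSum_of_ne hw hu (fun _ => by rw [hC.time]; exact hpar)]
      exact hm.yinv.timer _ u hu t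
  have hsub : ∀ w, subMass I S' w = subMass I S w := fun w => rfl
  refine ⟨hcore, hyi, fun u => ?_, fun u hu => ?_, fun u hu => ?_, fun j hj hjH => ?_,
    fun j hj hjH => ?_, fun _ => hmass, hm.mass_le, hm.mass_ge, hm.sub_ge, fun j hj hjH => ?_,
    fun h1 => by omega, ?_, hm.forest, hm.served, fun j hj hji => ?_, fun j hj hji => ?_,
    fun j hj hji => by omega⟩
  · by_cases hu : u = v
    · subst hu
      refine DualLB.append (New := [C]) (τ := τ) (hm.dlb _) hap.self (hold i le_rfl (by omega))
        (by simpa using hC.time) ?_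
      by_cases hb : C.IsBot
      · left; simpa using hb
      right
      rw [hap.dualObj_self hC.time, hC.dual hb]
      have h1 := dualObj_nonneg hm.core (I.anc r.leaf i) τ
      have h2 : I.gam / I.lam ^ I.H ≤ I.gam / I.lam ^ i0 :=
        div_le_div_of_nonneg_left I.gam_pos.le (I.lam_pow_pos _)
          (pow_le_pow_right₀ (by have := I.lam_ge'; linarith) (by omega))
      have h3 : 0 ≤ I.gam / I.lam ^ i0 := div_nonneg I.gam_pos.le (I.lam_pow_pos _).le
      have h4 := I.one_le_lam_pow i
      nlinarith
    · exact (hm.dlb u).congr (hcons u hu)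
  · rw [hcons u (hu i (by omega))]
    exact hm.cons u fun j hj => hu j (by omega)
  · refine hbal u 0 ?_ (hm.bal_off u hu)
    rintro rfl; exact hu (I.anc_mem _ _)
  · exact hbal _ _ (hne j (by omega) (by omega)) (hm.bal_up j (by omega) hjH)
  · rw [max_eq_right (by omega)]
    by_cases hji : j = i
    · subst hji; exact hbalv
    · have := hm.bal_lo j (by omega) hjH
      rw [max_eq_right (by omega)] at this
      exact hbal _ _ (hne j (by omega) hji) this
  · rw [hsub]
    refine (hm.sub_le j hj hjH).trans (le_of_eq ?_)
    rw [max_eq_left (by omega), max_eq_left (by omega)]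
  · refine hm.gain_le.trans (le_of_eq ?_)
    rw [max_eq_left (by omega), max_eq_left (by omega)]
  · obtain rfl : j = i := by omega
    intro D hD hDt
    rcases hap.mem.1 hD with h1 | ⟨-, rfl⟩
    · have := hold j le_rfl (by omega) D h1; omega
    · rw [hC.mass]; rfl
  · by_cases h1 : j = i
    · subst h1
      refine ⟨C, ?_, hC.congr hmass hm.forest⟩
      rw [← hv, hap.self, hm.cons]
      exact fun k hk => (hne k (by omega) (by omega)).symm
    · rw [hcons _ (hne j (by omega) h1)]
      exact hm.simple j (by omega) hji

theorem Mid.full_step (h : IterHyp I r lc τ S0) (hm : Mid I r lc τ S0 i0 i S)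
    (hi0 : IsLeast {i | (activeSib I S0 (I.anc r.leaf i)).Nonempty} i0)
    (hi : i0 < i) (hiH : i ≤ I.H) (hs : FullUpdate I r.leaf τ i S S') :
    Mid I r lc τ S0 i0 (i + 1) S' := by
  have hl := h.level
  obtain ⟨a, rfl⟩ : ∃ a, i = a + 1 := ⟨i - 1, by omega⟩
  set v := I.anc r.leaf (a + 1) with hv
  set u0 := I.anc r.leaf a with hu0
  have hlv : I.level v = a + 1 := by rw [hv, I.level_anc _ _ (by omega)]; omega
  have hlu : I.level u0 = a := by rw [hu0, I.level_anc _ _ (by omega)]; omega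
  have hch : u0 ∈ I.children v := I.anc_mem_children (by omega)
  have hu0root : u0 ≠ I.root := (I.mem_children.1 hch).1
  have hpar0 : I.parent u0 = v := (I.mem_children.1 hch).2
  set sib := activeSib I S u0 with hsib
  set LU := sib.biUnion (activeLeaves I S) with hLU
  have hsibmem : ∀ u, u ∈ sib ↔ u ∈ I.children v ∧ u ≠ u0 ∧ (activeLeaves I S u).Nonempty := by
    intro u
    rw [hsib, activeSib, if_neg hu0root, Finset.mem_filter, hpar0]
  have hx : Ctx I r.leaf v u0 sib LU := by
    refine ⟨hl, h.leaf, hch, I.anc_mem _ _, fun u hu => ((hsibmem u).1 hu).1,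
      fun h1 => ((hsibmem u0).1 h1).2.1 rfl, fun l hl' => ?_⟩
    rw [hLU, Finset.mem_biUnion] at hl'
    obtain ⟨u, hu, hlu⟩ := hl'
    rw [activeLeaves, Finset.mem_filter] at hlu
    exact ⟨hlu.2.1, u, hu, hlu.1⟩
  have hoffch : ∀ u ∈ I.children v, u ≠ u0 → r.leaf ∉ I.sub u := fun u hu hne =>
    hx.notMem_sub hu hne
  have hne : ∀ j, j ≤ I.H → j ≠ a + 1 → I.anc r.leaf j ≠ v := fun j hj hji =>
    anc_ne hl hj (by omega) hji
  have hcoff : ∀ u, r.leaf ∉ I.sub u → S.cons u = S0.cons u := fun u hu =>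
    hm.cons u fun j _ => by rintro rfl; exact hu (I.anc_mem _ _)
  have hold : ∀ j, a + 1 ≤ j → j ≤ I.H → ∀ B ∈ S.cons (I.anc r.leaf j), B.time < τ := by
    intro j hj hjH B hB
    rw [hm.cons _ fun k hk => anc_ne hl hjH (by omega) (by omega)] at hB
    have := h.core.times _ B hB
    have := h.pos
    omega
  have hsib0 : a = i0 → sib.Nonempty := by
    rintro rfl
    have h1 := hi0.1
    have h2 := hm.mass_eq le_rfl
    rw [hsib, activeSib_congr h2]
    exact h1
  have hh : FullHyp I v u0 sib τ S := by
    refine ⟨fun u _ _ => hm.dlb u, fun u hu hne C hC => ?_, fun u hu hne hus => ?_, ?_, ?_, ?_, ?_,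
      hold (a + 1) le_rfl hiH⟩
    · rw [hcoff u (hoffch u hu hne)] at hC
      exact h.off u (hoffch u hu hne) C hC
    · have h1 : ¬ (activeLeaves I S u).Nonempty := fun h1 => hus ((hsibmem u).2 ⟨hu, hne, h1⟩)
      have h2 : ∀ l ∈ (I.sub u).filter I.IsLeaf, S.mass l ≤ I.del := by
        intro l hl'
        rw [Finset.mem_filter] at hl'
        by_contra h3
        refine h1 ⟨l, ?_⟩
        rw [activeLeaves, Finset.mem_filter]
        exact ⟨hl'.1, hl'.2, by linarith⟩
      refine (Finset.sum_le_sum h2).trans ?_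
      rw [Finset.sum_const, nsmul_eq_mul, mul_comm, HST.nv]
      refine mul_le_mul_of_nonneg_left ?_ I.del_pos.le
      exact_mod_cast Finset.card_le_card (Finset.filter_subset _ _)
    -- the first full update uses the constraint of a simple update, the others that of a full update
    · by_cases h1 : a = i0
      · obtain ⟨C, hC, hC2⟩ := hm.simple a (by omega) h1.le
        by_cases hb : C.IsBot
        · left
          exact ⟨C, by rw [hu0, hC]; simp, hC2.time, hb⟩
        · right
          have h2 := hC2.dual hb
          rw [h1, mul_div_cancel₀ _ (I.lam_pow_pos i0).ne'] at h2
          rw [dualObj_eq, hu0, hC, List.map_append, List.sum_append, sum_map_zero, zero_add]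
          · simp only [List.map_cons, List.map_nil, List.sum_cons, List.sum_nil, add_zero]
            rw [if_pos hC2.time, h1]; exact h2
          · intro B hB
            rw [if_neg]
            have := h.core.times _ B hB
            have := h.pos
            omega
      · right
        exact (hm.full a (by omega) (by omega)).1
    · exact hm.mass0 a (by omega) rfl
    · by_cases h1 : a = i0
      · exact Or.inl (hsib0 h1)
      · right
        obtain ⟨-, New, h2, h3⟩ := hm.full a (by omega) (by omega)
        intro C hC hCt
        rw [hu0, h2, List.mem_append] at hC
        rcases hC with hC | hC
        · have := h.core.times _ C hC
          have := h.pos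
          omega
        · exact (h3 C hC).nonbot
    · intro hvr
      rw [hv, ← I.anc_succ]
      refine hold (a + 2) (by omega) ?_
      have := I.level_lt hvr
      omega
  have hbch : ∀ u ∈ I.children v, u ≠ u0 → Balance I S τ u 0 := fun u hu hne =>
    hm.bal_off u (hoffch u hu hne)
  have hr := hs.res (v := v) (u0 := u0) rfl rfl rfl rfl hx hh hm.core hm.yinv hbch
  rw [show a + 1 + 1 = a + 2 from rfl]
  have hg := I.gam_pos
  have hlam := I.lam_pow_pos
  -- the mass that enters the subtrees of the earlier nodes
  have hsubv : ∀ j, a + 1 ≤ j → j ≤ I.H →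
      subMass I S' (I.anc r.leaf j) = subMass I S (I.anc r.leaf j) := by
    intro j hj hjH
    refine hr.moved.subMass_eq hx.notMem_LU h.leaf (I.anc_mem _ _) fun l hl' =>
      ⟨(hx.leaves l hl').1, ?_⟩
    refine I.mem_sub_trans (hx.LU_sub hl') ?_
    obtain ⟨k, rfl⟩ := Nat.exists_eq_add_of_le hj
    rw [I.anc_add]; exact I.anc_mem _ _
  have hsubu : ∀ j, j ≤ a → subMass I S' (I.anc r.leaf j) =
      subMass I S (I.anc r.leaf j) + (S'.mass r.leaf - S.mass r.leaf) := by
    intro j hj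
    refine hr.moved.subMass_add h.leaf (I.anc_mem _ _) fun l hl' h1 => ?_
    refine hx.LU_not_sub hl' (I.mem_sub_trans h1 ?_)
    obtain ⟨k, rfl⟩ := Nat.exists_eq_add_of_le hj
    rw [hu0, I.anc_add]; exact I.anc_mem _ _
  have hgain := hr.gain_le
  rw [hlu] at hgain
  have hlam20 : 20 / 19 * I.gam * (1 / I.lam ^ a - 1 / I.lam ^ (a + 1)) ≥ I.gam / I.lam ^ a := by
    have h1 := I.lam_ge'
    have h2 := hlam a
    rw [pow_succ, ge_iff_le, div_le_iff₀ h2]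
    have h3 : 20 / 19 * I.gam * (1 / I.lam ^ a - 1 / (I.lam ^ a * I.lam)) * I.lam ^ a =
        20 / 19 * I.gam * (1 - 1 / I.lam) := by
      field_simp
    rw [h3]
    have h4 : 1 / I.lam ≤ 1 / 20 := one_div_le_one_div_of_le (by norm_num) h1
    nlinarith
  have hbstep : budget I (a + 2) ≤ budget I (a + 1) -
      (1 + 1 / (4 * I.H : ℝ)) * I.gam / I.lam ^ a := by
    have hH := I.H_ge
    have h1 := I.lam_ge
    have h2 := hlam a
    rw [budget, budget, show a + 2 - 1 = a + 1 by omega, show a + 1 - 1 = a by omega, ← sub_div,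
      div_le_div_iff₀ (hlam _) h2, pow_succ]
    have h3 : (1 + 3 / (4 * I.H : ℝ)) ≤ (1 / (2 * I.H)) * I.lam := by
      have : (1 / (2 * I.H : ℝ)) * (10 * I.H) ≤ (1 / (2 * I.H)) * I.lam :=
        mul_le_mul_of_nonneg_left h1 (by positivity)
      have h4 : (1 / (2 * I.H : ℝ)) * (10 * I.H) = 5 := by field_simp; norm_num
      have h5 : 3 / (4 * I.H : ℝ) ≤ 1 := by
        rw [div_le_one (by linarith)]; linarith
      linarith
    have h4 : ((1 + 3 / (4 * I.H : ℝ)) * I.gam - (1 + 1 / (4 * I.H : ℝ)) * I.gam) =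
        (1 / (2 * I.H)) * I.gam := by
      field_simp; ring
    rw [h4]
    have h5 : 0 ≤ I.gam * I.lam ^ a := mul_nonneg hg.le h2.le
    nlinarith
  have hbal0 : (1 + 1 / (4 * I.H : ℝ)) * I.gam / I.lam ^ a ≥ I.gam / I.lam ^ a := by
    refine div_le_div_of_nonneg_right ?_ (hlam a).le
    have : 0 ≤ 1 / (4 * I.H : ℝ) := by positivity
    nlinarith
  have hcongr : ∀ u b b', u ≠ v → I.parent u ≠ v → Balance I S τ u b →
      subMass I S' u + b' ≤ subMass I S u + b → Balance I S' τ u b' := by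
    intro u b b' huv hpu hb hsb
    refine hb.congr (hr.cons u huv) (hr.cons _ hpu) ?_ hsb
    rw [hr.y _ hpu]
  refine ⟨hr.core, hr.yinv, fun u => ?_, fun u hu => ?_, fun u hu => ?_, fun j hj hjH => ?_,
    fun j hj hjH => ?_, fun h1 => by omega, fun l hll => (hr.moved.le l hll).trans (hm.mass_le l hll),
    hm.mass_ge.trans hr.gain_nonneg, fun j hjH => (hm.sub_ge j hjH).trans ?_,
    fun j hj hjH => ?_, fun h1 => ?_, ?_, hr.forest.trans hm.forest, hr.served.trans hm.served,
    fun j hj hji => ?_, fun j hj hji => ?_, fun j hj hji => ?_⟩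
  · by_cases hu : u = v
    · subst hu
      obtain ⟨New, h1, h2⟩ := hr.new
      refine DualLB.append (τ := τ) (hm.dlb _) h1 (hold (a + 1) le_rfl hiH)
        (fun C hC => (h2 C hC).time) (Or.inr ?_)
      rw [hr.dual]
      exact div_le_self hg.le (I.one_le_lam_pow _)
    · exact (hm.dlb u).congr (hr.cons u hu)
  · rw [hr.cons u (hu (a + 1) (by omega))]
    exact hm.cons u fun j hj => hu j (by omega)
  · have huv : u ≠ v := by rintro rfl; exact hu (I.anc_mem _ _)
    by_cases hpu : I.parent u = v
    · have hur : u ≠ I.root := by rintro rfl; exact hu (I.mem_sub_root _)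
      refine hr.bal u (I.mem_children.2 ⟨hur, hpu⟩) ?_
      rintro rfl; exact hu (I.anc_mem _ _)
    · refine hcongr u 0 0 huv hpu (hm.bal_off u hu) ?_
      linarith [hr.moved.subMass_le hu]
  · have h1 := hm.bal_up j (by omega) hjH
    refine hcongr _ 0 0 (hne j (by omega) (by omega)) ?_ h1 ?_
    · rw [← I.anc_succ]; exact hne (j + 1) (by omega) (by omega)
    · rw [hsubv j (by omega) (by omega)]
  · rw [max_eq_left (by omega)]
    rcases Nat.lt_trichotomy j (a + 1) with h1 | rfl | h1
    · have h2 := hm.bal_lo j h1 hjH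
      rw [max_eq_left (by omega)] at h2
      by_cases hja : j = a
      · subst hja
        have h3 := hr.bal0 _ h2
        rw [hlu] at h3
        exact h3.anti hbstep
      · refine hcongr _ _ _ (hne j (by omega) (by omega)) ?_ h2 ?_
        · rw [← I.anc_succ]; exact hne (j + 1) (by omega) (by omega)
        · rw [hsubu j (by omega)]
          linarith
    · have h3 := hr.balv (I.anc_ne_root (by omega)) (hm.bal_up _ le_rfl hjH)
      rwa [hlv] at h3
    · omega
  · rcases Nat.lt_or_ge a j with h1 | h1
    · rw [hsubv j (by omega) hjH]
    · rw [hsubu j h1]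
      linarith [hr.gain_nonneg]
  · have h1 := hm.sub_le j hj hjH
    rcases Nat.lt_or_ge a j with h2 | h2
    · rw [hsubv j (by omega) hjH]
      rwa [max_eq_left (by omega)] at h1 ⊢
    · rw [hsubu j h2]
      rw [max_eq_right (by omega)] at h1 ⊢
      rw [show a + 1 - 1 = a by omega] at h1
      rw [show a + 2 - 1 = a + 1 by omega]
      nlinarith
  · by_cases h2 : a = i0
    · have h3 := hr.le_gain (hsib0 h2)
      rw [hlu, h2, hm.mass_eq (by omega)] at h3
      exact h3
    · have h3 := hm.gain (by omega)
      linarith [hr.gain_nonneg]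
  · have h1 := hm.gain_le
    rw [max_eq_right (by omega)] at h1 ⊢
    rw [show a + 1 - 1 = a by omega] at h1
    rw [show a + 2 - 1 = a + 1 by omega]
    nlinarith
  · obtain rfl : j = a + 1 := by omega
    intro C hC hCt
    obtain ⟨New, h1, h2⟩ := hr.new
    rw [h1, List.mem_append] at hC
    rcases hC with hC | hC
    · have := hold (a + 1) le_rfl hiH C hC; omega
    · rw [(h2 C hC).mass, hsubv _ le_rfl hiH]
  · rw [hr.cons _ (hne j (by omega) (by omega))]
    exact hm.simple j (by omega) hji
  · by_cases hja : j = a + 1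
    · subst hja
      obtain ⟨New, h1, h2⟩ := hr.new
      refine ⟨hr.dual, New, ?_, fun C hC => ?_⟩
      · rw [h1, hm.cons]
        exact fun k hk => (hne k (by omega) (by omega)).symm
      · have h3 := h2 C hC
        refine ⟨h3.time, h3.nonbot, fun h4 => ?_, h3.src0, ?_⟩
        · rw [h3.mass, subMass, subMass, hm.mass_eq (by omega)]
        · rw [hr.cons _ (hne (a + 1 - 1) (by omega) (by omega))]
          exact h3.exists_src
    · obtain ⟨h1, New, h2, h3⟩ := hm.full j (by omega) hji
      refine ⟨?_, New, ?_, fun C hC => ?_⟩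
      · rw [dualObj_eq, hr.cons _ (hne j (by omega) hja), ← dualObj_eq]; exact h1
      · rw [hr.cons _ (hne j (by omega) hja)]; exact h2
      · have h4 := h3 C hC
        refine ⟨h4.time, h4.nonbot, h4.mass, h4.src0, ?_⟩
        rw [hr.cons _ (hne (j - 1) (by omega) (by omega))]
        exact h4.exists_src

/-- The outcome of an iteration of the while-loop. -/
structure IterRes (I : Inst V) (r : Req V) (lc τ : ℕ) (S0 : State V) (i0 : ℕ) (S : State V) :
    Prop where
  lt : i0 < I.H
  least : IsLeast {i | (activeSib I S0 (I.anc r.leaf i)).Nonempty} i0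
  core : Core I τ S
  yinv : YInv I τ S
  dlb : ∀ u, DualLB I S u
  bal : ∀ u, u ≠ I.root → Balance I S τ u 0
  cons : ∀ u, r.leaf ∉ I.sub u → S.cons u = S0.cons u
  mass_le : ∀ l, l ≠ r.leaf → S.mass l ≤ S0.mass l
  mass_ge : S0.mass r.leaf ≤ S.mass r.leaf
  sub_ge : ∀ j ≤ I.H, subMass I S0 (I.anc r.leaf j) ≤ subMass I S (I.anc r.leaf j)
  sub_le : ∀ j, i0 < j → j ≤ I.H → subMass I S (I.anc r.leaf j) ≤ subMass I S0 (I.anc r.leaf j) +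
    (S.mass r.leaf - S0.mass r.leaf) / 2
  gain : I.gam / (4 * I.H * I.lam ^ i0) ≤ S.mass r.leaf - S0.mass r.leaf
  gain_le : S.mass r.leaf ≤ S0.mass r.leaf + 2 * I.gam
  forest : S.forest = S0.forest
  served : S0.served ⊆ S.served
  simple : ∀ j ≤ i0, ∃ C, S.cons (I.anc r.leaf j) = S0.cons (I.anc r.leaf j) ++ [C] ∧
    SimpleOK I r lc τ j (I.lam ^ j * (I.gam / I.lam ^ i0)) S0 C
  full : ∀ j, i0 < j → j ≤ I.H → dualObj I S (I.anc r.leaf j) τ = I.gam ∧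
    ∃ New, S.cons (I.anc r.leaf j) = S0.cons (I.anc r.leaf j) ++ New ∧
      ∀ C ∈ New, FullOK I r τ i0 j S0 S C

theorem Iteration.res (h : IterHyp I r lc τ S0) (hit : Iteration I r lc τ S0 S) :
    ∃ i0, IterRes I r lc τ S0 i0 S := by
  obtain ⟨i0, X, hi0, hX0, hX, rfl⟩ := hit
  have hl := h.level
  have hi0H : i0 < I.H := activeSib_anc_lt hi0.1 hl
  have hmid : ∀ i ≤ I.H + 1, Mid I r lc τ S0 i0 i (X i) := by
    intro i
    induction i with
    | zero => intro _; rw [hX0]; exact Mid.zero h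
    | succ i ih =>
      intro hi
      have h1 := hX i (by omega)
      split_ifs at h1 with h2
      · refine (ih (by omega)).simple_step h (fun j hj h3 => ?_) h2 hi0H h1
        exact absurd (hi0.2 h3) (by omega)
      · exact (ih (by omega)).full_step h hi0 (by omega) (by omega) h1
  have hm := hmid (I.H + 1) le_rfl
  have hg := I.gam_pos
  have hlam := I.lam_pow_pos
  refine ⟨i0, hi0H, hi0, ?_, ?_, ?_, ?_, ?_, hm.mass_le, hm.mass_ge, hm.sub_ge, ?_,
    hm.gain (by omega), ?_, hm.forest, ?_, ?_, ?_⟩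
  · exact ⟨hm.core.mass_nonneg, hm.core.le_total, hm.core.total_le, hm.core.times, hm.core.wf,
      fun w C hC u j hj => by
        obtain ⟨σ, h1, h2⟩ := hm.core.src w C hC u j hj
        exact ⟨σ, h1, ⟨h2.child, h2.A_inter, h2.agree, h2.time_le, h2.period, h2.bots⟩⟩,
      hm.core.cover, hm.core.awake, hm.core.load_le⟩
  · exact ⟨hm.yinv.nonneg, hm.yinv.zero, hm.yinv.le, hm.yinv.timer⟩
  · exact fun u => (hm.dlb u).congr rfl
  · intro u hu
    have h2 : Balance I (X (I.H + 1)) τ u 0 := by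
      by_cases h1 : r.leaf ∈ I.sub u
      · obtain ⟨h3, h4⟩ := I.eq_anc_of_mem_sub h1
        have h5 := I.level_lt hu
        have h6 := hm.bal_lo (I.level u) (by omega) h5
        rw [hl, Nat.sub_zero] at h4
        rw [h4] at h6
        refine h6.anti ?_
        rw [budget]
        have := I.H_ge
        exact div_nonneg (mul_nonneg (by positivity) hg.le) (hlam _).le
      · exact hm.bal_off u h1
    exact h2.congr rfl rfl rfl le_rfl
  · intro u hu
    exact hm.cons u fun j _ => by rintro rfl; exact hu (I.anc_mem _ _)
  · intro j hj hjH
    refine (hm.sub_le j hj.le hjH).trans (add_le_add le_rfl ?_)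
    have h1 := hm.gain (by omega)
    have hH := I.H_ge
    -- as `λ ≥ 10 H`, the mass that enters from above is a small part of what is moved
    have h2 : 1 / I.lam ^ j ≤ 1 / (I.lam ^ i0 * (10 * I.H)) := by
      refine one_div_le_one_div_of_le (mul_pos (hlam _) (by linarith)) ?_
      calc I.lam ^ i0 * (10 * I.H) ≤ I.lam ^ i0 * I.lam :=
            mul_le_mul_of_nonneg_left I.lam_ge (hlam _).le
        _ = I.lam ^ (i0 + 1) := (pow_succ _ _).symm
        _ ≤ _ := pow_le_pow_right₀ (by have := I.lam_ge'; linarith) hj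
    have h3 : 0 ≤ 1 / I.lam ^ (max j (I.H + 1 - 1)) := (one_div_pos.2 (hlam _)).le
    have h4 : I.gam * (1 / (I.lam ^ i0 * (10 * I.H))) =
        4 / 10 * (I.gam / (4 * I.H * I.lam ^ i0)) := by
      have := hlam i0
      field_simp
    change _ ≤ ((X (I.H + 1)).mass r.leaf - S0.mass r.leaf) / 2
    have h5 : I.gam * (1 / I.lam ^ j - 1 / I.lam ^ max j (I.H + 1 - 1)) ≤
        4 / 10 * (I.gam / (4 * I.H * I.lam ^ i0)) := by
      rw [← h4]; exact mul_le_mul_of_nonneg_left (by linarith) hg.le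
    have h6 : 0 ≤ I.gam / (4 * I.H * I.lam ^ i0) :=
      div_nonneg hg.le (mul_nonneg (by linarith) (hlam _).le)
    nlinarith
  · have h1 := hm.gain_le
    have h2 : 1 / I.lam ^ i0 ≤ 1 := by
      rw [div_le_one (hlam _)]; exact I.one_le_lam_pow _
    have h3 : 0 ≤ 1 / I.lam ^ (max i0 (I.H + 1 - 1)) := (one_div_pos.2 (hlam _)).le
    change (X (I.H + 1)).mass r.leaf ≤ _
    nlinarith
  · rw [← hm.served]; exact Set.subset_union_left
  · exact fun j hj => hm.simple j (by omega) hj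
  · intro j hj hjH
    obtain ⟨h1, New, h2, h3⟩ := hm.full j (by omega) hj
    exact ⟨h1, New, h2, fun C hC => ⟨(h3 C hC).time, (h3 C hC).nonbot, (h3 C hC).mass,
      (h3 C hC).src0, (h3 C hC).exists_src⟩⟩

end Iteration

/-! ### Charging forests -/

/-- The invariants of the charging forest `F` of a node up to time `q`, where `R` are the requests
served by then. -/
structure ForestInv (I : Inst V) (q : ℕ) (R : Set (Req V)) (F : Forest V) : Prop where
  le : ∀ w p, (w, p) ∈ F.node → p ≤ q
  spawned_node : ∀ w p, ∀ x ∈ F.spawned w p, (w, p) ∈ F.node ∧ (x, p) ∈ F.node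
  spawned_sub : ∀ w p, ∀ x ∈ F.spawned w p, x ∈ I.sub w ∧ I.level x < I.level w
  spawned_level : ∀ w p, ∀ x ∈ F.spawned w p, ∀ y ∈ F.spawned w p, I.level x = I.level y
  spawned_inj : ∀ w w' p x, x ∈ F.spawned w p → x ∈ F.spawned w' p → w = w'
  kids_node : ∀ a b, b ∈ F.kids a → a ∈ F.node
  kids_eq : ∀ w p, (w, p) ∈ F.node → ∀ b ∈ F.kids (w, p),
    IsGreatest {p' | p' < p ∧ (w, p') ∈ F.node} b.2 ∧ b.1 ∈ F.spawned w b.2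
  /-- A leaf of a charging tree starts later than the previous visit at its node. -/
  dead : ∀ w p, (w, p) ∈ F.node → F.kids (w, p) = ∅ → ∀ p' < p, (w, p') ∈ F.node →
    p' < (F.req (w, p)).b
  /-- If nothing is spawned, then all requests below are piggybacked. -/
  done : ∀ w p, (w, p) ∈ F.node → F.spawned w p = ∅ →
    ∀ s ∈ I.reqs, s.leaf ∈ I.sub w → s.b ≤ p → p ≤ s.e → s ∈ R

section ForestLemmas
variable {I : Inst V} {q : ℕ} {R : Set (Req V)} {F : Forest V}

theorem ForestInv.mono {q' : ℕ} {R' : Set (Req V)} (h : ForestInv I q R F) (hq : q ≤ q')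
    (hR : R ⊆ R') : ForestInv I q' R' F :=
  { h with
    le := fun w p hp => (h.le w p hp).trans hq
    done := fun w p hp h1 s h2 h3 h4 h5 => hR (h.done w p hp h1 s h2 h3 h4 h5) }

theorem ForestInv.kids_spec (h : ForestInv I q R F) {a b : V × ℕ} (hb : b ∈ F.kids a) :
    IsGreatest {p' | p' < a.2 ∧ (a.1, p') ∈ F.node} b.2 ∧ b.1 ∈ F.spawned a.1 b.2 :=
  h.kids_eq a.1 a.2 (h.kids_node a b hb) b hb

theorem ForestInv.kids_lt (h : ForestInv I q R F) {a b : V × ℕ} (hb : b ∈ F.kids a) :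
    b.1 ∈ I.sub a.1 ∧ I.level b.1 < I.level a.1 := h.spawned_sub _ _ _ (h.kids_spec hb).2

theorem ForestInv.desc_sub (h : ForestInv I q R F) {a b : V × ℕ} (hab : F.Desc a b) :
    b.1 ∈ I.sub a.1 := by
  induction hab with
  | refl => exact I.self_mem_sub _
  | tail _ h1 ih => exact I.mem_sub_trans (h.kids_lt h1).1 ih

theorem ForestInv.desc_lt (h : ForestInv I q R F) {a b : V × ℕ} (hab : F.Desc a b)
    (hne : b ≠ a) : I.level b.1 < I.level a.1 := by
  rcases Relation.ReflTransGen.cases_head hab with h1 | ⟨c, h1, h2⟩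
  · exact (hne h1.symm).elim
  · exact (I.level_le_of_mem_sub (h.desc_sub h2)).trans_lt (h.kids_lt h1).2

theorem ForestInv.desc_node (h : ForestInv I q R F) {a b : V × ℕ} (ha : a ∈ F.node)
    (hab : F.Desc a b) : b ∈ F.node := by
  induction hab with
  | refl => exact ha
  | tail _ h1 _ => exact (h.spawned_node _ _ _ (h.kids_spec h1).2).2

/-- The descent in a charging tree to a vertex at a given node is determined. -/
theorem ForestInv.desc_inj (h : ForestInv I q R F) {a b b' : V × ℕ} (hab : F.Desc a b)
    (hab' : F.Desc a b') (hb : b.1 = b'.1) : b = b' := by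
  induction hab using Relation.ReflTransGen.head_induction_on with
  | refl =>
    by_contra hne
    have := h.desc_lt hab' (Ne.symm hne)
    rw [hb] at this; exact lt_irrefl _ this
  | head h1 h2 ih =>
    rename_i a c
    rcases Relation.ReflTransGen.cases_head hab' with h3 | ⟨c', h3, h4⟩
    · have h5 := (I.level_le_of_mem_sub (h.desc_sub h2)).trans_lt (h.kids_lt h1).2
      rw [hb, ← h3] at h5; exact (lt_irrefl _ h5).elim
    · have h5 : c.2 = c'.2 := (h.kids_spec h1).1.unique (h.kids_spec h3).1
      have h6 := (h.kids_spec h1).2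
      have h7 := (h.kids_spec h3).2
      rw [← h5] at h7
      have h8 : c.1 = c'.1 := by
        refine I.eq_of_level_eq (u := b.1) (h.desc_sub h2) ?_ (h.spawned_level _ _ _ h6 _ h7)
        rw [hb]; exact h.desc_sub h4
      obtain rfl : c = c' := Prod.ext h8 h5
      exact ih h4

theorem ForestInv.treeOK (h : ForestInv I q R F) (a : V × ℕ) : TreeOK I F a :=
  ⟨fun _ hb => h.desc_sub hb, fun _ hb hne => h.desc_lt hb hne,
    fun _ _ h1 _ h2 _ h3 => h.desc_inj h1 h2 h3⟩

/-- Every vertex of a charging forest has at most one parent. -/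
theorem ForestInv.parent_unique (h : ForestInv I q R F) {a a' b : V × ℕ} (hb : b ∈ F.kids a)
    (hb' : b ∈ F.kids a') : a = a' := by
  have h1 := h.kids_spec hb
  have h2 := h.kids_spec hb'
  have h3 : a.1 = a'.1 := h.spawned_inj _ _ _ _ h1.2 h2.2
  refine Prod.ext h3 ?_
  have h4 := h.kids_node _ _ hb
  have h5 := h.kids_node _ _ hb'
  rcases lt_trichotomy a.2 a'.2 with h6 | h6 | h6
  · have h7 : a.2 ≤ b.2 := h2.1.2 ⟨h6, by rw [← h3]; exact h4⟩
    have := h1.1.1.1; omega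
  · exact h6
  · have h7 : a'.2 ≤ b.2 := h1.1.2 ⟨h6, by rw [h3]; exact h5⟩
    have := h2.1.1.1; omega

/-- Different charging trees of the same forest are disjoint. -/
theorem ForestInv.root_unique (h : ForestInv I q R F) {a a' b : V × ℕ} (hb : F.Desc a b)
    (hb' : F.Desc a' b) (ha : a.1 = a'.1) : a = a' := by
  induction hb with
  | refl =>
    by_contra hne
    have := h.desc_lt hb' hne
    rw [ha] at this; exact lt_irrefl _ this
  | tail h1 h2 ih =>
    rename_i c b
    rcases Relation.ReflTransGen.cases_tail hb' with h3 | ⟨c', h3, h4⟩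
    · have h5 := (h.kids_lt h2).2.trans_le (I.level_le_of_mem_sub (h.desc_sub h1))
      rw [ha, ← h3] at h5; exact (lt_irrefl _ h5).elim
    · obtain rfl := h.parent_unique h2 h4
      exact ih h3

/-- The times `q` at which the charging tree of `v` has a leaf at `u` whose window, followed until
the end of the time period of `q`, contains the timestep `t`. -/
def badTimes (I : Inst V) (F : Forest V) (v u : V) (t : ℕ) : Set ℕ :=
  {q | (v, q) ∈ F.node ∧ t < (q + 1) * I.N ∧
    ∃ p, F.Desc (v, q) (u, p) ∧ F.kids (u, p) = ∅ ∧ (F.req (u, p)).b * I.N < t}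

/-- A path in a charging tree, which goes back in time, crosses the time `B` at some vertex `c`; the
visit at the node of `c` that precedes `c` is then before `B`. -/
theorem ForestInv.exists_crossing (h : ForestInv I q R F) {a b : V × ℕ} (hab : F.Desc a b) {B : ℕ}
    (ha : B ≤ a.2) (hb : b.2 < B) : ∃ c, F.Desc a c ∧ b.1 ∈ I.sub c.1 ∧ B ≤ c.2 ∧ c ∈ F.node ∧
      ∀ p' < c.2, (c.1, p') ∈ F.node → p' < B := by
  induction hab using Relation.ReflTransGen.head_induction_on with
  | refl => omega
  | head h1 h2 ih =>
    rename_i a c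
    by_cases h3 : B ≤ c.2
    · obtain ⟨d, hd⟩ := ih h3
      exact ⟨d, Relation.ReflTransGen.head h1 hd.1, hd.2⟩
    · refine ⟨a, .refl, ?_, ha, h.kids_node _ _ h1, fun p' hp' hn => ?_⟩
      · exact I.mem_sub_trans (h.desc_sub h2) (h.kids_lt h1).1
      · have := (h.kids_spec h1).1.2 ⟨hp', hn⟩
        omega

/-- Every timestep is charged by few trees of the charging forest of `v`. All but one of these
trees cross the start `B` of the window of the latest leaf, at different ancestors of `u`: the
crossing vertex at a node is the first visit of this node at or after `B`, and trees are disjoint. -/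
theorem ForestInv.card_badTimes_le (h : ForestInv I q R F) (v u : V) (t : ℕ) {Q : Finset ℕ}
    (hQ : (Q : Set ℕ) ⊆ badTimes I F v u t) : Q.card ≤ I.H + 2 := by
  choose! p hp using fun q' (hq : q' ∈ badTimes I F v u t) => hq.2.2
  rcases Q.eq_empty_or_nonempty with rfl | hne
  · simp
  obtain ⟨m, hm, hmax⟩ := Q.exists_max_image p hne
  set B := (F.req (u, p m)).b with hB
  have hinj : ∀ q₁ ∈ Q, ∀ q₂ ∈ Q, p q₁ = p q₂ → q₁ = q₂ := by
    intro q₁ h1 q₂ h2 he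
    have h3 := (hp q₁ (hQ h1)).1
    have h4 := (hp q₂ (hQ h2)).1
    rw [← he] at h4
    exact congrArg Prod.snd (h.root_unique h3 h4 rfl)
  have hcross : ∀ q' ∈ Q.erase m, ∃ c, F.Desc (v, q') c ∧ u ∈ I.sub c.1 ∧ B ≤ c.2 ∧ c ∈ F.node ∧
      ∀ p' < c.2, (c.1, p') ∈ F.node → p' < B := by
    intro q' hq'
    obtain ⟨h1, h2⟩ := Finset.mem_erase.1 hq'
    have h3 := hp q' (hQ h2)
    have h4 := hp m (hQ hm)
    have h5 : p q' < p m := lt_of_le_of_ne (hmax q' h2) fun h6 => h1 (hinj _ h2 _ hm h6)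
    refine h.exists_crossing h3.1 ?_ ?_
    · have h6 := (hQ h2).2.1
      have h7 : B * I.N < (q' + 1) * I.N := h4.2.2.trans h6
      have := Nat.lt_of_mul_lt_mul_right h7
      change B ≤ q'
      omega
    · exact h.dead _ _ (h.desc_node (hQ hm).1 h4.1) h4.2.1 _ h5 (h.desc_node (hQ h2).1 h3.1)
  have : Nonempty V := ⟨v⟩
  choose! c hc using hcross
  have h1 : (Q.erase m).card ≤ (Finset.univ.filter fun w => u ∈ I.sub w).card := by
    refine Finset.card_le_card_of_injOn (fun q' => (c q').1)
      (fun q' hq' => by simpa using (hc q' hq').2.1) ?_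
    intro q₁ hq₁ q₂ hq₂ he
    have h2 := hc q₁ hq₁
    have h3 := hc q₂ hq₂
    simp only at he
    have h4 : (c q₁).2 = (c q₂).2 := by
      rcases lt_trichotomy (c q₁).2 (c q₂).2 with h5 | h5 | h5
      · have := h3.2.2.2.2 _ h5 (by rw [← he]; exact h2.2.2.2.1)
        have := h2.2.2.1; omega
      · exact h5
      · have := h2.2.2.2.2 _ h5 (by rw [he]; exact h3.2.2.2.1)
        have := h3.2.2.1; omega
    have h5 := h3.1
    rw [← Prod.ext he h4] at h5
    exact congrArg Prod.snd (h.root_unique h2.1 h5 rfl)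
  have h2 := I.card_ancestors_le u
  rw [Finset.card_erase_of_mem hm] at h1
  omega

end ForestLemmas

/-! ### Building the charging forests -/

section Build
variable {I : Inst V} {S : State V} {q : ℕ} {w : V} {G Sp : Finset V}

theorem FindLeaves.sub (h : FindLeaves I S q w G Sp) :
    ∀ x ∈ Sp, x ∈ I.sub w ∧ I.level x < I.level w := by
  obtain ⟨L, -, -, ⟨i, j, -, h1, -, rfl, rfl⟩ | ⟨-, rfl, rfl⟩⟩ := h
  · intro x hx
    rw [Finset.mem_filter, paths, Finset.mem_filter] at hx
    exact ⟨hx.1.1, hx.2 ▸ h1.1⟩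
  · simp

theorem FindLeaves.level_eq (h : FindLeaves I S q w G Sp) :
    ∀ x ∈ Sp, ∀ y ∈ Sp, I.level x = I.level y := by
  obtain ⟨L, -, -, ⟨i, j, -, h1, -, rfl, rfl⟩ | ⟨-, rfl, rfl⟩⟩ := h
  · intro x hx y hy
    rw [(Finset.mem_filter.1 hx).2, (Finset.mem_filter.1 hy).2]
  · simp

theorem exists_firstAtLeaf {s : Req V} (hs : Outstanding I S q s) :
    ∃ r, FirstAtLeaf I S q r ∧ r.leaf = s.leaf := by
  obtain ⟨r, ⟨h1, h2⟩, h3⟩ := WellFounded.has_min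
    (InvImage.wf (fun r : Req V => r.e) Nat.lt_wfRel.wf)
    {r | Outstanding I S q r ∧ r.leaf = s.leaf} ⟨s, hs, rfl⟩
  refine ⟨r, ⟨h1, fun r' hr' hl => ?_⟩, h2⟩
  exact not_lt.1 (h3 r' ⟨hr', hl.trans h2⟩)

/-- If nothing is spawned then all outstanding requests are included in the tree. -/
theorem FindLeaves.leaf_mem (h : FindLeaves I S q w G Sp) (hSp : Sp = ∅) {s : Req V}
    (hs : Outstanding I S q s) (hw : s.leaf ∈ I.sub w) : s.leaf ∈ G := by
  obtain ⟨L, -, hL, ⟨i, j, -, h1, -, rfl, h2⟩ | ⟨-, rfl, -⟩⟩ := h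
  · have h3 := h1.2
    rw [← h2, hSp, Finset.sum_empty] at h3
    have := I.c_pos w
    linarith
  · obtain ⟨r, hr, hrs⟩ := exists_firstAtLeaf hs
    rw [paths, Finset.mem_filter]
    exact ⟨hw, r, (hL r).2 ⟨hr, hrs ▸ hw⟩, hrs ▸ I.self_mem_sub _⟩

variable {R : Set (Req V)} {F F' : Forest V} {v : V} {q0 : ℕ} {tr : Set V}

/-- The invariants persist. For `dead`: if the previous visit at `w` were in the window of the earliest
request below `w`, and nothing had been spawned by `w` then, this request would have been piggybacked
at that time. -/
theorem BuildTreeAt.forestInv (h : ForestInv I q0 S.served F) (hq : q0 < q)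
    (hb : BuildTreeAt I S q v F F' tr) :
    ForestInv I q (S.served ∪ {s | Outstanding I S q s ∧ s.leaf ∈ tr}) F' := by
  obtain ⟨G, Sp, P, hP, hfind, htr, hnode, hnew, hold⟩ := hb
  have hlt : ∀ x p, (x, p) ∈ F.node → p < q := fun x p hx => (h.le x p hx).trans_lt hq
  have hmemP : ∀ w, w ∈ P ↔ Relation.ReflTransGen (fun a b => b ∈ Sp a) v w := fun w => by
    rw [hP]; rfl
  have hstep : ∀ w ∈ P, ∀ x ∈ Sp w, x ∈ P := fun w hw x hx =>
    (hmemP x).2 (((hmemP w).1 hw).tail hx)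
  have hmem : ∀ w p, (w, p) ∈ F'.node ↔ (w, p) ∈ F.node ∨ (w ∈ P ∧ p = q) := fun w p => by
    rw [hnode]; rfl
  have hspold : ∀ w p, ¬ (w ∈ P ∧ p = q) → F'.spawned w p = F.spawned w p := fun w p hn =>
    (hold w p hn).1
  have hspq : ∀ w, w ∉ P → F'.spawned w q = ∅ := by
    intro w hw
    rw [hspold w q (fun h1 => hw h1.1), Finset.eq_empty_iff_forall_notMem]
    intro x hx
    exact lt_irrefl _ (hlt _ _ (h.spawned_node _ _ _ hx).1)
  -- reachability between two nodes of the queue, one below the other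
  have hreach : ∀ x, x ∈ P → ∀ y, Relation.ReflTransGen (fun a b => b ∈ Sp a) v y → x ∈ I.sub y →
      Relation.ReflTransGen (fun a b => b ∈ Sp a) y x := by
    intro x hx y hy
    induction hy with
    | refl => exact fun _ => (hmemP x).1 hx
    | tail h1 h2 ih =>
      rename_i a y
      intro hxy
      have ha : a ∈ P := (hmemP a).2 h1
      have hfa := hfind a ha
      have hya := hfa.sub y h2
      rcases Relation.ReflTransGen.cases_head (ih (I.mem_sub_trans hxy hya.1)) with h3 | ⟨b, h3, h4⟩
      · subst h3
        have := I.level_le_of_mem_sub hxy; omega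
      · have hxb : ∀ z, Relation.ReflTransGen (fun a b => b ∈ Sp a) b z → z ∈ I.sub b := by
          intro z hz
          have hbP := hstep a ha b h3
          have : z ∈ I.sub b ∧ z ∈ P := by
            induction hz with
            | refl => exact ⟨I.self_mem_sub _, hbP⟩
            | tail _ h5 ih2 =>
              exact ⟨I.mem_sub_trans ((hfind _ ih2.2).sub _ h5).1 ih2.1, hstep _ ih2.2 _ h5⟩
          exact this.1
        rw [I.eq_of_level_eq hxy (hxb x h4) (hfa.level_eq y h2 b h3)]
        exact h4
  have hinj1 : ∀ w ∈ P, ∀ w' ∈ P, ∀ x, x ∈ Sp w → x ∈ Sp w' → w' ∈ I.sub w → w = w' := by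
    intro w hw w' hw' x hx hx' hsub
    rcases Relation.ReflTransGen.cases_head (hreach w' hw' w ((hmemP w).1 hw) hsub) with h1 | ⟨b, h1, h2⟩
    · exact h1
    · have h3 := (hfind w hw).level_eq x hx b h1
      have h4 := ((hfind w' hw').sub x hx').2
      have h5 : ∀ z, Relation.ReflTransGen (fun a b => b ∈ Sp a) b z →
          I.level z ≤ I.level b ∧ z ∈ P := by
        intro z hz
        induction hz with
        | refl => exact ⟨le_rfl, hstep w hw b h1⟩
        | tail _ h5 ih2 =>
          exact ⟨((hfind _ ih2.2).sub _ h5).2.le.trans ih2.1, hstep _ ih2.2 _ h5⟩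
      have := (h5 w' h2).1
      omega
  refine ⟨?_, ?_, ?_, ?_, ?_, ?_, ?_, ?_, ?_⟩
  · intro w p hp
    rcases (hmem w p).1 hp with h1 | ⟨-, rfl⟩
    exacts [(hlt _ _ h1).le, le_rfl]
  · intro w p x hx
    by_cases h1 : w ∈ P ∧ p = q
    · obtain ⟨h2, rfl⟩ := h1
      rw [(hnew w h2).1] at hx
      exact ⟨(hmem _ _).2 (Or.inr ⟨h2, rfl⟩), (hmem _ _).2 (Or.inr ⟨hstep w h2 x hx, rfl⟩)⟩
    · rw [hspold w p h1] at hx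
      have := h.spawned_node w p x hx
      exact ⟨(hmem _ _).2 (Or.inl this.1), (hmem _ _).2 (Or.inl this.2)⟩
  · intro w p x hx
    by_cases h1 : w ∈ P ∧ p = q
    · obtain ⟨h2, rfl⟩ := h1
      rw [(hnew w h2).1] at hx
      exact (hfind w h2).sub x hx
    · rw [hspold w p h1] at hx
      exact h.spawned_sub w p x hx
  · intro w p
    by_cases h1 : w ∈ P ∧ p = q
    · obtain ⟨h2, rfl⟩ := h1
      rw [(hnew w h2).1]
      exact (hfind w h2).level_eq
    · rw [hspold w p h1]
      exact h.spawned_level w p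
  · intro w w' p x hx hx'
    by_cases h1 : p = q
    · subst h1
      have h2 : w ∈ P := by by_contra h2; rw [hspq w h2] at hx; simp at hx
      have h3 : w' ∈ P := by by_contra h3; rw [hspq w' h3] at hx'; simp at hx'
      rw [(hnew w h2).1] at hx
      rw [(hnew w' h3).1] at hx'
      rcases le_total (I.level w) (I.level w') with h4 | h4
      · exact (hinj1 w' h3 w h2 x hx' hx (I.mem_sub_of_level_le ((hfind w h2).sub x hx).1
          ((hfind w' h3).sub x hx').1 h4)).symm
      · exact hinj1 w h2 w' h3 x hx hx' (I.mem_sub_of_level_le ((hfind w' h3).sub x hx').1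
          ((hfind w h2).sub x hx).1 h4)
    · rw [hspold _ _ fun h2 => h1 h2.2] at hx hx'
      exact h.spawned_inj _ _ _ _ hx hx'
  · rintro ⟨w, p⟩ b hb
    by_cases h1 : w ∈ P ∧ p = q
    · exact (hmem _ _).2 (Or.inr h1)
    · rw [(hold w p h1).2.2] at hb
      exact (hmem _ _).2 (Or.inl (h.kids_node _ _ hb))
  · intro w p hp b hb
    have hset : ∀ p ≤ q, {p' | p' < p ∧ (w, p') ∈ F'.node} = {p' | p' < p ∧ (w, p') ∈ F.node} := by
      intro p hpq
      ext p'
      simp only [Set.mem_ofPred_eq, hmem]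
      constructor
      · rintro ⟨h1, h2 | h2⟩
        exacts [⟨h1, h2⟩, by omega]
      · exact fun h1 => ⟨h1.1, Or.inl h1.2⟩
    by_cases h1 : w ∈ P ∧ p = q
    · obtain ⟨h2, rfl⟩ := h1
      rw [(hnew w h2).2.2] at hb
      rw [hset p le_rfl]
      refine ⟨hb.1, ?_⟩
      rw [hspold _ _ fun h3 => by have := h3.2; have := hb.1.1.1; omega]
      exact hb.2.2.2
    · rw [(hold w p h1).2.2] at hb
      have h2 := h.kids_node _ _ hb
      have h3 := h.kids_eq w p h2 b hb
      rw [hset p (hlt _ _ h2).le]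
      refine ⟨h3.1, ?_⟩
      rw [hspold _ _ fun h4 => ?_]
      · exact h3.2
      · have := hlt _ _ h2
        have := h3.1.1.1
        omega
  · intro w p hp hkids p' hp' hn
    have hn' : p ≤ q → (w, p') ∈ F.node := by
      intro hpq
      rcases (hmem w p').1 hn with h1 | h1
      exacts [h1, by omega]
    by_cases h1 : w ∈ P ∧ p = q
    · obtain ⟨h2, rfl⟩ := h1
      have hreq := (hnew w h2).2.1
      have hk := (hnew w h2).2.2
      rw [hkids] at hk
      -- the latest earlier visit of `w`
      have hfin : {p' | p' < p ∧ (w, p') ∈ F.node}.Finite :=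
        (Set.finite_lt_nat p).subset fun x hx => hx.1
      obtain ⟨m, hm⟩ := hfin.exists_maximal ⟨p', hp', hn' le_rfl⟩
      have hgreat : IsGreatest {p' | p' < p ∧ (w, p') ∈ F.node} m :=
        ⟨hm.1, fun x hx => not_lt.1 fun h3 => absurd (hm.2 hx h3.le) (by omega)⟩
      refine (hgreat.2 ⟨hp', hn' le_rfl⟩).trans_lt (not_le.1 fun h3 => ?_)
      have hmp : m < p := hgreat.1.1
      have h4 : F.spawned w m = ∅ := by
        rw [Finset.eq_empty_iff_forall_notMem]
        intro x hx
        have : (x, m) ∈ (∅ : Set (V × ℕ)) := by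
          rw [hk]
          exact ⟨hgreat, h3, hmp.le.trans hreq.1.2.2.1, hx⟩
        exact this
      exact hreq.1.2.2.2 (h.done w m hgreat.1.2 h4 _ hreq.1.1 hreq.2.1 h3
        (hmp.le.trans hreq.1.2.2.1))
    · rw [(hold w p h1).2.2] at hkids
      rw [(hold w p h1).2.1]
      have h2 : (w, p) ∈ F.node := ((hmem w p).1 hp).resolve_right h1
      exact h.dead w p h2 hkids p' hp' (hn' (hlt _ _ h2).le)
  · intro w p hp hsp s hs hsw hsb hse
    by_cases h1 : w ∈ P ∧ p = q
    · obtain ⟨h2, rfl⟩ := h1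
      rw [(hnew w h2).1] at hsp
      by_cases h3 : s ∈ S.served
      · exact Or.inl h3
      · right
        have h4 : Outstanding I S p s := ⟨hs, hsb, hse, h3⟩
        refine ⟨h4, ?_⟩
        rw [htr]
        exact ⟨w, h2, (hfind w h2).leaf_mem hsp h4 hsw⟩
    · rw [hspold w p h1] at hsp
      exact Or.inl (h.done w p (((hmem w p).1 hp).resolve_right h1) hsp s hs hsw hsb hse)

theorem BuildTreeAt.node_root (hb : BuildTreeAt I S q v F F' tr) : (v, q) ∈ F'.node := by
  obtain ⟨G, Sp, P, hP, -, -, hnode, -, -⟩ := hb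
  rw [hnode]
  right
  exact ⟨by rw [hP]; exact Relation.ReflTransGen.refl, rfl⟩

theorem BuildTreeAt.node_subset (hb : BuildTreeAt I S q v F F' tr) {w : V} {p : ℕ} (hp : p ≠ q) :
    (w, p) ∈ F'.node ↔ (w, p) ∈ F.node := by
  obtain ⟨G, Sp, P, -, -, -, hnode, -, -⟩ := hb
  rw [hnode]
  constructor
  · rintro (h | h)
    exacts [h, (hp h.2).elim]
  · exact Or.inl

theorem BuildTreeAt.req_root (hb : BuildTreeAt I S q v F F' tr) {r : Req V}
    (hr : Outstanding I S q r) (he : r.e = q) (hv : r.leaf ∈ I.sub v) : F'.req (v, q) = r := by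
  obtain ⟨G, Sp, P, hP, -, -, -, hnew, -⟩ := hb
  have h1 := (hnew v (by rw [hP]; exact Relation.ReflTransGen.refl)).2.1
  have h2 := h1.2.2 r hr hv
  have h3 := h1.1.2.2.1
  by_contra hne
  exact ((I.req_distinct _ h1.1.1 _ hr.1).2 hne).2 (by omega)

/-- The charging trees are not changed later. -/
theorem BuildTreeAt.badTimes_subset (h : ForestInv I q0 R F) (hq : q0 < q)
    (hb : BuildTreeAt I S q v F F' tr) (x u : V) (t : ℕ) :
    badTimes I F x u t ⊆ badTimes I F' x u t := by
  obtain ⟨G, Sp, P, -, -, -, hnode, -, hold⟩ := hb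
  rintro p ⟨h1, h2, p', h3, h4, h5⟩
  have hkeep : ∀ w p, (w, p) ∈ F.node → ¬ (w ∈ P ∧ p = q) := fun w p hn h6 => by
    have := h.le _ _ hn; omega
  have hdesc : ∀ a b, F.Desc a b → F'.Desc a b := by
    intro a b hab
    induction hab with
    | refl => exact .refl
    | tail _ h1 ih =>
      refine ih.tail ?_
      rw [(hold _ _ (hkeep _ _ (h.kids_node _ _ h1))).2.2]
      exact h1
  have hu := hold _ _ (hkeep _ _ (h.desc_node h1 h3))
  refine ⟨by rw [hnode]; exact Or.inl h1, h2, p', ?_, ?_, ?_⟩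
  · exact hdesc _ _ h3
  · rw [hu.2.2]; exact h4
  · rw [hu.2.1]; exact h5

end Build

/-! ### The cost of serving the critical request -/

/-- The server movement `a` from the other leaves gives `v0` mass `1 - δ'`, while no leaf that
sends out server mass is left with less than `δ - γ`. -/
structure IsMove (I : Inst V) (S : State V) (v0 : V) (a : V → ℝ) : Prop where
  nonneg : ∀ u, 0 ≤ a u
  leaf : ∀ u, a u ≠ 0 → I.IsLeaf u ∧ u ≠ v0 ∧ I.del - I.gam ≤ S.mass u - a u
  total : S.mass v0 + ∑ u, a u = 1 - I.del'

section MoveCost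
variable {I : Inst V} {S : State V} {v0 : V}

theorem moveCost_eq (I : Inst V) (S : State V) (v0 : V) : moveCost I S v0 =
    sInf {x | ∃ a, IsMove I S v0 a ∧ x = ∑ u, a u * I.dist u v0} := by
  unfold moveCost
  congr 1
  ext x
  constructor
  · rintro ⟨a, h1, h2, h3, h4⟩; exact ⟨a, ⟨h1, h2, h3⟩, h4⟩
  · rintro ⟨a, ⟨h1, h2, h3⟩, h4⟩; exact ⟨a, h1, h2, h3, h4⟩

theorem gam_le_del (I : Inst V) : I.gam ≤ I.del := by
  have := I.four_n_gam_le
  have := I.n_ge_three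
  have := I.gam_pos
  nlinarith

theorem HST.dist_nonneg (T : Inst V) (a b : V) : 0 ≤ T.dist a b := by
  refine Finset.sum_nonneg fun w _ => ?_
  split_ifs
  exacts [(T.c_pos w).le, le_rfl]

/-- There is a feasible movement: as there are `k ≥ 1` servers, the other leaves hold enough mass even
if each of them keeps `δ`. -/
theorem exists_isMove (hlevel : I.level v0 = 0) (hleaf : I.IsLeaf v0)
    (hnn : ∀ l, 0 ≤ S.mass l) (htot : (I.k : ℝ) ≤ subMass I S I.root)
    (hm : S.mass v0 ≤ 1 - I.del') : ∃ a, IsMove I S v0 a := by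
  have hd' := I.del'_pos
  have hd := I.del_pos
  have hg := I.gam_pos
  set av : V → ℝ := fun l => if I.IsLeaf l ∧ l ≠ v0 then max 0 (S.mass l - I.del) else 0 with hav
  have hav0 : ∀ l, 0 ≤ av l := fun l => by
    simp only [hav]; split_ifs
    exacts [le_max_left _ _, le_rfl]
  have hsum : 1 - S.mass v0 - I.del' / 10 ≤ ∑ l, av l := by
    have h1 : subMass I S I.root ≤ ∑ l, (av l + I.del + if l = v0 then S.mass v0 else 0) := by
      refine (Finset.sum_le_sum fun l hl => ?_).trans
        (Finset.sum_le_sum_of_subset_of_nonneg (Finset.subset_univ _) fun l _ _ => ?_)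
      · rw [Finset.mem_filter] at hl
        by_cases h2 : l = v0
        · subst h2
          rw [if_pos rfl]; linarith [hav0 l]
        · simp only [hav, if_neg h2, if_pos (And.intro hl.2 h2)]
          linarith [le_max_right 0 (S.mass l - I.del)]
      · have := hav0 l
        have := hnn v0
        split_ifs <;> linarith
    rw [Finset.sum_add_distrib, Finset.sum_add_distrib, Finset.sum_const, nsmul_eq_mul,
      Finset.sum_ite_eq', if_pos (Finset.mem_univ _), Finset.card_univ] at h1
    have h2 := I.del_mul_n
    rw [HST.n] at h2
    have := I.k_ge
    linarith
  have hpos : 0 < ∑ l, av l := by linarith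
  set ρ : ℝ := (1 - I.del' - S.mass v0) / ∑ l, av l with hρ
  have hρ0 : 0 ≤ ρ := div_nonneg (by linarith) hpos.le
  have hρ1 : ρ ≤ 1 := by rw [hρ, div_le_one hpos]; linarith
  refine ⟨fun l => ρ * av l, fun l => mul_nonneg hρ0 (hav0 l), fun l hl => ?_, ?_⟩
  · have h1 : av l ≠ 0 := fun h1 => hl (by simp [h1])
    have h2 : I.IsLeaf l ∧ l ≠ v0 := by
      by_contra h2
      exact h1 (if_neg h2)
    have h3 : av l = max 0 (S.mass l - I.del) := if_pos h2
    refine ⟨h2.1, h2.2, ?_⟩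
    have h4 : av l = S.mass l - I.del := by
      rcases max_cases 0 (S.mass l - I.del) with h5 | h5
      · exact (h1 (h3.trans h5.1)).elim
      · exact h3.trans h5.1
    have h5 : ρ * av l ≤ av l := mul_le_of_le_one_left (hav0 l) hρ1
    linarith
  · rw [← Finset.mul_sum, hρ, div_mul_cancel₀ _ hpos.ne']
    ring

/-- The movement `a` sends no more mass to `v0` from below `w` than there is. -/
theorem IsMove.sum_le {a : V → ℝ} (h : IsMove I S v0 a) (hnn : ∀ l, 0 ≤ S.mass l)
    (hleaf : I.IsLeaf v0) {w : V} (hw : v0 ∈ I.sub w) :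
    S.mass v0 + ∑ l ∈ I.sub w, a l ≤ subMass I S w := by
  have hg := gam_le_del I
  rw [subMass, Finset.sum_filter, ← Finset.add_sum_erase (I.sub w) a hw,
    ← Finset.add_sum_erase (I.sub w) (fun l => if I.IsLeaf l then S.mass l else 0) hw,
    if_pos hleaf]
  have h1 : a v0 = 0 := by
    by_contra h1
    exact (h.leaf v0 h1).2.1 rfl
  rw [h1, zero_add]
  refine add_le_add le_rfl (Finset.sum_le_sum fun l _ => ?_)
  by_cases h2 : a l = 0
  · rw [h2]; split_ifs
    exacts [hnn l, le_rfl]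
  · have h3 := h.leaf l h2
    rw [if_pos h3.1]; linarith

/-- If there is hardly any server mass below the ancestor `w` of the requested leaf, then the cost
is large. -/
theorem le_logCost (hlevel : I.level v0 = 0) (hleaf : I.IsLeaf v0)
    (hnn : ∀ l, 0 ≤ S.mass l) (htot : (I.k : ℝ) ≤ subMass I S I.root)
    (hm : S.mass v0 ≤ 1 - I.del') {w : V} (hw : v0 ∈ I.sub w)
    (hwm : subMass I S w ≤ I.del * I.n) : I.level w + 1 ≤ logCost I S v0 := by
  have hd' := I.del'_le
  have hlam := I.lam_ge'
  have hcost : I.lam ^ I.level w / 2 ≤ moveCost I S v0 := by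
    rw [moveCost_eq]
    obtain ⟨a0, ha0⟩ := exists_isMove hlevel hleaf hnn htot hm
    refine le_csInf ⟨_, a0, ha0, rfl⟩ ?_
    rintro x ⟨a, ha, rfl⟩
    have h1 := ha.sum_le hnn hleaf hw
    have h2 : ∑ u ∈ (I.sub w)ᶜ, a u * I.lam ^ I.level w ≤ ∑ u, a u * I.dist u v0 := by
      refine (Finset.sum_le_sum fun u hu => ?_).trans
        (Finset.sum_le_sum_of_subset_of_nonneg (Finset.subset_univ _) fun u _ _ =>
          mul_nonneg (ha.nonneg u) (HST.dist_nonneg I _ _))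
      refine mul_le_mul_of_nonneg_left ?_ (ha.nonneg u)
      rw [Finset.mem_compl] at hu
      rw [HST.dist]
      refine le_trans ?_ (Finset.single_le_sum (f := fun w =>
        if Xor (u ∈ I.sub w) (v0 ∈ I.sub w) then I.c w else 0) (fun x _ => ?_)
        (Finset.mem_univ w))
      · rw [if_pos (show Xor _ _ from Or.inr ⟨hw, hu⟩), HST.c]
      · split_ifs
        exacts [(I.c_pos x).le, le_rfl]
    rw [← Finset.sum_mul] at h2
    have h3 := Finset.sum_add_sum_compl (I.sub w) a
    have h4 := ha.total
    have h5 := I.del_mul_n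
    refine le_trans ?_ h2
    have h6 : (1 : ℝ) / 2 ≤ ∑ u ∈ (I.sub w)ᶜ, a u := by linarith
    have := I.lam_pow_pos (I.level w)
    nlinarith
  have h1 : I.lam ^ (I.level w + 1) ≤ 2 * I.lam * moveCost I S v0 := by
    rw [pow_succ]; nlinarith
  have h2 := I.lam_pow_pos (I.level w + 1)
  refine Nat.le_floor ?_
  rw [Real.le_logb_iff_rpow_le (by linarith) (by linarith), Real.rpow_natCast]
  exact h1

/-- There is a server movement which is not more expensive than `λ ^ logcost / 2`. -/
theorem exists_isMove_le (hlevel : I.level v0 = 0) (hleaf : I.IsLeaf v0)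
    (hnn : ∀ l, 0 ≤ S.mass l) (htot : (I.k : ℝ) ≤ subMass I S I.root)
    (hm : S.mass v0 ≤ 1 - I.del') : ∃ a, IsMove I S v0 a ∧
      ∑ i ∈ Finset.range I.H, I.lam ^ i * ∑ l ∈ (I.sub (I.anc v0 i))ᶜ, a l ≤
        I.lam ^ logCost I S v0 / 2 := by
  have hlam := I.lam_ge'
  have hcost : moveCost I S v0 < I.lam ^ logCost I S v0 / 2 := by
    rcases le_or_gt (moveCost I S v0) 0 with h1 | h1
    · have := I.lam_pow_pos (logCost I S v0); linarith
    · have h2 := Nat.lt_floor_add_one (Real.logb I.lam (2 * I.lam * moveCost I S v0))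
      rw [Real.logb_lt_iff_lt_rpow (by linarith) (by positivity)] at h2
      change _ < I.lam ^ ((logCost I S v0 : ℝ) + 1) at h2
      rw [Real.rpow_add_one (by linarith), Real.rpow_natCast] at h2
      nlinarith
  rw [moveCost_eq] at hcost
  obtain ⟨a0, ha0⟩ := exists_isMove hlevel hleaf hnn htot hm
  obtain ⟨x, ⟨a, ha, rfl⟩, hx⟩ := exists_lt_of_csInf_lt (s := {x | ∃ a, IsMove I S v0 a ∧
    x = ∑ u, a u * I.dist u v0}) ⟨_, a0, ha0, rfl⟩ hcost
  refine ⟨a, ha, le_trans ?_ hx.le⟩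
  have h1 : ∀ i ∈ Finset.range I.H, I.lam ^ i * ∑ l ∈ (I.sub (I.anc v0 i))ᶜ, a l =
      ∑ l, a l * if l ∉ I.sub (I.anc v0 i) then I.c (I.anc v0 i) else 0 := by
    intro i hi
    rw [Finset.mul_sum, ← Finset.sum_subset (Finset.subset_univ (I.sub (I.anc v0 i))ᶜ)]
    · refine Finset.sum_congr rfl fun l hl => ?_
      rw [if_pos (Finset.mem_compl.1 hl), HST.c, I.level_anc _ _
        (by have := Finset.mem_range.1 hi; omega), hlevel, zero_add, mul_comm]
    · intro l _ hl
      rw [Finset.mem_compl] at hl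
      rw [if_neg hl, mul_zero]
  rw [Finset.sum_congr rfl h1, Finset.sum_comm]
  refine Finset.sum_le_sum fun l _ => ?_
  rw [← Finset.mul_sum]
  refine mul_le_mul_of_nonneg_left ?_ (ha.nonneg l)
  have hinj : Set.InjOn (fun i => I.anc v0 i) (Finset.range I.H : Set ℕ) := by
    intro i hi j hj hij
    have hi' := Finset.mem_range.1 hi
    have hj' := Finset.mem_range.1 hj
    have := congrArg I.level hij
    simp only at this
    rw [I.level_anc _ _ (by omega), I.level_anc _ _ (by omega)] at this
    omega
  rw [← Finset.sum_image (f := fun w => if l ∉ I.sub w then I.c w else 0) hinj, HST.dist]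
  refine (Finset.sum_le_sum fun w hw => ?_).trans
    (Finset.sum_le_sum_of_subset_of_nonneg (Finset.subset_univ _) fun w _ _ => ?_)
  · rw [Finset.mem_image] at hw
    obtain ⟨i, -, rfl⟩ := hw
    by_cases h2 : l ∈ I.sub (I.anc v0 i)
    · rw [if_neg (not_not.2 h2)]
      split_ifs
      exacts [(I.c_pos _).le, le_rfl]
    · rw [if_pos h2, if_pos (show Xor _ _ from Or.inr ⟨I.anc_mem _ _, h2⟩)]
  · split_ifs
    exacts [(I.c_pos w).le, le_rfl]

/-- When all other leaves below the ancestor `w` of `v0` have become inactive, then `v0` has got at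
least the mass that the movement `a` sends to `v0` from below `w`, up to `n γ`. -/
theorem IsMove.le_mass {S' : State V} {a : V → ℝ} (h : IsMove I S v0 a) (hleaf : I.IsLeaf v0)
    {w : V} (hw : v0 ∈ I.sub w)
    (hle : ∀ l, l ≠ v0 → S'.mass l ≤ S.mass l) (hsub : subMass I S w ≤ subMass I S' w)
    (hlt : ∀ l ∈ I.sub w, I.IsLeaf l → l ≠ v0 → S'.mass l < I.del) :
    1 - I.del' - ∑ l ∈ (I.sub w)ᶜ, a l - I.n * I.gam ≤ S'.mass v0 := by
  have h1 : ∑ l ∈ (I.sub w).erase v0, (a l - I.gam) ≤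
      ∑ l ∈ (I.sub w).erase v0, ((if I.IsLeaf l then S.mass l else 0) -
        if I.IsLeaf l then S'.mass l else 0) := by
    refine Finset.sum_le_sum fun l hl => ?_
    obtain ⟨hl1, hl2⟩ := Finset.mem_erase.1 hl
    have hg := I.gam_pos
    by_cases h2 : a l = 0
    · rw [h2]
      have := hle l hl1
      split_ifs <;> linarith
    · obtain ⟨h3, -, h4⟩ := h.leaf l h2
      rw [if_pos h3, if_pos h3]
      have := hlt l hl2 h3 hl1
      linarith
  rw [Finset.sum_sub_distrib, Finset.sum_sub_distrib, Finset.sum_const, nsmul_eq_mul] at h1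
  rw [subMass, subMass, Finset.sum_filter, Finset.sum_filter, ← Finset.add_sum_erase _ _ hw,
    ← Finset.add_sum_erase _ _ hw, if_pos hleaf, if_pos hleaf] at hsub
  have h2 := Finset.sum_add_sum_compl (I.sub w) a
  have h3 := h.total
  have h4 : a v0 = 0 := by
    by_contra h4
    exact (h.leaf v0 h4).2.1 rfl
  rw [← Finset.add_sum_erase _ _ hw, h4, zero_add] at h2
  have h5 : (((I.sub w).erase v0).card : ℝ) ≤ I.n := by
    rw [HST.n]; exact_mod_cast Finset.card_le_univ _
  have := I.gam_pos
  nlinarith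

end MoveCost

/-! ### The dual variables added in one iteration -/

/-- The total of the dual variables of the constraints at `v` that were added by simple updates, and in
which `y(u, t)` occurs. -/
def simpSum (I : Inst V) (S : State V) (v u : V) (t : ℕ) : ℝ :=
  ((S.cons v).map fun C => if (∀ x, C.src x = none) ∧ C.Occurs I v u t then C.z else 0).sum

/-- The total of the dual variables of the constraints at the parent of `u` which are composed, at the same
timestep, from a `⊥`-constraint at `u` that has `t` in its window. -/
def wSum (I : Inst V) (S : State V) (u : V) (t : ℕ) : ℝ :=
  ((S.cons (I.parent u)).map fun C => if C.src u ≠ none ∧ u ∈ C.A ∧ C.tau u = C.time ∧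
    (C.f u).b * I.N < t ∧ t ≤ C.time then C.z else 0).sum

/-- The time periods with a `⊥`-constraint at `u` that has `t` in its window. -/
def botTimes (I : Inst V) (S : State V) (u : V) (t : ℕ) : Set ℕ :=
  {q | ∃ B ∈ S.cons u, B.IsBot ∧ 0 < B.time ∧ B.time / I.N = q ∧
    (B.f u).b * I.N < t ∧ t ≤ B.time}

section Increments
variable {I : Inst V} {r : Req V} {lc τ i0 : ℕ} {S0 S : State V}

theorem IterRes.cons_of_ne (h : IterRes I r lc τ S0 i0 S) {v : V}
    (hv : ∀ j ≤ I.H, v ≠ I.anc r.leaf j) : S.cons v = S0.cons v := by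
  refine h.cons v fun h1 => ?_
  obtain ⟨h2, h3⟩ := I.eq_anc_of_mem_sub h1
  exact hv _ ((Nat.sub_le _ _).trans (I.level_le v)) h3.symm

/-- A simple update at the `j`-th node only adds to the sums for timesteps that are charged by the tree
of the time period. -/
theorem IterRes.simpSum_le (h : IterRes I r lc τ S0 i0 S)
    (hnode : ∀ i ≤ I.H, (I.anc r.leaf (min i lc), r.e) ∈ (S0.forest (I.anc r.leaf (min i lc))).node)
    (hτ : τ < (r.e + 1) * I.N) (u : V) (t : ℕ) :
    ∑ v, simpSum I S v u t ≤ ∑ v, simpSum I S0 v u t + ∑ j ∈ Finset.range I.H,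
      if j ≤ i0 ∧ r.e ∈ badTimes I (S0.forest (I.anc r.leaf (min j lc))) (I.anc r.leaf (min j lc)) u t
      then 2 * I.H * I.c u / I.lam ^ (min j lc) * (I.lam ^ j * (I.gam / I.lam ^ i0)) else 0 := by
  set s : ℕ → ℝ := fun j => if j ≤ i0 ∧
      r.e ∈ badTimes I (S0.forest (I.anc r.leaf (min j lc))) (I.anc r.leaf (min j lc)) u t
      then 2 * I.H * I.c u / I.lam ^ (min j lc) * (I.lam ^ j * (I.gam / I.lam ^ i0)) else 0 with hs
  have hi0 := h.lt
  have hlam := I.lam_pow_pos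
  have hs0 : ∀ j, 0 ≤ s j := by
    intro j
    simp only [hs]
    split_ifs
    · have := I.c_pos u
      have := I.gam_pos
      have := hlam (min j lc)
      have := hlam j
      have := hlam i0
      positivity
    · exact le_rfl
  have hv : ∀ v, simpSum I S v u t ≤ simpSum I S0 v u t +
      ∑ j ∈ Finset.range I.H, if v = I.anc r.leaf j then s j else 0 := by
    intro v
    have hnn : 0 ≤ ∑ j ∈ Finset.range I.H, if v = I.anc r.leaf j then s j else 0 :=
      Finset.sum_nonneg fun j _ => by split_ifs; exacts [hs0 j, le_rfl]
    by_cases h1 : ∃ j ≤ I.H, v = I.anc r.leaf j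
    · obtain ⟨j, hj, rfl⟩ := h1
      rcases Nat.lt_or_ge i0 j with h2 | h2
      · obtain ⟨-, New, h3, h4⟩ := h.full j h2 hj
        rw [simpSum, h3, List.map_append, List.sum_append, sum_map_zero (L := New)]
        · rw [add_zero]; exact le_add_of_nonneg_right hnn
        · intro C hC
          rw [if_neg]
          exact fun h5 => (h4 C hC).src0 (h5.1 _)
      · obtain ⟨C, h3, h4⟩ := h.simple j h2
        rw [simpSum, h3, sum_map_append_singleton]
        refine add_le_add le_rfl ?_
        have h5 : s j ≤ ∑ j' ∈ Finset.range I.H, if I.anc r.leaf j = I.anc r.leaf j' then s j' else 0 := by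
          refine le_trans ?_ (Finset.single_le_sum (f := fun j' =>
            if I.anc r.leaf j = I.anc r.leaf j' then s j' else 0) (fun j' _ => ?_)
            (Finset.mem_range.2 (show j < I.H by omega)))
          · simp
          · split_ifs; exacts [hs0 j', le_rfl]
        refine le_trans ?_ h5
        split_ifs with h6
        · obtain ⟨p, h7, h8, h9, h10, h11⟩ := h4.occ u t h6.2
          simp only [hs]
          rw [if_pos]
          · exact h11
          · exact ⟨h2, hnode j hj, by omega, p, h7, h8, h9⟩
        · exact hs0 j
    · push Not at h1
      rw [simpSum, h.cons_of_ne h1]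
      exact le_add_of_nonneg_right hnn
  refine (Finset.sum_le_sum fun v _ => hv v).trans (le_of_eq ?_)
  rw [Finset.sum_add_distrib, Finset.sum_comm (s := Finset.univ)]
  congr 1
  refine Finset.sum_congr rfl fun j _ => ?_
  rw [Finset.sum_ite_eq' Finset.univ (I.anc r.leaf j) fun _ => s j, if_pos (Finset.mem_univ _)]

/-- If `u` itself is in the set `A` of a constraint composed from one at `u`, then the latter is a
`⊥`-constraint. -/
theorem Core.source_isBot {τ : ℕ} {S : State V} (h : Core I τ S) {v u : V} {C : Con V}
    (hC : C ∈ S.cons v) (hu : C.src u ≠ none) (hA : u ∈ C.A) :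
    ∃ σ j, C.src u = some j ∧ (S.cons u)[j]? = some σ ∧ σ.IsBot ∧ SrcOK I S v C u σ ∧
      C.tau u = σ.time ∧ C.f u = σ.f u := by
  obtain ⟨j, hj⟩ := Option.ne_none_iff_exists'.1 hu
  obtain ⟨σ, h1, h2⟩ := h.src v C hC u j hj
  have h3 := h.wf u σ (mem_of_getElem? h1)
  have h4 : u ∈ σ.A := by
    rw [← h2.A_inter, Finset.mem_inter]; exact ⟨hA, I.self_mem_sub u⟩
  have h5 := h2.agree u (I.self_mem_sub u)
  refine ⟨σ, j, hj, h1, ?_, h2, h5.2.trans h3.tau_self, h5.1⟩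
  by_contra h6
  exact h3.nonbot h6 h4

/-- The dual variables `wSum` only increase at the first node of the path with an active sibling,
and only if there is a `⊥`-constraint at this node. -/
theorem IterRes.wSum_le (h : IterRes I r lc τ S0 i0 S) (hh : IterHyp I r lc τ S0)
    (u : V) (t : ℕ) : wSum I S u t ≤ wSum I S0 u t ∨
      (u = I.anc r.leaf i0 ∧ τ / I.N ∈ botTimes I S u t ∧
        (∃ C, S.cons u = S0.cons u ++ [C] ∧ C.IsBot ∧
          SimpleOK I r lc τ i0 (I.lam ^ i0 * (I.gam / I.lam ^ i0)) S0 C) ∧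
        ∃ New, S.cons (I.anc r.leaf (i0 + 1)) = S0.cons (I.anc r.leaf (i0 + 1)) ++ New ∧
          (∀ C ∈ New, FullOK I r τ i0 (i0 + 1) S0 S C) ∧
          dualObj I S (I.anc r.leaf (i0 + 1)) τ = I.gam ∧
          wSum I S u t ≤ wSum I S0 u t + (New.map fun C => C.z).sum) := by
  have hl := hh.level
  have hi0 := h.lt
  have hlev : ∀ j ≤ I.H, I.level (I.anc r.leaf j) = j := fun j hj => by
    rw [I.level_anc _ _ (by omega)]; omega
  by_cases hur : u = I.root
  · left
    subst hur
    have h0 : ∀ t, wSum I S I.root t = 0 := by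
      intro t
      refine sum_map_zero fun C hC => if_neg fun h1 => ?_
      obtain ⟨σ, j, -, -, -, h2, -, -⟩ := h.core.source_isBot hC h1.1 h1.2.1
      exact (I.mem_children.1 h2.child).1 rfl
    have h0' : 0 ≤ wSum I S0 I.root t := sum_map_nonneg fun C hC => by
      have := (hh.core.wf _ C hC).z_nonneg
      split_ifs <;> simp [this]
    rw [h0]; exact h0'
  have hold : ∀ v, ∀ C ∈ S0.cons v, C.time < τ := fun v C hC => by
    have := hh.core.times v C hC
    have := hh.pos
    omega
  have huse : ∀ C ∈ S.cons (I.parent u), C.time = τ → (C.src u ≠ none ∧ u ∈ C.A ∧ C.tau u = C.time ∧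
      (C.f u).b * I.N < t ∧ t ≤ C.time) → ∃ σ ∈ S.cons u, σ.time = τ ∧ σ.IsBot ∧ C.f u = σ.f u := by
    intro C hC hCt h1
    obtain ⟨σ, j, -, h2, h3, h4, h5, h6⟩ := h.core.source_isBot hC h1.1 h1.2.1
    exact ⟨σ, mem_of_getElem? h2, by rw [← h5, h1.2.2.1, hCt], h3, h6⟩
  by_cases hp : ∃ j ≤ I.H, I.parent u = I.anc r.leaf j
  · obtain ⟨j, hj, hpj⟩ := hp
    rcases Nat.lt_or_ge i0 j with h2 | h2
    · obtain ⟨hdual, New, h3, h4⟩ := h.full j h2 hj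
      have hz : ∀ C ∈ New, 0 ≤ C.z := fun C hC =>
        (h.core.wf (I.anc r.leaf j) C (by rw [h3]; exact List.mem_append_right _ hC)).z_nonneg
      have hle : wSum I S u t = wSum I S0 u t + (New.map fun C => if C.src u ≠ none ∧ u ∈ C.A ∧
          C.tau u = C.time ∧ (C.f u).b * I.N < t ∧ t ≤ C.time then C.z else 0).sum := by
        rw [wSum, wSum, hpj, h3, List.map_append, List.sum_append]
      by_cases hex : ∃ C ∈ New, C.src u ≠ none ∧ u ∈ C.A ∧ C.tau u = C.time ∧
          (C.f u).b * I.N < t ∧ t ≤ C.time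
      · right
        obtain ⟨C, hC, hC2⟩ := hex
        obtain ⟨σ, hσ, hσt, hσb, hσf⟩ := huse C (by
          rw [hpj, h3]; exact List.mem_append_right _ hC) (h4 C hC).time hC2
        have hu : r.leaf ∈ I.sub u := by
          by_contra h5
          rw [h.cons u h5] at hσ
          have := hold u σ hσ; omega
        have hul : I.level u + 1 = j := by
          rw [← hlev j hj, ← hpj, I.level_parent u hur]
        have huj : u = I.anc r.leaf (I.level u) := by
          have := (I.eq_anc_of_mem_sub hu).2
          rw [hl, Nat.sub_zero] at this
          exact this.symm
        have hlu : I.level u = i0 := by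
          by_contra h5
          obtain ⟨-, New', h6, h7⟩ := h.full (I.level u) (by omega) (by omega)
          rw [huj, h6, List.mem_append] at hσ
          rcases hσ with hσ | hσ
          · have := hold _ σ hσ; omega
          · exact (h7 σ hσ).nonbot hσb
        rw [hlu] at huj hul
        subst hul
        obtain ⟨C0, h6, h7⟩ := h.simple i0 le_rfl
        have hσC : σ = C0 := by
          rw [huj, h6, List.mem_append] at hσ
          rcases hσ with hσ | hσ
          · have := hold _ σ hσ; omega
          · simpa using hσ
        refine ⟨huj, ⟨σ, hσ, hσb, by rw [hσt]; exact hh.pos, by rw [hσt], ?_, ?_⟩,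
          ⟨C0, by rw [huj]; exact h6, hσC ▸ hσb, h7⟩, New, h3, h4, hdual, ?_⟩
        · rw [← hσf]; exact hC2.2.2.2.1
        · have := hC2.2.2.2.2
          rw [(h4 C hC).time] at this
          omega
        · rw [hle]
          refine add_le_add le_rfl (sum_map_le fun D hD => ?_)
          split_ifs
          exacts [le_rfl, hz D hD]
      · left
        rw [hle, sum_map_zero, add_zero]
        intro C hC
        rw [if_neg fun h5 => hex ⟨C, hC, h5⟩]
    · left
      obtain ⟨C, h3, h4⟩ := h.simple j h2
      rw [wSum, hpj, h3, sum_map_append_singleton, if_neg fun h5 => h5.1 (h4.src u), add_zero, wSum,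
        hpj]
  · left
    push Not at hp
    rw [wSum, h.cons_of_ne hp, wSum]

end Increments

/-! ### A potential function for `⊥`-constraints -/

/-- The invariant behind the bound on `wSum` in a time period. Here `x` is the mass that is still
missing at the requested leaf, `x₁` its initial value, and `W` is a sum of durations that, multiplied
by the right-hand sides, add up to at most `x₁ - x`. Right-hand sides are at least `4 / 5 * x`, and they are
of the form `m - κ` for integers `m`, of which `p` is the least one to be considered. As long as
`p - κ` is less than `4 / 5 * x`, it is no right-hand side, so right-hand sides are at least `1 / 2`.
Once it is not, with missing mass `y` at that time, right-hand sides stay above `3 / 10 * y`, as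
`κ` grows at most half as fast as `x` decreases. -/
def SumBound (p : ℤ) (x₁ x κ W : ℝ) : Prop :=
  W ≤ 2 * (x₁ - x) ∨ ∃ y, x ≤ y ∧ y ≤ x₁ ∧ 0 < y ∧ W ≤ 2 * (x₁ - y) + (y - x) / (3 / 10 * y) ∧
    4 / 5 * y - (y - x) / 2 ≤ p - κ

theorem SumBound.le {p : ℤ} {x₁ x κ W : ℝ} (h : SumBound p x₁ x κ W) (hx : 0 ≤ x) (hx₁ : x₁ ≤ 1) :
    W ≤ 6 := by
  rcases h with h | ⟨y, h1, h2, h3, h4, -⟩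
  · linarith
  · have : (y - x) / (3 / 10 * y) ≤ 10 / 3 := by
      rw [div_le_iff₀ (by positivity)]; linarith
    linarith

/-- The invariant persists when durations with sum `Z` are added, where any lower bound `ρ` on the
possible right-hand sides gives `Z * ρ ≤ x - x'`. -/
theorem SumBound.step {p : ℤ} {κ₁ x₁ x x' κ κ' W Z : ℝ} (h : SumBound p x₁ x κ W)
    (hp : κ₁ < p) (hp' : p ≤ κ₁ + 1) (hκ : κ₁ ≤ κ) (hκ₁ : κ ≤ κ₁ + (x₁ - x) / 2)
    (hx1 : x₁ ≤ 1) (hx : 0 < x) (hxx : x' ≤ x) (hκ' : κ' ≤ κ + (x - x') / 2) (hx'' : x ≤ x₁)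
    (hZ : ∀ ρ : ℝ, 0 < ρ → (∀ m : ℤ, 4 / 5 * x ≤ m - κ → ρ ≤ m - κ) → Z * ρ ≤ x - x') :
    SumBound p x₁ x' κ' (W + Z) := by
  have hint : ∀ m : ℤ, 4 / 5 * x ≤ m - κ → (p : ℝ) ≤ m := by
    intro m hm
    have h1 : (p : ℝ) - 1 < m := by linarith
    have h2 : p - 1 < m := by exact_mod_cast h1
    exact_mod_cast (by omega : p ≤ m)
  have key : ∀ y, x ≤ y → y ≤ x₁ → 0 < y → W ≤ 2 * (x₁ - y) + (y - x) / (3 / 10 * y) →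
      4 / 5 * y - (y - x) / 2 ≤ p - κ → SumBound p x₁ x' κ' (W + Z) := by
    intro y h1 h2 h3 h4 h5
    refine Or.inr ⟨y, hxx.trans h1, h2, h3, ?_, by linarith⟩
    have h6 := hZ (3 / 10 * y) (by positivity) fun m hm => by
      have := hint m hm
      linarith
    have h7 : Z ≤ (x - x') / (3 / 10 * y) := by rwa [le_div_iff₀ (by positivity)]
    have h8 : (y - x) / (3 / 10 * y) + (x - x') / (3 / 10 * y) = (y - x') / (3 / 10 * y) := by
      rw [← add_div]; ring
    linarith
  rcases h with h | ⟨y, h1, h2, h3, h4, h5⟩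
  · by_cases hd : 4 / 5 * x ≤ p - κ
    · refine key x le_rfl hx'' hx ?_ (by simpa using hd)
      simpa using h
    · left
      have h6 := hZ (1 / 2) (by norm_num) fun m hm => by
        have h7 : (p : ℝ) < m := by
          push Not at hd
          linarith
        have h8 : p + 1 ≤ m := by
          have : p < m := by exact_mod_cast h7
          omega
        have h9 : (p : ℝ) + 1 ≤ m := by exact_mod_cast h8
        linarith
      linarith
  · exact key y h1 h2 h3 h4 h5

/-! ### The while-loop -/

/-- The assumptions about the state before the while-loop for the request `r`; `a` is a cheap server
movement that gives the requested leaf its mass. -/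
structure LoopHyp (I : Inst V) (r : Req V) (lc : ℕ) (a : V → ℝ) (S1 : State V) : Prop where
  level : I.level r.leaf = 0
  leaf : I.IsLeaf r.leaf
  mass_le : S1.mass r.leaf ≤ 1 - I.del'
  core : Core I (r.e * I.N) S1
  yinv : YInv I (r.e * I.N) S1
  dlb : ∀ u, DualLB I S1 u
  bal : ∀ u, u ≠ I.root → Balance I S1 (r.e * I.N) u 0
  off : ∀ u, ∀ C ∈ S1.cons u, C.time / I.N < r.e
  tree : ∀ i ≤ I.H, TreeOK I (S1.forest (I.anc r.leaf (min i lc))) (I.anc r.leaf (min i lc), r.e)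
  node : ∀ i ≤ I.H, (I.anc r.leaf (min i lc), r.e) ∈ (S1.forest (I.anc r.leaf (min i lc))).node
  move : IsMove I S1 r.leaf a
  move_le : ∑ i ∈ Finset.range I.H, I.lam ^ i * ∑ l ∈ (I.sub (I.anc r.leaf i))ᶜ, a l ≤
    I.lam ^ lc / 2

/-- What is known about a `⊥`-constraint `C` added at `u` in the while-loop for `r`, in terms of
the current state `X`. -/
structure NewBot (I : Inst V) (r : Req V) (lc : ℕ) (X : State V) (u : V) (C : Con V) : Prop where
  ne_root : u ≠ I.root
  mem : r.leaf ∈ I.sub u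
  f_eq : C.f u = r
  lt : ∀ l ∈ I.sub u, I.IsLeaf l → l ≠ r.leaf → X.mass l < I.del
  kids : (X.forest (I.anc r.leaf (min (I.level u) lc))).kids
    (I.anc r.leaf (min (I.level u) lc), r.e) = ∅

/-- The constraints at the `(i + 1)`-th node of the path added in the state `X` have right-hand sides
`m - kappa` with integers `m`. -/
def kappa (I : Inst V) (r : Req V) (i : ℕ) (X : State V) : ℝ :=
  subMass I X (I.anc r.leaf (i + 1)) + 2 * I.del * (I.n - I.nv (I.anc r.leaf (i + 1)))

/-- The requested leaf has at least this mass when all other leaves below its `j`-th ancestor are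
inactive. -/
def threshold (I : Inst V) (r : Req V) (a : V → ℝ) (j : ℕ) : ℝ :=
  1 - I.del' - ∑ l ∈ (I.sub (I.anc r.leaf j))ᶜ, a l - I.n * I.gam

/-- The invariants of the while-loop. The accumulated amounts `R j` bound the dual variables from
simple updates at the `j`-th node of the path, up to the factor `λ ^ j`, and the amounts `W j` those
composed from `⊥`-constraints at that node, up to the factor `4 H λ ^ j`. By `R_le'`, the amount
`R j` only grows once the requested leaf has got all the mass that a cheap movement sends from the
leaves below its `j`-th ancestor. -/
structure LoopInv (I : Inst V) (r : Req V) (lc : ℕ) (a : V → ℝ) (S1 : State V) (τ : ℕ)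
    (R W : ℕ → ℝ) (X : State V) : Prop where
  core : Core I τ X
  yinv : YInv I τ X
  dlb : ∀ u, DualLB I X u
  bal : ∀ u, u ≠ I.root → Balance I X τ u 0
  cons : ∀ u, r.leaf ∉ I.sub u → X.cons u = S1.cons u
  new : ∀ u, ∃ New, X.cons u = S1.cons u ++ New ∧
    ∀ C ∈ New, r.e * I.N < C.time ∧ (C.IsBot → NewBot I r lc X u C)
  mass_le : ∀ l, l ≠ r.leaf → X.mass l ≤ S1.mass l
  mass_ge : S1.mass r.leaf ≤ X.mass r.leaf
  mass_le' : X.mass r.leaf ≤ 1 - I.del' + 2 * I.gam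
  sub_ge : ∀ j ≤ I.H, subMass I S1 (I.anc r.leaf j) ≤ subMass I X (I.anc r.leaf j)
  forest : X.forest = S1.forest
  served : S1.served ⊆ X.served
  R_nonneg : ∀ j, 0 ≤ R j
  R_le : ∀ j < I.H, R j ≤ 4 * I.H * (X.mass r.leaf - S1.mass r.leaf)
  R_le' : ∀ j < I.H, R j ≤ 4 * I.H * max 0 (X.mass r.leaf - threshold I r a j)
  simp : ∀ u t, ∑ v, simpSum I X v u t ≤ ∑ v, simpSum I S1 v u t + ∑ j ∈ Finset.range I.H,
    if r.e ∈ badTimes I (S1.forest (I.anc r.leaf (min j lc))) (I.anc r.leaf (min j lc)) u t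
    then 2 * I.H * I.c u / I.lam ^ (min j lc) * (I.lam ^ j * R j) else 0
  W_nonneg : ∀ i, 0 ≤ W i
  W_le : ∀ i < I.H, W i ≤ 6
  W_bound : ∀ i < I.H, (∃ j ≤ i, (activeSib I X (I.anc r.leaf j)).Nonempty) →
    SumBound (⌊kappa I r i S1⌋ + 1) (1 - S1.mass r.leaf) (1 - X.mass r.leaf) (kappa I r i X) (W i) ∧
    kappa I r i X ≤ kappa I r i S1 + (X.mass r.leaf - S1.mass r.leaf) / 2
  w : ∀ u t, wSum I X u t ≤ wSum I S1 u t + if r.e ∈ botTimes I X u t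
    then W (I.level u) * (4 * I.H * I.c u) else 0

section Loop
variable {I : Inst V} {r : Req V} {lc τ i0 : ℕ} {a : V → ℝ} {S1 X X' : State V} {R W : ℕ → ℝ}

theorem activeSib_mono (hle : ∀ l, l ≠ r.leaf → X'.mass l ≤ X.mass l) {j : ℕ}
    (h : (activeSib I X' (I.anc r.leaf j)).Nonempty) :
    (activeSib I X (I.anc r.leaf j)).Nonempty := by
  obtain ⟨u, hu⟩ := h
  refine ⟨u, ?_⟩
  rw [activeSib] at hu ⊢
  split_ifs at hu ⊢ with h1
  · exact hu
  rw [Finset.mem_filter] at hu ⊢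
  obtain ⟨h2, h3, l, hl⟩ := hu
  refine ⟨h2, h3, l, ?_⟩
  rw [activeLeaves, Finset.mem_filter] at hl ⊢
  refine ⟨hl.1, hl.2.1, hl.2.2.trans (hle l ?_)⟩
  rintro rfl
  exact Finset.disjoint_left.1 (I.disjoint_sub h2 (I.mem_children.2 ⟨h1, rfl⟩) h3) hl.1
    (I.anc_mem _ _)

theorem LoopInv.start (h : LoopHyp I r lc a S1) :
    LoopInv I r lc a S1 (r.e * I.N) (fun _ => 0) (fun _ => 0) S1 := by
  have hg := I.gam_pos
  refine ⟨h.core, h.yinv, h.dlb, h.bal, fun _ _ => rfl, fun u => ⟨[], by simp, by simp⟩,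
    fun _ _ => le_rfl, le_rfl, by linarith [h.mass_le], fun _ _ => le_rfl, rfl, subset_rfl,
    fun _ => le_rfl, by simp, fun j _ => ?_, by simp, fun _ => le_rfl, by norm_num,
    fun i _ _ => ⟨Or.inl (by simp), by simp⟩, by simp⟩
  have := I.H_ge
  exact mul_nonneg (by linarith) (le_max_left _ _)

theorem LoopInv.iterHyp (h : LoopHyp I r lc a S1) (hi : LoopInv I r lc a S1 τ R W X)
    (hτ : (τ + 1) / I.N = r.e) (hm : X.mass r.leaf ≤ 1 - I.del') :
    IterHyp I r lc (τ + 1) X := by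
  refine ⟨h.level, h.leaf, hm, hi.core, by omega, hi.yinv, hi.dlb, hi.bal, fun u hu C hC => ?_, ?_⟩
  · rw [hi.cons u hu] at hC
    rw [hτ]; exact h.off u C hC
  · rw [hi.forest]; exact h.tree

/-- The sum of the dual variables composed from a `⊥`-constraint is controlled by lower bounds on
the possible right-hand sides. -/
theorem IterRes.sum_z_le (h : IterRes I r lc τ X i0 X') (hh : IterHyp I r lc τ X) {C0 : Con V}
    (hC0 : X'.cons (I.anc r.leaf i0) = X.cons (I.anc r.leaf i0) ++ [C0]) (hb : C0.IsBot)
    (hs : SimpleOK I r lc τ i0 (I.lam ^ i0 * (I.gam / I.lam ^ i0)) X C0) {New : List (Con V)}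
    (hN : X'.cons (I.anc r.leaf (i0 + 1)) = X.cons (I.anc r.leaf (i0 + 1)) ++ New)
    (hN2 : ∀ C ∈ New, FullOK I r τ i0 (i0 + 1) X X' C)
    (hd : dualObj I X' (I.anc r.leaf (i0 + 1)) τ = I.gam) {ρ : ℝ}
    (hρ : ∀ m : ℤ, 4 / 5 * (1 - X.mass r.leaf) ≤ m - kappa I r i0 X → ρ ≤ m - kappa I r i0 X) :
    (New.map fun C => C.z).sum * ρ ≤ I.gam := by
  have hold : ∀ v, ∀ C ∈ X.cons v, C.time ≠ τ := fun v C hC => by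
    have := hh.core.times v C hC
    have := hh.pos
    omega
  rw [dualObj_eq, hN, List.map_append, List.sum_append, sum_map_zero, zero_add] at hd
  · rw [← hd, ← List.sum_map_mul_right]
    refine sum_map_le fun C hC => ?_
    have h1 := hN2 C hC
    have hwf := h.core.wf (I.anc r.leaf (i0 + 1)) C (by rw [hN]; exact List.mem_append_right _ hC)
    rw [if_pos h1.time, mul_comm]
    refine mul_le_mul_of_nonneg_right ?_ hwf.z_nonneg
    obtain ⟨σ, hσ, hσt, hσr, -⟩ := h1.exists_src
    rw [Nat.add_sub_cancel] at hσ hσr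
    have h2 : σ = C0 := by
      rw [hC0, List.mem_append] at hσ
      rcases hσ with hσ | hσ
      · exact (hold _ σ hσ hσt).elim
      · simpa using hσ
    rw [h2] at hσr
    have h3 := (hs.bot hb).2.1
    have h4 : C.rhs I (I.anc r.leaf (i0 + 1)) = ((C.A.card : ℤ) : ℝ) - kappa I r i0 X := by
      rw [rhs_eq hwf.A_sub, h1.mass rfl, kappa]
      push_cast; ring
    rw [h4] at hσr ⊢
    exact hρ _ (h3.trans hσr)
  · intro C hC
    rw [if_neg (hold _ C hC)]

/-- An iteration adds `γ / λ ^ i₀` to `R j` for `j ≤ i₀`, and the durations of the timers at level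
`i₀ + 1` to `W i₀`, where `i₀` is the level of the first node of the path with an active sibling. -/
theorem LoopInv.step (h : LoopHyp I r lc a S1) (hi : LoopInv I r lc a S1 τ R W X)
    (hτ0 : r.e * I.N ≤ τ) (hτ : (τ + 1) / I.N = r.e) (hm : X.mass r.leaf ≤ 1 - I.del')
    (hs : Iteration I r lc (τ + 1) X X') : ∃ R' W', LoopInv I r lc a S1 (τ + 1) R' W' X' := by
  have hh := hi.iterHyp h hτ hm
  obtain ⟨i0, hr⟩ := hs.res hh
  have hl := h.level
  have hg := I.gam_pos
  have hlam := I.lam_pow_pos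
  have hH := I.H_ge
  have hi0H := hr.lt
  have hd' := I.del'_pos
  set G := X'.mass r.leaf - X.mass r.leaf with hG
  have hgain : I.gam / I.lam ^ i0 ≤ 4 * I.H * G := by
    have h1 := hr.gain
    rw [div_le_iff₀ (mul_pos (by linarith) (hlam _))] at h1
    rw [div_le_iff₀ (hlam _)]
    linarith
  have hG0 : 0 ≤ G := sub_nonneg.2 hr.mass_ge
  have hle : ∀ l, l ≠ r.leaf → X'.mass l ≤ S1.mass l := fun l hl' =>
    (hr.mass_le l hl').trans (hi.mass_le l hl')
  have hinact : ∀ j ≤ i0, ∀ l ∈ I.sub (I.anc r.leaf j), I.IsLeaf l → l ≠ r.leaf →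
      X.mass l < I.del := fun j hj =>
    mass_lt_of_activeSib_empty hl (by omega) fun k hk h3 => absurd (hr.least.2 h3) (by omega)
  obtain ⟨C0, hC0, hC0s⟩ := hr.simple i0 le_rfl
  obtain ⟨hdual, New, hN, hN2⟩ := hr.full (i0 + 1) (by omega) (by omega)
  set U : ℝ := 4 * I.H * I.lam ^ i0 with hU
  have hUpos : 0 < U := mul_pos (by linarith) (hlam _)
  set Z : ℝ := if C0.IsBot then (New.map fun C => C.z).sum / U else 0 with hZdef
  have hNz : ∀ C ∈ New, 0 ≤ C.z := fun C hC =>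
    (hr.core.wf _ C (by rw [hN]; exact List.mem_append_right _ hC)).z_nonneg
  have hZ0 : 0 ≤ Z := by
    rw [hZdef]; split_ifs
    exacts [div_nonneg (sum_map_nonneg hNz) hUpos.le, le_rfl]
  have hZ : ∀ ρ : ℝ, 0 < ρ → (∀ m : ℤ, 4 / 5 * (1 - X.mass r.leaf) ≤ m - kappa I r i0 X →
      ρ ≤ m - kappa I r i0 X) → Z * ρ ≤ (1 - X.mass r.leaf) - (1 - X'.mass r.leaf) := by
    intro ρ hρ hρ2
    have hG' : (1 - X.mass r.leaf) - (1 - X'.mass r.leaf) = G := by rw [hG]; ring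
    rw [hG', hZdef]
    split_ifs with hb
    · have h1 := hr.sum_z_le hh hC0 hb hC0s hN hN2 hdual hρ2
      rw [div_mul_eq_mul_div, div_le_iff₀ hUpos]
      refine h1.trans ?_
      rw [div_le_iff₀ (hlam _)] at hgain
      rw [hU]; linarith
    · rw [zero_mul]; exact hG0
  -- the potential bounds the `W i` for all nodes above the first one with an active sibling
  have hpot : ∀ i < I.H, i0 ≤ i → SumBound (⌊kappa I r i S1⌋ + 1) (1 - S1.mass r.leaf)
      (1 - X'.mass r.leaf) (kappa I r i X') (if i = i0 then W i + Z else W i) ∧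
      kappa I r i X' ≤ kappa I r i S1 + (X'.mass r.leaf - S1.mass r.leaf) / 2 := by
    intro i hiH hii
    obtain ⟨h1, h2⟩ := hi.W_bound i hiH ⟨i0, hii, hr.least.1⟩
    have h3 : kappa I r i X' ≤ kappa I r i X + G / 2 := by
      have := hr.sub_le (i + 1) (by omega) (by omega)
      rw [kappa, kappa, hG]; linarith
    refine ⟨?_, by rw [hG] at h3; linarith⟩
    have h4 : kappa I r i S1 ≤ kappa I r i X := by
      have := hi.sub_ge (i + 1) (by omega)
      rw [kappa, kappa]; linarith
    have hstep : ∀ Z' : ℝ, (∀ ρ : ℝ, 0 < ρ → (∀ m : ℤ, 4 / 5 * (1 - X.mass r.leaf) ≤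
        m - kappa I r i X → ρ ≤ m - kappa I r i X) → Z' * ρ ≤
        (1 - X.mass r.leaf) - (1 - X'.mass r.leaf)) →
        SumBound (⌊kappa I r i S1⌋ + 1) (1 - S1.mass r.leaf)
          (1 - X'.mass r.leaf) (kappa I r i X') (W i + Z') := by
      intro Z' hZ'
      refine h1.step (κ₁ := kappa I r i S1) ?_ ?_ h4 (by linarith) ?_ (by linarith)
        (by linarith [hr.mass_ge]) (by rw [hG] at h3; linarith) (by linarith [hi.mass_ge]) hZ'
      · push_cast; exact Int.lt_floor_add_one _
      · push_cast; linarith [Int.floor_le (kappa I r i S1)]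
      · linarith [h.core.mass_nonneg r.leaf]
    split_ifs with h5
    · subst h5; exact hstep Z hZ
    · have := hstep 0 fun ρ _ _ => by rw [zero_mul]; linarith
      rwa [add_zero] at this
  refine ⟨fun j => if j ≤ i0 then R j + I.gam / I.lam ^ i0 else R j,
    fun i => if i = i0 then W i + Z else W i, hr.core, hr.yinv, hr.dlb, hr.bal, fun u hu => ?_,
    fun u => ?_, hle, hi.mass_ge.trans hr.mass_ge, ?_, fun j hj => (hi.sub_ge j hj).trans (hr.sub_ge j hj),
    hr.forest.trans hi.forest, hi.served.trans hr.served, fun j => ?_, fun j hj => ?_,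
    fun j hj => ?_, fun u t => ?_, fun i => ?_, ?_, ?_, fun u t => ?_⟩
  · rw [hr.cons u hu, hi.cons u hu]
  · obtain ⟨New1, h1, h2⟩ := hi.new u
    have hkeep : ∀ C ∈ New1, r.e * I.N < C.time ∧ (C.IsBot → NewBot I r lc X' u C) := by
      intro C hC
      refine ⟨(h2 C hC).1, fun hb => ?_⟩
      have h3 := (h2 C hC).2 hb
      exact ⟨h3.ne_root, h3.mem, h3.f_eq, fun l h4 h5 h6 => (hr.mass_le l h6).trans_lt (h3.lt l h4 h5 h6),
        by rw [hr.forest]; exact h3.kids⟩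
    by_cases hu : ∃ j ≤ I.H, u = I.anc r.leaf j
    · obtain ⟨j, hj, rfl⟩ := hu
      rcases Nat.lt_or_ge i0 j with h3 | h3
      · obtain ⟨-, New2, h4, h5⟩ := hr.full j h3 hj
        refine ⟨New1 ++ New2, by rw [h4, h1, List.append_assoc], fun C hC => ?_⟩
        rcases List.mem_append.1 hC with hC | hC
        · exact hkeep C hC
        · exact ⟨by rw [(h5 C hC).time]; omega, fun hb => ((h5 C hC).nonbot hb).elim⟩
      · obtain ⟨C, h4, h5⟩ := hr.simple j h3
        refine ⟨New1 ++ [C], by rw [h4, h1, List.append_assoc], fun D hD => ?_⟩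
        rcases List.mem_append.1 hD with hD | hD
        · exact hkeep D hD
        · obtain rfl : D = C := by simpa using hD
          refine ⟨by rw [h5.time]; omega, fun hb => ?_⟩
          obtain ⟨h6, -, h7⟩ := h5.bot hb
          have hlev : I.level (I.anc r.leaf j) = j := by rw [I.level_anc _ _ (by omega)]; omega
          refine ⟨I.anc_ne_root (by omega), I.anc_mem _ _, h6, fun l h8 h9 h10 =>
            (hr.mass_le l h10).trans_lt (hinact j h3 l h8 h9 h10), ?_⟩
          rw [hlev, hr.forest]; exact h7
    · push Not at hu
      exact ⟨New1, by rw [hr.cons_of_ne hu, h1], hkeep⟩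
  · have := hr.gain_le
    linarith
  · have := hi.R_nonneg j
    have : 0 ≤ I.gam / I.lam ^ i0 := div_nonneg hg.le (hlam _).le
    split_ifs <;> linarith
  · have h1 := hi.R_le j hj
    split_ifs <;> nlinarith
  · have h1 := hi.R_le' j hj
    split_ifs with h2
    · have h3 : threshold I r a j ≤ X.mass r.leaf :=
        h.move.le_mass h.leaf (I.anc_mem _ _) hi.mass_le (hi.sub_ge j hj.le) (hinact j h2)
      rw [max_eq_right (by linarith)] at h1
      rw [max_eq_right (by linarith)]
      nlinarith
    · refine h1.trans (mul_le_mul_of_nonneg_left (max_le_max le_rfl ?_) (by linarith))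
      linarith
  · have h1 := hr.simpSum_le (u := u) (t := t) (by rw [hi.forest]; exact h.node) (by
      have h2 := Nat.lt_succ_iff.2 hτ.le
      exact (Nat.div_lt_iff_lt_mul (by have := I.two_le_N; omega)).1 h2)
    refine h1.trans ?_
    refine (add_le_add (hi.simp u t) le_rfl).trans (le_of_eq ?_)
    rw [add_assoc, ← Finset.sum_add_distrib]
    congr 1
    refine Finset.sum_congr rfl fun j _ => ?_
    rw [hi.forest]
    by_cases h2 : j ≤ i0
    · simp only [h2, true_and, if_true]
      split_ifs
      · ring
      · simp
    · simp only [h2, false_and, if_false, add_zero]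
  · have := hi.W_nonneg i
    split_ifs <;> linarith
  · intro i hiH
    by_cases h1 : i0 ≤ i
    · refine (hpot i hiH h1).1.le ?_ ?_
      · have h2 := hr.gain_le
        have := I.gam_le_del'
        linarith
      · linarith [h.core.mass_nonneg r.leaf]
    · rw [if_neg (by omega)]; exact hi.W_le i hiH
  · intro i hiH ⟨j, hj, hact⟩
    exact hpot i hiH ((hr.least.2 (activeSib_mono hr.mass_le hact)).trans hj)
  · -- only `wSum` at the first node with an active sibling can increase
    have hmono : r.e ∈ botTimes I X u t → r.e ∈ botTimes I X' u t := by
      rintro ⟨B, hB, h1⟩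
      refine ⟨B, ?_, h1⟩
      by_cases hu : ∃ j ≤ I.H, u = I.anc r.leaf j
      · obtain ⟨j, hj, rfl⟩ := hu
        rcases Nat.lt_or_ge i0 j with h3 | h3
        · obtain ⟨-, New2, h4, h5⟩ := hr.full j h3 hj
          rw [h4]; exact List.mem_append_left _ hB
        · obtain ⟨C, h4, h5⟩ := hr.simple j h3
          rw [h4]; exact List.mem_append_left _ hB
      · push Not at hu
        rw [hr.cons_of_ne hu]; exact hB
    have hcu := I.c_pos u
    have hb : wSum I X u t ≤ wSum I S1 u t + if r.e ∈ botTimes I X' u t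
        then W (I.level u) * (4 * I.H * I.c u) else 0 := by
      refine (hi.w u t).trans (add_le_add le_rfl ?_)
      by_cases h1 : r.e ∈ botTimes I X u t
      · rw [if_pos h1, if_pos (hmono h1)]
      · rw [if_neg h1]
        have := hi.W_nonneg (I.level u)
        split_ifs <;> positivity
    rcases hr.wSum_le hh u t with h1 | ⟨hu, hbt, ⟨C, h2, h3, -⟩, New', h4, -, -, h5⟩
    · refine (h1.trans hb).trans (add_le_add le_rfl ?_)
      split_ifs
      · refine mul_le_mul_of_nonneg_right ?_ (by positivity)
        linarith
      · exact le_rfl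
      · exact le_rfl
    · rw [hτ] at hbt
      rw [if_pos hbt] at hb ⊢
      have hlev : I.level u = i0 := by rw [hu, I.level_anc _ _ (by omega)]; omega
      rw [hlev] at hb ⊢
      simp only [if_true]
      have hCC : C = C0 := by
        rw [hu, hC0] at h2
        simpa using (List.append_cancel_left h2).symm
      have hNN : New' = New := List.append_cancel_left (h4.symm.trans hN)
      rw [hNN] at h5
      have hcU : 4 * I.H * I.c u = U := by rw [HST.c, hlev, hU]
      have hZU : Z * U = (New.map fun C => C.z).sum := by
        rw [hZdef, if_pos (hCC ▸ h3), div_mul_cancel₀ _ hUpos.ne']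
      rw [hcU] at hb ⊢
      rw [add_mul, hZU]
      linarith

/-- The dual variables from simple updates in a time period: the first part of the path, up to
level `logcost`, is paid for by the mass that the requested leaf gets, and the rest by the cost of
serving the request. -/
theorem LoopInv.sum_R_le (h : LoopHyp I r lc a S1) (hi : LoopInv I r lc a S1 τ R W X) (u : V)
    (t : ℕ) : (∑ j ∈ Finset.range I.H,
      if r.e ∈ badTimes I (S1.forest (I.anc r.leaf (min j lc))) (I.anc r.leaf (min j lc)) u t
      then 2 * I.H * I.c u / I.lam ^ (min j lc) * (I.lam ^ j * R j) else 0) ≤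
    16 * I.H ^ 2 * I.c u *
      ((Finset.univ.filter fun w => r.e ∈ badTimes I (S1.forest w) w u t).card : ℝ) := by
  have hl := h.level
  have hg := I.gam_pos
  have hlam := I.lam_pow_pos
  have hH := I.H_ge
  have hc := I.c_pos u
  set D := Finset.univ.filter fun w => r.e ∈ badTimes I (S1.forest w) w u t with hD
  have hmemD : ∀ w, w ∈ D ↔ r.e ∈ badTimes I (S1.forest w) w u t := fun w => by simp [hD]
  have hR1 : ∀ j < I.H, R j ≤ 4 * I.H := by
    intro j hj
    refine (hi.R_le j hj).trans ?_
    have h1 := hi.mass_le'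
    have h2 := I.gam_le_del'
    have h3 := h.core.mass_nonneg r.leaf
    have h4 := I.del'_pos
    nlinarith
  have hR2 : ∑ j ∈ Finset.range I.H, I.lam ^ j * R j ≤ 4 * I.H * I.lam ^ lc := by
    have h1 : ∀ j ∈ Finset.range I.H, I.lam ^ j * R j ≤ 4 * I.H *
        (I.lam ^ j * ∑ l ∈ (I.sub (I.anc r.leaf j))ᶜ, a l + I.lam ^ j * ((I.n + 2) * I.gam)) := by
      intro j hj
      have h2 := hi.R_le' j (Finset.mem_range.1 hj)
      have h3 : max 0 (X.mass r.leaf - threshold I r a j) ≤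
          ∑ l ∈ (I.sub (I.anc r.leaf j))ᶜ, a l + (I.n + 2) * I.gam := by
        have h4 := hi.mass_le'
        have h5 : 0 ≤ ∑ l ∈ (I.sub (I.anc r.leaf j))ᶜ, a l :=
          Finset.sum_nonneg fun l _ => h.move.nonneg l
        have h6 := I.n_ge_three
        refine max_le (by positivity) ?_
        rw [threshold]; linarith
      have h7 := mul_le_mul_of_nonneg_left (h2.trans (mul_le_mul_of_nonneg_left h3
        (by linarith : (0 : ℝ) ≤ 4 * I.H))) (hlam j).le
      linarith
    refine (Finset.sum_le_sum h1).trans ?_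
    rw [← Finset.mul_sum, Finset.sum_add_distrib, ← Finset.sum_mul]
    refine mul_le_mul_of_nonneg_left ?_ (by linarith)
    have h2 := h.move_le
    have h3 : (1 : ℝ) ≤ I.lam ^ lc := I.one_le_lam_pow lc
    -- the choice of `γ` makes the error terms small in spite of the aspect ratio
    have h4 : (∑ j ∈ Finset.range I.H, I.lam ^ j) * ((I.n + 2) * I.gam) ≤ 1 / 2 := by
      have hgeom : ∀ m : ℕ, ∑ j ∈ Finset.range (m + 1), I.lam ^ j ≤ 2 * I.lam ^ m := by
        intro m
        induction m with
        | zero => simp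
        | succ m ih =>
          rw [Finset.sum_range_succ]
          have := I.lam_ge'
          have := hlam m
          rw [pow_succ] at *
          nlinarith
      have h5 : ∑ j ∈ Finset.range I.H, I.lam ^ j ≤ 2 * I.Δ := by
        have h6 := hgeom (I.H - 1)
        rw [Nat.sub_add_cancel (by have := I.two_le_H; omega)] at h6
        exact h6.trans (by linarith [I.Δ_ge])
      have h6 := I.n_ge_three
      have h7 : 0 < I.Δ := by linarith [I.Δ_ge']
      have h8 : 0 ≤ (I.n + 2) * I.gam := by positivity
      refine (mul_le_mul_of_nonneg_right h5 h8).trans ?_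
      have h9 : 2 * I.Δ * ((I.n + 2) * I.gam) = 2 * (I.n + 2) / I.n ^ 4 := by
        rw [Inst.gam]; field_simp
      rw [h9, div_le_div_iff₀ (by positivity) (by norm_num)]
      have h10 : (3 : ℝ) ^ 3 ≤ I.n ^ 3 := pow_le_pow_left₀ (by norm_num) h6 3
      have h11 : I.n ^ 4 = I.n * I.n ^ 3 := by ring
      rw [h11]; nlinarith
    linarith
  rw [← Finset.sum_filter_add_sum_filter_not _ (fun j => j ≤ lc)]
  -- up to level `lc`, different nodes of the path have different charging forests
  have hA : (∑ j ∈ (Finset.range I.H).filter (fun j => j ≤ lc),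
      if r.e ∈ badTimes I (S1.forest (I.anc r.leaf (min j lc))) (I.anc r.leaf (min j lc)) u t
      then 2 * I.H * I.c u / I.lam ^ (min j lc) * (I.lam ^ j * R j) else 0) ≤
      8 * I.H ^ 2 * I.c u * D.card := by
    rw [← Finset.sum_filter]
    have h1 : (((Finset.range I.H).filter (fun j => j ≤ lc)).filter fun j =>
        r.e ∈ badTimes I (S1.forest (I.anc r.leaf (min j lc))) (I.anc r.leaf (min j lc)) u t).card ≤
        D.card := by
      refine Finset.card_le_card_of_injOn (fun j => I.anc r.leaf j) (fun j hj => ?_) ?_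
      · have hj' := Finset.mem_filter.1 (Finset.mem_coe.1 hj)
        have h2 := (Finset.mem_filter.1 hj'.1).2
        rw [Finset.mem_coe, hmemD]
        have h3 := hj'.2
        rwa [min_eq_left h2] at h3
      · intro j hj j' hj' he
        have h2 := Finset.mem_range.1 (Finset.mem_filter.1
          (Finset.mem_filter.1 (Finset.mem_coe.1 hj)).1).1
        have h3 := Finset.mem_range.1 (Finset.mem_filter.1
          (Finset.mem_filter.1 (Finset.mem_coe.1 hj')).1).1
        by_contra hne
        exact anc_ne hl h2.le h3.le hne he
    calc _ ≤ ∑ j ∈ ((Finset.range I.H).filter (fun j => j ≤ lc)).filter fun j =>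
        r.e ∈ badTimes I (S1.forest (I.anc r.leaf (min j lc))) (I.anc r.leaf (min j lc)) u t,
        8 * I.H ^ 2 * I.c u := by
          refine Finset.sum_le_sum fun j hj => ?_
          have h2 := Finset.mem_filter.1 (Finset.mem_filter.1 hj).1
          rw [min_eq_left h2.2, ← mul_assoc, div_mul_cancel₀ _ (hlam j).ne']
          have h3 := hR1 j (Finset.mem_range.1 h2.1)
          have h4 : 0 ≤ 2 * I.H * I.c u := by positivity
          nlinarith
      _ ≤ _ := by
          rw [Finset.sum_const, nsmul_eq_mul, mul_comm]
          exact mul_le_mul_of_nonneg_left (by exact_mod_cast h1) (by positivity)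
  -- above level `lc`, all simple updates use the charging forest of the node on level `lc`
  have hB : (∑ j ∈ (Finset.range I.H).filter (fun j => ¬ j ≤ lc),
      if r.e ∈ badTimes I (S1.forest (I.anc r.leaf (min j lc))) (I.anc r.leaf (min j lc)) u t
      then 2 * I.H * I.c u / I.lam ^ (min j lc) * (I.lam ^ j * R j) else 0) ≤
      8 * I.H ^ 2 * I.c u * D.card := by
    have hmin : ∀ j ∈ (Finset.range I.H).filter (fun j => ¬ j ≤ lc), min j lc = lc := fun j hj =>
      min_eq_right (not_le.1 (Finset.mem_filter.1 hj).2).le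
    by_cases hb : r.e ∈ badTimes I (S1.forest (I.anc r.leaf lc)) (I.anc r.leaf lc) u t
    · have h1 : (1 : ℝ) ≤ D.card := by
        exact_mod_cast Finset.card_pos.2 ⟨_, (hmemD _).2 hb⟩
      calc _ ≤ ∑ j ∈ Finset.range I.H, 2 * I.H * I.c u / I.lam ^ lc * (I.lam ^ j * R j) := by
            rw [Finset.sum_congr rfl fun j hj => by rw [hmin j hj, if_pos hb]]
            refine Finset.sum_le_sum_of_subset_of_nonneg (Finset.filter_subset _ _) fun j _ _ => ?_
            have := hi.R_nonneg j
            have := hlam j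
            have := hlam lc
            positivity
        _ ≤ 8 * I.H ^ 2 * I.c u := by
            rw [← Finset.mul_sum, div_mul_eq_mul_div, div_le_iff₀ (hlam lc)]
            have : 0 ≤ 2 * I.H * I.c u := by positivity
            nlinarith
        _ ≤ _ := le_mul_of_one_le_right (by positivity) h1
    · rw [Finset.sum_eq_zero]
      · positivity
      · intro j hj
        rw [hmin j hj, if_neg hb]
  linarith

/-- The outcome of the while-loop for the request `r`. -/
structure LoopRes (I : Inst V) (r : Req V) (lc : ℕ) (S1 S2 : State V) : Prop where
  core : Core I (r.e * I.N + (I.N - 1)) S2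
  yinv : YInv I (r.e * I.N + (I.N - 1)) S2
  dlb : ∀ u, DualLB I S2 u
  bal : ∀ u, u ≠ I.root → Balance I S2 (r.e * I.N + (I.N - 1)) u 0
  new : ∀ u, ∃ New, S2.cons u = S1.cons u ++ New ∧
    ∀ C ∈ New, r.e * I.N < C.time ∧ (C.IsBot → NewBot I r lc S2 u C)
  mass_le : ∀ l, l ≠ r.leaf → S2.mass l ≤ S1.mass l
  forest : S2.forest = S1.forest
  served : S1.served ⊆ S2.served
  simp : ∀ u t, ∑ v, simpSum I S2 v u t ≤ ∑ v, simpSum I S1 v u t + 16 * I.H ^ 2 * I.c u *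
    ((Finset.univ.filter fun w => r.e ∈ badTimes I (S1.forest w) w u t).card : ℝ)
  w : ∀ u t, wSum I S2 u t ≤ wSum I S1 u t + if r.e ∈ botTimes I S2 u t
    then 24 * I.H * I.c u else 0

theorem WhileLoop.res (hcore : Core I (r.e * I.N) S1) (hy : YInv I (r.e * I.N) S1)
    (hdlb : ∀ u, DualLB I S1 u) (hbal : ∀ u, u ≠ I.root → Balance I S1 (r.e * I.N) u 0)
    (h : S1.mass r.leaf ≤ 1 - I.del' → ∃ a, LoopHyp I r lc a S1) (hw : WhileLoop I r lc S1 X) :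
    LoopRes I r lc S1 X := by
  obtain ⟨m, Y, hm, hY0, hYm, hstep, -⟩ := hw
  have hN := I.two_le_N
  have hH := I.H_ge
  rcases Nat.eq_zero_or_pos m with rfl | hpos
  · obtain rfl : S1 = X := hY0.symm.trans hYm
    refine ⟨hcore.mono (by omega), hy.mono (by omega), hdlb,
      fun u hu => (hbal u hu).mono_time hy.zero (by omega), fun u => ⟨[], by simp, by simp⟩,
      fun _ _ => le_rfl, rfl, subset_rfl, fun u t => ?_, fun u t => ?_⟩
    · have := I.c_pos u
      exact le_add_of_nonneg_right (by positivity)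
    · have := I.c_pos u
      refine le_add_of_nonneg_right ?_
      split_ifs <;> positivity
  · obtain ⟨a, hh⟩ := h (hY0 ▸ (hstep 0 hpos).1)
    have hinv : ∀ i ≤ m, ∃ R W, LoopInv I r lc a S1 (r.e * I.N + i) R W (Y i) := by
      intro i
      induction i with
      | zero => intro _; rw [hY0]; exact ⟨_, _, LoopInv.start hh⟩
      | succ i ih =>
        intro hi
        obtain ⟨R, W, h1⟩ := ih (by omega)
        obtain ⟨h2, h3⟩ := hstep i (by omega)
        refine h1.step (τ := r.e * I.N + i) hh (Nat.le_add_right _ _) ?_ h2 h3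
        rw [add_assoc, Nat.div_eq_of_lt_le]
        · exact Nat.le_add_right _ _
        · rw [add_mul]; omega
    obtain ⟨R, W, h1⟩ := hinv m le_rfl
    rw [hYm] at h1
    refine ⟨h1.core.mono (by omega), h1.yinv.mono (by omega), h1.dlb,
      fun u hu => (h1.bal u hu).mono_time h1.yinv.zero (by omega), h1.new, h1.mass_le, h1.forest,
      h1.served, fun u t => (h1.simp u t).trans (add_le_add le_rfl (h1.sum_R_le hh u t)),
      fun u t => (h1.w u t).trans (add_le_add le_rfl ?_)⟩
    split_ifs with h2
    · have hc := I.c_pos u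
      obtain ⟨B, hB, hb, -, hBt, -⟩ := h2
      -- the root has no such constraints
      have hu : I.level u < I.H := by
        obtain ⟨New, h3, h4⟩ := h1.new u
        rw [h3, List.mem_append] at hB
        rcases hB with hB | hB
        · have := hh.off u B hB; omega
        · exact I.level_lt ((h4 B hB).2 hb).ne_root
      have := h1.W_le _ hu
      have h5 : 0 ≤ 4 * I.H * I.c u := by positivity
      nlinarith
    · exact le_rfl

end Loop

/-! ### Invariants of a run -/

/-- The number of nodes `w` of `T_u` for which a charging tree with root `(w, q)` was built. -/
def visits (I : Inst V) (S : State V) (u : V) (q : ℕ) : ℕ :=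
  (Finset.univ.filter fun w => w ∈ I.sub u ∧ (w, q) ∈ (S.forest w).node).card

/-- What is known about a `⊥`-constraint `B` at `u`, from its creation onwards: the nodes for which
charging trees were built at that time are ancestors of the requested leaf, up to some level,
and the subtrees of `T_u` without the requested leaf are nearly empty as long as they
are not visited. -/
structure BotOK (I : Inst V) (S : State V) (u : V) (B : Con V) : Prop where
  mem : (B.f u).leaf ∈ I.sub u
  root : ∀ w, (w, B.time / I.N) ∈ (S.forest w).node → (B.f u).leaf ∈ I.sub w ∧
    ∀ w' ∈ I.sub w, (B.f u).leaf ∈ I.sub w' → (w', B.time / I.N) ∈ (S.forest w').node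
  light : ∀ w ∈ I.sub u, (B.f u).leaf ∉ I.sub w → subMass I S w ≤ I.del * I.n ∨
    ∃ q' > B.time / I.N, (w, q') ∈ (S.forest w).node
  lt_root : u ≠ I.root

/-- The invariants after the time periods `1, …, q`. -/
structure RunInv (I : Inst V) (q : ℕ) (S : State V) : Prop where
  core : Core I (q * I.N + (I.N - 1)) S
  yinv : YInv I (q * I.N + (I.N - 1)) S
  dlb : ∀ u, DualLB I S u
  bal : ∀ u, u ≠ I.root → Balance I S (q * I.N + (I.N - 1)) u 0
  forest : ∀ v, ForestInv I q S.served (S.forest v)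
  simp : ∀ u t, ∑ v, simpSum I S v u t ≤
    16 * I.H ^ 2 * I.c u * ∑ w, ((badTimes I (S.forest w) w u t).ncard : ℝ)
  w : ∀ u t, wSum I S u t ≤ 24 * I.H * I.c u * ((botTimes I S u t).ncard : ℝ)
  bot : ∀ u, ∀ B ∈ S.cons u, B.IsBot → 0 < B.time → BotOK I S u B
  /-- Between two overlapping `⊥`-constraints, the number of visited levels increases. -/
  pair : ∀ u, ∀ B ∈ S.cons u, ∀ B' ∈ S.cons u, B.IsBot → B'.IsBot → 0 < B.time →
    B.time / I.N < B'.time / I.N → (B'.f u).b ≤ B.time / I.N →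
    visits I S u (B.time / I.N) < visits I S u (B'.time / I.N)

section Congr
variable {I : Inst V} {τ : ℕ} {S S' : State V} {u : V}

theorem Core.congr (h : Core I τ S) (hm : S'.mass = S.mass) (hc : S'.cons = S.cons)
    (ha : S'.awake = S.awake) : Core I τ S' := by
  obtain ⟨m, c, a, y, f, s⟩ := S
  obtain ⟨m', c', a', y', f', s'⟩ := S'
  obtain rfl : m' = m := hm
  obtain rfl : c' = c := hc
  obtain rfl : a' = a := ha
  exact ⟨h.mass_nonneg, h.le_total, h.total_le, h.times, h.wf,
    fun w C hC u j hj => by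
      obtain ⟨σ, h1, h2⟩ := h.src w C hC u j hj
      exact ⟨σ, h1, ⟨h2.child, h2.A_inter, h2.agree, h2.time_le, h2.period, h2.bots⟩⟩,
    h.cover, h.awake, h.load_le⟩

theorem YInv.congr (h : YInv I τ S) (hc : S'.cons = S.cons) (hy : S'.y = S.y) : YInv I τ S' := by
  obtain ⟨m, c, a, y, f, s⟩ := S
  obtain ⟨m', c', a', y', f', s'⟩ := S'
  obtain rfl : c' = c := hc
  obtain rfl : y' = y := hy
  exact ⟨h.nonneg, h.zero, h.le, h.timer⟩

theorem simpSum_congr (hc : S'.cons = S.cons) (v u : V) (t : ℕ) :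
    simpSum I S' v u t = simpSum I S v u t := by rw [simpSum, simpSum, hc]

theorem wSum_congr (hc : S'.cons = S.cons) (u : V) (t : ℕ) :
    wSum I S' u t = wSum I S u t := by rw [wSum, wSum, hc]

theorem botTimes_congr (hc : S'.cons = S.cons) (u : V) (t : ℕ) :
    botTimes I S' u t = botTimes I S u t := by rw [botTimes, botTimes, hc]

theorem subMass_congr (hm : S'.mass = S.mass) (u : V) : subMass I S' u = subMass I S u := by
  rw [subMass, subMass, hm]

end Congr

/-- The invariants do not depend on which requests are served, as long as there are enough. -/
theorem RunInv.congr_served {I : Inst V} {q q' : ℕ} {S : State V} (h : RunInv I q S) (hq : q ≤ q')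
    {R : Set (Req V)} (hR : S.served ⊆ R) : RunInv I q' { S with served := R } := by
  have hτ : q * I.N + (I.N - 1) ≤ q' * I.N + (I.N - 1) :=
    Nat.add_le_add_right (Nat.mul_le_mul_right _ hq) _
  refine ⟨(h.core.mono hτ).congr rfl rfl rfl, (h.yinv.mono hτ).congr rfl rfl,
    fun u => (h.dlb u).congr rfl,
    fun u hu => ((h.bal u hu).mono_time h.yinv.zero hτ).congr rfl rfl rfl le_rfl,
    fun v => (h.forest v).mono hq hR, h.simp, h.w, fun u B hB hb ht => ?_, h.pair⟩
  have := h.bot u B hB hb ht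
  exact ⟨this.mem, this.root, this.light, this.lt_root⟩

section Start
variable (I : Inst V)

theorem isLeaf_dummy {v : V} (hv : v ∈ I.dummy) : I.IsLeaf v :=
  I.isLeaf_iff.2 (I.dummy_spec v hv).2.2

theorem RunInv.start : RunInv I 0 (start I) := by
  have hd := I.del_pos
  have hd' := I.del'_pos
  have hd'1 := I.del'_le
  have hdn := I.del_mul_n
  have hk := I.k_ge
  have hcons : ∀ v, ∀ C ∈ (KServerTW.start I).cons v, v ∈ I.dummy ∧
      C = { time := 0, A := {v}, f := fun _ => ⟨v, 0, 0⟩, tau := fun _ => 0, mass := 1 / 2,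
            src := fun _ => none, z := 0 } := by
    intro v C hC
    simp only [KServerTW.start] at hC
    split_ifs at hC with h1
    · exact ⟨h1, by simpa using hC⟩
    · simp at hC
  have hmass : ∀ l, 0 ≤ (KServerTW.start I).mass l := by
    intro l
    simp only [KServerTW.start]
    split_ifs <;> linarith
  have hnoT : ∀ v, ∀ C ∈ (KServerTW.start I).cons v, C.time = 0 ∧ C.z = 0 ∧ C.IsBot ∧
      (∀ u, C.src u = none) := by
    intro v C hC
    obtain ⟨-, rfl⟩ := hcons v C hC
    exact ⟨rfl, rfl, by simp [Con.IsBot], fun _ => rfl⟩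
  have htot : subMass I (KServerTW.start I) I.root =
      I.k + ∑ l ∈ Finset.univ.filter (fun l => l ∉ I.dummy ∧ I.IsLeaf l), I.del / 2 := by
    have h1 : subMass I (KServerTW.start I) I.root = ∑ l, (KServerTW.start I).mass l := by
      rw [subMass, Finset.sum_filter, ← Finset.sum_subset (Finset.subset_univ (I.sub I.root))]
      · refine Finset.sum_congr rfl fun l _ => ?_
        by_cases h2 : I.IsLeaf l
        · rw [if_pos h2]
        · have h3 : l ∉ I.dummy := fun h3 => h2 (isLeaf_dummy I h3)
          simp [KServerTW.start, h2, h3]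
      · intro l _ hl; exact (hl (I.mem_sub_root l)).elim
    have h2 : ∀ l, (KServerTW.start I).mass l = (if l ∈ I.dummy then (1 : ℝ) / 2 else 0) +
        if l ∉ I.dummy ∧ I.IsLeaf l then I.del / 2 else 0 := by
      intro l
      simp only [KServerTW.start]
      by_cases h3 : l ∈ I.dummy <;> by_cases h4 : I.IsLeaf l <;> simp [h3, h4]
    rw [h1, Finset.sum_congr rfl fun l _ => h2 l, Finset.sum_add_distrib, ← Finset.sum_filter,
      ← Finset.sum_filter, Finset.sum_const, nsmul_eq_mul]
    congr 1
    have h5 : Finset.univ.filter (fun l => l ∈ I.dummy) = I.dummy := by ext; simp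
    rw [h5, I.dummy_card]
    push_cast; ring
  have hoth : 0 ≤ ∑ l ∈ Finset.univ.filter (fun l => l ∉ I.dummy ∧ I.IsLeaf l), I.del / 2 ∧
      ∑ l ∈ Finset.univ.filter (fun l => l ∉ I.dummy ∧ I.IsLeaf l), I.del / 2 ≤ 1 := by
    refine ⟨Finset.sum_nonneg fun _ _ => by linarith, ?_⟩
    rw [Finset.sum_const, nsmul_eq_mul]
    have h1 : ((Finset.univ.filter (fun l => l ∉ I.dummy ∧ I.IsLeaf l)).card : ℝ) ≤ I.n := by
      rw [HST.n]; exact_mod_cast Finset.card_le_univ _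
    nlinarith
  have hload : ∀ u j, load I (KServerTW.start I) u j = 0 := by
    intro u j
    rw [load_eq]
    refine sum_map_zero fun C hC => ?_
    rw [(hnoT _ C hC).2.1]; simp
  have hcore : Core I (0 * I.N + (I.N - 1)) (KServerTW.start I) := by
    refine ⟨hmass, by rw [htot]; linarith [hoth.1], by rw [htot]; linarith [hoth.2],
      fun v C hC => by rw [(hnoT v C hC).1]; omega, fun v C hC => ?_, fun v C hC u j hj => ?_,
      fun v C hC => ?_, fun u j B hB => ?_, fun u j B hB hb => ?_⟩
    · obtain ⟨h1, rfl⟩ := hcons v C hC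
      refine ⟨by simpa using I.self_mem_sub v, by simp, rfl, le_rfl, ?_, fun _ => ⟨rfl, rfl, fun _ => rfl⟩,
        fun h2 => (h2 (by simp [Con.IsBot])).elim, ?_⟩
      · rw [rhs_eq (by simpa using I.self_mem_sub v)]
        simp only [Finset.card_singleton, Nat.cast_one]
        have := I.nv_pos v
        nlinarith
      · change (1 : ℝ) / 2 ≤ I.k + 1
        linarith
    · rw [(hnoT v C hC).2.2.2] at hj; cases hj
    · rintro ⟨u, hu⟩; exact (hu ((hnoT v C hC).2.2.2 u)).elim
    · left
      obtain ⟨h1, rfl⟩ := hcons u B (mem_of_getElem? hB)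
      simp [KServerTW.start, h1]
    · exact (hb (hnoT u B (mem_of_getElem? hB)).2.2.1).elim
  have hsum0 : ∀ v u t, simpSum I (KServerTW.start I) v u t = 0 := fun v u t =>
    sum_map_zero fun C hC => by rw [(hnoT v C hC).2.1]; simp
  refine ⟨hcore, ⟨fun _ _ _ => le_rfl, fun _ _ _ _ => rfl, fun v u t => ?_, fun v u hu t => ?_⟩,
    fun u T hT => ?_, fun u hu => ?_, fun v => ?_, fun u t => ?_, fun u t => ?_,
    fun u B hB _ ht => ?_, fun u B hB B' hB' _ _ ht => ?_⟩
  · change (0 : ℝ) ≤ I.k + 3; linarith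
  · have : timerSum (KServerTW.start I) v u t = 0 := sum_map_zero fun C hC => by
      rw [(hnoT v C hC).2.1]; simp
    rw [this]
    simp [KServerTW.start]
  · obtain ⟨C, hC, -, hb⟩ := hT
    exact (hb (hnoT u C hC).2.2.1).elim
  · intro C0 hC0 _
    have hpot : pot I (KServerTW.start I) u C0.time = 0 := idxSum_zero fun j B hB => by
      rw [(hnoT u B (mem_of_getElem? hB)).1, if_neg (by omega)]
    obtain ⟨h1, rfl⟩ := hcons u C0 hC0
    rw [hpot]
    have hleaf := isLeaf_dummy I h1
    have h2 : subMass I (KServerTW.start I) u = 1 / 2 := by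
      rw [subMass, I.sub_eq_of_isLeaf hleaf, Finset.sum_filter, Finset.sum_singleton, if_pos hleaf]
      simp [KServerTW.start, h1]
    rw [h2]
    have := I.gam_pos
    simp [KServerTW.start]
    exact this.le
  · refine ⟨?_, ?_, ?_, ?_, ?_, ?_, ?_, ?_, ?_⟩ <;> simp [KServerTW.start]
  · have := I.c_pos u
    rw [Finset.sum_congr rfl fun v _ => hsum0 v u t, Finset.sum_const_zero]
    positivity
  · have : wSum I (KServerTW.start I) u t = 0 := sum_map_zero fun C hC => by
      rw [(hnoT _ C hC).2.1]; simp
    rw [this]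
    have := I.c_pos u
    positivity
  · rw [(hnoT u B hB).1] at ht; omega
  · rw [(hnoT u B hB).1] at ht; omega

end Start

/-- The effect of building the charging trees for the critical request `r`. -/
structure Built (I : Inst V) (S S1 : State V) (r : Req V) (R : Set (Req V)) : Prop where
  mass : S1.mass = S.mass
  cons : S1.cons = S.cons
  awake : S1.awake = S.awake
  y : S1.y = S.y
  served : S1.served = S.served
  inv : ∀ v, ForestInv I r.e R (S1.forest v)
  node : ∀ v w p, p ≠ r.e → ((w, p) ∈ (S1.forest v).node ↔ (w, p) ∈ (S.forest v).node)
  visit : ∀ w, (w, r.e) ∈ (S1.forest w).node ↔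
    ∃ i ≤ min (logCost I S r.leaf) I.H, w = I.anc r.leaf i
  req : ∀ i ≤ min (logCost I S r.leaf) I.H,
    (S1.forest (I.anc r.leaf i)).req (I.anc r.leaf i, r.e) = r
  bad : ∀ v u t, badTimes I (S.forest v) v u t ⊆ badTimes I (S1.forest v) v u t

theorem BuildTree.built {I : Inst V} {q : ℕ} {S S1 : State V} {r : Req V} {tr : V → Set V}
    (h : ∀ v, ForestInv I q S.served (S.forest v)) (hc : Critical I S (q + 1) r)
    (hb : BuildTree I S S1 r tr) : Built I S S1 r
      (S.served ∪ {s | Outstanding I S (q + 1) s ∧ ∃ v, s.leaf ∈ tr v}) := by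
  obtain ⟨F', rfl, hF⟩ := hb
  obtain ⟨hr, he, hns⟩ := hc
  have hout : Outstanding I S r.e r := ⟨hr, (I.req_window r hr).2.le, le_rfl, hns⟩
  have hq : q < r.e := by omega
  refine ⟨rfl, rfl, rfl, rfl, rfl, fun v => ?_, fun v w _ hp => ?_, fun w => ?_, fun i hi => ?_,
    fun v u t => ?_⟩
  · have h1 := hF v
    split_ifs at h1 with h2
    · refine (h1.forestInv (h v) hq).mono le_rfl ?_
      rw [he]
      rintro s (hs | hs)
      exacts [Or.inl hs, Or.inr ⟨hs.1, v, hs.2⟩]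
    · simp only [h1.1]
      exact (h v).mono hq.le Set.subset_union_left
  · have h1 := hF v
    split_ifs at h1 with h2
    · exact h1.node_subset hp
    · simp only [h1.1]
  · have h1 := hF w
    split_ifs at h1 with h2
    · exact ⟨fun _ => h2, fun _ => h1.node_root⟩
    · simp only [h1.1]
      refine ⟨fun h3 => ?_, fun h3 => (h2 h3).elim⟩
      have := (h w).le _ _ h3
      omega
  · have h1 := hF (I.anc r.leaf i)
    rw [if_pos ⟨i, hi, rfl⟩] at h1
    exact h1.req_root hout rfl (I.anc_mem _ _)
  · have h1 := hF v
    split_ifs at h1 with h2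
    · exact h1.badTimes_subset (h v) hq v u t
    · simp only [h1.1]
      exact subset_rfl

theorem Core.finite_botTimes {I : Inst V} {τ : ℕ} {S : State V} (h : Core I τ S) (u : V) (t : ℕ) :
    (botTimes I S u t).Finite := by
  refine (Set.finite_le_nat τ).subset ?_
  rintro q ⟨B, hB, -, -, rfl, -⟩
  exact (Nat.div_le_self _ _).trans (h.times u B hB)

theorem ForestInv.finite_badTimes {I : Inst V} {q : ℕ} {R : Set (Req V)} {F : Forest V}
    (h : ForestInv I q R F) (v u : V) (t : ℕ) : (badTimes I F v u t).Finite :=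
  (Set.finite_le_nat q).subset fun _ hp => h.le _ _ hp.1

theorem RunInv.critical {I : Inst V} {q : ℕ} {S S1 S2 : State V} {r : Req V} {tr : V → Set V}
    (h : RunInv I q S) (hc : Critical I S (q + 1) r) (hb : BuildTree I S S1 r tr)
    (hw : WhileLoop I r (logCost I S r.leaf) S1 S2) :
    RunInv I (q + 1) { S2 with
      served := S2.served ∪ {s | Outstanding I S1 (q + 1) s ∧ ∃ v, s.leaf ∈ tr v} } := by
  have hB := hb.built h.forest hc
  obtain ⟨hr, he, hns⟩ := hc
  have hN := I.two_le_N
  have hlevel : I.level r.leaf = 0 := I.leaf_level _ (I.req_leaf r hr).1 (I.req_leaf r hr).2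
  have hleaf : I.IsLeaf r.leaf := I.isLeaf_iff.2 (I.req_leaf r hr).2
  set lc := logCost I S r.leaf with hlc
  have hτ : q * I.N + (I.N - 1) ≤ r.e * I.N := by rw [he, add_mul]; omega
  have hoff : ∀ u, ∀ C ∈ S.cons u, C.time / I.N ≤ q := by
    intro u C hC
    have h1 := h.core.times u C hC
    rw [← Nat.lt_succ_iff, Nat.div_lt_iff_lt_mul (by omega), Nat.succ_mul]
    omega
  have hcore1 : Core I (r.e * I.N) S1 := (h.core.mono hτ).congr hB.mass hB.cons hB.awake
  have hminH : ∀ i ≤ I.H, min i lc ≤ min lc I.H := fun i hi => by omega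
  have hres : LoopRes I r lc S1 S2 := by
    refine hw.res hcore1 ((h.yinv.mono hτ).congr hB.cons hB.y)
      (fun u => (h.dlb u).congr (by rw [hB.cons]))
      (fun u hu => ((h.bal u hu).mono_time h.yinv.zero hτ).congr (by rw [hB.cons]) (by rw [hB.cons])
        (by rw [hB.y]) (by rw [subMass_congr hB.mass])) fun hm => ?_
    rw [hB.mass] at hm
    obtain ⟨a, ha, ha2⟩ := exists_isMove_le hlevel hleaf h.core.mass_nonneg h.core.le_total hm
    refine ⟨a, hlevel, hleaf, by rw [hB.mass]; exact hm, hcore1, (h.yinv.mono hτ).congr hB.cons hB.y,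
      fun u => (h.dlb u).congr (by rw [hB.cons]),
      fun u hu => ((h.bal u hu).mono_time h.yinv.zero hτ).congr (by rw [hB.cons]) (by rw [hB.cons])
        (by rw [hB.y]) (by rw [subMass_congr hB.mass]), fun u C hC => ?_,
      fun i hi => (hB.inv _).treeOK _, fun i hi => (hB.visit _).2 ⟨_, hminH i hi, rfl⟩,
      ⟨ha.nonneg, by rw [hB.mass]; exact ha.leaf, by rw [hB.mass]; exact ha.total⟩, ha2⟩
    rw [hB.cons] at hC
    have := hoff u C hC
    omega
  have hcons : ∀ u, ∃ New, S2.cons u = S.cons u ++ New ∧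
      ∀ C ∈ New, C.time / I.N = q + 1 ∧ (C.IsBot → NewBot I r lc S2 u C) := by
    intro u
    obtain ⟨New, h1, h2⟩ := hres.new u
    refine ⟨New, by rw [h1, hB.cons], fun C hC => ⟨?_, (h2 C hC).2⟩⟩
    have h3 := hres.core.times u C (by rw [h1]; exact List.mem_append_right _ hC)
    have h4 := (h2 C hC).1
    rw [← he]
    refine Nat.div_eq_of_lt_le h4.le ?_
    rw [add_mul]; omega
  have hmemS : ∀ u, ∀ C ∈ S.cons u, C ∈ S2.cons u := by
    intro u C hC
    obtain ⟨New, h1, -⟩ := hcons u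
    rw [h1]; exact List.mem_append_left _ hC
  have hnode : ∀ w p, p ≤ q → ((w, p) ∈ (S2.forest w).node ↔ (w, p) ∈ (S.forest w).node) :=
    fun w p hp => by rw [hres.forest]; exact hB.node w w p (by omega)
  have hvisit : ∀ w, (w, q + 1) ∈ (S2.forest w).node ↔ ∃ i ≤ min lc I.H, w = I.anc r.leaf i :=
    fun w => by rw [hres.forest, ← he]; exact hB.visit w
  have hvisits : ∀ u p, p ≤ q → visits I S2 u p = visits I S u p := by
    intro u p hp
    unfold visits
    congr 1
    ext w
    simp only [Finset.mem_filter, Finset.mem_univ, true_and, hnode w p hp]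
  have hanc : ∀ w, r.leaf ∈ I.sub w → w = I.anc r.leaf (I.level w) := by
    intro w hw
    have := (I.eq_anc_of_mem_sub hw).2
    rw [hlevel, Nat.sub_zero] at this
    exact this.symm
  -- a nearly empty subtree that receives server mass is visited
  have hlight : ∀ w, r.leaf ∈ I.sub w → subMass I S w ≤ I.del * I.n → I.level w + 1 ≤ lc := by
    intro w hw hsm
    refine le_logCost hlevel hleaf h.core.mass_nonneg h.core.le_total ?_ hw hsm
    have h1 : S.mass r.leaf ≤ subMass I S w :=
      Finset.single_le_sum (f := S.mass) (fun l _ => h.core.mass_nonneg l)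
        (Finset.mem_filter.2 ⟨hw, hleaf⟩)
    have h2 := I.del_mul_n
    have h3 := I.del'_le
    linarith
  set S3 : State V := { S2 with
      served := S2.served ∪ {s | Outstanding I S1 (q + 1) s ∧ ∃ v, s.leaf ∈ tr v} } with hS3
  have hcore2 := hres.core
  have hyinv2 := hres.yinv
  have hbal2 := hres.bal
  rw [he] at hcore2 hyinv2 hbal2
  have hbadq : ∀ w u t, q + 1 ∉ badTimes I (S.forest w) w u t := fun w u t hx => by
    have := (h.forest w).le _ _ hx.1; omega
  refine ⟨hcore2.congr rfl rfl rfl, hyinv2.congr rfl rfl, fun u => (hres.dlb u).congr rfl,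
    fun u hu => (hbal2 u hu).congr rfl rfl rfl le_rfl, fun v => ?_, fun u t => ?_, fun u t => ?_,
    fun u B hBm hbot hpos => ?_, fun u B hBm B' hBm' hbot hbot' hpos hlt hov => ?_⟩
  -- the charging forests
  · change ForestInv I (q + 1) _ (S2.forest v)
    rw [hres.forest, ← he]
    refine (hB.inv v).mono le_rfl ?_
    rintro s (hs | hs)
    · exact Or.inl (hres.served (hB.served ▸ hs))
    · refine Or.inr ⟨?_, hs.2⟩
      rw [Outstanding, hB.served]; exact hs.1
  -- every tree that charges `t` in the current time period is counted for the first time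
  · have h1 := hres.simp u t
    have h2 := h.simp u t
    rw [Finset.sum_congr rfl fun v _ => simpSum_congr hB.cons v u t] at h1
    have hc := I.c_pos u
    have h3 : ∑ w, ((badTimes I (S.forest w) w u t).ncard : ℝ) +
        ((Finset.univ.filter fun w => q + 1 ∈ badTimes I (S1.forest w) w u t).card : ℝ) ≤
        ∑ w, ((badTimes I (S3.forest w) w u t).ncard : ℝ) := by
      rw [Finset.card_filter, Nat.cast_sum, ← Finset.sum_add_distrib]
      refine Finset.sum_le_sum fun w _ => ?_
      have h4 : S3.forest w = S1.forest w := by rw [← hres.forest]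
      have hfin := (hB.inv w).finite_badTimes w u t
      rw [h4]
      split_ifs with h5
      · have h6 : insert (q + 1) (badTimes I (S.forest w) w u t) ⊆ badTimes I (S1.forest w) w u t :=
          Set.insert_subset h5 (hB.bad w u t)
        have h7 := Set.ncard_le_ncard h6 hfin
        rw [Set.ncard_insert_of_notMem (hbadq w u t) ((h.forest w).finite_badTimes w u t)] at h7
        exact_mod_cast h7
      · have h7 := Set.ncard_le_ncard (hB.bad w u t) hfin
        push_cast
        rw [add_zero]; exact_mod_cast h7
    rw [Finset.sum_congr rfl fun v _ => simpSum_congr (S := S2) (S' := S3) rfl v u t]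
    have h8 : (0 : ℝ) ≤ 16 * I.H ^ 2 * I.c u := by positivity
    rw [he] at h1
    nlinarith
  -- likewise for the `⊥`-constraints
  · have h1 := hres.w u t
    rw [wSum_congr hB.cons, he] at h1
    rw [wSum_congr (S := S2) (S' := S3) rfl, botTimes_congr (S := S2) (S' := S3) rfl]
    have h2 := h.w u t
    have hc := I.c_pos u
    have hsub : botTimes I S u t ⊆ botTimes I S2 u t := by
      rintro p ⟨B, hB1, hB2⟩
      exact ⟨B, hmemS u B hB1, hB2⟩
    have hfin := hcore2.finite_botTimes u t
    have h8 : (0 : ℝ) ≤ 24 * I.H * I.c u := by positivity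
    have h3 : ((botTimes I S u t).ncard : ℝ) + (if q + 1 ∈ botTimes I S2 u t then 1 else 0) ≤
        (botTimes I S2 u t).ncard := by
      split_ifs with h5
      · have h7 := Set.ncard_le_ncard (Set.insert_subset h5 hsub) hfin
        rw [Set.ncard_insert_of_notMem ?_ (h.core.finite_botTimes u t)] at h7
        · exact_mod_cast h7
        · rintro ⟨B, hB1, -, -, hB2, -⟩
          have := hoff u B hB1; omega
      · have h7 := Set.ncard_le_ncard hsub hfin
        rw [add_zero]; exact_mod_cast h7
    refine h1.trans ((add_le_add h2 le_rfl).trans ?_)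
    refine le_trans (le_of_eq ?_) (mul_le_mul_of_nonneg_left h3 h8)
    split_ifs <;> ring
  -- nearly empty subtrees either stay so or are visited in the current time period
  · obtain ⟨New, h1, h2⟩ := hcons u
    have hBm1 : B ∈ S.cons u ++ New := h1 ▸ hBm
    rcases List.mem_append.1 hBm1 with h3 | h3
    · have h4 := h.bot u B h3 hbot hpos
      have h5 := hoff u B h3
      refine ⟨h4.mem, fun w hw => ?_, fun w hwu hwl => ?_, h4.lt_root⟩
      · obtain ⟨h6, h7⟩ := h4.root w ((hnode w _ h5).1 hw)
        exact ⟨h6, fun w' h8 h9 => (hnode w' _ h5).2 (h7 w' h8 h9)⟩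
      · rcases h4.light w hwu hwl with h6 | ⟨p, h6, h7⟩
        · by_cases h8 : r.leaf ∈ I.sub w
          · right
            refine ⟨q + 1, by omega, (hvisit w).2 ⟨I.level w, ?_, hanc w h8⟩⟩
            have := hlight w h8 h6
            have := I.level_le w
            omega
          · left
            refine le_trans (Finset.sum_le_sum fun l hl => ?_) h6
            have h9 : l ≠ r.leaf := by
              rintro rfl; exact h8 (Finset.mem_filter.1 hl).1
            have h10 := hres.mass_le l h9
            rw [hB.mass] at h10
            exact h10
        · right
          exact ⟨p, h6, (hnode w p ((h.forest w).le _ _ h7)).2 h7⟩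
    · have h4 := (h2 B h3).2 hbot
      have h5 := (h2 B h3).1
      refine ⟨by rw [h4.f_eq]; exact h4.mem, fun w hw => ?_, fun w hwu hwl => ?_, h4.ne_root⟩
      · rw [h5] at hw ⊢
        rw [h4.f_eq]
        obtain ⟨i, hi, rfl⟩ := (hvisit w).1 hw
        refine ⟨I.anc_mem _ _, fun w' h6 h7 => (hvisit w').2 ⟨I.level w', ?_, hanc w' h7⟩⟩
        have h8 := I.level_le_of_mem_sub h6
        rw [I.level_anc _ _ (by omega)] at h8
        omega
      · left
        rw [h4.f_eq] at hwl
        have h6 : subMass I S3 w ≤ ∑ l ∈ (I.sub w).filter I.IsLeaf, I.del := by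
          refine Finset.sum_le_sum fun l hl => ?_
          rw [Finset.mem_filter] at hl
          refine (h4.lt l (I.mem_sub_trans hl.1 hwu) hl.2 ?_).le
          rintro rfl; exact hwl hl.1
        refine h6.trans ?_
        rw [Finset.sum_const, nsmul_eq_mul, mul_comm]
        refine mul_le_mul_of_nonneg_left ?_ I.del_pos.le
        rw [HST.n]; exact_mod_cast Finset.card_le_univ _
  -- the new `⊥`-constraints at `u` come with more visited levels than the earlier ones
  · obtain ⟨New, h1, h2⟩ := hcons u
    have hBm1 : B ∈ S.cons u ++ New := h1 ▸ hBm
    have hBm1' : B' ∈ S.cons u ++ New := h1 ▸ hBm'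
    change visits I S2 u _ < visits I S2 u _
    rcases List.mem_append.1 hBm1' with h3' | h3'
    · have h4' := hoff u B' h3'
      rcases List.mem_append.1 hBm1 with h3 | h3
      · rw [hvisits u _ (hoff u B h3), hvisits u _ h4']
        exact h.pair u B h3 B' h3' hbot hbot' hpos hlt hov
      · have := (h2 B h3).1; omega
    · have h4' := (h2 B' h3').2 hbot'
      have h5' := (h2 B' h3').1
      rcases List.mem_append.1 hBm1 with h3 | h3
      swap
      · have := (h2 B h3).1; omega
      have hold := h.bot u B h3 hbot hpos
      have hqa := hoff u B h3
      rw [h4'.f_eq] at hov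
      set p := B.time / I.N with hp
      set s := min (I.level u) lc with hs
      set ws := I.anc r.leaf s with hws
      have hsH : s ≤ min lc I.H := by have := I.level_le u; omega
      have hwslev : I.level ws = s := by rw [hws, I.level_anc _ _ (by omega)]; omega
      have hwsu : ws ∈ I.sub u :=
        I.mem_sub_of_level_le (I.anc_mem _ _) h4'.mem (by omega)
      -- the node `ws` has not been visited since the start of the window of `r`
      have hdead : ∀ p' ≤ q, (ws, p') ∈ (S.forest ws).node → p' < r.b := by
        intro p' hp' hn
        have h6 := (hB.inv ws).dead ws r.e ((hB.visit ws).2 ⟨s, hsH, rfl⟩)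
          (by rw [← hres.forest]; exact h4'.kids) p' (by omega)
          ((hB.node ws ws p' (by omega)).2 hn)
        rwa [hB.req s hsH] at h6
      -- in the current time period, the levels up to that of `ws` are visited
      have hbig : s + 1 ≤ visits I S2 u (B'.time / I.N) := by
        rw [h5', visits]
        calc s + 1 = ((Finset.range (s + 1)).image fun i => I.anc r.leaf i).card := by
              rw [Finset.card_image_of_injOn, Finset.card_range]
              intro i hi j hj hij
              have hi' := Finset.mem_range.1 (Finset.mem_coe.1 hi)
              have hj' := Finset.mem_range.1 (Finset.mem_coe.1 hj)
              by_contra hne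
              exact anc_ne hlevel (by omega) (by omega) hne hij
          _ ≤ _ := by
              refine Finset.card_le_card fun w hw => ?_
              obtain ⟨i, hi, rfl⟩ := Finset.mem_image.1 hw
              have hi' := Finset.mem_range.1 hi
              refine Finset.mem_filter.2 ⟨Finset.mem_univ _, ?_, (hvisit _).2 ⟨i, by omega, rfl⟩⟩
              refine I.mem_sub_of_level_le (I.anc_mem _ _) h4'.mem ?_
              rw [I.level_anc _ _ (by omega)]; omega
      -- in the earlier time period, the visits ended below `ws`: otherwise `ws` would have been visited
      -- then, or later when its nearly empty subtree received server mass
      have hsmall : visits I S2 u p ≤ s := by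
        rw [hvisits u p hqa, visits]
        have hin : (B.f u).leaf ∈ I.sub ws := by
          by_contra hnot
          rcases hold.light ws hwsu hnot with h6 | ⟨p', h6, h7⟩
          · have h7 := hlight ws (I.anc_mem _ _) h6
            have h8 : ws = u := I.eq_of_mem_sub_of_level hwsu (by omega)
            rw [h8] at hnot
            exact hnot hold.mem
          · have := hdead p' ((h.forest ws).le _ _ h7) h7
            omega
        have hnotv : (ws, p) ∉ (S.forest ws).node := fun h6 => by
          have := hdead p hqa h6
          omega
        calc _ ≤ (Finset.range s).card := by
              refine Finset.card_le_card_of_injOn (fun w => I.level w) (fun w hw => ?_) ?_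
              · have hw' := (Finset.mem_filter.1 (Finset.mem_coe.1 hw)).2
                rw [Finset.mem_coe, Finset.mem_range]
                by_contra h6
                change ¬ I.level w < s at h6
                obtain ⟨h7, h8⟩ := hold.root w hw'.2
                exact hnotv (h8 ws (I.mem_sub_of_level_le hin h7 (by omega)) hin)
              · intro w hw w' hw' hww
                have h6 := (Finset.mem_filter.1 (Finset.mem_coe.1 hw)).2
                have h7 := (Finset.mem_filter.1 (Finset.mem_coe.1 hw')).2
                exact I.eq_of_level_eq (hold.root w h6.2).1 (hold.root w' h7.2).1 hww
          _ = s := Finset.card_range s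
      omega

theorem Run.inv {I : Inst V} {q : ℕ} {S : State V} (h : Run I q S) : RunInv I q S := by
  induction h with
  | start => exact RunInv.start I
  | idle q S _ _ ih => exact ih.congr_served (by omega) Set.subset_union_left
  | critical q S S1 S2 r tr _ hc hb hw ih => exact ih.critical hc hb hw

/-! ### Dual feasibility -/

theorem sum_map_finset_sum {α ι : Type*} (L : List α) (s : Finset ι) (g : α → ι → ℝ) :
    (L.map fun a => ∑ i ∈ s, g a i).sum = ∑ i ∈ s, (L.map fun a => g a i).sum := by
  induction L with
  | nil => simp
  | cons a L ih => simp [ih, Finset.sum_add_distrib]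

/-- The total of the dual variables of the constraints at `v` in which `y(u, t)` occurs. -/
def occSum (I : Inst V) (S : State V) (v u : V) (t : ℕ) : ℝ :=
  ((S.cons v).map fun C => if C.Occurs I v u t then C.z else 0).sum

/-- The part of `occSum` from composed constraints. -/
def compSum (I : Inst V) (S : State V) (v u : V) (t : ℕ) : ℝ :=
  ((S.cons v).map fun C => if (¬ ∀ x, C.src x = none) ∧ C.Occurs I v u t then C.z else 0).sum

section Occ
variable {I : Inst V} {τ : ℕ} {S : State V} {u v w : V} {t : ℕ}

theorem occSum_eq : occSum I S v u t = compSum I S v u t + simpSum I S v u t := by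
  rw [occSum, compSum, simpSum, ← List.sum_map_add]
  refine sum_map_congr fun C _ => ?_
  by_cases h1 : ∀ x, C.src x = none <;> by_cases h2 : C.Occurs I v u t <;> simp [h1, h2]

theorem Con.Occurs.lt {C : Con V} (h : C.Occurs I v u t) : ∃ a ∈ C.A, a ∈ I.sub u := by
  obtain ⟨h1, h2, -⟩ := h
  rw [HST.subTo, Finset.mem_filter] at h1
  exact h1.2.resolve_left h2

/-- In a composed constraint, the variables below a child `w` occur as in its source at `w`. -/
theorem Core.exists_source (h : Core I τ S) {C : Con V} (hC : C ∈ S.cons v)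
    (hs : ¬ ∀ x, C.src x = none) (ho : C.Occurs I v u t) (hw : w ∈ I.children v)
    (huw : u ∈ I.sub w) : ∃ j σ, C.src w = some j ∧ (S.cons w)[j]? = some σ ∧ SrcOK I S v C w σ := by
  obtain ⟨a, ha, hau⟩ := ho.lt
  push Not at hs
  obtain ⟨w', hw', haw'⟩ := h.cover v C hC hs a ha
  obtain ⟨j, hj⟩ := Option.ne_none_iff_exists'.1 hw'
  obtain ⟨σ, h1, h2⟩ := h.src v C hC w' j hj
  have h3 : w' = w := by
    by_contra hne
    exact Finset.disjoint_left.1 (I.disjoint_sub h2.child hw hne) haw' (I.mem_sub_trans hau huw)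
  subst h3
  exact ⟨j, σ, hj, h1, h2⟩

theorem SrcOK.occurs {C σ : Con V} (h : SrcOK I S v C w σ) (ho : C.Occurs I v u t)
    (huw : u ∈ I.sub w) (hne : u ≠ w) : σ.Occurs I w u t := by
  obtain ⟨a, ha, hau⟩ := ho.lt
  have hA : ∀ x ∈ I.sub w, x ∈ σ.A ↔ x ∈ C.A := fun x hx => by
    rw [← h.A_inter, Finset.mem_inter]; exact and_iff_left hx
  have hp := h.agree _ (I.parent_mem_sub huw hne)
  have hu := h.agree u huw
  refine ⟨?_, hne, ?_⟩
  · rw [HST.subTo, Finset.mem_filter]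
    exact ⟨huw, Or.inr ⟨a, (hA a (I.mem_sub_trans hau huw)).2 ha, hau⟩⟩
  · have h1 := ho.2.2
    rw [hu.1, hu.2, hp.2] at h1
    rw [hA u huw]
    exact h1

theorem ConWF.not_isBot_of_occurs {C : Con V} (h : ConWF I v C) (ho : C.Occurs I v u t) :
    ¬ C.IsBot := fun hb => by
  obtain ⟨a, ha, hau⟩ := ho.lt
  rw [(h.bot hb).1, Finset.mem_singleton] at ha
  subst ha
  have h1 := ho.1
  rw [HST.subTo, Finset.mem_filter] at h1
  exact ho.2.1 (I.eq_of_mem_sub_of_level h1.1 (I.level_le_of_mem_sub hau))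

/-- As no constraint is used beyond its capacity, the dual variables grow by a factor of at most
`1 + 1 / H` from a node to its parent. -/
theorem Core.compSum_le (h : Core I τ S) (hw : w ∈ I.children v) (huw : u ∈ I.sub w) (hne : u ≠ w) :
    compSum I S v u t ≤ (1 + 1 / (I.H : ℝ)) * occSum I S w u t := by
  have hpar : I.parent w = v := (I.mem_children.1 hw).2
  calc compSum I S v u t ≤ ((S.cons v).map fun C => idxSum (S.cons w) fun j σ =>
        if σ.Occurs I w u t then (if C.src w = some j then C.z else 0) else 0).sum := by
        refine sum_map_le fun C hC => ?_
        have hz := (h.wf v C hC).z_nonneg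
        split_ifs with h1
        · obtain ⟨j, σ, h2, h3, h4⟩ := h.exists_source hC h1.1 h1.2 hw huw
          have h5 := h4.occurs h1.2 huw hne
          refine le_trans (le_of_eq ?_) (idxSum_le (f := fun j' (_ : Con V) =>
            if j' = j then C.z else 0) fun j' σ' h6 => ?_)
          · exact (idxSum_single h3 fun _ => C.z).symm
          · by_cases h7 : j' = j
            · subst h7
              rw [h3] at h6
              obtain rfl := Option.some.inj h6
              simp [h5, h2]
            · simp only [if_neg h7]
              split_ifs <;> simp [hz]
        · refine le_trans (le_of_eq (idxSum_zero (f := fun _ _ => 0) fun _ _ _ => rfl).symm)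
            (idxSum_le fun j σ _ => ?_)
          split_ifs <;> simp [hz]
    _ = idxSum (S.cons w) fun j σ => if σ.Occurs I w u t then load I S w j else 0 := by
        rw [sum_map_idxSum]
        refine idxSum_congr fun j σ _ => ?_
        split_ifs with h1
        · rw [load_eq, hpar]
        · simp
    _ ≤ idxSum (S.cons w) fun _ σ =>
        (1 + 1 / (I.H : ℝ)) * (if σ.Occurs I w u t then σ.z else 0) := by
        refine idxSum_le fun j σ hσ => ?_
        split_ifs with h1
        · exact h.load_le w j σ hσ ((h.wf w σ (mem_of_getElem? hσ)).not_isBot_of_occurs h1)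
        · simp
    _ = _ := by
        rw [idxSum_mul (S.cons w) _ fun _ σ => if σ.Occurs I w u t then σ.z else 0, idxSum_const,
          occSum]

theorem Core.simpSum_nonneg (h : Core I τ S) : 0 ≤ simpSum I S v u t :=
  sum_map_nonneg fun C hC => by
    have := (h.wf v C hC).z_nonneg
    split_ifs <;> simp [this]

/-- Following the sources downwards from `v` to the parent of `u`, all contributions start either with a
composed constraint at the parent of `u`, or with a simple update. -/
theorem Core.occSum_le (h : Core I τ S) (hu : u ∈ I.sub v) (hne : u ≠ v) :
    occSum I S v u t ≤ (1 + 1 / (I.H : ℝ)) ^ (I.level v - I.level u - 1) *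
      (compSum I S (I.parent u) u t + ∑ x ∈ I.sub v, simpSum I S x u t) := by
  have hH := I.H_ge
  have hone : 1 ≤ 1 + 1 / (I.H : ℝ) := by
    have : 0 ≤ 1 / (I.H : ℝ) := by positivity
    linarith
  induction hl : I.level v using Nat.strong_induction_on generalizing v with
  | _ l ih =>
    obtain ⟨w, hw, huw⟩ := I.exists_child hu hne
    have hlw := I.level_of_mem_children hw
    have hnotw : v ∉ I.sub w := I.notMem_sub_of_mem_children hw
    have hsum : simpSum I S v u t + ∑ x ∈ I.sub w, simpSum I S x u t ≤
        ∑ x ∈ I.sub v, simpSum I S x u t := by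
      rw [← Finset.sum_insert (f := fun x => simpSum I S x u t) hnotw]
      refine Finset.sum_le_sum_of_subset_of_nonneg (fun x hx => ?_) fun x _ _ => h.simpSum_nonneg
      rcases Finset.mem_insert.1 hx with rfl | hx
      · exact I.self_mem_sub _
      · exact I.sub_subset (I.mem_sub_of_mem_children hw) hx
    have hsw : 0 ≤ ∑ x ∈ I.sub w, simpSum I S x u t := Finset.sum_nonneg fun _ _ => h.simpSum_nonneg
    rw [occSum_eq]
    by_cases huw' : u = w
    · subst huw'
      rw [(I.mem_children.1 hw).2, show l - I.level u - 1 = 0 by omega, pow_zero, one_mul]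
      linarith
    · have h1 := ih (I.level w) (by omega) huw huw' rfl
      have hlu : I.level u < I.level w := by
        rcases Nat.lt_or_ge (I.level u) (I.level w) with h2 | h2
        · exact h2
        · exact (huw' (I.eq_of_mem_sub_of_level huw h2)).elim
      have h2 := h.compSum_le (t := t) hw huw huw'
      have h3 := mul_le_mul_of_nonneg_left h1 (by linarith : 0 ≤ 1 + 1 / (I.H : ℝ))
      rw [← mul_assoc, ← pow_succ', show I.level w - I.level u - 1 + 1 = l - I.level u - 1 by
        omega] at h3
      have h4 : 1 ≤ (1 + 1 / (I.H : ℝ)) ^ (l - I.level u - 1) := one_le_pow₀ hone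
      have h5 := h.simpSum_nonneg (v := v) (u := u) (t := t)
      have h6 : simpSum I S v u t ≤ (1 + 1 / (I.H : ℝ)) ^ (l - I.level u - 1) * simpSum I S v u t :=
        le_mul_of_one_le_left h5 h4
      refine le_trans ?_ (mul_le_mul_of_nonneg_left (add_le_add_right hsum _) (by linarith))
      rw [mul_add] at h3
      rw [mul_add, mul_add]
      linarith

/-- The bound on a timer that results from the bound on the variable. -/
def logBound (I : Inst V) : ℝ := Real.log (1 + (I.k + 3) / I.rate)

theorem logBound_nonneg (I : Inst V) : 0 ≤ logBound I := by
  refine Real.log_nonneg ?_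
  have := I.rate_pos
  have : 0 ≤ ((I.k : ℝ) + 3) / I.rate := by positivity
  linarith

/-- As the variables are bounded and grow exponentially, the timers are bounded. -/
theorem YInv.timerSum_le (h : YInv I τ S) (hu : u ∈ I.children v) (t : ℕ) :
    timerSum S v u t ≤ I.c u * logBound I := by
  have h1 := h.timer v u hu t
  have h2 := h.le v u t
  have hr := I.rate_pos
  have hc := I.lam_pow_pos (I.level u)
  have h3 : Real.exp (timerSum S v u t / I.lam ^ I.level u) ≤ 1 + (I.k + 3) / I.rate := by
    rw [← sub_nonneg]
    have : 1 + (I.k + 3) / I.rate - Real.exp (timerSum S v u t / I.lam ^ I.level u) =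
        (I.rate + (I.k + 3) - I.rate * Real.exp (timerSum S v u t / I.lam ^ I.level u)) / I.rate := by
      field_simp
    rw [this]
    exact div_nonneg (by linarith) hr.le
  have h4 := Real.log_le_log (Real.exp_pos _) h3
  rw [Real.log_exp, div_le_iff₀ hc] at h4
  rw [HST.c, logBound]; linarith

/-- The timers of the constraints at `v` which use a constraint at `u` from before `t`: every such
timer is also seen at the last non-solitary timestep up to `t` or at the successor of the last
timestep before `t` with a constraint at `u`. -/
theorem Core.sum_before_le (h : Core I τ S) (t : ℕ) :
    ∃ t₁ t₂, ((S.cons v).map fun C => if C.src u ≠ none ∧ C.tau u < t ∧ t ≤ C.time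
      then C.z else 0).sum ≤ timerSum S v u t₁ + timerSum S v u t₂ := by
  set T := Nat.findGreatest (fun x => ∃ B ∈ S.cons u, B.time = x) (t - 1) with hT
  set t₁ := Nat.findGreatest (fun x => x ∈ nonSolitary S u) t with ht₁
  refine ⟨t₁, T + 1, ?_⟩
  rw [timerSum, timerSum, ← List.sum_map_add]
  refine sum_map_le fun C hC => ?_
  have hz := (h.wf v C hC).z_nonneg
  split_ifs with h1 h2 h3 h4 h4 <;> try linarith
  exfalso
  obtain ⟨j, hj⟩ := Option.ne_none_iff_exists'.1 h1.1
  obtain ⟨σ, h5, h6⟩ := h.src v C hC u j hj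
  have hσ := mem_of_getElem? h5
  have h7 : C.tau u = σ.time :=
    (h6.agree u (I.self_mem_sub u)).2.trans (h.wf u σ hσ).tau_self
  have h8 : C.tau u ≤ t - 1 := by omega
  have h9 : C.tau u ≤ T := Nat.le_findGreatest h8 ⟨σ, hσ, h7.symm⟩
  obtain ⟨B, hB, hBT⟩ : ∃ B ∈ S.cons u, B.time = T :=
    Nat.findGreatest_spec (P := fun x => ∃ B ∈ S.cons u, B.time = x) h8 ⟨σ, hσ, h7.symm⟩
  have h10 : T ≤ t - 1 := Nat.findGreatest_le _
  rcases h9.lt_or_eq with h11 | h11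
  · have h12 : ¬ B.IsBot := fun hb => by
      have := h6.bots B hB hb (by omega)
      omega
    have h13 : T ∈ nonSolitary S u := ⟨B, hB, hBT, h12⟩
    have h14 : T ≤ t₁ := Nat.le_findGreatest (by omega) h13
    have h15 : t₁ ∈ nonSolitary S u :=
      Nat.findGreatest_spec (P := fun x => x ∈ nonSolitary S u) (show T ≤ t by omega) h13
    have h16 : t₁ ≤ t := Nat.findGreatest_le _
    exact h2 ⟨h1.1, by omega, by omega, Or.inl h15⟩
  · exact h4 ⟨h1.1, by omega, by omega, Or.inr (by omega)⟩

end Occ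

section Run
variable {I : Inst V} {q : ℕ} {S : State V} {u v w : V} {t : ℕ}

/-- Few time periods have a `⊥`-constraint at `u` with `t` in its window, as the number of visited levels
increases from each of them to the next. -/
theorem RunInv.ncard_botTimes_le (h : RunInv I q S) (u : V) (t : ℕ) :
    (botTimes I S u t).ncard ≤ I.H + 1 := by
  have hN := I.two_le_N
  have hmono : ∀ p ∈ botTimes I S u t, ∀ p' ∈ botTimes I S u t, p < p' →
      visits I S u p < visits I S u p' := by
    rintro p ⟨B, hB, hb, h0, rfl, -, ht⟩ p' ⟨B', hB', hb', -, rfl, ht', -⟩ hlt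
    refine h.pair u B hB B' hB' hb hb' h0 hlt ?_
    have h1 : (B'.f u).b * I.N ≤ B.time := by omega
    exact (Nat.le_div_iff_mul_le (by omega)).2 h1
  have hle : ∀ p ∈ botTimes I S u t, visits I S u p ≤ I.H := by
    rintro p ⟨B, hB, hb, h0, rfl, -, -⟩
    have hB := h.bot u B hB hb h0
    have hu := I.level_lt hB.lt_root
    refine le_trans ?_ (show (Finset.range (I.level u + 1)).card ≤ I.H by
      rw [Finset.card_range]; omega)
    refine Finset.card_le_card_of_injOn (fun w => I.level w) (fun w hw => ?_) ?_
    · have hw' := (Finset.mem_filter.1 (Finset.mem_coe.1 hw)).2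
      have := I.level_le_of_mem_sub hw'.1
      rw [Finset.mem_coe, Finset.mem_range]
      exact Nat.lt_succ_of_le this
    · intro w hw w' hw' hww
      have h6 := (Finset.mem_filter.1 (Finset.mem_coe.1 hw)).2
      have h7 := (Finset.mem_filter.1 (Finset.mem_coe.1 hw')).2
      exact I.eq_of_level_eq (hB.root w h6.2).1 (hB.root w' h7.2).1 hww
  have hfin := h.core.finite_botTimes u t
  rw [Set.ncard_eq_toFinset_card _ hfin]
  refine le_trans ?_ (show (Finset.range (I.H + 1)).card ≤ I.H + 1 by rw [Finset.card_range])
  refine Finset.card_le_card_of_injOn (fun p => visits I S u p) (fun p hp => ?_) ?_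
  · rw [Finset.mem_coe, hfin.mem_toFinset] at hp
    rw [Finset.mem_coe, Finset.mem_range]
    exact Nat.lt_succ_of_le (hle p hp)
  · intro p hp p' hp' he
    rw [Finset.mem_coe, hfin.mem_toFinset] at hp hp'
    have he' : visits I S u p = visits I S u p' := he
    rcases lt_trichotomy p p' with h1 | h1 | h1
    · have := hmono p hp p' hp' h1; omega
    · exact h1
    · have := hmono p' hp' p hp h1; omega

/-- The constraints composed from `⊥`-constraints of earlier time periods: in every time period only
the last one is used, and the timers of its constraints are seen at its successor. -/
theorem RunInv.sum_after_le (h : RunInv I q S) (hu : u ∈ I.children v) (t : ℕ) :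
    ((S.cons v).map fun C => if C.src u ≠ none ∧ u ∈ C.A ∧ (C.f u).b * I.N < t ∧ t ≤ C.tau u ∧
      C.tau u < C.time then C.z else 0).sum ≤ (I.H + 1) * (I.c u * logBound I) := by
  set P : Con V → Prop := fun C => C.src u ≠ none ∧ u ∈ C.A ∧ (C.f u).b * I.N < t ∧ t ≤ C.tau u ∧
      C.tau u < C.time with hP
  set TS : Finset ℕ := (((S.cons v).filter fun C => P C).map fun C => C.tau u).toFinset with hTS
  have hmem : ∀ T, T ∈ TS ↔ ∃ C ∈ S.cons v, P C ∧ C.tau u = T := by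
    intro T
    simp only [hTS, List.mem_toFinset, List.mem_map, List.mem_filter, decide_eq_true_eq, and_assoc]
  have hsrc : ∀ C ∈ S.cons v, P C → ∃ σ ∈ S.cons u, σ.IsBot ∧ SrcOK I S v C u σ ∧
      C.tau u = σ.time ∧ C.f u = σ.f u := by
    intro C hC hPC
    obtain ⟨σ, j, -, h2, h3, h4, h5, h6⟩ := h.core.source_isBot hC hPC.1 hPC.2.1
    exact ⟨σ, mem_of_getElem? h2, h3, h4, h5, h6⟩
  have hle : ∀ T ∈ TS, ∀ T' ∈ TS, T < T' → T / I.N ≠ T' / I.N := by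
    intro T hT T' hT' hlt he
    obtain ⟨C, hC, hPC, rfl⟩ := (hmem T).1 hT
    obtain ⟨C', hC', hPC', rfl⟩ := (hmem T').1 hT'
    obtain ⟨σ, hσ, -, hs, hσt, -⟩ := hsrc C hC hPC
    obtain ⟨σ', hσ', hb', -, hσt', -⟩ := hsrc C' hC' hPC'
    have h1 := hs.period (by rw [← hσt]; exact hPC.2.2.2.2)
    have h2 : σ'.time ≤ C.time := by
      by_contra h3
      have := Nat.div_le_div_right (c := I.N) (not_le.1 h3).le
      rw [hσt, hσt'] at he
      omega
    have := hs.bots σ' hσ' hb' h2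
    omega
  have hcard : TS.card ≤ I.H + 1 := by
    refine le_trans ?_ (h.ncard_botTimes_le u t)
    have hfin := h.core.finite_botTimes u t
    rw [Set.ncard_eq_toFinset_card _ hfin]
    refine Finset.card_le_card_of_injOn (fun T => T / I.N) (fun T hT => ?_) ?_
    · obtain ⟨C, hC, hPC, rfl⟩ := (hmem T).1 hT
      obtain ⟨σ, hσ, hb, -, hσt, hσf⟩ := hsrc C hC hPC
      rw [Finset.mem_coe, hfin.mem_toFinset]
      have h1 := hPC.2.2
      exact ⟨σ, hσ, hb, by omega, by rw [hσt], by rw [← hσf]; exact h1.1, by rw [← hσt]; exact h1.2.1⟩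
    · intro T hT T' hT' he
      rcases lt_trichotomy T T' with h1 | h1 | h1
      · exact (hle T hT T' hT' h1 he).elim
      · exact h1
      · exact (hle T' hT' T hT h1 he.symm).elim
  calc _ ≤ ((S.cons v).map fun C => ∑ T ∈ TS, if C.src u ≠ none ∧ C.tau u < T + 1 ∧ T + 1 ≤ C.time ∧
        (T + 1 ∈ nonSolitary S u ∨ T + 1 = C.tau u + 1) then C.z else 0).sum := by
        refine sum_map_le fun C hC => ?_
        have hz := (h.core.wf v C hC).z_nonneg
        have hnn : ∀ T ∈ TS, 0 ≤ if C.src u ≠ none ∧ C.tau u < T + 1 ∧ T + 1 ≤ C.time ∧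
            (T + 1 ∈ nonSolitary S u ∨ T + 1 = C.tau u + 1) then C.z else 0 := fun T _ => by
          split_ifs <;> simp [hz]
        split_ifs with h1
        · refine le_trans (le_of_eq ?_) (Finset.single_le_sum hnn ((hmem _).2 ⟨C, hC, h1, rfl⟩))
          rw [if_pos]
          exact ⟨h1.1, by omega, by have := h1.2.2.2.2; omega, Or.inr rfl⟩
        · exact Finset.sum_nonneg hnn
    _ = ∑ T ∈ TS, timerSum S v u (T + 1) := by rw [sum_map_finset_sum]; rfl
    _ ≤ ∑ _T ∈ TS, I.c u * logBound I := Finset.sum_le_sum fun T _ => h.yinv.timerSum_le hu _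
    _ ≤ _ := by
        rw [Finset.sum_const, nsmul_eq_mul]
        refine mul_le_mul_of_nonneg_right (by exact_mod_cast hcard) ?_
        exact mul_nonneg (I.c_pos u).le (logBound_nonneg I)

/-- The constraints composed at the parent of `u`, in which `y(u, t)` occurs, use a constraint at `u` from
before `t`, or a `⊥`-constraint at `u` which is from the same timestep or from an earlier one. -/
theorem RunInv.compSum_parent_le (h : RunInv I q S) (hu : u ∈ I.children v) (t : ℕ) :
    compSum I S v u t ≤ I.c u * ((I.H + 3) * logBound I + 24 * I.H * (I.H + 1)) := by
  have hpar : I.parent u = v := (I.mem_children.1 hu).2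
  obtain ⟨t₁, t₂, h1⟩ := h.core.sum_before_le (u := u) (v := v) t
  have h2 := h.sum_after_le hu t
  have h3 := h.w u t
  have h4 := h.yinv.timerSum_le hu t₁
  have h5 := h.yinv.timerSum_le hu t₂
  have hc := I.c_pos u
  have h6 : 24 * I.H * I.c u * ((botTimes I S u t).ncard : ℝ) ≤ 24 * I.H * I.c u * (I.H + 1) := by
    refine mul_le_mul_of_nonneg_left ?_ (by positivity)
    exact_mod_cast h.ncard_botTimes_le u t
  rw [wSum, hpar] at h3
  have h7 : compSum I S v u t ≤
      ((S.cons v).map fun C => if C.src u ≠ none ∧ C.tau u < t ∧ t ≤ C.time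
        then C.z else 0).sum +
      (((S.cons v).map fun C => if C.src u ≠ none ∧ u ∈ C.A ∧ C.tau u = C.time ∧
        (C.f u).b * I.N < t ∧ t ≤ C.time then C.z else 0).sum +
      ((S.cons v).map fun C => if C.src u ≠ none ∧ u ∈ C.A ∧ (C.f u).b * I.N < t ∧ t ≤ C.tau u ∧
        C.tau u < C.time then C.z else 0).sum) := by
    rw [← List.sum_map_add, ← List.sum_map_add]
    refine sum_map_le fun C hC => ?_
    have hz := (h.core.wf v C hC).z_nonneg
    have htv := (h.core.wf v C hC).tau_self
    by_cases h8 : (¬ ∀ x, C.src x = none) ∧ C.Occurs I v u t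
    swap
    · rw [if_neg h8]
      split_ifs <;> linarith
    rw [if_pos h8]
    obtain ⟨j, σ, h9, h10, h11⟩ := h.core.exists_source hC h8.1 h8.2 hu (I.self_mem_sub u)
    have hsn : C.src u ≠ none := by rw [h9]; exact Option.some_ne_none j
    have htu : C.tau u ≤ C.time := by
      rw [(h11.agree u (I.self_mem_sub u)).2, (h.core.wf u σ (mem_of_getElem? h10)).tau_self]
      exact h11.time_le
    have h12 := h8.2.2.2
    rw [hpar, htv] at h12
    rcases lt_or_ge (C.tau u) t with h13 | h13
    · rw [if_pos ⟨hsn, h13, by rcases h12 with h12 | h12 <;> exact h12.2.2⟩]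
      split_ifs <;> linarith
    · have h14 : u ∈ C.A ∧ (C.f u).b * I.N < t ∧ t ≤ C.time := by
        rcases h12 with h12 | h12
        · exact h12
        · omega
      rcases htu.lt_or_eq with h15 | h15
      · rw [if_pos (c := C.src u ≠ none ∧ u ∈ C.A ∧ (C.f u).b * I.N < t ∧ t ≤ C.tau u ∧
          C.tau u < C.time) ⟨hsn, h14.1, h14.2.1, h13, h15⟩]
        split_ifs <;> linarith
      · rw [if_pos (c := C.src u ≠ none ∧ u ∈ C.A ∧ C.tau u = C.time ∧
          (C.f u).b * I.N < t ∧ t ≤ C.time) ⟨hsn, h14.1, h15, h14.2⟩]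
        split_ifs <;> linarith
  nlinarith

theorem RunInv.sum_badTimes_le (h : RunInv I q S) (u : V) (t : ℕ) :
    ∑ w, ((badTimes I (S.forest w) w u t).ncard : ℝ) ≤ (I.H + 1) * (I.H + 2) := by
  calc ∑ w, ((badTimes I (S.forest w) w u t).ncard : ℝ) ≤
        ∑ w, if u ∈ I.sub w then ((I.H : ℝ) + 2) else 0 := by
        refine Finset.sum_le_sum fun w _ => ?_
        split_ifs with h1
        · have hfin := (h.forest w).finite_badTimes w u t
          rw [Set.ncard_eq_toFinset_card _ hfin]
          exact_mod_cast (h.forest w).card_badTimes_le w u t (Q := hfin.toFinset) (by simp)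
        · have h2 : badTimes I (S.forest w) w u t = ∅ := by
            rw [Set.eq_empty_iff_forall_notMem]
            rintro p ⟨-, -, p', h3, -⟩
            exact h1 ((h.forest w).desc_sub h3)
          rw [h2]; simp
    _ ≤ _ := by
        rw [← Finset.sum_filter, Finset.sum_const, nsmul_eq_mul]
        refine mul_le_mul_of_nonneg_right ?_ (by positivity)
        exact_mod_cast I.card_ancestors_le u

theorem logBound_le (I : Inst V) :
    logBound I ≤ 2 + (Real.log I.n + Real.log I.M + Real.log (I.k / I.gam)) := by
  have hn : (1 : ℝ) ≤ I.n := by have := I.n_ge_three; linarith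
  have hM := I.one_le_M
  have hk := I.k_ge
  have hg := I.gam_pos
  have hg1 : I.gam ≤ 1 := by have := I.gam_le_one; linarith
  have hkg : 1 ≤ I.k / I.gam := by rw [le_div_iff₀ hg]; linarith
  have h1 : 1 + (I.k + 3) / I.rate ≤ 5 * (I.n * I.M * (I.k / I.gam)) := by
    have h2 : (I.k + 3) / I.rate = (I.k + 3) / I.gam * (I.M * I.n) := by
      rw [Inst.rate]; field_simp
    have h3 : (I.k + 3) / I.gam ≤ 4 * (I.k / I.gam) := by
      rw [← mul_div_assoc]
      exact div_le_div_of_nonneg_right (by linarith) hg.le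
    have h4 : 1 ≤ I.M * I.n := by nlinarith
    have h5 : 1 ≤ I.n * I.M * (I.k / I.gam) := by nlinarith
    rw [h2]
    nlinarith
  rw [logBound]
  have hr := I.rate_pos
  refine (Real.log_le_log (by positivity) h1).trans ?_
  rw [Real.log_mul (by norm_num) (by positivity), Real.log_mul (by positivity) (by positivity),
    Real.log_mul (by positivity) (by positivity)]
  have h5 : Real.log 5 ≤ 2 := by
    rw [Real.log_le_iff_le_exp (by norm_num)]
    have h6 := Real.add_one_le_exp (1 : ℝ)
    have h7 : Real.exp 2 = Real.exp 1 * Real.exp 1 := by rw [← Real.exp_add]; norm_num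
    have h8 := Real.exp_one_gt_d9
    rw [h7]; nlinarith
  linarith

theorem RunInv.betaFeasible (h : RunInv I q S) {v : V} {d : ℕ} (hv : I.level v = d + 1) :
    BetaFeasible I S v ((1 + 1 / (I.H : ℝ)) ^ d * (60 * ((I.H : ℝ) ^ 4 +
      I.H * (Real.log I.n + Real.log I.M + Real.log (I.k / I.gam))))) := by
  have hH := I.H_ge
  set X := Real.log I.n + Real.log I.M + Real.log (I.k / I.gam) with hX
  have hX0 : 0 ≤ X := by
    have hn : (1 : ℝ) ≤ I.n := by have := I.n_ge_three; linarith
    have hg := I.gam_pos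
    have hkg : 1 ≤ I.k / I.gam := by
      rw [le_div_iff₀ hg]; have := I.gam_le_one; have := I.k_ge; linarith
    have := Real.log_nonneg hn
    have := Real.log_nonneg I.one_le_M
    have := Real.log_nonneg hkg
    linarith
  have hone : 1 ≤ 1 + 1 / (I.H : ℝ) := by
    have : 0 ≤ 1 / (I.H : ℝ) := by positivity
    linarith
  have hpow : ∀ m, 1 ≤ (1 + 1 / (I.H : ℝ)) ^ m := fun m => one_le_pow₀ hone
  have hH4 : (16 : ℝ) ≤ (I.H : ℝ) ^ 4 := by
    have := pow_le_pow_left₀ (by norm_num) hH 4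
    linarith
  set E := 60 * ((I.H : ℝ) ^ 4 + I.H * X) with hE
  have hE1 : 1 ≤ E := by
    have : 0 ≤ (I.H : ℝ) * X := by positivity
    linarith
  set β := (1 + 1 / (I.H : ℝ)) ^ d * E with hβ
  have hβ1 : 1 ≤ β := by have := hpow d; nlinarith
  refine ⟨hβ1, fun C hC => div_nonneg (h.core.wf v C hC).z_nonneg (by linarith),
    fun u hu hne t => ?_⟩
  have hsum : ((S.cons v).map fun C => (if C.Occurs I v u t then 1 else 0) * (C.z / β)).sum =
      occSum I S v u t / β := by
    rw [occSum, div_eq_mul_inv, ← List.sum_map_mul_right]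
    refine sum_map_congr fun C _ => ?_
    split_ifs <;> simp [div_eq_mul_inv]
  rw [hsum, div_le_iff₀ (by linarith)]
  have hc := I.c_pos u
  have hur : u ≠ I.root := by
    rintro rfl
    exact hne (I.eq_of_mem_sub_of_level hu (I.level_root ▸ I.level_le v))
  have h1 := h.core.occSum_le (t := t) hu hne
  have h2 := h.compSum_parent_le (I.mem_children.2 ⟨hur, rfl⟩) t
  have h3 : ∑ x ∈ I.sub v, simpSum I S x u t ≤ 16 * I.H ^ 2 * I.c u * ((I.H + 1) * (I.H + 2)) := by
    refine (Finset.sum_le_sum_of_subset_of_nonneg (Finset.subset_univ _)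
      fun _ _ _ => h.core.simpSum_nonneg).trans ((h.simp u t).trans ?_)
    exact mul_le_mul_of_nonneg_left (h.sum_badTimes_le u t) (by positivity)
  have h4 : (I.H + 3) * logBound I + 24 * I.H * (I.H + 1) + 16 * I.H ^ 2 * ((I.H + 1) * (I.H + 2)) ≤
      E := by
    have h5 := logBound_le I
    have h6 : (I.H + 3) * logBound I ≤ 3 * I.H * (2 + X) := by
      have := logBound_nonneg I
      have : ((I.H : ℝ) + 3) ≤ 3 * I.H := by linarith
      nlinarith
    have h7 : 6 * (I.H : ℝ) ≤ I.H ^ 4 := by nlinarith [pow_le_pow_left₀ (by norm_num) hH 3]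
    have h8 : 24 * (I.H : ℝ) * (I.H + 1) ≤ 9 * I.H ^ 4 := by
      have h9 : 24 * (I.H : ℝ) * (I.H + 1) ≤ 36 * I.H ^ 2 := by nlinarith
      have h10 : (4 : ℝ) ≤ I.H ^ 2 := by nlinarith
      nlinarith
    have h9 : 16 * (I.H : ℝ) ^ 2 * ((I.H + 1) * (I.H + 2)) ≤ 48 * I.H ^ 4 := by
      have h10 : ((I.H : ℝ) + 1) * (I.H + 2) ≤ 3 * I.H ^ 2 := by nlinarith
      have h11 : 0 ≤ 16 * (I.H : ℝ) ^ 2 := by positivity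
      nlinarith
    have h10 : 0 ≤ (I.H : ℝ) * X := by positivity
    rw [hE]; linarith
  have h5 : compSum I S (I.parent u) u t + ∑ x ∈ I.sub v, simpSum I S x u t ≤ I.c u * E := by
    nlinarith
  have h6 : 0 ≤ I.c u * E := by positivity
  calc occSum I S v u t ≤ (1 + 1 / (I.H : ℝ)) ^ (I.level v - I.level u - 1) * (I.c u * E) :=
        h1.trans (mul_le_mul_of_nonneg_left h5 (by have := hpow (I.level v - I.level u - 1); linarith))
    _ ≤ (1 + 1 / (I.H : ℝ)) ^ d * (I.c u * E) :=
        mul_le_mul_of_nonneg_right (pow_le_pow_right₀ hone (by omega)) h6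
    _ = _ := by rw [hβ]; ring

end Run

end KServerTW

end

theorem mainTheorem4 :
    ∃ K : ℝ, ∀ (V : Type*) [Fintype V] (I : KServerTW.Inst V) (q : ℕ) (S : KServerTW.State V),
      KServerTW.Run I q S → ∀ (v : V) (h : ℕ), I.level v = h + 1 →
        KServerTW.BetaFeasible I S v
          ((1 + 1 / (I.H : ℝ)) ^ h *
            (K * ((I.H : ℝ) ^ 4 +
              I.H * (Real.log I.n + Real.log I.M + Real.log (I.k / I.gam))))) :=
  ⟨60, fun _ _ _ _ _ hS _ _ hv => hS.inv.betaFeasible hv⟩
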